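/- Everything is over $\mathbb C$; "super" means $\mathbb Z_2$-graded, $|x|$ is the parity of a homogeneous $x$. Fix an integer $r\ge 1$. **Sergeev superalgebra and permutation supermodules.** $H=H_c(r)$ is the superalgebra with even generators $s_1,\dots,s_{r-1}$, odd generators $c_1,\dots,c_r$ and relations $c_j^2=1$, $c_ic_j=-c_jc_i$ ($i\ne j$), $s_i^2=1$, $s_is_{i+1}s_i=s_{i+1}s_is_{i+1}$, $s_is_j=s_js_i$ ($|i-j|\ne1$), $c_is_i=s_ic_{i+1}$, $c_{i+1}s_i=s_ic_i$, $c_js_i=s_ic_j$ ($j\ne i,i+1$). Let $V=\mathbb C^{n|n}$ have the even basis $v_1,\dots,v_n$ and the odd basis $v_{\bar1},\dots,v_{\bar n}$ (with $\bar{\bar k}=k$). $H$ acts on $V^{\otimes r}$: $s_i$ interchanges the tensorands $u_i,u_{i+1}$ with the sign $(-1)^{|u_i||u_{i+1}|}$, and $c_j$ applies $P$ to the tensorand $u_j$ with the sign $(-1)^{|u_1|+\dots+|u_{j-1}|}$, where $P(v_k)=\sqrt{-1}\,v_{\bar k}$, $P(v_{\bar k})=-\sqrt{-1}\,v_k$ for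 $1\le k\le n$. Let $\Lambda(n,r)$ be the set of $\lambda\in\mathbb Z_{\ge0}^n$ with $\sum_k\lambda_k=r$. The permutation supermodule $M^\lambda\subseteq V^{\otimes r}$ is the span of the monomials $v_{i_1}\otimes\dots\otimes v_{i_r}$ with exactly $\lambda_k$ tensorands in $\{v_k,v_{\bar k}\}$ for each $k$. For $H$-supermodules, $\operatorname{Hom}_H(M,N)$ is the superspace spanned by the homogeneous linear maps $f$ with $f(xm)=(-1)^{|f||x|}xf(m)$ for homogeneous $x\in H$. Let $\Lambda'(r)\subseteq\Lambda(r,r)$ consist of the $\lambda$ whose only zero entries are trailing ones. **Schur superalgebra of type Q.** $\mathscr S_c(n,r)$ is the superalgebra with even generators $1_\lambda$ ($\lambda\in\Lambda(n,r)$), $e_i,f_i$ ($1\le i\le n-1$), odd generators $e_{\bar i},f_{\bar i}$ ($1\le i\le n-1$), $h_{\bar j}$ ($1\le j\le n$) and the following relations, for all admissible indices, where $\alpha_i=(\dots,0,1,-1,0,\dots)$ with $1$ at place $i$, $1_\mu:=0$ if $\mu\notin\Lambda(n,r)$, $[x,y]=xy-(-1)^{|x||y|}yx$, and all relations except those of the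 first two lines are required after multiplication by each $1_\lambda$ on the right: * $1_\lambda1_\mu=\delta_{\lambda\mu}1_\lambda$, $\sum_\lambda1_\lambda=1$, $h_{\bar j}1_\lambda=1_\lambda h_{\bar j}$, $h_{\bar j}1_\lambda=0$ if $\lambda_j=0$, $[h_{\bar i},h_{\bar j}]1_\lambda=\delta_{ij}2\lambda_i1_\lambda$; * $x1_\lambda=1_{\lambda+\alpha_i}x$ and $1_\lambda x=x1_{\lambda-\alpha_i}$ for $x\in\{e_i,e_{\bar i}\}$, $y1_\lambda=1_{\lambda-\alpha_i}y$ and $1_\lambda y=y1_{\lambda+\alpha_i}$ for $y\in\{f_i,f_{\bar i}\}$; * $[h_{\bar j},e_i]=(\delta_{ij}-\delta_{j,i+1})e_{\bar i}$, $[h_{\bar j},f_i]=-(\delta_{ij}-\delta_{j,i+1})f_{\bar i}$, $[h_{\bar j},e_{\bar i}]=(\delta_{ij}+\delta_{j,i+1})e_i$, $[h_{\bar j},f_{\bar i}]=(\delta_{ij}+\delta_{j,i+1})f_i$; * $[e_i,f_j]1_\lambda=\delta_{ij}(\lambda_i-\lambda_{i+1})1_\lambda$, $[e_{\bar i},f_{\bar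 j}]1_\lambda=\delta_{ij}(\lambda_i+\lambda_{i+1})1_\lambda$, $[e_i,f_{\bar j}]=[e_{\bar i},f_j]=\delta_{ij}(h_{\bar i}-h_{\overline{i+1}})$; * $e_{\bar i}^2=f_{\bar i}^2=0$; $[e_i,e_{\bar j}]=[f_i,f_{\bar j}]=0$ for $|i-j|\ne1$; $[e_i,e_j]=[f_i,f_j]=[e_{\bar i},e_{\bar j}]=[f_{\bar i},f_{\bar j}]=0$ for $|i-j|>1$; $[e_i,e_{i+1}]=[e_{\bar i},e_{\overline{i+1}}]$, $[e_i,e_{\overline{i+1}}]=[e_{\bar i},e_{i+1}]$, $[f_{i+1},f_i]=[f_{\overline{i+1}},f_{\bar i}]$, $[f_{\overline{i+1}},f_i]=[f_{i+1},f_{\bar i}]$; * $e_i^{(2)}x-e_ixe_i+xe_i^{(2)}=0$ for $x\in\{e_j,e_{\bar j}\}$ and $f_i^{(2)}x-f_ixf_i+xf_i^{(2)}=0$ for $x\in\{f_j,f_{\bar j}\}$, where $|i-j|=1$. Here $x^{(k)}=x^k/k!$. It acts on $V^{\otimes r}$ by even and odd operators which supercommute with $H$: $1_\lambda$ is the projection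 onto $M^\lambda$ along the other $M^\mu$, and every other generator $x$ acts by $u_1\otimes\dots\otimes u_r\mapsto\sum_p(-1)^{|x|(|u_1|+\dots+|u_{p-1}|)}u_1\otimes\dots\otimes x.u_p\otimes\dots\otimes u_r$, where, for $1\le k\le n$, $e_i$ sends $v_{i+1}\mapsto v_i$, $v_{\overline{i+1}}\mapsto v_{\bar i}$; $f_i$ sends $v_i\mapsto v_{i+1}$, $v_{\bar i}\mapsto v_{\overline{i+1}}$; $e_{\bar i}$ sends $v_{i+1}\mapsto v_{\bar i}$, $v_{\overline{i+1}}\mapsto v_i$; $f_{\bar i}$ sends $v_i\mapsto v_{\overline{i+1}}$, $v_{\bar i}\mapsto v_{i+1}$; $h_{\bar j}$ sends $v_j\mapsto v_{\bar j}$, $v_{\bar j}\mapsto v_j$; all other basis vectors go to $0$. For $n=r$ and an element $z=1_\mu z1_\lambda$ with $\lambda,\mu\in\Lambda'(r)$, let $\phi^r(z)\in\operatorname{Hom}_H(M^\lambda,M^\mu)\subseteq\operatorname{End}_H\bigl(\bigoplus_{\nu\in\Lambda'(r)}M^\nu\bigr)$ be the map by which it acts. **Web superalgebra.** Let $\mathsf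 A(r)$ be the set of tuples $\mathsf a=(a_1,\dots,a_m)$ of positive integers with sum $r$. The superalgebra $W=W(r)$ is generated by webs, each having a tuple in $\mathsf A(r)$ along its bottom and one along its top, where the product $xy$ is $x$ drawn on top of $y$. The generators are the even identities $\mathsf a:\mathsf a\to\mathsf a$, the even merges $(a_1,\dots,a_m)\to(a_1,\dots,a_i+a_{i+1},\dots,a_m)$, the even splits $(a_1,\dots,a_i+a_{i+1},\dots,a_m)\to(a_1,\dots,a_m)$ and the odd dots $\mathsf a\to\mathsf a$ on the strand $a_j$. The relations are as follows. * Compatibility: $xy=0$ if the bottom of $x$ is not the top of $y$, the $\mathsf a$ act as identities on generators with matching boundary, and $\sum_{\mathsf a\in\mathsf A(r)}\mathsf a=1$. * Superinterchange: webs $w_1$ (left) and $w_2$ (right) on disjoint sets of strands exchange heights with the sign $(-1)^{|w_1||w_2|}$. * The local relations below (identity strands to the left and to the right are not shown). Write $M_{k,l}:(k,l)\to(k+l)$, $S_{k,l}:(k+l)\to(k,l)$ for merge and split, $d_j$ for the dot on the $j$-th strand shown, $d$ for the dot on a single strand, and juxtaposition of webs separated by $|$ for horizontal placement with identities. For all $h,k,l>0$: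 * $M_{h+k,l}(M_{h,k}|l)=M_{h,k+l}(h|M_{k,l})$ and $(S_{h,k}|l)S_{h+k,l}=(h|S_{k,l})S_{h,k+l}$; * $M_{k,l}S_{k,l}=\binom{k+l}{l}\,\mathrm{id}$; $d^2=k\,\mathrm{id}$ on a $k$-strand; * $d\,M=M d_1+M d_2$ and $S d=d_1S+d_2S$ for $M\in\{M_{1,k},M_{k,1}\}$, $S\in\{S_{1,k},S_{k,1}\}$; * with $X=S_{1,1}M_{1,1}$: $X-d_1d_2Xd_1d_2=2\,\mathrm{id}$ on $(1,1)$; * on $(k,l)$: $EF-FE=(k-l)\,\mathrm{id}$ and $\bar EF-F\bar E=d_1-d_2=E\bar F-\bar FE$; * on $(h,k,l)$, where $E_1,E_2$ act on the strands $1,2$ and $2,3$ respectively: $E_1E_2-E_2E_1=\bar E_1\bar E_2+\bar E_2\bar E_1$ and $E_1\bar E_2-\bar E_2E_1=\bar E_1E_2-E_2\bar E_1$; and their mirror images, with $F_1,F_2$ acting on the strands $1,2$ and $2,3$: $F_2F_1-F_1F_2=\bar F_2\bar F_1+\bar F_1\bar F_2$ and $F_2\bar F_1-\bar F_1F_2=\bar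 F_2F_1-F_1\bar F_2$. Here $E:(k,l)\to(k+1,l-1)$ is the ladder with a rung of thickness $1$ from right to left, $E=(M_{k,1}|l-1)(k|S_{1,l-1})$, $F:(k,l)\to(k-1,l+1)$ is the ladder with a rung of thickness $1$ from left to right, $F=(k-1|M_{1,l})(S_{k-1,1}|l)$, and $\bar E,\bar F$ are the same webs with a dot on the rung. In these webs $0$-strands are erased (a merge or split involving a $0$-strand is an identity). $W$ is graded by the number of dots modulo $2$; for $\mathsf a,\mathsf b\in\mathsf A(r)$ the superspace $\mathsf bW\mathsf a$ is spanned by the webs from $\mathsf a$ to $\mathsf b$. For $\mathsf a\in\mathsf A(r)$ let $\widehat{\mathsf a}\in\Lambda'(r)$ be $\mathsf a$ followed by zeros. **Theorem.** There is an isomorphism of superalgebras $$\psi:W(r)\;\xrightarrow{\ \sim\ }\;\operatorname{End}_{H_c(r)}\Bigl(\bigoplus_{\lambda\in\Lambda'(r)}M^\lambda\Bigr)$$ (bijective, multiplicative, unital, preserving and reflecting parity), which is locally unital, i.e. it maps each $\mathsf a\in\mathsf A(r)$ to the projection $\phi^r(1_{\widehat{\mathsf a}})$ onto $M^{\widehat{\mathsf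 a}}$, and which is given on the other generators as follows, for $\mathsf a=(a_1,\dots,a_m)\in\mathsf A(r)$, $1\le i\le m-1$, $1\le j\le m$, and with $\mathsf c=(a_1,\dots,a_i+a_{i+1},\dots,a_m)$: * the merge $\mathsf a\to\mathsf c$ goes to $\phi^r\bigl(e_{r-1}^{(\widehat{\mathsf a}_r)}e_{r-2}^{(\widehat{\mathsf a}_{r-1})}\cdots e_i^{(\widehat{\mathsf a}_{i+1})}1_{\widehat{\mathsf a}}\bigr)$; * the split $\mathsf c\to\mathsf a$ goes to $\phi^r\bigl(f_i^{(\widehat{\mathsf a}_{i+1})}f_{i+1}^{(\widehat{\mathsf a}_{i+2})}\cdots f_{r-1}^{(\widehat{\mathsf a}_r)}1_{\widehat{\mathsf c}}\bigr)$; * the dot on the $j$-th strand of $\mathsf a$ goes to $\phi^r(h_{\bar j}1_{\widehat{\mathsf a}})$. In particular, for all $\mathsf a,\mathsf b\in\mathsf A(r)$, $\psi$ restricts to an isomorphism of superspaces $\psi_{\mathsf a,\mathsf b}:\mathsf bW\mathsf a\xrightarrow{\sim}\operatorname{Hom}_{H_c(r)}(M^{\widehat{\mathsf a}},M^{\widehat{\mathsf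 b}})$. -/

import Mathlib

open scoped DirectSum

noncomputable section

namespace TypeQ

/-! ## Superspaces, presented superalgebras and super-linear maps -/

/-- The sign `(-1)^(i j)` for parities `i j`. -/
def ksign (i j : ZMod 2) : ℂ := if i = 1 ∧ j = 1 then -1 else 1

theorem zmod2_cases (i : ZMod 2) : i = 0 ∨ i = 1 := by
  revert i; decide

theorem ksign_add (i j k : ZMod 2) : ksign i (j + k) = ksign i j * ksign i k := by
  have h : (1 : ZMod 2) + 1 = 0 := by decide
  rcases zmod2_cases i with rfl | rfl <;> rcases zmod2_cases j with rfl | rfl <;>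
    rcases zmod2_cases k with rfl | rfl <;> simp [ksign, h]

theorem ksign_comm (i j : ZMod 2) : ksign i j = ksign j i := by
  simp [ksign, and_comm]

theorem ksign_add_left (i j k : ZMod 2) : ksign (i + j) k = ksign i k * ksign j k := by
  rw [ksign_comm, ksign_add, ksign_comm k i, ksign_comm k j]

theorem ksign_mul_self (i j : ZMod 2) : ksign i j * ksign i j = 1 := by
  unfold ksign; split_ifs <;> simp

@[simp] theorem ksign_zero_left (j : ZMod 2) : ksign 0 j = 1 := by simp [ksign]
@[simp] theorem ksign_zero_right (j : ZMod 2) : ksign j 0 = 1 := by simp [ksign]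
@[simp] theorem ksign_one_one : ksign 1 1 = -1 := by simp [ksign]

/-- The superalgebra with generators `G` and relations `R`. -/
def Presented {G : Type} (R : FreeAlgebra ℂ G → FreeAlgebra ℂ G → Prop) : Type := RingQuot R

instance {G : Type} (R : FreeAlgebra ℂ G → FreeAlgebra ℂ G → Prop) : Ring (Presented R) :=
  inferInstanceAs (Ring (RingQuot R))

instance {G : Type} (R : FreeAlgebra ℂ G → FreeAlgebra ℂ G → Prop) : Algebra ℂ (Presented R) :=
  inferInstanceAs (Algebra ℂ (RingQuot R))

/-- The quotient map from the free algebra. -/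
def Presented.mk {G : Type} (R : FreeAlgebra ℂ G → FreeAlgebra ℂ G → Prop) :
    FreeAlgebra ℂ G →ₐ[ℂ] Presented R :=
  RingQuot.mkAlgHom ℂ R

/-- The algebra homomorphism determined by images of the generators that satisfy the relations. -/
def Presented.lift {G A : Type} [Ring A] [Algebra ℂ A]
    (R : FreeAlgebra ℂ G → FreeAlgebra ℂ G → Prop) (F : G → A)
    (h : ∀ x y, R x y → FreeAlgebra.lift ℂ F x = FreeAlgebra.lift ℂ F y) :
    Presented R →ₐ[ℂ] A :=
  RingQuot.liftAlgHom ℂ ⟨FreeAlgebra.lift ℂ F, fun _ _ hxy => h _ _ hxy⟩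

theorem Presented.lift_mk {G A : Type} [Ring A] [Algebra ℂ A]
    (R : FreeAlgebra ℂ G → FreeAlgebra ℂ G → Prop) (F : G → A)
    (h : ∀ x y, R x y → FreeAlgebra.lift ℂ F x = FreeAlgebra.lift ℂ F y) (x : FreeAlgebra ℂ G) :
    Presented.lift R F h (Presented.mk R x) = FreeAlgebra.lift ℂ F x :=
  RingQuot.liftAlgHom_mkAlgHom_apply ℂ _ _ _

theorem Presented.mk_surjective {G : Type} (R : FreeAlgebra ℂ G → FreeAlgebra ℂ G → Prop) :
    Function.Surjective (Presented.mk R) :=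
  RingQuot.mkAlgHom_surjective ℂ R

theorem Presented.mk_rel {G : Type} {R : FreeAlgebra ℂ G → FreeAlgebra ℂ G → Prop}
    {x y : FreeAlgebra ℂ G} (h : R x y) : Presented.mk R x = Presented.mk R y :=
  RingQuot.mkAlgHom_rel ℂ h

/-- The parity `i` part of the superalgebra presented by generators `G` of parities `p` and
relations `R` (homogeneous in all cases below): it is spanned by the words in the generators whose
total parity is `i`. -/
def parityPart {G : Type} (R : FreeAlgebra ℂ G → FreeAlgebra ℂ G → Prop) (p : G → ZMod 2)
    (i : ZMod 2) : Submodule ℂ (Presented R) :=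
  Submodule.span ℂ {x | ∃ w : List G, (w.map p).sum = i ∧
    x = Presented.mk R (w.map (FreeAlgebra.ι ℂ)).prod}

/-- The parity `i` part of `Hom_H(M, N)`, for supermodules `M`, `N` over a superalgebra `H` (the
gradings are `gH`, `gM`, `gN`): the linear maps `f` of parity `i` which supercommute with `H`,
i.e. `f (x m) = (-1)^(i |x|) x (f m)`. -/
def homPart {H M N : Type} [Ring H] [Algebra ℂ H] [AddCommGroup M] [Module ℂ M] [Module H M]
    [AddCommGroup N] [Module ℂ N] [Module H N] [IsScalarTower ℂ H N]
    (gH : ZMod 2 → Submodule ℂ H) (gM : ZMod 2 → Submodule ℂ M) (gN : ZMod 2 → Submodule ℂ N)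
    (i : ZMod 2) : Submodule ℂ (M →ₗ[ℂ] N) where
  carrier := {f | (∀ j, ∀ m ∈ gM j, f m ∈ gN (i + j)) ∧
    ∀ k, ∀ x ∈ gH k, ∀ m, f (x • m) = ksign i k • x • f m}
  add_mem' := by
    rintro f g ⟨hf, hf'⟩ ⟨hg, hg'⟩
    refine ⟨fun j m hm => (gN _).add_mem (hf j m hm) (hg j m hm), fun k x hx m => ?_⟩
    simp [hf' k x hx m, hg' k x hx m]
  zero_mem' := ⟨fun j m _ => (gN _).zero_mem, fun k x _ m => by simp⟩
  smul_mem' := by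
    rintro c f ⟨hf, hf'⟩
    refine ⟨fun j m hm => (gN _).smul_mem c (hf j m hm), fun k x hx m => ?_⟩
    have : x • c • f m = c • x • f m := by
      rw [← algebraMap_smul H c (f m), ← algebraMap_smul H c (x • f m), smul_smul, smul_smul,
        Algebra.commutes]
    simp only [LinearMap.smul_apply, hf' k x hx m, this]
    rw [smul_comm]

/-- `Hom_H(M, N)`, the sum of its even and its odd part. -/
def superHom {H M N : Type} [Ring H] [Algebra ℂ H] [AddCommGroup M] [Module ℂ M] [Module H M]
    [AddCommGroup N] [Module ℂ N] [Module H N] [IsScalarTower ℂ H N]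
    (gH : ZMod 2 → Submodule ℂ H) (gM : ZMod 2 → Submodule ℂ M) (gN : ZMod 2 → Submodule ℂ N) :
    Submodule ℂ (M →ₗ[ℂ] N) :=
  homPart gH gM gN 0 ⊔ homPart gH gM gN 1

theorem homPart_le_superHom {H M N : Type} [Ring H] [Algebra ℂ H] [AddCommGroup M] [Module ℂ M]
    [Module H M] [AddCommGroup N] [Module ℂ N] [Module H N] [IsScalarTower ℂ H N]
    (gH : ZMod 2 → Submodule ℂ H) (gM : ZMod 2 → Submodule ℂ M) (gN : ZMod 2 → Submodule ℂ N)
    (i : ZMod 2) : homPart gH gM gN i ≤ superHom gH gM gN := by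
  rcases zmod2_cases i with rfl | rfl
  · exact le_sup_left
  · exact le_sup_right

theorem homPart_mul {H M : Type} [Ring H] [Algebra ℂ H] [AddCommGroup M] [Module ℂ M]
    [Module H M] [IsScalarTower ℂ H M]
    (gH : ZMod 2 → Submodule ℂ H) (gM : ZMod 2 → Submodule ℂ M) {i j : ZMod 2}
    {f g : Module.End ℂ M} (hf : f ∈ homPart gH gM gM i) (hg : g ∈ homPart gH gM gM j) :
    f * g ∈ homPart gH gM gM (i + j) := by
  refine ⟨fun k m hm => ?_, fun k x hx m => ?_⟩
  · rw [add_assoc]; exact hf.1 _ _ (hg.1 _ _ hm)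
  · simp only [Module.End.mul_apply]
    rw [hg.2 k x hx m, map_smul, hf.2 k x hx, ksign_add_left, smul_smul, mul_comm]

/-- The superalgebra `End_H(M)`. -/
def superEnd {H M : Type} [Ring H] [Algebra ℂ H] [AddCommGroup M] [Module ℂ M] [Module H M]
    [IsScalarTower ℂ H M] (gH : ZMod 2 → Submodule ℂ H) (gM : ZMod 2 → Submodule ℂ M) :
    Subalgebra ℂ (Module.End ℂ M) :=
  (superHom gH gM gM).toSubalgebra
    (homPart_le_superHom gH gM gM 0 ⟨fun j m hm => by simpa using hm, fun k x _ m => by simp⟩)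
    (by
      intro f g hf hg
      obtain ⟨f0, hf0, f1, hf1, rfl⟩ := Submodule.mem_sup.1 hf
      obtain ⟨g0, hg0, g1, hg1, rfl⟩ := Submodule.mem_sup.1 hg
      have key : ∀ {i j : ZMod 2} {f g : Module.End ℂ M}, f ∈ homPart gH gM gM i →
          g ∈ homPart gH gM gM j → f * g ∈ superHom gH gM gM :=
        fun hf hg => homPart_le_superHom gH gM gM _ (homPart_mul gH gM hf hg)
      rw [add_mul, mul_add, mul_add]
      exact add_mem (add_mem (key hf0 hg0) (key hf0 hg1)) (add_mem (key hf1 hg0) (key hf1 hg1)))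

/-! ## The tensor space `V^{⊗ r}`, `V = ℂ^{n|n}`

The homogeneous basis vector `v_k` (resp. `v_{k̄}`) of `V` is labelled by `(k, 0)` (resp. `(k, 1)`),
with `k : Fin n`, so the monomial basis of `V^{⊗ r}` is labelled by the functions
`Fin r → Fin n × ZMod 2`. -/

/-- Labels of the monomials `v_{i_1} ⊗ ⋯ ⊗ v_{i_r}`. -/
abbrev Mono (n r : ℕ) : Type := Fin r → Fin n × ZMod 2

/-- The superspace `V^{⊗ r}`. -/
def Tens (n r : ℕ) : Type := Mono n r →₀ ℂ

instance (n r : ℕ) : AddCommGroup (Tens n r) := inferInstanceAs (AddCommGroup (Mono n r →₀ ℂ))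
instance (n r : ℕ) : Module ℂ (Tens n r) := inferInstanceAs (Module ℂ (Mono n r →₀ ℂ))

variable {n r : ℕ}

/-- The monomial `v_{i_1} ⊗ ⋯ ⊗ v_{i_r}`. -/
def mono (I : Mono n r) : Tens n r := Finsupp.single I (1 : ℂ)

/-- The linear operator on `V^{⊗ r}` with prescribed values on monomials. -/
def onMono (F : Mono n r → Tens n r) : Module.End ℂ (Tens n r) :=
  Finsupp.linearCombination ℂ (M := Tens n r) F

@[simp] theorem onMono_mono (F : Mono n r → Tens n r) (I : Mono n r) :
    onMono F (mono I) = F I :=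
  (Finsupp.linearCombination_single ℂ 1 I).trans (one_smul ℂ _)

theorem end_ext {A B : Module.End ℂ (Tens n r)} (h : ∀ I, A (mono I) = B (mono I)) : A = B := by
  have : (A : (Mono n r →₀ ℂ) →ₗ[ℂ] Tens n r) = B := by
    apply Finsupp.lhom_ext'
    intro I
    apply LinearMap.ext_ring
    exact h I
  exact this

/-- The parity `|v_{i_1}| + ⋯ + |v_{i_{p-1}}|` of the part of the monomial before position `p`. -/
def prePar (I : Mono n r) (p : Fin r) : ZMod 2 := ∑ q : Fin r, if q < p then (I q).2 else 0

/-- The weight of a monomial: the number of tensorands `v_k` or `v_{k̄}`, for each `k`. -/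
def wt (I : Mono n r) (k : Fin n) : ℕ := (Finset.univ.filter fun p => (I p).1 = k).card

/-- The parity `i` part of `V^{⊗ r}`. -/
def tensParity (n r : ℕ) (i : ZMod 2) : Submodule ℂ (Tens n r) :=
  Submodule.span ℂ {v | ∃ I : Mono n r, ∑ p, (I p).2 = i ∧ v = mono I}

theorem prePar_update (I : Mono n r) (p q : Fin r) (a : Fin n) (d : ZMod 2) :
    prePar (Function.update I p (a, (I p).2 + d)) q = prePar I q + if p < q then d else 0 := by
  unfold prePar
  have : ∀ s : Fin r, (if s < q then ((Function.update I p (a, (I p).2 + d)) s).2 else 0) =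
      (if s < q then (I s).2 else 0) + (if s = p then (if p < q then d else 0) else 0) := by
    intro s
    by_cases hs : s = p
    · subst hs; by_cases h : s < q <;> simp [h]
    · simp [hs]
  simp only [this, Finset.sum_add_distrib]
  simp

/-! ## The Sergeev superalgebra -/

/-- Generators `s_1, …, s_{r-1}` and `c_1, …, c_r` (with indices shifted to start at `0`). -/
inductive SergeevGen (r : ℕ) : Type
  | s (i : ℕ) (hi : i + 1 < r)
  | c (j : Fin r)

/-- The `s_i` are even, the `c_j` are odd. -/
def SergeevGen.par {r : ℕ} : SergeevGen r → ZMod 2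
  | .s _ _ => 0
  | .c _ => 1

/-- The free generator `s_i`. -/
def gS {r : ℕ} (i : ℕ) (hi : i + 1 < r) : FreeAlgebra ℂ (SergeevGen r) := FreeAlgebra.ι ℂ (.s i hi)

/-- The free generator `c_j`. -/
def gC {r : ℕ} (j : Fin r) : FreeAlgebra ℂ (SergeevGen r) := FreeAlgebra.ι ℂ (.c j)

/-- The defining relations of the Sergeev superalgebra. -/
inductive SergeevRel (r : ℕ) :
    FreeAlgebra ℂ (SergeevGen r) → FreeAlgebra ℂ (SergeevGen r) → Prop
  | c_sq (j) : SergeevRel r (gC j * gC j) 1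
  | c_anti (i j) : i ≠ j → SergeevRel r (gC i * gC j) (-(gC j * gC i))
  | s_sq (i hi) : SergeevRel r (gS i hi * gS i hi) 1
  | braid (i) (hi : i + 1 < r) (hi' : i + 1 + 1 < r) :
      SergeevRel r (gS i hi * gS (i + 1) hi' * gS i hi) (gS (i + 1) hi' * gS i hi * gS (i + 1) hi')
  | s_comm (i j hi hj) : i ≠ j + 1 → j ≠ i + 1 →
      SergeevRel r (gS i hi * gS j hj) (gS j hj * gS i hi)
  | cs_left (i) (hi : i + 1 < r) :
      SergeevRel r (gC ⟨i, by omega⟩ * gS i hi) (gS i hi * gC ⟨i + 1, hi⟩)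
  | cs_right (i) (hi : i + 1 < r) :
      SergeevRel r (gC ⟨i + 1, hi⟩ * gS i hi) (gS i hi * gC ⟨i, by omega⟩)
  | cs_far (i hi) (j : Fin r) : j.val ≠ i → j.val ≠ i + 1 →
      SergeevRel r (gC j * gS i hi) (gS i hi * gC j)

/-- The Sergeev superalgebra of rank `r`. -/
abbrev Sergeev (r : ℕ) : Type := Presented (SergeevRel r)

/-- The grading of the Sergeev superalgebra. -/
abbrev sergeevParity (r : ℕ) : ZMod 2 → Submodule ℂ (Sergeev r) :=
  parityPart (SergeevRel r) SergeevGen.par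

/-- The action of `s_i`: the signed swap of the tensorands `i` and `i + 1`. -/
def opS (i : ℕ) (hi : i + 1 < r) : Module.End ℂ (Tens n r) :=
  onMono fun I => ksign (I ⟨i, by omega⟩).2 (I ⟨i + 1, hi⟩).2 •
    mono (I ∘ Equiv.swap (⟨i, by omega⟩ : Fin r) ⟨i + 1, hi⟩)

/-- The action of `c_j`: `P` applied to the tensorand `j`, where
`P v_i = (-1)^{|i|} √-1 v_{ī}`, with the sign `(-1)^{|u_1| + ⋯ + |u_{j-1}|}`. -/
def opC (j : Fin r) : Module.End ℂ (Tens n r) :=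
  onMono fun I => (ksign 1 (prePar I j) * (ksign 1 (I j).2 * Complex.I)) •
    mono (Function.update I j ((I j).1, (I j).2 + 1))

theorem prePar_swap (I : Mono n r) (i : ℕ) (hi : i + 1 < r) (j : Fin r) (hj : j.val ≠ i + 1) :
    prePar (I ∘ Equiv.swap (⟨i, by omega⟩ : Fin r) ⟨i + 1, hi⟩) j = prePar I j := by
  unfold prePar
  rw [← Equiv.sum_comp (Equiv.swap (⟨i, by omega⟩ : Fin r) ⟨i + 1, hi⟩)]
  refine Finset.sum_congr rfl fun s _ => ?_
  simp only [Function.comp_apply, Equiv.swap_apply_self]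
  have : (Equiv.swap (⟨i, by omega⟩ : Fin r) ⟨i + 1, hi⟩ s < j) ↔ s < j := by
    rw [Equiv.swap_apply_def]
    simp only [Fin.lt_def, Fin.ext_iff]
    split_ifs with h1 h2 <;> simp_all <;> omega
  simp [this]

theorem prePar_succ (I : Mono n r) (i : ℕ) (hi : i + 1 < r) :
    prePar I ⟨i + 1, hi⟩ = prePar I ⟨i, by omega⟩ + (I ⟨i, by omega⟩).2 := by
  unfold prePar
  have : ∀ s : Fin r, (if s < ⟨i + 1, hi⟩ then (I s).2 else 0) =
      (if s < (⟨i, by omega⟩ : Fin r) then (I s).2 else 0) +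
      (if s = ⟨i, by omega⟩ then (I ⟨i, by omega⟩).2 else 0) := by
    intro s
    by_cases hs : s = ⟨i, by omega⟩
    · subst hs; simp
    · have : s < ⟨i + 1, hi⟩ ↔ s < (⟨i, by omega⟩ : Fin r) := by
        simp only [Fin.lt_def, Fin.ext_iff] at *; omega
      simp [hs, this]
  simp only [this, Finset.sum_add_distrib]
  simp

theorem opS_sq (i : ℕ) (hi : i + 1 < r) : opS (n := n) i hi * opS i hi = 1 := by
  refine end_ext fun I => ?_
  simp only [Module.End.mul_apply, opS, onMono_mono, map_smul, smul_smul, Function.comp_apply,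
    Equiv.swap_apply_left, Equiv.swap_apply_right, Module.End.one_apply]
  rw [ksign_comm (I ⟨i + 1, hi⟩).2, ksign_mul_self, one_smul]
  congr 1; funext s; simp

theorem opC_sq (j : Fin r) : opC (n := n) j * opC j = 1 := by
  refine end_ext fun I => ?_
  simp only [Module.End.mul_apply, opC, onMono_mono, map_smul, smul_smul, Module.End.one_apply,
    prePar_update, lt_irrefl, if_false, add_zero, Function.update_self, Function.update_idem,
    ksign_add]
  have h : (1 : ZMod 2) + 1 = 0 := by decide
  rw [add_assoc, h, add_zero]
  have : Function.update I j ((I j).1, (I j).2) = I := by simp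
  rw [this]
  have e : ksign 1 (prePar I j) * (ksign 1 (I j).2 * Complex.I) *
      (ksign 1 (prePar I j) * (ksign 1 (I j).2 * ksign 1 1 * Complex.I)) =
      (ksign 1 (prePar I j) * ksign 1 (prePar I j)) * (ksign 1 (I j).2 * ksign 1 (I j).2) *
        (-(Complex.I * Complex.I)) := by rw [ksign_one_one]; ring
  rw [e, ksign_mul_self, ksign_mul_self]; simp

theorem opC_anti (i j : Fin r) (hij : i ≠ j) : opC (n := n) i * opC j = -(opC j * opC i) := by
  refine end_ext fun I => ?_
  simp only [LinearMap.neg_apply, Module.End.mul_apply, opC, onMono_mono, map_smul, smul_smul,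
    prePar_update, Function.update_of_ne hij, Function.update_of_ne hij.symm, ksign_add]
  rw [Function.update_comm hij, ← neg_smul]
  congr 1
  rcases lt_or_gt_of_ne hij with h | h
  · simp [h, h.not_gt]; ring
  · simp [h, h.not_gt]; ring

theorem opC_opS_left (i : ℕ) (hi : i + 1 < r) :
    opC (n := n) ⟨i, by omega⟩ * opS i hi = opS i hi * opC ⟨i + 1, hi⟩ := by
  refine end_ext fun I => ?_
  have hne : (⟨i, by omega⟩ : Fin r) ≠ ⟨i + 1, hi⟩ := by simp [Fin.ext_iff]
  simp only [Module.End.mul_apply, opC, opS, onMono_mono, map_smul, smul_smul,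
    Function.comp_apply, Equiv.swap_apply_left, Function.update_self, Function.update_of_ne hne]
  rw [prePar_swap _ _ _ _ (by simp), prePar_succ]
  congr 1
  · simp only [ksign_add]
    rw [ksign_comm (I ⟨i, by omega⟩).2 1]
    linear_combination (-ksign (I ⟨i, by omega⟩).2 (I ⟨i + 1, hi⟩).2 *
      ksign 1 (prePar I ⟨i, by omega⟩) * ksign 1 (I ⟨i + 1, hi⟩).2 * Complex.I) *
      ksign_mul_self 1 (I ⟨i, by omega⟩).2
  · congr 1
    funext s
    by_cases h1 : s = ⟨i, by omega⟩
    · subst h1; simp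
    · by_cases h2 : s = ⟨i + 1, hi⟩
      · subst h2; simp [hne, hne.symm]
      · simp [h1, h2, Equiv.swap_apply_of_ne_of_ne h1 h2]

theorem opC_opS_far (i : ℕ) (hi : i + 1 < r) (j : Fin r) (h1 : j.val ≠ i) (h2 : j.val ≠ i + 1) :
    opC (n := n) j * opS i hi = opS i hi * opC j := by
  refine end_ext fun I => ?_
  have n1 : (⟨i, by omega⟩ : Fin r) ≠ j := by simp [Fin.ext_iff]; omega
  have n2 : (⟨i + 1, hi⟩ : Fin r) ≠ j := by simp [Fin.ext_iff]; omega
  simp only [Module.End.mul_apply, opC, opS, onMono_mono, map_smul, smul_smul,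
    Function.comp_apply, Equiv.swap_apply_of_ne_of_ne n1.symm n2.symm, Function.update_of_ne n1,
    Function.update_of_ne n2]
  rw [prePar_swap _ _ _ _ h2]
  congr 1
  · ring
  · congr 1
    funext s
    by_cases hs : s = j
    · subst hs; simp [Equiv.swap_apply_of_ne_of_ne n1.symm n2.symm]
    · have : Equiv.swap (⟨i, by omega⟩ : Fin r) ⟨i + 1, hi⟩ s ≠ j := by
        rw [Equiv.swap_apply_def]; split_ifs <;> assumption
      simp [hs, this]

theorem opS_comm (i j : ℕ) (hi : i + 1 < r) (hj : j + 1 < r) (h1 : i ≠ j + 1) (h2 : j ≠ i + 1) :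
    opS (n := n) i hi * opS j hj = opS j hj * opS i hi := by
  by_cases h : i = j
  · subst h; rfl
  refine end_ext fun I => ?_
  have a1 : (⟨i, by omega⟩ : Fin r) ≠ ⟨j, by omega⟩ := by simp [Fin.ext_iff]; omega
  have a2 : (⟨i, by omega⟩ : Fin r) ≠ ⟨j + 1, hj⟩ := by simp [Fin.ext_iff]; omega
  have a3 : (⟨i + 1, hi⟩ : Fin r) ≠ ⟨j, by omega⟩ := by simp [Fin.ext_iff]; omega
  have a4 : (⟨i + 1, hi⟩ : Fin r) ≠ ⟨j + 1, hj⟩ := by simp [Fin.ext_iff]; omega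
  simp only [Module.End.mul_apply, opS, onMono_mono, map_smul, smul_smul,
    Function.comp_apply, Equiv.swap_apply_of_ne_of_ne a1 a2, Equiv.swap_apply_of_ne_of_ne a3 a4,
    Equiv.swap_apply_of_ne_of_ne a1.symm a3.symm, Equiv.swap_apply_of_ne_of_ne a2.symm a4.symm]
  congr 1
  · ring
  · congr 1
    funext s
    simp only [Function.comp_apply]
    congr 1
    have hd : (Equiv.swap (⟨i, by omega⟩ : Fin r) ⟨i + 1, hi⟩).Disjoint
        (Equiv.swap (⟨j, by omega⟩ : Fin r) ⟨j + 1, hj⟩) := by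
      intro x
      by_cases x1 : x = ⟨i, by omega⟩
      · right; subst x1; exact Equiv.swap_apply_of_ne_of_ne a1 a2
      · by_cases x2 : x = ⟨i + 1, hi⟩
        · right; subst x2; exact Equiv.swap_apply_of_ne_of_ne a3 a4
        · left; exact Equiv.swap_apply_of_ne_of_ne x1 x2
    exact congrArg (fun σ : Equiv.Perm (Fin r) => σ s) hd.commute.eq.symm

theorem opS_braid (i : ℕ) (hi : i + 1 < r) (hi' : i + 1 + 1 < r) :
    opS (n := n) i hi * opS (i + 1) hi' * opS i hi =
      opS (i + 1) hi' * opS i hi * opS (i + 1) hi' := by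
  refine end_ext fun I => ?_
  have a1 : (⟨i, by omega⟩ : Fin r) ≠ ⟨i + 1, by omega⟩ := by simp [Fin.ext_iff]
  have a2 : (⟨i, by omega⟩ : Fin r) ≠ ⟨i + 1 + 1, by omega⟩ := by simp [Fin.ext_iff]; omega
  have a3 : (⟨i + 1, by omega⟩ : Fin r) ≠ ⟨i + 1 + 1, by omega⟩ := by simp [Fin.ext_iff]
  simp only [Module.End.mul_apply, opS, onMono_mono, map_smul, smul_smul,
    Function.comp_apply, Equiv.swap_apply_left, Equiv.swap_apply_right,
    Equiv.swap_apply_of_ne_of_ne a1 a2, Equiv.swap_apply_of_ne_of_ne a2.symm a3.symm]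
  congr 1
  · ring
  · congr 1
    funext s
    simp only [Function.comp_apply]
    congr 1
    by_cases s1 : s = ⟨i, by omega⟩
    · subst s1
      simp [Equiv.swap_apply_of_ne_of_ne a1 a2, Equiv.swap_apply_of_ne_of_ne a2.symm a3.symm]
    by_cases s2 : s = ⟨i + 1, by omega⟩
    · subst s2
      simp [Equiv.swap_apply_of_ne_of_ne a1 a2, Equiv.swap_apply_of_ne_of_ne a2.symm a3.symm]
    by_cases s3 : s = ⟨i + 1 + 1, by omega⟩
    · subst s3
      simp [Equiv.swap_apply_of_ne_of_ne a1 a2, Equiv.swap_apply_of_ne_of_ne a2.symm a3.symm]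
    simp [Equiv.swap_apply_of_ne_of_ne s1 s2, Equiv.swap_apply_of_ne_of_ne s2 s3]

/-- The operators by which the generators of the Sergeev superalgebra act. -/
def sergeevOp : SergeevGen r → Module.End ℂ (Tens n r)
  | .s i hi => opS i hi
  | .c j => opC j

theorem sergeevOp_rel {x y : FreeAlgebra ℂ (SergeevGen r)} (h : SergeevRel r x y) :
    FreeAlgebra.lift ℂ (sergeevOp (n := n)) x = FreeAlgebra.lift ℂ sergeevOp y := by
  induction h <;>
    simp only [gS, gC, map_mul, map_neg, map_one, FreeAlgebra.lift_ι_apply, sergeevOp]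
  case c_sq j => exact opC_sq j
  case c_anti i j hij => exact opC_anti i j hij
  case s_sq i hi => exact opS_sq i hi
  case braid i hi hi' => exact opS_braid i hi hi'
  case s_comm i j hi hj h1 h2 => exact opS_comm i j hi hj h1 h2
  case cs_left i hi => exact opC_opS_left i hi
  case cs_right i hi =>
    have h := congrArg (fun x => opS i hi * x * opS i hi) (opC_opS_left (n := n) i hi)
    beta_reduce at h
    rw [← mul_assoc, mul_assoc _ (opS i hi) (opS i hi), opS_sq, mul_one, ← mul_assoc (opS i hi),
      opS_sq, one_mul] at h
    exact h.symm
  case cs_far i hi j h1 h2 => exact opC_opS_far i hi j h1 h2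

/-- The action of the Sergeev superalgebra on `V^{⊗ r}`. -/
def sergeevRep (n r : ℕ) : Sergeev r →ₐ[ℂ] Module.End ℂ (Tens n r) :=
  Presented.lift _ sergeevOp fun _ _ h => sergeevOp_rel h

instance : Module (Sergeev r) (Tens n r) := Module.compHom _ (sergeevRep n r).toRingHom

theorem sergeev_smul_def (x : Sergeev r) (v : Tens n r) : x • v = sergeevRep n r x v := rfl

instance : IsScalarTower ℂ (Sergeev r) (Tens n r) where
  smul_assoc c x v := by simp [sergeev_smul_def]

/-! ## Permutation supermodules -/

/-- `Λ(n, r)`: the compositions of `r` with `n` (possibly zero) entries. -/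
abbrev Weight (n r : ℕ) : Type := {l : Fin n → ℕ // ∑ k, l k = r}

instance : Fintype (Weight n r) :=
  Fintype.subtype (Finset.piAntidiag Finset.univ r) (by simp [Finset.mem_piAntidiag])

theorem wt_swap (I : Mono n r) (σ : Equiv.Perm (Fin r)) : wt (I ∘ σ) = wt I := by
  funext k
  exact Finset.card_bij (fun p _ => σ p) (by simp) (by simp)
    (fun q hq => ⟨σ.symm q, by simpa using hq, by simp⟩)

theorem wt_congr {I J : Mono n r} (h : ∀ p, (I p).1 = (J p).1) : wt I = wt J := by
  funext k; simp [wt, h]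

/-- The span of the monomials of weight `l`. -/
def weightSpace (l : Weight n r) : Submodule ℂ (Tens n r) :=
  Submodule.span ℂ {v | ∃ I : Mono n r, wt I = l.1 ∧ v = mono I}

theorem sergeevOp_weightSpace (l : Weight n r) (g : SergeevGen r) {v : Tens n r}
    (hv : v ∈ weightSpace l) : sergeevOp g v ∈ weightSpace l := by
  refine (Submodule.span_le (p := (weightSpace l).comap (sergeevOp g))).2 ?_ hv
  rintro _ ⟨I, hI, rfl⟩
  cases g with
  | s i hi =>
    simp only [sergeevOp, opS, SetLike.mem_coe, Submodule.mem_comap, onMono_mono]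
    exact Submodule.smul_mem _ _ (Submodule.subset_span ⟨_, by rw [wt_swap, hI], rfl⟩)
  | c j =>
    simp only [sergeevOp, opC, SetLike.mem_coe, Submodule.mem_comap, onMono_mono]
    refine Submodule.smul_mem _ _ (Submodule.subset_span ⟨_, ?_, rfl⟩)
    rw [← hI]
    refine wt_congr fun p => ?_
    by_cases h : p = j
    · subst h; simp
    · simp [h]

/-- The permutation supermodule `M^λ`: the span of the monomials of weight `λ`. -/
def permMod (l : Weight n r) : Submodule (Sergeev r) (Tens n r) where
  carrier := weightSpace l
  add_mem' := (weightSpace l).add_mem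
  zero_mem' := (weightSpace l).zero_mem
  smul_mem' := by
    intro x v hv
    obtain ⟨y, rfl⟩ := Presented.mk_surjective (SergeevRel r) x
    have key : ∀ v ∈ weightSpace l, FreeAlgebra.lift ℂ (sergeevOp (n := n)) y v ∈
        weightSpace l := by
      induction y using FreeAlgebra.induction with
      | grade0 c => intro v hv; simpa [Algebra.algebraMap_eq_smul_one] using
          (weightSpace l).smul_mem c hv
      | grade1 g => intro v hv; simpa using sergeevOp_weightSpace l g hv
      | mul a b ha hb => intro v hv; simpa using ha _ (hb _ hv)
      | add a b ha hb => intro v hv; simpa using add_mem (ha _ hv) (hb _ hv)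
    simpa [sergeev_smul_def, sergeevRep, Presented.lift_mk] using key v hv

/-- The grading of `M^λ`, inherited from `V^{⊗ r}`. -/
def permParity (l : Weight n r) (i : ZMod 2) : Submodule ℂ (permMod l) :=
  (tensParity n r i).comap ((permMod l).subtype.restrictScalars ℂ)

/-- `Λ'(r)`: the compositions of `r` with `r` entries whose only zeros are trailing. -/
abbrev Weight' (r : ℕ) : Type := {l : Weight r r // ∀ i j : Fin r, i ≤ j → l.1 i = 0 → l.1 j = 0}

/-- `⨁_{λ ∈ Λ'(r)} M^λ`. -/
abbrev PermSum (r : ℕ) : Type := ⨁ l : Weight' r, permMod l.1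

/-- The grading of `⨁_{λ ∈ Λ'(r)} M^λ`. -/
def permSumParity (r : ℕ) (i : ZMod 2) : Submodule ℂ (PermSum r) :=
  ⨅ l : Weight' r, (permParity l.1 i).comap (DirectSum.component ℂ (Weight' r) _ l)

instance (r : ℕ) : IsScalarTower ℂ (Sergeev r) (PermSum r) where
  smul_assoc c x v := by
    ext l; simp [DirectSum.smul_apply]

/-- The superalgebra `End_H(⨁_{λ ∈ Λ'(r)} M^λ)`. -/
abbrev EndPerm (r : ℕ) : Subalgebra ℂ (Module.End ℂ (PermSum r)) :=
  superEnd (sergeevParity r) (permSumParity r)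

/-- The inclusion `⨁_{λ ∈ Λ'(r)} M^λ ⊆ V^{⊗ r}`. -/
def permIncl (r : ℕ) : PermSum r →ₗ[ℂ] Tens r r :=
  DirectSum.toModule ℂ (Weight' r) (Tens r r) fun l => (permMod l.1).subtype.restrictScalars ℂ

/-! ## The Schur superalgebra of type Q -/

/-- The divided power `x^{(k)} = x^k / k!`. -/
def divPow {A : Type} [Ring A] [Algebra ℂ A] (x : A) (k : ℕ) : A := ((k.factorial : ℂ)⁻¹) • x ^ k

/-- `m = l + α_i`, where `α_i` has the entries `1`, `-1` at the places `i`, `i + 1`. -/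
def IsShift (i : ℕ) (l m : Weight n r) : Prop :=
  ∀ k : Fin n, (m.1 k : ℤ) = l.1 k + (if k.val = i then 1 else 0) - (if k.val = i + 1 then 1 else 0)

/-- Generators of the Schur superalgebra: `1_λ`, `e_i` and `f_i` (the case `b = 0`), `e_{ī}` and
`f_{ī}` (the case `b = 1`), and `h_{j̄}`, with indices shifted to start at `0`. -/
inductive SchurGen (n r : ℕ) : Type
  | one (l : Weight n r)
  | e (i : ℕ) (hi : i + 1 < n) (b : ZMod 2)
  | f (i : ℕ) (hi : i + 1 < n) (b : ZMod 2)
  | hb (j : Fin n)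

/-- The free generator `1_λ`. -/
def g1 (l : Weight n r) : FreeAlgebra ℂ (SchurGen n r) := FreeAlgebra.ι ℂ (.one l)
/-- The free generator `e_i` or `e_{ī}`. -/
def gE (i : ℕ) (hi : i + 1 < n) (b : ZMod 2) : FreeAlgebra ℂ (SchurGen n r) :=
  FreeAlgebra.ι ℂ (.e i hi b)
/-- The free generator `f_i` or `f_{ī}`. -/
def gF (i : ℕ) (hi : i + 1 < n) (b : ZMod 2) : FreeAlgebra ℂ (SchurGen n r) :=
  FreeAlgebra.ι ℂ (.f i hi b)
/-- The free generator `h_{j̄}`. -/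
def gH (j : Fin n) : FreeAlgebra ℂ (SchurGen n r) := FreeAlgebra.ι ℂ (.hb j)

/-- The defining relations of the Schur superalgebra of type Q. -/
inductive SchurRel (n r : ℕ) :
    FreeAlgebra ℂ (SchurGen n r) → FreeAlgebra ℂ (SchurGen n r) → Prop
  -- idempotents and the odd Cartan generators
  | one_mul (l m) : SchurRel n r (g1 l * g1 m) (if l = m then g1 l else 0)
  | one_sum : SchurRel n r (∑ l, g1 l) 1
  | h_one (j l) : SchurRel n r (gH j * g1 l) (g1 l * gH j)
  | h_h (i j) (l) : SchurRel n r ((gH i * gH j + gH j * gH i) * g1 l)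
      (if i = j then ((2 * l.1 i : ℕ) : ℂ) • g1 l else 0)
  | h_zero (j) (l : Weight n r) : l.1 j = 0 → SchurRel n r (gH j * g1 l) 0
  -- weights
  | e_shift (i hi b l m) : IsShift i l m → SchurRel n r (gE i hi b * g1 l) (g1 m * gE i hi b)
  | e_right (i hi b) (l : Weight n r) : (∀ m, ¬ IsShift i l m) → SchurRel n r (gE i hi b * g1 l) 0
  | e_left (i hi b) (m : Weight n r) : (∀ l, ¬ IsShift i l m) → SchurRel n r (g1 m * gE i hi b) 0
  | f_shift (i hi b l m) : IsShift i l m → SchurRel n r (gF i hi b * g1 m) (g1 l * gF i hi b)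
  | f_right (i hi b) (m : Weight n r) : (∀ l, ¬ IsShift i l m) → SchurRel n r (gF i hi b * g1 m) 0
  | f_left (i hi b) (l : Weight n r) : (∀ m, ¬ IsShift i l m) → SchurRel n r (g1 l * gF i hi b) 0
  -- brackets of `h` with `e` and `f`
  | h_e (i hi) (j : Fin n) (l) : j.val = i →
      SchurRel n r ((gH j * gE i hi 0 - gE i hi 0 * gH j) * g1 l) (gE i hi 1 * g1 l)
  | h_e' (i hi) (j : Fin n) (l) : j.val = i + 1 →
      SchurRel n r ((gH j * gE i hi 0 - gE i hi 0 * gH j) * g1 l) (-(gE i hi 1) * g1 l)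
  | h_f (i hi) (j : Fin n) (l) : j.val = i →
      SchurRel n r ((gH j * gF i hi 0 - gF i hi 0 * gH j) * g1 l) (-(gF i hi 1) * g1 l)
  | h_f' (i hi) (j : Fin n) (l) : j.val = i + 1 →
      SchurRel n r ((gH j * gF i hi 0 - gF i hi 0 * gH j) * g1 l) (gF i hi 1 * g1 l)
  | h_eb (i hi) (j : Fin n) (l) : j.val = i ∨ j.val = i + 1 →
      SchurRel n r ((gH j * gE i hi 1 + gE i hi 1 * gH j) * g1 l) (gE i hi 0 * g1 l)
  | h_fb (i hi) (j : Fin n) (l) : j.val = i ∨ j.val = i + 1 →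
      SchurRel n r ((gH j * gF i hi 1 + gF i hi 1 * gH j) * g1 l) (gF i hi 0 * g1 l)
  | h_e_far (i hi) (j : Fin n) (l) : j.val ≠ i → j.val ≠ i + 1 →
      SchurRel n r ((gH j * gE i hi 0 - gE i hi 0 * gH j) * g1 l) 0
  | h_f_far (i hi) (j : Fin n) (l) : j.val ≠ i → j.val ≠ i + 1 →
      SchurRel n r ((gH j * gF i hi 0 - gF i hi 0 * gH j) * g1 l) 0
  | h_eb_far (i hi) (j : Fin n) (l) : j.val ≠ i → j.val ≠ i + 1 →
      SchurRel n r ((gH j * gE i hi 1 + gE i hi 1 * gH j) * g1 l) 0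
  | h_fb_far (i hi) (j : Fin n) (l) : j.val ≠ i → j.val ≠ i + 1 →
      SchurRel n r ((gH j * gF i hi 1 + gF i hi 1 * gH j) * g1 l) 0
  -- brackets of `e` with `f`
  | e_f (i hi) (l) : SchurRel n r ((gE i hi 0 * gF i hi 0 - gF i hi 0 * gE i hi 0) * g1 l)
      (((l.1 ⟨i, by omega⟩ : ℂ) - (l.1 ⟨i + 1, hi⟩ : ℂ)) • g1 l)
  | eb_fb (i hi) (l) : SchurRel n r ((gE i hi 1 * gF i hi 1 + gF i hi 1 * gE i hi 1) * g1 l)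
      (((l.1 ⟨i, by omega⟩ : ℂ) + (l.1 ⟨i + 1, hi⟩ : ℂ)) • g1 l)
  | e_fb (i hi) (l) : SchurRel n r ((gE i hi 0 * gF i hi 1 - gF i hi 1 * gE i hi 0) * g1 l)
      ((gH ⟨i, by omega⟩ - gH ⟨i + 1, hi⟩) * g1 l)
  | eb_f (i hi) (l) : SchurRel n r ((gE i hi 1 * gF i hi 0 - gF i hi 0 * gE i hi 1) * g1 l)
      ((gH ⟨i, by omega⟩ - gH ⟨i + 1, hi⟩) * g1 l)
  | e_f_ne (i j hi hj) (l) : i ≠ j →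
      SchurRel n r ((gE i hi 0 * gF j hj 0 - gF j hj 0 * gE i hi 0) * g1 l) 0
  | eb_fb_ne (i j hi hj) (l) : i ≠ j →
      SchurRel n r ((gE i hi 1 * gF j hj 1 + gF j hj 1 * gE i hi 1) * g1 l) 0
  | e_fb_ne (i j hi hj) (l) : i ≠ j →
      SchurRel n r ((gE i hi 0 * gF j hj 1 - gF j hj 1 * gE i hi 0) * g1 l) 0
  | eb_f_ne (i j hi hj) (l) : i ≠ j →
      SchurRel n r ((gE i hi 1 * gF j hj 0 - gF j hj 0 * gE i hi 1) * g1 l) 0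
  -- brackets among the `e` and among the `f`
  | eb_sq (i hi) (l) : SchurRel n r (gE i hi 1 ^ 2 * g1 l) 0
  | fb_sq (i hi) (l) : SchurRel n r (gF i hi 1 ^ 2 * g1 l) 0
  | e_eb (i j hi hj) (l) : i ≠ j + 1 → j ≠ i + 1 →
      SchurRel n r ((gE i hi 0 * gE j hj 1 - gE j hj 1 * gE i hi 0) * g1 l) 0
  | f_fb (i j hi hj) (l) : i ≠ j + 1 → j ≠ i + 1 →
      SchurRel n r ((gF i hi 0 * gF j hj 1 - gF j hj 1 * gF i hi 0) * g1 l) 0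
  | e_e (i j hi hj) (l) : i + 1 < j ∨ j + 1 < i →
      SchurRel n r ((gE i hi 0 * gE j hj 0 - gE j hj 0 * gE i hi 0) * g1 l) 0
  | f_f (i j hi hj) (l) : i + 1 < j ∨ j + 1 < i →
      SchurRel n r ((gF i hi 0 * gF j hj 0 - gF j hj 0 * gF i hi 0) * g1 l) 0
  | eb_eb (i j hi hj) (l) : i + 1 < j ∨ j + 1 < i →
      SchurRel n r ((gE i hi 1 * gE j hj 1 + gE j hj 1 * gE i hi 1) * g1 l) 0
  | fb_fb (i j hi hj) (l) : i + 1 < j ∨ j + 1 < i →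
      SchurRel n r ((gF i hi 1 * gF j hj 1 + gF j hj 1 * gF i hi 1) * g1 l) 0
  | e_e_adj (i) (hi : i + 1 < n) (hj : i + 1 + 1 < n) (l) :
      SchurRel n r ((gE i hi 0 * gE (i + 1) hj 0 - gE (i + 1) hj 0 * gE i hi 0) * g1 l)
        ((gE i hi 1 * gE (i + 1) hj 1 + gE (i + 1) hj 1 * gE i hi 1) * g1 l)
  | e_eb_adj (i) (hi : i + 1 < n) (hj : i + 1 + 1 < n) (l) :
      SchurRel n r ((gE i hi 0 * gE (i + 1) hj 1 - gE (i + 1) hj 1 * gE i hi 0) * g1 l)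
        ((gE i hi 1 * gE (i + 1) hj 0 - gE (i + 1) hj 0 * gE i hi 1) * g1 l)
  | f_f_adj (i) (hi : i + 1 < n) (hj : i + 1 + 1 < n) (l) :
      SchurRel n r ((gF (i + 1) hj 0 * gF i hi 0 - gF i hi 0 * gF (i + 1) hj 0) * g1 l)
        ((gF (i + 1) hj 1 * gF i hi 1 + gF i hi 1 * gF (i + 1) hj 1) * g1 l)
  | f_fb_adj (i) (hi : i + 1 < n) (hj : i + 1 + 1 < n) (l) :
      SchurRel n r ((gF (i + 1) hj 1 * gF i hi 0 - gF i hi 0 * gF (i + 1) hj 1) * g1 l)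
        ((gF (i + 1) hj 0 * gF i hi 1 - gF i hi 1 * gF (i + 1) hj 0) * g1 l)
  -- Serre relations
  | serre_e (i j hi hj b) (l) : i = j + 1 ∨ j = i + 1 →
      SchurRel n r ((divPow (gE i hi 0) 2 * gE j hj b - gE i hi 0 * gE j hj b * gE i hi 0 +
        gE j hj b * divPow (gE i hi 0) 2) * g1 l) 0
  | serre_f (i j hi hj b) (l) : i = j + 1 ∨ j = i + 1 →
      SchurRel n r ((divPow (gF i hi 0) 2 * gF j hj b - gF i hi 0 * gF j hj b * gF i hi 0 +
        gF j hj b * divPow (gF i hi 0) 2) * g1 l) 0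

/-- The Schur superalgebra of type Q. -/
abbrev Schur (n r : ℕ) : Type := Presented (SchurRel n r)

/-- The action of `1_λ`: the projection of `V^{⊗ r}` onto the monomials of weight `λ`. -/
def opOne (l : Weight n r) : Module.End ℂ (Tens n r) :=
  onMono fun I => if wt I = l.1 then mono I else 0

/-- Let `x` be the linear operator of parity `d` on `V` which sends `v_b` to `v_a` and `v_{b̄}` to
`v_{ā}` if `d` is even, `v_b` to `v_{ā}` and `v_{b̄}` to `v_a` if `d` is odd, and the other basis
vectors to `0`. This is the operator which applies `x` to the tensorand `p`, with the sign
`(-1)^{d (|u_1| + ⋯ + |u_{p-1}|)}`. -/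
def opAt (a b : Fin n) (d : ZMod 2) (p : Fin r) : Module.End ℂ (Tens n r) :=
  onMono fun I => if (I p).1 = b then
    ksign d (prePar I p) • mono (Function.update I p (a, (I p).2 + d)) else 0

/-- The action of the same operator `x` on `V^{⊗ r}`: the sum over all tensorands. -/
def opD (a b : Fin n) (d : ZMod 2) : Module.End ℂ (Tens n r) := ∑ p, opAt a b d p

/-- The operators by which the generators of the Schur superalgebra act. -/
def schurOp : SchurGen n r → Module.End ℂ (Tens n r)
  | .one l => opOne l
  | .e i hi b => opD ⟨i, by omega⟩ ⟨i + 1, hi⟩ b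
  | .f i hi b => opD ⟨i + 1, hi⟩ ⟨i, by omega⟩ b
  | .hb j => opD j j 1

theorem opAt_same (a b c d : Fin n) (x y : ZMod 2) (p : Fin r) :
    opAt a b x p * opAt c d y p = if b = c then opAt a d (x + y) p else 0 := by
  refine end_ext fun I => ?_
  by_cases hd : (I p).1 = d
  · by_cases hc : c = b
    · subst hc
      simp [opAt, Module.End.mul_apply, hd, prePar_update, smul_smul, ksign_add_left, add_assoc,
        add_comm y x, mul_comm]
    · have hc' : ¬ b = c := fun h => hc h.symm
      simp [opAt, Module.End.mul_apply, hd, hc, hc']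
  · by_cases hc : b = c <;> simp [opAt, Module.End.mul_apply, hd, hc]

theorem opAt_ne (a b c d : Fin n) (x y : ZMod 2) {p q : Fin r} (hpq : p ≠ q) :
    opAt a b x p * opAt c d y q = ksign x y • (opAt c d y q * opAt a b x p) := by
  refine end_ext fun I => ?_
  by_cases hd : (I q).1 = d <;> by_cases hb : (I p).1 = b <;>
    simp only [opAt, LinearMap.smul_apply, Module.End.mul_apply, onMono_mono, hd, hb, if_true,
      if_false, map_smul, map_zero, Function.update_of_ne hpq, Function.update_of_ne hpq.symm,
      smul_zero, prePar_update, ksign_add, smul_smul]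
  rw [Function.update_comm hpq]
  congr 1
  rcases lt_or_gt_of_ne hpq with h | h
  · simp only [h, h.not_gt, if_true, if_false, ksign_zero_right]
    rw [ksign_comm y x]
    linear_combination (-ksign y (prePar I q) * ksign x (prePar I p)) * ksign_mul_self x y
  · simp only [h, h.not_gt, if_true, if_false, ksign_zero_right]
    ring

theorem opD_bracket (a b c d : Fin n) (x y : ZMod 2) :
    opD (r := r) a b x * opD c d y - ksign x y • (opD c d y * opD a b x) =
      (if b = c then opD a d (x + y) else 0) -
        ksign x y • (if d = a then opD c b (x + y) else 0) := by
  have h1 : opD (r := r) a b x * opD c d y =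
      ∑ p, ∑ q, opAt a b x p * opAt c d y q := by
    simp only [opD, Finset.sum_mul, Finset.mul_sum]
    rw [Finset.sum_comm]
  have h2 : opD (r := r) c d y * opD a b x =
      ∑ p, ∑ q, opAt c d y q * opAt a b x p := by
    simp only [opD, Finset.sum_mul, Finset.mul_sum]
  rw [h1, h2, Finset.smul_sum, ← Finset.sum_sub_distrib]
  have h3 : ∀ p : Fin r, ∑ q, opAt a b x p * opAt c d y q -
      ksign x y • ∑ q, opAt c d y q * opAt a b x p =
      (if b = c then opAt a d (x + y) p else 0) -
        ksign x y • (if d = a then opAt c b (x + y) p else 0) := by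
    intro p
    rw [Finset.smul_sum, ← Finset.sum_sub_distrib, Finset.sum_eq_single p]
    · rw [opAt_same, opAt_same, add_comm y x]
    · intro q _ hq
      rw [opAt_ne a b c d x y hq.symm, sub_self]
    · simp
  rw [Finset.sum_congr rfl fun p _ => h3 p, Finset.sum_sub_distrib, ← Finset.smul_sum]
  congr 2
  · split_ifs <;> simp [opD]
  · split_ifs <;> simp [opD]

theorem wt_update (I : Mono n r) (p : Fin r) (a : Fin n) (x : ZMod 2) (k : Fin n) :
    wt (Function.update I p (a, x)) k + (if (I p).1 = k then 1 else 0) =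
      wt I k + if a = k then 1 else 0 := by
  unfold wt
  simp only [Finset.card_filter]
  rw [← Finset.add_sum_erase _ _ (Finset.mem_univ p),
    ← Finset.add_sum_erase _ (fun q => if (I q).1 = k then 1 else 0) (Finset.mem_univ p)]
  have : ∑ q ∈ Finset.univ.erase p, (if ((Function.update I p (a, x)) q).1 = k then 1 else 0) =
      ∑ q ∈ Finset.univ.erase p, if (I q).1 = k then 1 else 0 :=
    Finset.sum_congr rfl fun q hq => by rw [Function.update_of_ne (Finset.ne_of_mem_erase hq)]
  rw [this]
  simp only [Function.update_self]
  omega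

theorem opD_mono (a b : Fin n) (d : ZMod 2) (I : Mono n r) :
    opD a b d (mono I) = ∑ p, if (I p).1 = b then
      ksign d (prePar I p) • mono (Function.update I p (a, (I p).2 + d)) else 0 := by
  simp [opD, opAt]

theorem opD_opOne (a b : Fin n) (d : ZMod 2) (l m : Weight n r)
    (h : ∀ k : Fin n, (m.1 k : ℤ) + (if b = k then 1 else 0) = l.1 k + if a = k then 1 else 0) :
    opD a b d * opOne l = opOne m * opD a b d := by
  refine end_ext fun I => ?_
  simp only [Module.End.mul_apply, opD_mono, map_sum]
  have key : ∀ p, (I p).1 = b → (wt (Function.update I p (a, (I p).2 + d)) = m.1 ↔ wt I = l.1) := by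
    intro p hp
    have hw := wt_update I p a ((I p).2 + d)
    rw [hp] at hw
    constructor
    · intro h'; funext k
      have := hw k; have := h k; rw [h'] at *; split_ifs at * <;> omega
    · intro h'; funext k
      have := hw k; have := h k; rw [h'] at *; split_ifs at * <;> omega
  by_cases hI : wt I = l.1
  · simp only [opOne, onMono_mono, hI, if_true, opD_mono]
    refine Finset.sum_congr rfl fun p _ => ?_
    by_cases hp : (I p).1 = b
    · simp [hp, (key p hp).2 hI]
    · simp [hp]
  · simp only [opOne, onMono_mono, hI, if_false, map_zero]
    refine (Finset.sum_eq_zero fun p _ => ?_).symm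
    by_cases hp : (I p).1 = b
    · have : ¬ wt (Function.update I p (a, (I p).2 + d)) = m.1 := fun h' => hI ((key p hp).1 h')
      simp [hp, this]
    · simp [hp]

theorem sum_wt (I : Mono n r) : ∑ k, wt I k = r := by
  have := Finset.card_eq_sum_card_fiberwise (s := (Finset.univ : Finset (Fin r)))
    (t := (Finset.univ : Finset (Fin n))) (f := fun p => (I p).1) (by simp)
  simpa [wt] using this.symm

/-- The weight of a monomial as an element of `Λ(n, r)`. -/
def wtW (I : Mono n r) : Weight n r := ⟨wt I, sum_wt I⟩

theorem opD_opOne_zero (a b : Fin n) (d : ZMod 2) (l : Weight n r)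
    (h : ∀ m : Weight n r, ¬ ∀ k : Fin n,
      (m.1 k : ℤ) + (if b = k then 1 else 0) = l.1 k + if a = k then 1 else 0) :
    opD a b d * opOne l = 0 := by
  refine end_ext fun I => ?_
  by_cases hI : wt I = l.1
  · simp only [Module.End.mul_apply, opOne, onMono_mono, hI, if_true, opD_mono,
      LinearMap.zero_apply]
    refine Finset.sum_eq_zero fun p _ => ?_
    by_cases hp : (I p).1 = b
    · refine absurd (fun k => ?_) (h (wtW (Function.update I p (a, (I p).2 + d))))
      have hw := wt_update I p a ((I p).2 + d) k
      rw [hp, hI] at hw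
      simp only [wtW]
      split_ifs at * <;> omega
    · simp [hp]
  · simp [Module.End.mul_apply, opOne, hI]

theorem opOne_opD_zero (a b : Fin n) (d : ZMod 2) (m : Weight n r)
    (h : ∀ l : Weight n r, ¬ ∀ k : Fin n,
      (m.1 k : ℤ) + (if b = k then 1 else 0) = l.1 k + if a = k then 1 else 0) :
    opOne m * opD a b d = 0 := by
  refine end_ext fun I => ?_
  simp only [Module.End.mul_apply, opD_mono, map_sum, LinearMap.zero_apply]
  refine Finset.sum_eq_zero fun p _ => ?_
  by_cases hp : (I p).1 = b
  · by_cases hm : wt (Function.update I p (a, (I p).2 + d)) = m.1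
    · refine absurd (fun k => ?_) (h (wtW I))
      have hw := wt_update I p a ((I p).2 + d) k
      rw [hp, hm] at hw
      simp only [wtW]
      split_ifs at * <;> omega
    · simp [hp, opOne, hm]
  · simp [hp]

theorem opD_diag (j : Fin n) (l : Weight n r) :
    opD j j 0 * opOne l = (l.1 j : ℂ) • opOne l := by
  refine end_ext fun I => ?_
  by_cases hI : wt I = l.1
  · have : ∀ p, (if (I p).1 = j then
        ksign 0 (prePar I p) • mono (Function.update I p (j, (I p).2 + 0)) else 0) =
        (if (I p).1 = j then (1 : ℂ) else 0) • mono I := by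
      intro p
      by_cases hp : (I p).1 = j
      · subst hp; simp
      · simp [hp]
    simp only [Module.End.mul_apply, LinearMap.smul_apply, opOne, onMono_mono, hI, if_true,
      opD_mono, this, ← Finset.sum_smul]
    rw [← hI]
    simp [wt]
  · simp [Module.End.mul_apply, opOne, hI]

theorem opD_diag_zero (j : Fin n) (d : ZMod 2) (l : Weight n r) (h : l.1 j = 0) :
    opD j j d * opOne l = 0 := by
  refine end_ext fun I => ?_
  by_cases hI : wt I = l.1
  · simp only [Module.End.mul_apply, opOne, onMono_mono, hI, if_true, opD_mono,
      LinearMap.zero_apply]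
    refine Finset.sum_eq_zero fun p _ => ?_
    have : (I p).1 ≠ j := by
      intro hp
      have h0 : wt I j = 0 := by rw [hI, h]
      simp only [wt, Finset.card_eq_zero, Finset.filter_eq_empty_iff] at h0
      exact h0 (Finset.mem_univ p) hp
    simp [this]
  · simp [Module.End.mul_apply, opOne, hI]

theorem serre_aux {A : Type} [Ring A] [Algebra ℂ A] {x y c : A} (h : x * y - y * x = c)
    (hc : x * c - c * x = 0) : divPow x 2 * y - x * y * x + y * divPow x 2 = 0 := by
  subst h
  have h2 : ∀ z : A, z = (2⁻¹ : ℂ) • (z + z) := by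
    intro z; rw [← two_smul ℂ z, smul_smul]; norm_num
  have : divPow x 2 = (2⁻¹ : ℂ) • (x * x) := by simp [divPow, pow_two]
  rw [this, smul_mul_assoc, mul_smul_comm, h2 (x * y * x)]
  rw [← smul_sub, ← smul_add]
  have e : x * x * y - (x * y * x + x * y * x) + y * (x * x) =
      x * (x * y - y * x) - (x * y - y * x) * x := by noncomm_ring
  rw [e, hc, smul_zero]

theorem zmod2_one_add_one : (1 : ZMod 2) + 1 = 0 := by decide

theorem isShift_iff (i : ℕ) (hi : i + 1 < n) (l m : Weight n r) : IsShift i l m ↔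
    ∀ k : Fin n, (m.1 k : ℤ) + (if (⟨i + 1, hi⟩ : Fin n) = k then 1 else 0) =
      l.1 k + if (⟨i, by omega⟩ : Fin n) = k then 1 else 0 := by
  refine forall_congr' fun k => ?_
  simp only [Fin.ext_iff, eq_comm (b := k.val)]
  constructor <;> intro h <;> linarith

theorem isShift_iff' (i : ℕ) (hi : i + 1 < n) (l m : Weight n r) : IsShift i l m ↔
    ∀ k : Fin n, (l.1 k : ℤ) + (if (⟨i, by omega⟩ : Fin n) = k then 1 else 0) =
      m.1 k + if (⟨i + 1, hi⟩ : Fin n) = k then 1 else 0 := by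
  rw [isShift_iff i hi]
  exact forall_congr' fun k => eq_comm

set_option maxHeartbeats 1000000 in
theorem schurOp_rel {x y : FreeAlgebra ℂ (SchurGen n r)} (h : SchurRel n r x y) :
    FreeAlgebra.lift ℂ schurOp x = FreeAlgebra.lift ℂ schurOp y := by
  have br := fun (a b c d : Fin n) (x y : ZMod 2) => opD_bracket (r := r) a b c d x y
  have dp : ∀ z : FreeAlgebra ℂ (SchurGen n r), FreeAlgebra.lift ℂ schurOp (divPow z 2) =
      divPow (FreeAlgebra.lift ℂ schurOp z) 2 := by intro z; simp [divPow]
  induction h <;>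
    simp only [gE, gF, gH, g1, map_mul, map_add, map_sub, map_neg, map_one, map_zero, map_sum,
      map_smul, map_pow, apply_ite (FreeAlgebra.lift ℂ schurOp), FreeAlgebra.lift_ι_apply, schurOp,
      dp]
  case one_mul l m =>
    refine end_ext fun I => ?_
    by_cases h : l = m
    · subst h
      by_cases hI : wt I = l.1 <;> simp [Module.End.mul_apply, opOne, hI]
    · have h' : ¬ m.1 = l.1 := fun e => h (Subtype.ext e.symm)
      by_cases hI : wt I = m.1 <;> simp [Module.End.mul_apply, opOne, h, h', hI]
  case one_sum =>
    refine end_ext fun I => ?_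
    simp only [LinearMap.sum_apply, opOne, onMono_mono, Module.End.one_apply]
    rw [Finset.sum_eq_single (wtW I)]
    · simp [wtW]
    · intro l _ hl
      rw [if_neg]
      exact fun e => hl (Subtype.ext e.symm)
    · simp
  case h_one j l => exact opD_opOne j j 1 l l fun k => rfl
  case h_h i j l =>
    have h := br i i j j 1 1
    by_cases hij : i = j
    · subst hij
      simp only [zmod2_one_add_one, if_true, ksign_one_one, neg_smul, one_smul, sub_neg_eq_add] at h
      rw [if_pos rfl, h, add_mul, opD_diag, ← add_smul]
      push_cast; rw [two_mul]
    · have hij' : ¬ j = i := fun e => hij e.symm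
      simp only [hij, hij', if_false, ksign_one_one, neg_smul, one_smul, sub_neg_eq_add, smul_zero,
        sub_zero] at h
      rw [if_neg hij, h, zero_mul]
  case h_zero j l hl => exact opD_diag_zero j 1 l hl
  case e_shift i hi b l m h => exact opD_opOne _ _ b l m ((isShift_iff i hi l m).1 h)
  case e_right i hi b l h =>
    exact opD_opOne_zero _ _ b l fun m hm => h m ((isShift_iff i hi l m).2 hm)
  case e_left i hi b m h =>
    exact opOne_opD_zero _ _ b m fun l hl => h l ((isShift_iff i hi l m).2 hl)
  case f_shift i hi b l m h => exact opD_opOne _ _ b m l ((isShift_iff' i hi l m).1 h)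
  case f_right i hi b m h =>
    exact opD_opOne_zero _ _ b m fun l hl => h l ((isShift_iff' i hi l m).2 hl)
  case f_left i hi b l h =>
    exact opOne_opD_zero _ _ b l fun m hm => h m ((isShift_iff' i hi l m).2 hm)
  case e_f i hi l =>
    have h := br ⟨i, by omega⟩ ⟨i + 1, hi⟩ ⟨i + 1, hi⟩ ⟨i, by omega⟩ 0 0
    simp only [if_true, ksign_zero_left, one_smul, add_zero] at h
    rw [h, sub_mul, opD_diag, opD_diag, sub_smul]
  case eb_fb i hi l =>
    have h := br ⟨i, by omega⟩ ⟨i + 1, hi⟩ ⟨i + 1, hi⟩ ⟨i, by omega⟩ 1 1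
    simp only [if_true, ksign_one_one, neg_smul, one_smul, sub_neg_eq_add, zmod2_one_add_one] at h
    rw [h, add_mul, opD_diag, opD_diag, add_smul]
  case serre_e i j hi hj b l hij =>
    rw [serre_aux rfl, zero_mul]
    have h := br ⟨i, by omega⟩ ⟨i + 1, hi⟩ ⟨j, by omega⟩ ⟨j + 1, hj⟩ 0 b
    simp only [ksign_zero_left, one_smul, zero_add, Fin.mk.injEq] at h
    rw [h]
    rcases hij with rfl | rfl
    · have h' := br ⟨j + 1, by omega⟩ ⟨j + 1 + 1, hi⟩ ⟨j, by omega⟩ ⟨j + 1 + 1, hi⟩ 0 b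
      simp [add_assoc, sub_eq_zero] at h'
      simp [add_assoc, h']
    · have h' := br ⟨i, by omega⟩ ⟨i + 1, hi⟩ ⟨i, by omega⟩ ⟨i + 1 + 1, hj⟩ 0 b
      simp [add_assoc, sub_eq_zero] at h'
      simp [add_assoc, h']
  case serre_f i j hi hj b l hij =>
    rw [serre_aux rfl, zero_mul]
    have h := br ⟨i + 1, hi⟩ ⟨i, by omega⟩ ⟨j + 1, hj⟩ ⟨j, by omega⟩ 0 b
    simp only [ksign_zero_left, one_smul, zero_add, Fin.mk.injEq] at h
    rw [h]
    rcases hij with rfl | rfl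
    · have h' := br ⟨j + 1 + 1, hi⟩ ⟨j + 1, by omega⟩ ⟨j + 1 + 1, hi⟩ ⟨j, by omega⟩ 0 b
      simp [add_assoc, sub_eq_zero] at h'
      simp [add_assoc, h']
    · have h' := br ⟨i + 1, hi⟩ ⟨i, by omega⟩ ⟨i + 1 + 1, hj⟩ ⟨i, by omega⟩ 0 b
      simp [add_assoc, sub_eq_zero] at h'
      simp [add_assoc, h']
  case eb_sq i hi l =>
    have h := br ⟨i, by omega⟩ ⟨i + 1, hi⟩ ⟨i, by omega⟩ ⟨i + 1, hi⟩ 1 1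
    simp only [ksign_one_one, neg_smul, one_smul, sub_neg_eq_add, Fin.mk.injEq,
      Nat.succ_ne_self, if_false, add_zero] at h
    rw [← two_smul ℂ, smul_eq_zero] at h
    rw [pow_two, h.resolve_left two_ne_zero, zero_mul]
  case fb_sq i hi l =>
    have h := br ⟨i + 1, hi⟩ ⟨i, by omega⟩ ⟨i + 1, hi⟩ ⟨i, by omega⟩ 1 1
    simp only [ksign_one_one, neg_smul, one_smul, sub_neg_eq_add, Fin.mk.injEq,
      (Nat.succ_ne_self _).symm, if_false, add_zero] at h
    rw [← two_smul ℂ, smul_eq_zero] at h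
    rw [pow_two, h.resolve_left two_ne_zero, zero_mul]
  case h_e i hi j l hj =>
    have h := br j j ⟨i, by omega⟩ ⟨i + 1, hi⟩ 1 0
    have ej : (⟨i, by omega⟩ : Fin n) = j := Fin.ext hj.symm
    have e1 : ¬ (⟨i + 1, hi⟩ : Fin n) = j := by rw [Fin.ext_iff]; simp [hj]
    have e2 : ¬ j = (⟨i + 1, hi⟩ : Fin n) := fun e => e1 e.symm
    rw [ej] at h ⊢
    simp [e1, e2] at h; rw [h]
  case h_e' i hi j l hj =>
    have h := br j j ⟨i, by omega⟩ ⟨i + 1, hi⟩ 1 0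
    obtain rfl : j = ⟨i + 1, hi⟩ := Fin.ext hj
    simp at h; rw [h]
  case h_f i hi j l hj =>
    have h := br j j ⟨i + 1, hi⟩ ⟨i, by omega⟩ 1 0
    have ej : (⟨i, by omega⟩ : Fin n) = j := Fin.ext hj.symm
    have e1 : ¬ (⟨i + 1, hi⟩ : Fin n) = j := by rw [Fin.ext_iff]; simp [hj]
    have e2 : ¬ j = (⟨i + 1, hi⟩ : Fin n) := fun e => e1 e.symm
    rw [ej] at h ⊢
    simp [e1, e2] at h; rw [h]
  case h_f' i hi j l hj =>
    have h := br j j ⟨i + 1, hi⟩ ⟨i, by omega⟩ 1 0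
    obtain rfl : j = ⟨i + 1, hi⟩ := Fin.ext hj
    simp at h; rw [h]
  case h_eb i hi j l hj =>
    have h := br j j ⟨i, by omega⟩ ⟨i + 1, hi⟩ 1 1
    rcases hj with hj | hj
    · have ej : (⟨i, by omega⟩ : Fin n) = j := Fin.ext hj.symm
      have e1 : ¬ (⟨i + 1, hi⟩ : Fin n) = j := by rw [Fin.ext_iff]; simp [hj]
      have e2 : ¬ j = (⟨i + 1, hi⟩ : Fin n) := fun e => e1 e.symm
      rw [ej] at h ⊢
      simp [zmod2_one_add_one, e1, e2] at h; rw [h]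
    · obtain rfl : j = ⟨i + 1, hi⟩ := Fin.ext hj
      simp [zmod2_one_add_one] at h; rw [h]
  case h_fb i hi j l hj =>
    have h := br j j ⟨i + 1, hi⟩ ⟨i, by omega⟩ 1 1
    rcases hj with hj | hj
    · have ej : (⟨i, by omega⟩ : Fin n) = j := Fin.ext hj.symm
      have e1 : ¬ (⟨i + 1, hi⟩ : Fin n) = j := by rw [Fin.ext_iff]; simp [hj]
      have e2 : ¬ j = (⟨i + 1, hi⟩ : Fin n) := fun e => e1 e.symm
      rw [ej] at h ⊢
      simp [zmod2_one_add_one, e1, e2] at h; rw [h]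
    · obtain rfl : j = ⟨i + 1, hi⟩ := Fin.ext hj
      simp [zmod2_one_add_one] at h; rw [h]
  case h_e_far i hi j l h1 h2 =>
    have h := br j j ⟨i, by omega⟩ ⟨i + 1, hi⟩ 1 0
    simp [Fin.ext_iff, h1, h2, Ne.symm h1, Ne.symm h2] at h; rw [h, zero_mul]
  case h_f_far i hi j l h1 h2 =>
    have h := br j j ⟨i + 1, hi⟩ ⟨i, by omega⟩ 1 0
    simp [Fin.ext_iff, h1, h2, Ne.symm h1, Ne.symm h2] at h; rw [h, zero_mul]
  case h_eb_far i hi j l h1 h2 =>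
    have h := br j j ⟨i, by omega⟩ ⟨i + 1, hi⟩ 1 1
    simp [Fin.ext_iff, h1, h2, Ne.symm h1, Ne.symm h2] at h; rw [h, zero_mul]
  case h_fb_far i hi j l h1 h2 =>
    have h := br j j ⟨i + 1, hi⟩ ⟨i, by omega⟩ 1 1
    simp [Fin.ext_iff, h1, h2, Ne.symm h1, Ne.symm h2] at h; rw [h, zero_mul]
  case e_fb i hi l =>
    have h := br ⟨i, by omega⟩ ⟨i + 1, hi⟩ ⟨i + 1, hi⟩ ⟨i, by omega⟩ 0 1
    simp at h; rw [h]
  case eb_f i hi l =>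
    have h := br ⟨i, by omega⟩ ⟨i + 1, hi⟩ ⟨i + 1, hi⟩ ⟨i, by omega⟩ 1 0
    simp at h; rw [h]
  case e_f_ne i j hi hj l hij =>
    have h := br ⟨i, by omega⟩ ⟨i + 1, hi⟩ ⟨j + 1, hj⟩ ⟨j, by omega⟩ 0 0
    simp [hij, hij.symm] at h; rw [h, zero_mul]
  case eb_fb_ne i j hi hj l hij =>
    have h := br ⟨i, by omega⟩ ⟨i + 1, hi⟩ ⟨j + 1, hj⟩ ⟨j, by omega⟩ 1 1
    simp [hij, hij.symm] at h; rw [h, zero_mul]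
  case e_fb_ne i j hi hj l hij =>
    have h := br ⟨i, by omega⟩ ⟨i + 1, hi⟩ ⟨j + 1, hj⟩ ⟨j, by omega⟩ 0 1
    simp [hij, hij.symm] at h; rw [h, zero_mul]
  case eb_f_ne i j hi hj l hij =>
    have h := br ⟨i, by omega⟩ ⟨i + 1, hi⟩ ⟨j + 1, hj⟩ ⟨j, by omega⟩ 1 0
    simp [hij, hij.symm] at h; rw [h, zero_mul]
  case e_eb i j hi hj l h1 h2 =>
    have h := br ⟨i, by omega⟩ ⟨i + 1, hi⟩ ⟨j, by omega⟩ ⟨j + 1, hj⟩ 0 1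
    simp [h1.symm, h2.symm] at h; rw [h, zero_mul]
  case f_fb i j hi hj l h1 h2 =>
    have h := br ⟨i + 1, hi⟩ ⟨i, by omega⟩ ⟨j + 1, hj⟩ ⟨j, by omega⟩ 0 1
    simp [h1, h2] at h; rw [h, zero_mul]
  case e_e i j hi hj l hij =>
    have h := br ⟨i, by omega⟩ ⟨i + 1, hi⟩ ⟨j, by omega⟩ ⟨j + 1, hj⟩ 0 0
    have h1 : ¬ i + 1 = j := by omega
    have h2 : ¬ j + 1 = i := by omega
    simp [h1, h2] at h; rw [h, zero_mul]
  case f_f i j hi hj l hij =>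
    have h := br ⟨i + 1, hi⟩ ⟨i, by omega⟩ ⟨j + 1, hj⟩ ⟨j, by omega⟩ 0 0
    have h1 : ¬ i = j + 1 := by omega
    have h2 : ¬ j = i + 1 := by omega
    simp [h1, h2] at h; rw [h, zero_mul]
  case eb_eb i j hi hj l hij =>
    have h := br ⟨i, by omega⟩ ⟨i + 1, hi⟩ ⟨j, by omega⟩ ⟨j + 1, hj⟩ 1 1
    have h1 : ¬ i + 1 = j := by omega
    have h2 : ¬ j + 1 = i := by omega
    simp [h1, h2] at h; rw [h, zero_mul]
  case fb_fb i j hi hj l hij =>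
    have h := br ⟨i + 1, hi⟩ ⟨i, by omega⟩ ⟨j + 1, hj⟩ ⟨j, by omega⟩ 1 1
    have h1 : ¬ i = j + 1 := by omega
    have h2 : ¬ j = i + 1 := by omega
    simp [h1, h2] at h; rw [h, zero_mul]
  case e_e_adj i hi hj l =>
    have h := br ⟨i, by omega⟩ ⟨i + 1, hi⟩ ⟨i + 1, hi⟩ ⟨i + 1 + 1, hj⟩ 0 0
    have h' := br ⟨i, by omega⟩ ⟨i + 1, hi⟩ ⟨i + 1, hi⟩ ⟨i + 1 + 1, hj⟩ 1 1
    simp [zmod2_one_add_one, add_assoc] at h h'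
    simp only [add_assoc, Nat.reduceAdd]
    rw [h, h']
  case e_eb_adj i hi hj l =>
    have h := br ⟨i, by omega⟩ ⟨i + 1, hi⟩ ⟨i + 1, hi⟩ ⟨i + 1 + 1, hj⟩ 0 1
    have h' := br ⟨i, by omega⟩ ⟨i + 1, hi⟩ ⟨i + 1, hi⟩ ⟨i + 1 + 1, hj⟩ 1 0
    simp [add_assoc] at h h'
    simp only [add_assoc, Nat.reduceAdd]
    rw [h, h']
  case f_f_adj i hi hj l =>
    have h := br ⟨i + 1 + 1, hj⟩ ⟨i + 1, hi⟩ ⟨i + 1, hi⟩ ⟨i, by omega⟩ 0 0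
    have h' := br ⟨i + 1 + 1, hj⟩ ⟨i + 1, hi⟩ ⟨i + 1, hi⟩ ⟨i, by omega⟩ 1 1
    simp [zmod2_one_add_one, add_assoc] at h h'
    simp only [add_assoc, Nat.reduceAdd]
    rw [h, h']
  case f_fb_adj i hi hj l =>
    have h := br ⟨i + 1 + 1, hj⟩ ⟨i + 1, hi⟩ ⟨i + 1, hi⟩ ⟨i, by omega⟩ 1 0
    have h' := br ⟨i + 1 + 1, hj⟩ ⟨i + 1, hi⟩ ⟨i + 1, hi⟩ ⟨i, by omega⟩ 0 1
    simp [add_assoc] at h h'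
    simp only [add_assoc, Nat.reduceAdd]
    rw [h, h']

/-- The action of the Schur superalgebra on `V^{⊗ r}`, i.e. the homomorphism `φ^n`. -/
def schurRep (n r : ℕ) : Schur n r →ₐ[ℂ] Module.End ℂ (Tens n r) :=
  Presented.lift _ schurOp fun _ _ h => schurOp_rel h

/-! ## Webs of type Q -/

/-- The local pictures: the merge of strands `k`, `l`, the split into strands `k`, `l` and the dot on
a `k`-strand. -/
inductive LocGen : Type
  | merge (k l : ℕ)
  | split (k l : ℕ)
  | dot (k : ℕ)

/-- The labels of the strands along the bottom. -/
def LocGen.src : LocGen → List ℕ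
  | .merge k l => [k, l]
  | .split k l => [k + l]
  | .dot k => [k]

/-- The labels of the strands along the top. -/
def LocGen.tgt : LocGen → List ℕ
  | .merge k l => [k + l]
  | .split k l => [k, l]
  | .dot k => [k]

/-- Merges and splits are even, dots are odd. -/
def LocGen.par : LocGen → ZMod 2
  | .merge _ _ => 0
  | .split _ _ => 0
  | .dot _ => 1

theorem LocGen.sum_tgt (x : LocGen) : x.tgt.sum = x.src.sum := by
  cases x <;> simp [src, tgt]

/-- The generators of the web superalgebra. The index set `A(r)` is Mathlib's type `Composition r`
(tuples of positive integers with sum `r`). The generator `loc L x R a b _ _ : a → b` is the local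
picture `x` with identity strands `L` to its left and `R` to its right. -/
inductive WebGen (r : ℕ) : Type
  | one (a : Composition r)
  | loc (L : List ℕ) (x : LocGen) (R : List ℕ) (a b : Composition r)
      (ha : a.blocks = L ++ x.src ++ R) (hb : b.blocks = L ++ x.tgt ++ R)

/-- The object along the bottom of a generator. -/
def WebGen.src {r : ℕ} : WebGen r → Composition r
  | .one a => a
  | .loc _ _ _ a _ _ _ => a

/-- The object along the top of a generator. -/
def WebGen.tgt {r : ℕ} : WebGen r → Composition r
  | .one a => a
  | .loc _ _ _ _ b _ _ => b

/-- Dots are odd, all other generators are even. -/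
def WebGen.par {r : ℕ} : WebGen r → ZMod 2
  | .one _ => 0
  | .loc _ x _ _ _ _ _ => x.par

/-- Erasing the `0`-strands. -/
def erase0 (L : List ℕ) : List ℕ := L.filter (0 < ·)

theorem erase0_pos {L : List ℕ} {i : ℕ} (h : i ∈ erase0 L) : 0 < i := by
  simpa [erase0] using (List.mem_filter.1 h).2

theorem erase0_sum (L : List ℕ) : (erase0 L).sum = L.sum := by
  induction L with
  | nil => rfl
  | cons a L ih =>
    unfold erase0 at *
    rcases Nat.eq_zero_or_pos a with rfl | h
    · simpa using ih
    · simp [h, ih]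

/-- The identity web on the strands `L`, with `0`-strands erased
(it is `0` if the total thickness is not `r`). -/
def wOne (r : ℕ) (L : List ℕ) : FreeAlgebra ℂ (WebGen r) :=
  if h : L.sum = r then
    FreeAlgebra.ι ℂ (.one ⟨erase0 L, fun hi => erase0_pos hi, (erase0_sum L).trans h⟩)
  else 0

/-- The local picture `x`, all of whose strands have positive labels, with identity strands `L` to
its left and `R` to its right, where `0`-strands are erased. (It is `0` if the total thickness is not
`r` or if a strand of `x` has label `0`.) -/
def wLoc (r : ℕ) (L : List ℕ) (x : LocGen) (R : List ℕ) : FreeAlgebra ℂ (WebGen r) :=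
  if h : (L ++ x.src ++ R).sum = r ∧ ∀ i ∈ x.src ++ x.tgt, 0 < i then
    FreeAlgebra.ι ℂ (.loc (erase0 L) x (erase0 R)
      ⟨erase0 L ++ x.src ++ erase0 R, by
        intro i hi
        simp only [List.mem_append] at hi
        rcases hi with (hi | hi) | hi
        exacts [erase0_pos hi, h.2 i (by simp [hi]), erase0_pos hi], by
        rw [← h.1]; simp [erase0_sum]⟩
      ⟨erase0 L ++ x.tgt ++ erase0 R, by
        intro i hi
        simp only [List.mem_append] at hi
        rcases hi with (hi | hi) | hi
        exacts [erase0_pos hi, h.2 i (by simp [hi]), erase0_pos hi], by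
        rw [← h.1]; simp [erase0_sum, LocGen.sum_tgt]⟩ rfl rfl)
  else 0

/-- The merge of adjacent strands `k`, `l`; if one of them is a `0`-strand, it is erased. -/
def wMerge (r : ℕ) (L : List ℕ) (k l : ℕ) (R : List ℕ) : FreeAlgebra ℂ (WebGen r) :=
  if k = 0 ∨ l = 0 then wOne r (L ++ (k + l) :: R) else wLoc r L (.merge k l) R

/-- The split into adjacent strands `k`, `l`; if one of them is a `0`-strand, it is erased. -/
def wSplit (r : ℕ) (L : List ℕ) (k l : ℕ) (R : List ℕ) : FreeAlgebra ℂ (WebGen r) :=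
  if k = 0 ∨ l = 0 then wOne r (L ++ (k + l) :: R) else wLoc r L (.split k l) R

/-- The dot on a `k`-strand (`0` if `k = 0`). -/
def wDot (r : ℕ) (L : List ℕ) (k : ℕ) (R : List ℕ) : FreeAlgebra ℂ (WebGen r) :=
  wLoc r L (.dot k) R

/-- The ladder `(k, l + 1) → (k + 1, l)` whose rung has thickness `1` and points to the left; the
rung carries a dot if `d` is `true`. -/
def rungL (r : ℕ) (L : List ℕ) (k l : ℕ) (R : List ℕ) (d : Bool) : FreeAlgebra ℂ (WebGen r) :=
  wMerge r L k 1 (l :: R) * (if d then wDot r (L ++ [k]) 1 (l :: R) else 1) *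
    wSplit r (L ++ [k]) 1 l R

/-- The ladder `(k + 1, l) → (k, l + 1)` whose rung has thickness `1` and points to the right; the
rung carries a dot if `d` is `true`. -/
def rungR (r : ℕ) (L : List ℕ) (k l : ℕ) (R : List ℕ) (d : Bool) : FreeAlgebra ℂ (WebGen r) :=
  wMerge r (L ++ [k]) 1 l R * (if d then wDot r (L ++ [k]) 1 (l :: R) else 1) *
    wSplit r L k 1 (l :: R)

/-- Two rungs pointing to the left, `(h, k + 1, l + 1) → (h + 1, k + 1, l)`, the right one being the
lower one. The left (right) rung carries a dot if `x` (`y`) is `true`. -/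
def rungsLL (r : ℕ) (L : List ℕ) (h k l : ℕ) (R : List ℕ) (x y : Bool) : FreeAlgebra ℂ (WebGen r) :=
  rungL r L h (k + 1) (l :: R) x * rungL r (L ++ [h]) (k + 1) l R y

/-- Two rungs pointing to the left, `(h, k + 1, l + 1) → (h + 1, k + 1, l)`, the left one being the
lower one. The left (right) rung carries a dot if `x` (`y`) is `true`. -/
def rungsLL' (r : ℕ) (L : List ℕ) (h k l : ℕ) (R : List ℕ) (x y : Bool) :
    FreeAlgebra ℂ (WebGen r) :=
  rungL r (L ++ [h + 1]) k l R y * rungL r L h k ((l + 1) :: R) x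

/-- Two rungs pointing to the right, `(l + 1, k + 1, h) → (l, k + 1, h + 1)`, the left one being the
lower one. The right (left) rung carries a dot if `x` (`y`) is `true`. -/
def rungsRR (r : ℕ) (L : List ℕ) (l k h : ℕ) (R : List ℕ) (x y : Bool) : FreeAlgebra ℂ (WebGen r) :=
  rungR r (L ++ [l]) (k + 1) h R x * rungR r L l (k + 1) (h :: R) y

/-- Two rungs pointing to the right, `(l + 1, k + 1, h) → (l, k + 1, h + 1)`, the right one being the
lower one. The right (left) rung carries a dot if `x` (`y`) is `true`. -/
def rungsRR' (r : ℕ) (L : List ℕ) (l k h : ℕ) (R : List ℕ) (x y : Bool) :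
    FreeAlgebra ℂ (WebGen r) :=
  rungR r L l k ((h + 1) :: R) y * rungR r (L ++ [l + 1]) k h R x

/-- The defining relations of the web superalgebra. A product `x * y` of webs is `x` drawn on top
of `y`. All relations are local: `L` and `R` are identity strands to the left and to the right. -/
inductive WebRel (r : ℕ) : FreeAlgebra ℂ (WebGen r) → FreeAlgebra ℂ (WebGen r) → Prop
  -- compatibility, identities
  | one_left (b : Composition r) (g : WebGen r) :
      WebRel r (FreeAlgebra.ι ℂ (.one b) * FreeAlgebra.ι ℂ g)
        (if b = g.tgt then FreeAlgebra.ι ℂ g else 0)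
  | one_right (a : Composition r) (g : WebGen r) :
      WebRel r (FreeAlgebra.ι ℂ g * FreeAlgebra.ι ℂ (.one a))
        (if a = g.src then FreeAlgebra.ι ℂ g else 0)
  | one_sum : WebRel r (∑ a : Composition r, FreeAlgebra.ι ℂ (.one a)) 1
  | superinterchange (L : List ℕ) (x : LocGen) (M : List ℕ) (y : LocGen) (R : List ℕ) :
      WebRel r (wLoc r L x (M ++ y.tgt ++ R) * wLoc r (L ++ x.src ++ M) y R)
        (ksign x.par y.par • (wLoc r (L ++ x.tgt ++ M) y R * wLoc r L x (M ++ y.src ++ R)))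
  -- associativity
  | merge_assoc (L R : List ℕ) (h k l : ℕ) : 0 < h → 0 < k → 0 < l →
      WebRel r (wMerge r L (h + k) l R * wMerge r L h k (l :: R))
        (wMerge r L h (k + l) R * wMerge r (L ++ [h]) k l R)
  | split_assoc (L R : List ℕ) (h k l : ℕ) : 0 < h → 0 < k → 0 < l →
      WebRel r (wSplit r L h k (l :: R) * wSplit r L (h + k) l R)
        (wSplit r (L ++ [h]) k l R * wSplit r L h (k + l) R)
  -- explosion
  | explosion (L R : List ℕ) (k l : ℕ) : 0 < k → 0 < l →
      WebRel r (wMerge r L k l R * wSplit r L k l R)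
        (((k + l).choose l : ℂ) • wOne r (L ++ (k + l) :: R))
  -- collision of dots
  | dot_sq (L R : List ℕ) (k : ℕ) : 0 < k →
      WebRel r (wDot r L k R * wDot r L k R) ((k : ℂ) • wOne r (L ++ k :: R))
  -- dots past merges and splits, with the reflected relations
  | dot_merge (L R : List ℕ) (k : ℕ) : 0 < k →
      WebRel r (wDot r L (1 + k) R * wMerge r L 1 k R)
        (wMerge r L 1 k R * wDot r L 1 (k :: R) + wMerge r L 1 k R * wDot r (L ++ [1]) k R)
  | dot_merge' (L R : List ℕ) (k : ℕ) : 0 < k →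
      WebRel r (wDot r L (k + 1) R * wMerge r L k 1 R)
        (wMerge r L k 1 R * wDot r L k (1 :: R) + wMerge r L k 1 R * wDot r (L ++ [k]) 1 R)
  | dot_split (L R : List ℕ) (k : ℕ) : 0 < k →
      WebRel r (wSplit r L 1 k R * wDot r L (1 + k) R)
        (wDot r L 1 (k :: R) * wSplit r L 1 k R + wDot r (L ++ [1]) k R * wSplit r L 1 k R)
  | dot_split' (L R : List ℕ) (k : ℕ) : 0 < k →
      WebRel r (wSplit r L k 1 R * wDot r L (k + 1) R)
        (wDot r L k (1 :: R) * wSplit r L k 1 R + wDot r (L ++ [k]) 1 R * wSplit r L k 1 R)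
  -- dumbbell relation
  | dumbbell (L R : List ℕ) :
      WebRel r
        (wSplit r L 1 1 R * wMerge r L 1 1 R -
          wDot r L 1 (1 :: R) * wDot r (L ++ [1]) 1 R * (wSplit r L 1 1 R * wMerge r L 1 1 R) *
            (wDot r L 1 (1 :: R) * wDot r (L ++ [1]) 1 R))
        ((2 : ℂ) • wOne r (L ++ 1 :: 1 :: R))
  -- square switches, on strands `k + 1` and `l + 1`
  | square_switch (L R : List ℕ) (k l : ℕ) :
      WebRel r
        (rungL r L k (l + 1) R false * rungR r L k (l + 1) R false -
          rungR r L (k + 1) l R false * rungL r L (k + 1) l R false)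
        (((k + 1 : ℕ) - (l + 1 : ℕ) : ℂ) • wOne r (L ++ (k + 1) :: (l + 1) :: R))
  | square_switch_dots (L R : List ℕ) (k l : ℕ) :
      WebRel r
        (rungL r L k (l + 1) R true * rungR r L k (l + 1) R false -
          rungR r L (k + 1) l R false * rungL r L (k + 1) l R true)
        (wDot r L (k + 1) ((l + 1) :: R) - wDot r (L ++ [k + 1]) (l + 1) R)
  | square_switch_dots' (L R : List ℕ) (k l : ℕ) :
      WebRel r
        (rungL r L k (l + 1) R false * rungR r L k (l + 1) R true -
          rungR r L (k + 1) l R true * rungL r L (k + 1) l R false)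
        (wDot r L (k + 1) ((l + 1) :: R) - wDot r (L ++ [k + 1]) (l + 1) R)
  -- double rungs, on strands `h`, `k + 1`, `l + 1`, with the relations for the reversed rungs
  | double_rungs_one (L R : List ℕ) (h k l : ℕ) : 0 < h →
      WebRel r (rungsLL r L h k l R false false - rungsLL' r L h k l R false false)
        (rungsLL r L h k l R true true + rungsLL' r L h k l R true true)
  | double_rungs_two (L R : List ℕ) (h k l : ℕ) : 0 < h →
      WebRel r (rungsLL r L h k l R false true - rungsLL' r L h k l R false true)
        (rungsLL r L h k l R true false - rungsLL' r L h k l R true false)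
  | double_rungs_one' (L R : List ℕ) (h k l : ℕ) : 0 < h →
      WebRel r (rungsRR r L l k h R false false - rungsRR' r L l k h R false false)
        (rungsRR r L l k h R true true + rungsRR' r L l k h R true true)
  | double_rungs_two' (L R : List ℕ) (h k l : ℕ) : 0 < h →
      WebRel r (rungsRR r L l k h R false true - rungsRR' r L l k h R false true)
        (rungsRR r L l k h R true false - rungsRR' r L l k h R true false)

/-- The web superalgebra `W(r)`. -/
abbrev Web (r : ℕ) : Type := Presented (WebRel r)

/-- The grading of the web superalgebra. -/
abbrev webParity (r : ℕ) : ZMod 2 → Submodule ℂ (Web r) := parityPart (WebRel r) WebGen.par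

/-- The element of the web superalgebra given by a generator. -/
def Web.gen {r : ℕ} (g : WebGen r) : Web r := Presented.mk (WebRel r) (FreeAlgebra.ι ℂ g)

/-- The superspace of the webs from `a` (along the bottom) to `b` (along the top), i.e. `b W a`. -/
def Web.hom {r : ℕ} (a b : Composition r) : Submodule ℂ (Web r) where
  carrier := {w | Web.gen (.one b) * w * Web.gen (.one a) = w}
  add_mem' := by
    intro v w hv hw
    simp only [Set.mem_ofPred_eq] at *
    rw [mul_add, add_mul, hv, hw]
  zero_mem' := by simp
  smul_mem' := by
    intro c w hw
    simp only [Set.mem_ofPred_eq] at *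
    rw [mul_smul_comm, smul_mul_assoc, hw]

/-! ## The values on the generators -/

theorem sum_range_getD (L : List ℕ) (n : ℕ) (h : L.length ≤ n) :
    ∑ i ∈ Finset.range n, L.getD i 0 = L.sum := by
  induction L generalizing n with
  | nil => simp
  | cons a L ih =>
    obtain ⟨n, rfl⟩ : ∃ k, n = k + 1 := ⟨n - 1, by simp at h; omega⟩
    rw [Finset.sum_range_succ']
    simp only [List.getD_cons_succ, List.getD_cons_zero, List.sum_cons]
    rw [ih n (by simpa using h), add_comm]

/-- The composition `â ∈ Λ'(r)`: `a ∈ A(r)` followed by zeros. -/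
def hat {r : ℕ} (a : Composition r) : Weight' r :=
  ⟨⟨fun i => a.blocks.getD i 0, by
    rw [Fin.sum_univ_eq_sum_range (fun i => a.blocks.getD i 0) r,
      sum_range_getD _ _ a.length_le, a.blocks_sum]⟩, by
    intro i j hij hi
    have hlen : a.blocks.length ≤ i := by
      by_contra hlt
      rw [not_le] at hlt
      simp only [List.getD_eq_getElem _ _ hlt] at hi
      exact (a.blocks_pos (List.getElem_mem hlt)).ne' hi
    simp only
    rw [List.getD_eq_default _ _ (hlen.trans hij)]⟩

/-- The idempotent `1_λ` of the Schur superalgebra. -/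
def schurOne {n r : ℕ} (l : Weight n r) : Schur n r := Presented.mk _ (g1 l)

/-- The element `e_i` of the Schur superalgebra (for `i + 1 < n`; indices start at `0`). -/
def schurE (n r i : ℕ) : Schur n r := if h : i + 1 < n then Presented.mk _ (gE i h 0) else 0

/-- The element `f_i` of the Schur superalgebra (for `i + 1 < n`; indices start at `0`). -/
def schurF (n r i : ℕ) : Schur n r := if h : i + 1 < n then Presented.mk _ (gF i h 0) else 0

/-- The element `h_{j̄}` of the Schur superalgebra (for `j < n`; indices start at `0`). -/
def schurH (n r j : ℕ) : Schur n r := if h : j < n then Presented.mk _ (gH ⟨j, h⟩) else 0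

/-- The element `x_{r-2}^{(a_{r-1})} ⋯ x_{i+1}^{(a_{i+2})} x_i^{(a_{i+1})}` with `x = e`, where
indices start at `0` and `a` is continued by zeros. -/
def eProd {r : ℕ} (i : ℕ) (a : Composition r) : Schur r r :=
  (((List.range' i (r - 1 - i)).map fun p =>
    divPow (schurE r r p) (a.blocks.getD (p + 1) 0)).reverse).prod

/-- The element `x_i^{(a_{i+1})} x_{i+1}^{(a_{i+2})} ⋯ x_{r-2}^{(a_{r-1})}` with `x = f`, where
indices start at `0` and `a` is continued by zeros. -/
def fProd {r : ℕ} (i : ℕ) (a : Composition r) : Schur r r :=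
  ((List.range' i (r - 1 - i)).map fun p =>
    divPow (schurF r r p) (a.blocks.getD (p + 1) 0)).prod

/-- The element of the Schur superalgebra whose image is the image of a generating web: `1_â` for
the identity web of `a`; `e_{r-2}^{(â_{r-1})} ⋯ e_i^{(â_{i+1})} 1_â` for the merge `a → b` of the
strands at the places `i`, `i + 1`; `f_i^{(b̂_{i+1})} ⋯ f_{r-2}^{(b̂_{r-1})} 1_â` for the split
`a → b` into the strands at the places `i`, `i + 1`; `h_{j̄} 1_â` for the dot on the strand at the
place `j`. -/
def genElt {r : ℕ} : WebGen r → Schur r r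
  | .one a => schurOne (hat a).1
  | .loc L (.merge _ _) _ a _ _ _ => eProd L.length a * schurOne (hat a).1
  | .loc L (.split _ _) _ a b _ _ => fProd L.length b * schurOne (hat a).1
  | .loc L (.dot _) _ a _ _ _ => schurH r r L.length * schurOne (hat a).1

/-- The inclusion of the summand `M^λ` into `⨁_{λ ∈ Λ'(r)} M^λ`. -/
def permOf {r : ℕ} (l : Weight' r) : permMod l.1 →ₗ[ℂ] PermSum r :=
  DirectSum.lof ℂ (Weight' r) (fun l => permMod l.1) l

/-- The projection of `⨁_{λ ∈ Λ'(r)} M^λ` onto the summand `M^λ`, i.e. the identity of `M^λ`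
extended by zero. -/
def permProj {r : ℕ} (l : Weight' r) : Module.End ℂ (PermSum r) :=
  permOf l ∘ₗ DirectSum.component ℂ (Weight' r) (fun l => permMod l.1) l

end TypeQ

end

open TypeQ

/-! The homomorphism is built through a combinatorial model. A monomial of `V^{⊗ r}` whose weight
has only trailing zeros amounts to an ordered set partition of the `r` places (the fibres of its
labels) together with a parity at each place. On lists of blocks with coefficients in `(ℂ^{1|1})^{⊗
r}` webs act in an obvious way: a merge unites two blocks, a split sums over the ways to cut a block
in two, a dot sums the Clifford generators at the places of a block. The web relations hold there
(`opWeb_rel`). Those without ladders come from counting subsets and from the Clifford relations. In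
the ladder relations a rung of thickness `1` moves a single place from one block to the next, so it
acts as an operator `opD a b` on monomials, and the relations become instances of the bracket
formula `opD_bracket`.

The comparison map `toBlocks` is injective on the sum of the permutation supermodules
(`toBlocks_permIncl_injective`) and carries the prescribed elements of the Schur superalgebra to the
generating webs (`toBlocks_genElt`): a divided power of `e_i` or `f_i` moves each subset of the
given size exactly once, and the other factors only close or open a gap in the labels, which the
list of nonempty blocks does not see. Hence the prescribed values satisfy the web relations. They
supercommute with the Sergeev superalgebra because the operators `opD` and `opOne` do. This gives
`webHom`.

Bijectivity is reduced to strands of thickness `1`. Let `e = thinOne r`. By the explosion relation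
every thick strand factors through thin ones, so `1` lies in the ideal `W e W`
(`one_mem_thinIdeal'`). The corner `e W e` is generated by thin dots and by the webs `cross r j`
(`exists_thin`); after subtracting `e` from the latter these satisfy the Sergeev relations
(`sergeevFamily_thin`), and normal forms bound the dimension of the corner by `2 ^ r * r!`.
Conversely, webs applied to `v_1 ⊗ ⋯ ⊗ v_r` reach every monomial of weight `(1, …, 1)`, and there
are `2 ^ r * r!` of them. So evaluation at this vector is injective on `e W e` (`compress_eq_zero`).
The vector also generates its permutation supermodule over the Sergeev superalgebra, so an
endomorphism of that supermodule is determined by its value there, and every value is that of a web.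
Thus `e W e` is the full endomorphism superalgebra of this summand, and since `1 ∈ W e W`, both
injectivity and surjectivity extend to all of `W`. -/

noncomputable section

namespace TypeQ

variable {r : ℕ} {E E' : Type} [AddCommGroup E] [Module ℂ E] [AddCommGroup E'] [Module ℂ E']

/-! ## The model: ordered set partitions with parities -/

/-- Lists of blocks with coefficients in the superspace `(ℂ^{1|1})^{⊗ r}`. -/
abbrev BlockSpace (r : ℕ) : Type := List (Finset (Fin r)) →₀ Tens 1 r

/-- The basis vector of a list of blocks, the empty blocks being erased. -/
def st (B : List (Finset (Fin r))) : Tens 1 r →ₗ[ℂ] BlockSpace r :=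
  Finsupp.lsingle (B.filter fun A => decide A.Nonempty)

/-- The Clifford generator acting on `(ℂ^{1|1})^{⊗ r}` at the place `p`. -/
def clif (p : Fin r) : Module.End ℂ (Tens 1 r) := opAt 0 0 1 p

/-- There is only one label, so nothing changes. It allows an undotted rung to be treated as the
even case of `opAt 0 0 d p`, uniformly with a dotted one. -/
theorem opAt_one_zero (p : Fin r) : opAt (n := 1) 0 0 0 p = 1 := by
  refine end_ext fun I => ?_
  have h : (I p).1 = 0 := Subsingleton.elim _ _
  have h2 : ((0 : Fin 1), (I p).2) = I p := by rw [← h]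
  simp [opAt, h2, h]

theorem clif_sq (p : Fin r) : clif p * clif p = 1 := by
  rw [clif, opAt_same, if_pos rfl, zmod2_one_add_one, opAt_one_zero]

theorem clif_anti {p q : Fin r} (h : p ≠ q) : clif p * clif q = -(clif q * clif p) := by
  rw [clif, clif, opAt_ne _ _ _ _ _ _ h]; simp

/-- The action of a local picture on the blocks `X`, continued by `f`. -/
def LocGen.act (x : LocGen) (X : List (Finset (Fin r)))
    (f : List (Finset (Fin r)) → Tens 1 r →ₗ[ℂ] E) : Tens 1 r →ₗ[ℂ] E :=
  match x, X with
  | .merge _ _, [A, A'] => f [A ∪ A']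
  -- The second label of a split is the size of the right block `T`; the first is determined by it
  -- and by the size of `A`.
  | .split _ l, [A] => ∑ T ∈ A.powersetCard l, f [A \ T, T]
  | .dot _, [A] => ∑ p ∈ A, f [A] ∘ₗ clif p
  -- Not reached for lists of blocks whose sizes are `x.src`.
  | _, _ => 0

/-- The operator of a generating web on the model. -/
def opGen : WebGen r → Module.End ℂ (BlockSpace r)
  | .one a => Finsupp.lsum ℂ fun B => if B.map Finset.card = a.blocks then st B else 0
  | .loc L x _ a _ _ _ => Finsupp.lsum ℂ fun B => if B.map Finset.card = a.blocks then
      x.act ((B.drop L.length).take x.src.length) fun X' =>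
        st (B.take L.length ++ X' ++ B.drop (L.length + x.src.length)) else 0

/-- The action of the free algebra on the model. -/
def opWeb : FreeAlgebra ℂ (WebGen r) →ₐ[ℂ] Module.End ℂ (BlockSpace r) :=
  FreeAlgebra.lift ℂ opGen

theorem st_congr {B B' : List (Finset (Fin r))}
    (h : (B.filter fun A => decide A.Nonempty) = B'.filter fun A => decide A.Nonempty) :
    st B = st B' := by simp [st, h]

theorem erase0_append (L L' : List ℕ) : erase0 (L ++ L') = erase0 L ++ erase0 L' := by
  simp [erase0]

theorem erase0_eq_self {L : List ℕ} (h : ∀ i ∈ L, 0 < i) : erase0 L = L := by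
  simpa [erase0] using h

theorem filter_map_card (B : List (Finset (Fin r))) :
    (B.filter fun A => decide A.Nonempty).map Finset.card = erase0 (B.map Finset.card) := by
  simp only [erase0, List.filter_map]
  congr 1
  refine List.filter_congr fun A _ => ?_
  simp [Finset.card_pos]

theorem opGen_one_single (a : Composition r) (B : List (Finset (Fin r))) (v : Tens 1 r) :
    opGen (.one a) (Finsupp.single B v) =
      if B.map Finset.card = a.blocks then st B v else 0 := by
  simp only [opGen, Finsupp.lsum_single]
  split_ifs <;> rfl

theorem opGen_loc_single (L x R) (a b : Composition r) (ha hb) (B : List (Finset (Fin r)))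
    (v : Tens 1 r) :
    opGen (.loc L x R a b ha hb) (Finsupp.single B v) = if B.map Finset.card = a.blocks then
      x.act ((B.drop L.length).take x.src.length) (fun X' =>
        st (B.take L.length ++ X' ++ B.drop (L.length + x.src.length))) v else 0 := by
  simp only [opGen, Finsupp.lsum_single]
  split_ifs <;> rfl

/-- The list of nonempty blocks has the given cardinalities, up to empty blocks. -/
def HasType (B : List (Finset (Fin r))) (L : List ℕ) : Prop :=
  erase0 (B.map Finset.card) = erase0 L

theorem opWeb_wOne (L : List ℕ) (B : List (Finset (Fin r))) (v : Tens 1 r)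
    (h : HasType B L) (hs : L.sum = r) : opWeb (wOne r L) (st B v) = st B v := by
  rw [wOne, dif_pos hs]
  simp only [opWeb, FreeAlgebra.lift_ι_apply]
  rw [st, Finsupp.lsingle_apply, opGen_one_single, filter_map_card, if_pos (show _ = _ from h), st]
  simp

theorem opWeb_wOne_zero (L : List ℕ) (B : List (Finset (Fin r))) (v : Tens 1 r)
    (h : ¬ HasType B L) : opWeb (wOne r L) (st B v) = 0 := by
  rw [wOne]
  split_ifs with hs
  · simp only [opWeb, FreeAlgebra.lift_ι_apply]
    rw [st, Finsupp.lsingle_apply, opGen_one_single, filter_map_card,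
      if_neg (show ¬ _ = _ from h)]
  · simp

theorem opWeb_wLoc_zero (L R : List ℕ) (x : LocGen) (B : List (Finset (Fin r))) (v : Tens 1 r)
    (h : ¬ HasType B (L ++ x.src ++ R)) : opWeb (wLoc r L x R) (st B v) = 0 := by
  rw [wLoc]
  split_ifs with hs
  · simp only [opWeb, FreeAlgebra.lift_ι_apply]
    rw [st, Finsupp.lsingle_apply, opGen_loc_single, filter_map_card, if_neg]
    intro h'
    apply h
    rw [HasType, h', erase0_append, erase0_append, erase0_eq_self (L := x.src)]
    exact fun i hi => hs.2 i (by simp [hi])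
  · simp

/-- The outer blocks may be empty. Erasing empty blocks corresponds to erasing `0`-strands in `L`
and `R`, and the blocks of `X` survive because the labels of `x` are positive; so after erasure the
picture still acts exactly on `X`. -/
theorem opWeb_wLoc {L R : List ℕ} {x : LocGen} {B₁ X B₂ : List (Finset (Fin r))} (v : Tens 1 r)
    (h₁ : B₁.map Finset.card = L) (hX : X.map Finset.card = x.src)
    (h₂ : B₂.map Finset.card = R) (hs : (L ++ x.src ++ R).sum = r)
    (hp : ∀ i ∈ x.src ++ x.tgt, 0 < i) :
    opWeb (wLoc r L x R) (st (B₁ ++ X ++ B₂) v) =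
      x.act X (fun X' => st (B₁ ++ X' ++ B₂)) v := by
  rw [wLoc, dif_pos ⟨hs, hp⟩]
  simp only [opWeb, FreeAlgebra.lift_ι_apply]
  have hXe : (X.filter fun A => decide A.Nonempty) = X := by
    refine List.filter_eq_self.2 fun A hA => ?_
    have : A.card ∈ x.src := by rw [← hX]; exact List.mem_map_of_mem hA
    simpa [Finset.card_pos] using hp A.card (by simp [this])
  rw [st, Finsupp.lsingle_apply, opGen_loc_single, filter_map_card, if_pos]
  swap
  · rw [List.map_append, List.map_append, h₁, hX, h₂, erase0_append, erase0_append,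
      erase0_eq_self (L := x.src) fun i hi => hp i (by simp [hi])]
  have hl₁ : (B₁.filter fun A => decide A.Nonempty).length = (erase0 L).length := by
    rw [← h₁, ← filter_map_card, List.length_map]
  have hlX : X.length = x.src.length := by rw [← hX, List.length_map]
  rw [List.filter_append, List.filter_append, hXe, ← hl₁, ← hlX]
  have e1 : ((List.filter (fun A => decide A.Nonempty) B₁ ++ X ++
      List.filter (fun A => decide A.Nonempty) B₂).drop
        (List.filter (fun A => decide A.Nonempty) B₁).length).take X.length = X := by
    rw [List.append_assoc, List.drop_left, List.take_left]
  have e2 : (List.filter (fun A => decide A.Nonempty) B₁ ++ X ++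
      List.filter (fun A => decide A.Nonempty) B₂).take
        (List.filter (fun A => decide A.Nonempty) B₁).length =
      List.filter (fun A => decide A.Nonempty) B₁ := by
    rw [List.append_assoc, List.take_left]
  have e3 : (List.filter (fun A => decide A.Nonempty) B₁ ++ X ++
      List.filter (fun A => decide A.Nonempty) B₂).drop
        ((List.filter (fun A => decide A.Nonempty) B₁).length + X.length) =
      List.filter (fun A => decide A.Nonempty) B₂ := by
    rw [← List.length_append, List.drop_left]
  rw [e1, e2, e3]
  congr 2
  funext X'
  apply st_congr
  simp [List.filter_append]

/-- The continuation is evaluated only at lists with block sizes `x.tgt`. Disjointness enters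
through the size of the union in a merge. -/
theorem LocGen.act_congr (x : LocGen) {X : List (Finset (Fin r))}
    {f g : List (Finset (Fin r)) → Tens 1 r →ₗ[ℂ] E} (hX : X.map Finset.card = x.src)
    (h : ∀ X', X'.map Finset.card = x.tgt → f X' = g X')
    (hd : X.Pairwise Disjoint) : x.act X f = x.act X g := by
  rcases x with ⟨k, l⟩ | ⟨k, l⟩ | k
  all_goals
    simp only [LocGen.src, List.map_eq_cons_iff, List.map_eq_nil_iff] at hX
  · obtain ⟨A, _, rfl, rfl, A', _, rfl, rfl, rfl⟩ := hX
    simp only [LocGen.act]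
    refine h _ ?_
    simp only [List.pairwise_cons, List.mem_cons, List.not_mem_nil, or_false, forall_eq] at hd
    simp [LocGen.tgt, Finset.card_union_of_disjoint hd.1]
  · obtain ⟨A, _, rfl, hA, rfl⟩ := hX
    simp only [LocGen.act]
    refine Finset.sum_congr rfl fun T hT => h _ ?_
    rw [Finset.mem_powersetCard] at hT
    simp [LocGen.tgt, Finset.card_sdiff_of_subset hT.1, hT.2, hA]
  · obtain ⟨A, _, rfl, hA, rfl⟩ := hX
    simp only [LocGen.act]
    refine Finset.sum_congr rfl fun p _ => ?_
    rw [h _ (by simpa [LocGen.tgt] using hA)]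

/-- This is how a second web is applied after a local picture: it passes into the continuation. -/
theorem LocGen.comp_act (x : LocGen) (X : List (Finset (Fin r))) (F : E →ₗ[ℂ] E')
    (f : List (Finset (Fin r)) → Tens 1 r →ₗ[ℂ] E) :
    F ∘ₗ x.act X f = x.act X fun X' => F ∘ₗ f X' := by
  unfold LocGen.act
  split <;> simp [LinearMap.ext_iff]

/-- Merges and splits contribute only sums, which may be exchanged. The sign comes from two dots:
their Clifford generators sit at places of disjoint blocks, hence at distinct places, and
anticommute. -/
theorem LocGen.act_comm (x y : LocGen) {X Y : List (Finset (Fin r))}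
    (h : ∀ A ∈ X, ∀ B ∈ Y, Disjoint A B)
    (f : List (Finset (Fin r)) → List (Finset (Fin r)) → Tens 1 r →ₗ[ℂ] E) :
    (y.act Y fun Y' => x.act X fun X' => f X' Y') =
      ksign x.par y.par • x.act X fun X' => y.act Y fun Y' => f X' Y' := by
  unfold LocGen.act
  split <;> split <;> ext v <;>
    simp only [LocGen.par, ksign_zero_left, ksign_zero_right, one_smul, LinearMap.sum_apply,
      LinearMap.comp_apply, LinearMap.zero_apply, Finset.sum_const_zero, LinearMap.smul_apply,
      smul_zero]
  · exact Finset.sum_comm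
  · exact Finset.sum_comm
  · exact Finset.sum_comm
  · rename_i A B
    rw [Finset.sum_comm, Finset.smul_sum]
    refine Finset.sum_congr rfl fun p hp => ?_
    rw [Finset.smul_sum]
    refine Finset.sum_congr rfl fun q hq => ?_
    have hpq : p ≠ q := by
      rintro rfl
      have := h _ (List.mem_singleton.2 rfl) _ (List.mem_singleton.2 rfl)
      exact Finset.disjoint_left.1 this hp hq
    have := congrArg (fun T => T v) (clif_anti hpq)
    simp only [Module.End.mul_apply, LinearMap.neg_apply] at this
    simp [this]

/-! ### The action of merges, splits and dots, `0`-strands included. -/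

section rules

variable {B₁ B₂ : List (Finset (Fin r))} {A A' : Finset (Fin r)} {L R : List ℕ} {k l : ℕ}
  {B : List (Finset (Fin r))} (v : Tens 1 r)

theorem st_nil_mid (B₁ B₂ : List (Finset (Fin r))) : st (B₁ ++ ∅ :: B₂) = st (B₁ ++ B₂) :=
  st_congr (by simp [List.filter_append])

theorem opWeb_wMerge (hB : B = B₁ ++ A :: A' :: B₂) (h₁ : B₁.map Finset.card = L)
    (hA : A.card = k) (hA' : A'.card = l) (h₂ : B₂.map Finset.card = R)
    (hs : (L ++ k :: l :: R).sum = r) :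
    opWeb (wMerge r L k l R) (st B v) = st (B₁ ++ (A ∪ A') :: B₂) v := by
  subst hB
  rw [wMerge]
  split_ifs with h
  -- A `0`-strand is an empty block: the union with it changes nothing, and the merge is an identity
  -- web.
  · have key : st (B₁ ++ A :: A' :: B₂) = st (B₁ ++ (A ∪ A') :: B₂) := by
      rcases h with rfl | rfl
      · rw [Finset.card_eq_zero] at hA; subst hA
        rw [st_nil_mid, Finset.empty_union]
      · rw [Finset.card_eq_zero] at hA'; subst hA'
        have := st_nil_mid (B₁ ++ [A]) B₂
        simpa using this
    rw [opWeb_wOne, key]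
    · subst h₁ h₂
      rcases h with rfl | rfl <;> simp [HasType, erase0, List.filter_cons, hA, hA']
    · simpa [add_assoc] using hs
  · have := opWeb_wLoc (x := .merge k l) (X := [A, A']) v h₁ (by simp [LocGen.src, hA, hA']) h₂
      (by simpa [LocGen.src] using hs) (by simp [LocGen.src, LocGen.tgt]; omega)
    simpa [LocGen.act] using this

theorem opWeb_wSplit (hB : B = B₁ ++ A :: B₂) (h₁ : B₁.map Finset.card = L)
    (hA : A.card = k + l) (h₂ : B₂.map Finset.card = R)
    (hs : (L ++ (k + l) :: R).sum = r) :
    opWeb (wSplit r L k l R) (st B v) =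
      ∑ T ∈ A.powersetCard l, st (B₁ ++ (A \ T) :: T :: B₂) v := by
  subst hB
  rw [wSplit]
  split_ifs with h
  · rw [opWeb_wOne _ _ _ (by subst h₁ h₂; simp [HasType, hA]) hs]
    rcases h with rfl | rfl
    · rw [zero_add] at hA
      rw [← hA, Finset.powersetCard_self, Finset.sum_singleton, Finset.sdiff_self]
      simp [st_nil_mid]
    · rw [Finset.powersetCard_zero, Finset.sum_singleton, Finset.sdiff_empty]
      have := st_nil_mid (B₁ ++ [A]) B₂
      simp only [List.append_assoc, List.singleton_append] at this
      rw [this]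
  · have := opWeb_wLoc (x := .split k l) (X := [A]) v h₁ (by simp [LocGen.src, hA]) h₂
      (by simpa [LocGen.src] using hs) (by simp [LocGen.src, LocGen.tgt]; omega)
    simpa [LocGen.act] using this

theorem opWeb_wDot (hB : B = B₁ ++ A :: B₂) (h₁ : B₁.map Finset.card = L)
    (hA : A.card = k) (h₂ : B₂.map Finset.card = R)
    (hs : (L ++ k :: R).sum = r) :
    opWeb (wDot r L k R) (st B v) = st B (∑ p ∈ A, clif p v) := by
  subst hB
  -- The dot on a `0`-strand is `0` by convention, which agrees with the empty sum of Clifford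
  -- generators.
  rcases Nat.eq_zero_or_pos k with rfl | hk
  · rw [Finset.card_eq_zero] at hA; subst hA
    rw [wDot, wLoc, dif_neg (by simp [LocGen.src])]
    simp
  · have := opWeb_wLoc (x := .dot k) (X := [A]) v h₁ (by simp [LocGen.src, hA]) h₂
      (by simpa [LocGen.src] using hs) (by simpa [LocGen.src, LocGen.tgt] using hk)
    simpa [LocGen.act, wDot] using this

/-- A variant of `opWeb_wSplit`, which sums over the left block. -/
theorem opWeb_wSplit' (hB : B = B₁ ++ A :: B₂) (h₁ : B₁.map Finset.card = L)
    (hA : A.card = k + l) (h₂ : B₂.map Finset.card = R)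
    (hs : (L ++ (k + l) :: R).sum = r) :
    opWeb (wSplit r L k l R) (st B v) =
      ∑ T ∈ A.powersetCard k, st (B₁ ++ T :: (A \ T) :: B₂) v := by
  rw [opWeb_wSplit v hB h₁ hA h₂ hs]
  refine Finset.sum_bij' (fun T _ => A \ T) (fun T _ => A \ T) ?_ ?_ ?_ ?_ ?_
  · intro T hT
    rw [Finset.mem_powersetCard] at *
    refine ⟨Finset.sdiff_subset, ?_⟩
    rw [Finset.card_sdiff_of_subset hT.1]; omega
  · intro T hT
    rw [Finset.mem_powersetCard] at *
    refine ⟨Finset.sdiff_subset, ?_⟩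
    rw [Finset.card_sdiff_of_subset hT.1]; omega
  · intro T hT
    exact Finset.sdiff_sdiff_eq_self (Finset.mem_powersetCard.1 hT).1
  · intro T hT
    exact Finset.sdiff_sdiff_eq_self (Finset.mem_powersetCard.1 hT).1
  · intro T hT
    rw [Finset.sdiff_sdiff_eq_self (Finset.mem_powersetCard.1 hT).1]

end rules

end TypeQ

end


noncomputable section

namespace TypeQ

variable {r : ℕ}

/-! ## The web relations hold in the model -/

/-- `x` annihilates the lists of blocks which are not of type `L`. -/
def Kills (x : FreeAlgebra ℂ (WebGen r)) (L : List ℕ) : Prop :=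
  ∀ B v, ¬ HasType B L → opWeb x (st B v) = 0

theorem Kills.mul_left {x : FreeAlgebra ℂ (WebGen r)} {L : List ℕ} (h : Kills x L)
    (y : FreeAlgebra ℂ (WebGen r)) : Kills (y * x) L := fun B v hB => by
  rw [map_mul, Module.End.mul_apply, h B v hB, map_zero]

theorem Kills.add {x y : FreeAlgebra ℂ (WebGen r)} {L : List ℕ} (h : Kills x L)
    (h' : Kills y L) : Kills (x + y) L := fun B v hB => by
  rw [map_add, LinearMap.add_apply, h B v hB, h' B v hB, add_zero]

theorem Kills.sub {x y : FreeAlgebra ℂ (WebGen r)} {L : List ℕ} (h : Kills x L)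
    (h' : Kills y L) : Kills (x - y) L := fun B v hB => by
  rw [map_sub, LinearMap.sub_apply, h B v hB, h' B v hB, sub_zero]

theorem Kills.smul {x : FreeAlgebra ℂ (WebGen r)} {L : List ℕ} (h : Kills x L)
    (c : ℂ) : Kills (c • x) L := fun B v hB => by
  rw [map_smul, LinearMap.smul_apply, h B v hB, smul_zero]

theorem kills_zero (L : List ℕ) : Kills (0 : FreeAlgebra ℂ (WebGen r)) L := fun B v _ => by simp

theorem kills_wOne (L : List ℕ) : Kills (wOne r L) L := fun B v h => opWeb_wOne_zero L B v h

theorem kills_wLoc (L R : List ℕ) (x : LocGen) : Kills (wLoc r L x R) (L ++ x.src ++ R) :=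
  fun B v h => opWeb_wLoc_zero L R x B v h

theorem Kills.congr {x : FreeAlgebra ℂ (WebGen r)} {L L' : List ℕ} (h : Kills x L)
    (e : erase0 L = erase0 L') : Kills x L' :=
  fun B v hB => h B v (by rwa [HasType, e])

theorem kills_wMerge (L R : List ℕ) (k l : ℕ) : Kills (wMerge r L k l R) (L ++ k :: l :: R) := by
  rw [wMerge]
  split_ifs with h
  · refine (kills_wOne _).congr ?_
    rcases h with rfl | rfl <;> simp [erase0, List.filter_cons]
  · exact (kills_wLoc _ _ _).congr (by simp [LocGen.src])

theorem kills_wSplit (L R : List ℕ) (k l : ℕ) :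
    Kills (wSplit r L k l R) (L ++ (k + l) :: R) := by
  rw [wSplit]
  split_ifs with h
  · exact kills_wOne _
  · exact (kills_wLoc _ _ _).congr (by simp [LocGen.src])

theorem kills_wDot (L R : List ℕ) (k : ℕ) : Kills (wDot r L k R) (L ++ k :: R) :=
  (kills_wLoc _ _ _).congr (by simp [LocGen.src])

theorem kills_rungL (L R : List ℕ) (k l : ℕ) (d : Bool) :
    Kills (rungL r L k l R d) (L ++ k :: (l + 1) :: R) :=
  ((kills_wSplit _ _ _ _).mul_left _).congr (by simp [add_comm])

theorem kills_rungR (L R : List ℕ) (k l : ℕ) (d : Bool) :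
    Kills (rungR r L k l R d) (L ++ (k + 1) :: l :: R) :=
  (kills_wSplit _ _ _ _).mul_left _

/-- The lists of pairwise disjoint blocks with union `Fin r`. -/
def Good (B : List (Finset (Fin r))) : Prop :=
  B.Pairwise Disjoint ∧ (B.map Finset.card).sum = r

/-- Empty blocks are inserted where `L` has a zero; `st` does not notice them. -/
theorem exists_of_hasType_aux (L : List ℕ) : ∀ K : List (Finset (Fin r)),
    K.map Finset.card = erase0 L →
      ∃ B : List (Finset (Fin r)), (B.filter fun A => decide A.Nonempty) = K ∧
        B.map Finset.card = L := by
  induction L with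
  | nil =>
    intro K hK
    exact ⟨[], by simpa [erase0, eq_comm] using hK, rfl⟩
  | cons a L ih =>
    intro K hK
    rcases Nat.eq_zero_or_pos a with rfl | ha
    · obtain ⟨B, h1, h2⟩ := ih K (by simpa [erase0] using hK)
      exact ⟨∅ :: B, by simpa using h1, by simpa using h2⟩
    · have : erase0 (a :: L) = a :: erase0 L := by simp [erase0, ha]
      rw [this, List.map_eq_cons_iff] at hK
      obtain ⟨A, K', rfl, hA, hK'⟩ := hK
      obtain ⟨B, h1, h2⟩ := ih K' hK'
      have hne : A.Nonempty := Finset.card_pos.1 (hA ▸ ha)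
      exact ⟨A :: B, by simp [hne, h1], by simp [hA, h2]⟩

/-- Passing to a representative whose sizes are literally `L` makes the rules `opWeb_wMerge`,
`opWeb_wSplit` and `opWeb_wDot` applicable, even if `L` has zeros. -/
theorem exists_of_hasType {K : List (Finset (Fin r))} {L : List ℕ} (h : HasType K L)
    (hK : Good K) : ∃ B : List (Finset (Fin r)), st B = st K ∧ B.map Finset.card = L ∧
      B.Pairwise Disjoint ∧ L.sum = r := by
  obtain ⟨B, h1, h2⟩ := exists_of_hasType_aux L _ ((filter_map_card K).trans h)
  refine ⟨B, st_congr h1, h2, ?_, ?_⟩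
  · have : (B.filter fun A => decide A.Nonempty).Pairwise Disjoint := by
      rw [h1]; exact hK.1.filter _
    rw [List.pairwise_filter] at this
    refine this.imp fun {A A'} hd => ?_
    rcases A.eq_empty_or_nonempty with rfl | hA
    · simp
    rcases A'.eq_empty_or_nonempty with rfl | hA'
    · simp
    exact hd (by simpa using hA) (by simpa using hA')
  · rw [← erase0_sum, ← h, erase0_sum, hK.2]

/-- The general way to verify a relation in the model: off the type `L` both sides vanish, and on
the type `L` a representative with exact block sizes may be used. -/
theorem model_rel {x y : FreeAlgebra ℂ (WebGen r)} {L : List ℕ} (hx : Kills x L) (hy : Kills y L)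
    (h : ∀ B : List (Finset (Fin r)), B.Pairwise Disjoint → L.sum = r → B.map Finset.card = L →
      ∀ v, opWeb x (st B v) = opWeb y (st B v))
    (K : List (Finset (Fin r))) (hK : Good K) (v : Tens 1 r) :
    opWeb x (st K v) = opWeb y (st K v) := by
  by_cases hT : HasType K L
  · obtain ⟨B, h1, h2, h3, h4⟩ := exists_of_hasType hT hK
    rw [← h1]
    exact h B h3 h4 h2 v
  · rw [hx K v hT, hy K v hT]

/-! ### Generators as local pictures -/

theorem ι_one_eq (a : Composition r) : FreeAlgebra.ι ℂ (WebGen.one a) = wOne r a.blocks := by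
  rw [wOne, dif_pos a.blocks_sum]
  congr 2
  ext1
  exact (erase0_eq_self fun i hi => a.blocks_pos hi).symm

theorem ι_loc_eq (L x R) (a b : Composition r) (ha hb) :
    FreeAlgebra.ι ℂ (WebGen.loc L x R a b ha hb) = wLoc r L x R := by
  have hLp : ∀ i ∈ L, 0 < i := fun i hi => a.blocks_pos (by simp [ha, hi])
  have hRp : ∀ i ∈ R, 0 < i := fun i hi => a.blocks_pos (by simp [ha, hi])
  have hp : ∀ i ∈ x.src ++ x.tgt, 0 < i := by
    intro i hi
    rcases List.mem_append.1 hi with hi | hi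
    · exact a.blocks_pos (by simp [ha, hi])
    · exact b.blocks_pos (by simp [hb, hi])
  rw [wLoc, dif_pos ⟨by rw [← ha, a.blocks_sum], hp⟩]
  congr 1
  obtain ⟨ab, hab, has⟩ := a
  obtain ⟨bb, hbb, hbs⟩ := b
  simp only at ha hb
  subst ha hb
  simp only [erase0_eq_self hLp, erase0_eq_self hRp]

theorem opWeb_one_gen (b : Composition r) {B : List (Finset (Fin r))} {L : List ℕ}
    (hB : B.map Finset.card = L) (hL : ∀ i ∈ L, 0 < i) (v : Tens 1 r) :
    opWeb (FreeAlgebra.ι ℂ (.one b)) (st B v) = if b.blocks = L then st B v else 0 := by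
  rw [ι_one_eq]
  split_ifs with h
  · exact opWeb_wOne _ _ _ (by rw [HasType, hB, h]) b.blocks_sum
  · refine opWeb_wOne_zero _ _ _ fun h' => h ?_
    rw [HasType, hB, erase0_eq_self hL, erase0_eq_self fun i hi => b.blocks_pos hi] at h'
    exact h'.symm

theorem exists_split3 {B : List (Finset (Fin r))} {L X R : List ℕ}
    (h : B.map Finset.card = L ++ X ++ R) : ∃ B₁ BX B₂, B = B₁ ++ BX ++ B₂ ∧
      B₁.map Finset.card = L ∧ BX.map Finset.card = X ∧ B₂.map Finset.card = R := by
  obtain ⟨BL, B₂, rfl, h1, h2⟩ := List.map_eq_append_iff.1 h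
  obtain ⟨B₁, BX, rfl, h3, h4⟩ := List.map_eq_append_iff.1 h1
  exact ⟨B₁, BX, B₂, rfl, h3, h4, h2⟩

theorem model_one_left (b : Composition r) (g : WebGen r) (K : List (Finset (Fin r)))
    (hK : Good K) (v : Tens 1 r) :
    opWeb (FreeAlgebra.ι ℂ (.one b) * FreeAlgebra.ι ℂ g) (st K v) =
      opWeb (if b = g.tgt then FreeAlgebra.ι ℂ g else 0) (st K v) := by
  rcases g with a | ⟨L, x, R, a, c, ha, hc⟩
  · refine model_rel (L := a.blocks) ?_ ?_ ?_ K hK v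
    · exact Kills.mul_left (by rw [ι_one_eq]; exact kills_wOne _) _
    · split_ifs
      · rw [ι_one_eq]; exact kills_wOne _
      · exact kills_zero _
    · intro B _ _ hB v
      have hp : ∀ i ∈ a.blocks, 0 < i := fun i hi => a.blocks_pos hi
      rw [map_mul, Module.End.mul_apply, opWeb_one_gen a hB hp, if_pos rfl,
        opWeb_one_gen b hB hp]
      by_cases hb : b = a
      · subst hb; simp [WebGen.tgt, opWeb_one_gen b hB hp]
      · have : ¬ b.blocks = a.blocks := fun h => hb (Composition.ext h)
        simp [WebGen.tgt, hb, this]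
  · have hp : ∀ i ∈ x.src ++ x.tgt, 0 < i := by
      intro i hi
      rcases List.mem_append.1 hi with hi | hi
      · exact a.blocks_pos (by simp [ha, hi])
      · exact c.blocks_pos (by simp [hc, hi])
    refine model_rel (L := L ++ x.src ++ R) ?_ ?_ ?_ K hK v
    · exact Kills.mul_left (by rw [ι_loc_eq]; exact kills_wLoc _ _ _) _
    · split_ifs
      · rw [ι_loc_eq]; exact kills_wLoc _ _ _
      · exact kills_zero _
    · intro B hd hs hB v
      obtain ⟨B₁, X, B₂, rfl, h₁, hX, h₂⟩ := exists_split3 hB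
      have hdX : X.Pairwise Disjoint :=
        ((List.pairwise_append.1 (List.pairwise_append.1 hd).1).2).1
      have key : opWeb (FreeAlgebra.ι ℂ (WebGen.loc L x R a c ha hc)) (st (B₁ ++ X ++ B₂) v) =
          x.act X (fun X' => st (B₁ ++ X' ++ B₂)) v := by
        rw [ι_loc_eq]; exact opWeb_wLoc v h₁ hX h₂ hs hp
      rw [map_mul, Module.End.mul_apply, key, ← LinearMap.comp_apply, LocGen.comp_act]
      -- All lists produced by `x` have the type of `c`, so the identity web acts on them by the
      -- same scalar, `1` or `0`.
      have e : ∀ X' : List (Finset (Fin r)), X'.map Finset.card = x.tgt →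
          opWeb (FreeAlgebra.ι ℂ (.one b)) ∘ₗ st (B₁ ++ X' ++ B₂) =
            (if b = c then LinearMap.id else 0 : Module.End ℂ (BlockSpace r)) ∘ₗ st (B₁ ++ X' ++ B₂) := by
        intro X' hX'
        ext1 v
        have hc' : (B₁ ++ X' ++ B₂).map Finset.card = c.blocks := by
          rw [List.map_append, List.map_append, h₁, hX', h₂, hc]
        rw [LinearMap.comp_apply, opWeb_one_gen b hc' fun i hi => c.blocks_pos hi]
        by_cases hb : b = c
        · subst hb; simp
        · have : ¬ b.blocks = c.blocks := fun h => hb (Composition.ext h)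
          simp [hb, this]
      rw [x.act_congr hX e hdX, ← LocGen.comp_act, LinearMap.comp_apply, ← key]
      by_cases hb : b = c <;> simp [WebGen.tgt, hb]

theorem opWeb_ι_loc_of (L x R) (a c : Composition r) (ha hc) (a' : Composition r)
    {B : List (Finset (Fin r))} (hB : B.map Finset.card = a'.blocks) (v : Tens 1 r) (h : a' ≠ a) :
    opWeb (FreeAlgebra.ι ℂ (WebGen.loc L x R a c ha hc)) (st B v) = 0 := by
  rw [ι_loc_eq]
  refine kills_wLoc _ _ _ B v fun h' => h ?_
  rw [HasType, hB, ← ha, erase0_eq_self fun i hi => a'.blocks_pos hi,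
    erase0_eq_self fun i hi => a.blocks_pos hi] at h'
  exact Composition.ext h'

theorem model_one_right (a : Composition r) (g : WebGen r) (K : List (Finset (Fin r)))
    (hK : Good K) (v : Tens 1 r) :
    opWeb (FreeAlgebra.ι ℂ g * FreeAlgebra.ι ℂ (.one a)) (st K v) =
      opWeb (if a = g.src then FreeAlgebra.ι ℂ g else 0) (st K v) := by
  -- The nonzero block sizes of a good list form a composition of `r`.
  have hT : ∃ c : Composition r, HasType K c.blocks :=
    ⟨⟨erase0 (K.map Finset.card), fun hi => erase0_pos hi, by rw [erase0_sum, hK.2]⟩, by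
      simp [HasType, erase0]⟩
  obtain ⟨c, hc⟩ := hT
  obtain ⟨B, h1, h2, h3, h4⟩ := exists_of_hasType hc hK
  have hp : ∀ i ∈ c.blocks, 0 < i := fun i hi => c.blocks_pos hi
  rw [← h1, map_mul, Module.End.mul_apply, opWeb_one_gen a h2 hp]
  by_cases hac : a = c
  · subst hac
    rw [if_pos rfl]
    rcases g with a' | ⟨L, x, R, a', c', ha, hc'⟩
    · by_cases h : a = a'
      · simp [WebGen.src, h]
      · have : ¬ a'.blocks = a.blocks := fun e => h (Composition.ext e).symm
        simp [WebGen.src, h, opWeb_one_gen a' h2 hp, this]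
    · by_cases h : a = a'
      · simp [WebGen.src, h]
      · simp [WebGen.src, h, opWeb_ι_loc_of _ _ _ _ _ _ _ a h2 v h]
  · have : ¬ a.blocks = c.blocks := fun e => hac (Composition.ext e)
    rw [if_neg this, map_zero]
    by_cases h : a = g.src
    · rw [if_pos h]
      rcases g with a' | ⟨L, x, R, a', c', ha, hc'⟩
      · simp only [WebGen.src] at h
        subst h
        rw [opWeb_one_gen a h2 hp, if_neg this]
      · simp only [WebGen.src] at h
        subst h
        rw [opWeb_ι_loc_of _ _ _ _ _ _ _ c h2 v (Ne.symm hac)]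
    · simp [h]

theorem model_one_sum (K : List (Finset (Fin r))) (hK : Good K) (v : Tens 1 r) :
    opWeb (∑ a : Composition r, FreeAlgebra.ι ℂ (.one a)) (st K v) = opWeb 1 (st K v) := by
  have hT : ∃ c : Composition r, HasType K c.blocks :=
    ⟨⟨erase0 (K.map Finset.card), fun hi => erase0_pos hi, by rw [erase0_sum, hK.2]⟩, by
      simp [HasType, erase0]⟩
  obtain ⟨c, hc⟩ := hT
  obtain ⟨B, h1, h2, h3, h4⟩ := exists_of_hasType hc hK
  have hp : ∀ i ∈ c.blocks, 0 < i := fun i hi => c.blocks_pos hi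
  rw [← h1, map_sum, LinearMap.sum_apply, Finset.sum_eq_single c]
  · rw [opWeb_one_gen c h2 hp, if_pos rfl]; simp
  · intro a _ hac
    rw [opWeb_one_gen a h2 hp, if_neg fun e => hac (Composition.ext e)]
  · simp

/-- Both orders give an iterated `act` on the disjoint groups of blocks `X` and `Y`;
`LocGen.act_comm` compares them. -/
theorem model_superinterchange (L : List ℕ) (x : LocGen) (M : List ℕ) (y : LocGen) (R : List ℕ)
    (K : List (Finset (Fin r))) (hK : Good K) (v : Tens 1 r) :
    opWeb (wLoc r L x (M ++ y.tgt ++ R) * wLoc r (L ++ x.src ++ M) y R) (st K v) =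
      opWeb (ksign x.par y.par • (wLoc r (L ++ x.tgt ++ M) y R * wLoc r L x (M ++ y.src ++ R)))
        (st K v) := by
  -- A picture with a strand labelled `0` is `0` by the convention in `wLoc`, and then both sides
  -- vanish.
  by_cases hx : ∀ i ∈ x.src ++ x.tgt, 0 < i
  swap
  · have : ∀ R', wLoc r L x R' = 0 := fun R' => by rw [wLoc, dif_neg fun h => hx h.2]
    simp [this]
  by_cases hy : ∀ i ∈ y.src ++ y.tgt, 0 < i
  swap
  · have : ∀ L', wLoc r L' y R = 0 := fun R' => by rw [wLoc, dif_neg fun h => hy h.2]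
    simp [this]
  refine model_rel (L := L ++ x.src ++ M ++ y.src ++ R) ?_ ?_ ?_ K hK v
  · exact Kills.mul_left (kills_wLoc _ _ _) _
  · refine Kills.smul (Kills.mul_left ((kills_wLoc _ _ _).congr ?_) _) _
    simp
  · intro B hd hs hB v
    obtain ⟨B', Y, B₂, rfl, h', hY, h₂⟩ := exists_split3 hB
    obtain ⟨B₁, X, BM, rfl, h₁, hX, hM⟩ := exists_split3 h'
    have hdisj : ∀ A ∈ X, ∀ A' ∈ Y, Disjoint A A' := by
      intro A hA A' hA'
      refine (List.pairwise_append.1 (List.pairwise_append.1 hd).1).2.2 A ?_ A' hA'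
      simp [hA]
    have hdX : X.Pairwise Disjoint := by
      have := (List.pairwise_append.1 (List.pairwise_append.1 hd).1).1
      exact ((List.pairwise_append.1 (List.pairwise_append.1 this).1).2).1
    have hdY : Y.Pairwise Disjoint :=
      ((List.pairwise_append.1 (List.pairwise_append.1 hd).1).2).1
    have sx := x.sum_tgt
    have sy := y.sum_tgt
    simp only [List.sum_append] at hs
    have lhs : opWeb (wLoc r L x (M ++ y.tgt ++ R) * wLoc r (L ++ x.src ++ M) y R)
        (st (B₁ ++ X ++ BM ++ Y ++ B₂) v) =
          y.act Y (fun Y' => x.act X fun X' => st (B₁ ++ X' ++ BM ++ Y' ++ B₂)) v := by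
      rw [map_mul, Module.End.mul_apply,
        opWeb_wLoc v h' hY h₂ (by simp only [List.sum_append]; omega) hy,
        ← LinearMap.comp_apply, LocGen.comp_act]
      refine congrFun (congrArg _ (y.act_congr hY (fun Y' hY' => ?_) hdY)) v
      ext1 v
      have e : ∀ X' : List (Finset (Fin r)), B₁ ++ X' ++ BM ++ Y' ++ B₂ =
          B₁ ++ X' ++ (BM ++ Y' ++ B₂) := fun X' => by simp
      rw [LinearMap.comp_apply, e X, opWeb_wLoc v h₁ hX
        (by rw [List.map_append, List.map_append, hM, hY', h₂])
        (by simp only [List.sum_append]; omega) hx]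
      simp only [e]
    have rhs : opWeb (wLoc r (L ++ x.tgt ++ M) y R * wLoc r L x (M ++ y.src ++ R))
        (st (B₁ ++ X ++ BM ++ Y ++ B₂) v) =
          x.act X (fun X' => y.act Y fun Y' => st (B₁ ++ X' ++ BM ++ Y' ++ B₂)) v := by
      have e : ∀ X' : List (Finset (Fin r)), B₁ ++ X' ++ BM ++ Y ++ B₂ =
          B₁ ++ X' ++ (BM ++ Y ++ B₂) := fun X' => by simp
      rw [map_mul, Module.End.mul_apply, e X,
        opWeb_wLoc v h₁ hX (by rw [List.map_append, List.map_append, hM, hY, h₂])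
          (by simp only [List.sum_append]; omega) hx,
        ← LinearMap.comp_apply, LocGen.comp_act]
      refine congrFun (congrArg _ (x.act_congr hX (fun X' hX' => ?_) hdX)) v
      ext1 v
      rw [LinearMap.comp_apply, ← e, opWeb_wLoc v
        (by rw [List.map_append, List.map_append, h₁, hX', hM]) hY h₂
        (by simp only [List.sum_append]; omega) hy]
    rw [lhs, map_smul, LinearMap.smul_apply, rhs, LocGen.act_comm x y hdisj, LinearMap.smul_apply]

end TypeQ

end


/-! ### The relations without ladders in the model. -/

noncomputable section

namespace TypeQ

variable {r n : ℕ}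

/-- Each Clifford generator has square `1` and the mixed terms cancel in pairs. -/
theorem clif_sum_sq (A : Finset (Fin r)) (v : Tens 1 r) :
    ∑ p ∈ A, clif p (∑ q ∈ A, clif q v) = (A.card : ℂ) • v := by
  induction A using Finset.induction_on generalizing v with
  | empty => simp
  | insert a A ha ih =>
    have anti : ∀ p ∈ A, clif a (clif p v) = -clif p (clif a v) := by
      intro p hp
      have hne : a ≠ p := by rintro rfl; exact ha hp
      exact congrArg (fun T => T v) (clif_anti hne)
    have sq : clif a (clif a v) = v := congrArg (fun T => T v) (clif_sq a)
    simp only [Finset.sum_insert ha, map_add, Finset.sum_add_distrib, sq, ih,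
      Finset.card_insert_of_notMem ha]
    rw [map_sum, Finset.sum_congr rfl anti, Finset.sum_neg_distrib]
    push_cast
    module

theorem model_merge_assoc (L R : List ℕ) (h k l : ℕ) (K : List (Finset (Fin r))) (hK : Good K)
    (v : Tens 1 r) :
    opWeb (wMerge r L (h + k) l R * wMerge r L h k (l :: R)) (st K v) =
      opWeb (wMerge r L h (k + l) R * wMerge r (L ++ [h]) k l R) (st K v) := by
  refine model_rel (L := L ++ [h, k, l] ++ R) ((kills_wMerge _ _ _ _).mul_left _ |>.congr (by simp))
    ((kills_wMerge _ _ _ _).mul_left _ |>.congr (by simp)) ?_ K hK v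
  intro B hd hs hB v
  obtain ⟨B₁, X, B₂, rfl, h₁, hX, h₂⟩ := exists_split3 hB
  simp only [List.map_eq_cons_iff, List.map_eq_nil_iff] at hX
  obtain ⟨A, _, rfl, hA, A', _, rfl, hA', A'', _, rfl, hA'', rfl⟩ := hX
  have hd' := ((List.pairwise_append.1 (List.pairwise_append.1 hd).1).2).1
  simp only [List.pairwise_cons, List.mem_cons, List.not_mem_nil, or_false, forall_eq_or_imp,
    forall_eq] at hd'
  simp only [List.sum_append, List.sum_cons, List.sum_nil] at hs
  rw [map_mul, Module.End.mul_apply, opWeb_wMerge (B₁ := B₁) (A := A) (A' := A')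
    (B₂ := A'' :: B₂) v (by simp) h₁ hA hA' (by simp [h₂, hA'']) (by simp; omega),
    opWeb_wMerge (B₁ := B₁) (A := A ∪ A') (A' := A'') (B₂ := B₂) v rfl h₁
      (by rw [Finset.card_union_of_disjoint hd'.1.1, hA, hA']) hA'' h₂ (by simp; omega),
    map_mul, Module.End.mul_apply, opWeb_wMerge (B₁ := B₁ ++ [A]) (A := A') (A' := A'')
    (B₂ := B₂) v (by simp) (by simp [h₁, hA]) hA' hA'' h₂ (by simp; omega),
    opWeb_wMerge (B₁ := B₁) (A := A) (A' := A' ∪ A'') (B₂ := B₂) v (by simp) h₁ hA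
      (by rw [Finset.card_union_of_disjoint hd'.2.1, hA', hA'']) h₂ (by simp; omega),
    Finset.union_assoc]

/-- Both sides sum over the ordered ways to cut `A` into blocks of sizes `h`, `k`, `l`. The left
side chooses the last block `T` and then the middle block `U`; the right side chooses `T ∪ U` and
then `T`. -/
theorem model_split_assoc (L R : List ℕ) (h k l : ℕ) (K : List (Finset (Fin r))) (hK : Good K)
    (v : Tens 1 r) :
    opWeb (wSplit r L h k (l :: R) * wSplit r L (h + k) l R) (st K v) =
      opWeb (wSplit r (L ++ [h]) k l R * wSplit r L h (k + l) R) (st K v) := by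
  refine model_rel (L := L ++ [h + k + l] ++ R)
    ((kills_wSplit _ _ _ _).mul_left _ |>.congr (by simp))
    ((kills_wSplit _ _ _ _).mul_left _ |>.congr (by simp [add_assoc])) ?_ K hK v
  intro B hd hs hB v
  obtain ⟨B₁, X, B₂, rfl, h₁, hX, h₂⟩ := exists_split3 hB
  simp only [List.map_eq_cons_iff, List.map_eq_nil_iff] at hX
  obtain ⟨A, _, rfl, hA, rfl⟩ := hX
  simp only [List.sum_append, List.sum_cons, List.sum_nil] at hs
  have e1 : opWeb (wSplit r L h k (l :: R) * wSplit r L (h + k) l R) (st (B₁ ++ [A] ++ B₂) v) =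
      ∑ T ∈ A.powersetCard l, ∑ U ∈ (A \ T).powersetCard k,
        st (B₁ ++ ((A \ T) \ U) :: U :: T :: B₂) v := by
    rw [map_mul, Module.End.mul_apply, opWeb_wSplit (B₁ := B₁) (A := A) (B₂ := B₂) v (by simp) h₁
      hA h₂ (by simp; omega), map_sum]
    refine Finset.sum_congr rfl fun T hT => ?_
    rw [Finset.mem_powersetCard] at hT
    exact opWeb_wSplit (B₁ := B₁) (B₂ := T :: B₂) v rfl h₁
      (by rw [Finset.card_sdiff_of_subset hT.1]; omega) (by simp [h₂, hT.2]) (by simp; omega)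
  have e2 : opWeb (wSplit r (L ++ [h]) k l R * wSplit r L h (k + l) R) (st (B₁ ++ [A] ++ B₂) v) =
      ∑ S ∈ A.powersetCard (k + l), ∑ T ∈ S.powersetCard l,
        st (B₁ ++ (A \ S) :: (S \ T) :: T :: B₂) v := by
    rw [map_mul, Module.End.mul_apply, opWeb_wSplit (B₁ := B₁) (A := A) (B₂ := B₂) v (by simp) h₁
      (by omega) h₂ (by simp; omega), map_sum]
    refine Finset.sum_congr rfl fun S hS => ?_
    rw [Finset.mem_powersetCard] at hS
    rw [opWeb_wSplit (B₁ := B₁ ++ [A \ S]) (A := S) (B₂ := B₂) v (by simp)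
      (by simp [h₁]; rw [Finset.card_sdiff_of_subset hS.1]; omega) hS.2 h₂ (by simp; omega)]
    simp
  rw [e1, e2, Finset.sum_sigma', Finset.sum_sigma']
  refine Finset.sum_bij' (fun x _ => ⟨x.1 ∪ x.2, x.1⟩) (fun x _ => ⟨x.2, x.1 \ x.2⟩) ?_ ?_ ?_ ?_ ?_
  · rintro ⟨T, U⟩ h
    simp only [Finset.mem_sigma, Finset.mem_powersetCard, Finset.subset_sdiff] at h ⊢
    refine ⟨⟨Finset.union_subset h.1.1 h.2.1.1, ?_⟩, Finset.subset_union_left, h.1.2⟩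
    rw [Finset.card_union_of_disjoint h.2.1.2.symm]; omega
  · rintro ⟨S, T⟩ h
    simp only [Finset.mem_sigma, Finset.mem_powersetCard] at h ⊢
    refine ⟨⟨h.2.1.trans h.1.1, h.2.2⟩, Finset.sdiff_subset_sdiff h.1.1 le_rfl, ?_⟩
    rw [Finset.card_sdiff_of_subset h.2.1]; omega
  · rintro ⟨T, U⟩ h
    simp only [Finset.mem_sigma, Finset.mem_powersetCard, Finset.subset_sdiff] at h
    simp [Finset.union_sdiff_cancel_left h.2.1.2.symm]
  · rintro ⟨S, T⟩ h
    simp only [Finset.mem_sigma, Finset.mem_powersetCard] at h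
    simp [Finset.union_sdiff_of_subset h.2.1]
  · rintro ⟨T, U⟩ h
    simp only [Finset.mem_sigma, Finset.mem_powersetCard, Finset.subset_sdiff] at h
    simp only [sdiff_sdiff, Finset.union_sdiff_cancel_left h.2.1.2.symm]
    rfl

theorem model_explosion (L R : List ℕ) (k l : ℕ) (K : List (Finset (Fin r))) (hK : Good K)
    (v : Tens 1 r) :
    opWeb (wMerge r L k l R * wSplit r L k l R) (st K v) =
      opWeb (((k + l).choose l : ℂ) • wOne r (L ++ (k + l) :: R)) (st K v) := by
  refine model_rel (L := L ++ [k + l] ++ R) ((kills_wSplit _ _ _ _).mul_left _ |>.congr (by simp))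
    ((kills_wOne _).smul _ |>.congr (by simp)) ?_ K hK v
  intro B hd hs hB v
  obtain ⟨B₁, X, B₂, rfl, h₁, hX, h₂⟩ := exists_split3 hB
  simp only [List.map_eq_cons_iff, List.map_eq_nil_iff] at hX
  obtain ⟨A, _, rfl, hA, rfl⟩ := hX
  simp only [List.sum_append, List.sum_cons, List.sum_nil] at hs
  rw [map_mul, Module.End.mul_apply, opWeb_wSplit (B₁ := B₁) (A := A) (B₂ := B₂) v (by simp) h₁
    hA h₂ (by simp; omega), map_sum, map_smul, LinearMap.smul_apply,
    opWeb_wOne _ _ _ (by subst h₁ h₂; simp [HasType, hA]) (by simp; omega)]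
  -- Every summand of the split merges back to `A`, so the binomial coefficient counts the summands.
  have : ∀ T ∈ A.powersetCard l, opWeb (wMerge r L k l R) (st (B₁ ++ (A \ T) :: T :: B₂) v) =
      st (B₁ ++ [A] ++ B₂) v := by
    intro T hT
    rw [Finset.mem_powersetCard] at hT
    rw [opWeb_wMerge v rfl h₁ (by rw [Finset.card_sdiff_of_subset hT.1]; omega) hT.2 h₂
      (by simp; omega), Finset.sdiff_union_of_subset hT.1]
    simp
  rw [Finset.sum_congr rfl this, Finset.sum_const, Finset.card_powersetCard, hA,
    ← Nat.cast_smul_eq_nsmul ℂ]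

theorem model_dot_sq (L R : List ℕ) (k : ℕ) (K : List (Finset (Fin r))) (hK : Good K)
    (v : Tens 1 r) :
    opWeb (wDot r L k R * wDot r L k R) (st K v) =
      opWeb ((k : ℂ) • wOne r (L ++ k :: R)) (st K v) := by
  refine model_rel (L := L ++ [k] ++ R) ((kills_wDot _ _ _).mul_left _ |>.congr (by simp))
    ((kills_wOne _).smul _ |>.congr (by simp)) ?_ K hK v
  intro B hd hs hB v
  obtain ⟨B₁, X, B₂, rfl, h₁, hX, h₂⟩ := exists_split3 hB
  simp only [List.map_eq_cons_iff, List.map_eq_nil_iff] at hX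
  obtain ⟨A, _, rfl, hA, rfl⟩ := hX
  simp only [List.sum_append, List.sum_cons, List.sum_nil] at hs
  rw [map_mul, Module.End.mul_apply, opWeb_wDot v (B₁ := B₁) (A := A) (B₂ := B₂) (by simp) h₁
    hA h₂ (by simp; omega), opWeb_wDot _ (B₁ := B₁) (A := A) (B₂ := B₂) (by simp) h₁
    hA h₂ (by simp; omega), map_smul, LinearMap.smul_apply,
    opWeb_wOne _ _ _ (by subst h₁ h₂; simp [HasType, hA]) (by simp; omega), clif_sum_sq, hA,
    map_smul]

/-- The sum of Clifford generators over a disjoint union is the sum of the two sums. No thickness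
has to be `1` here, so both defining relations for merges are instances. -/
theorem model_dot_merge (L R : List ℕ) (k l : ℕ) (K : List (Finset (Fin r))) (hK : Good K)
    (v : Tens 1 r) :
    opWeb (wDot r L (k + l) R * wMerge r L k l R) (st K v) =
      opWeb (wMerge r L k l R * wDot r L k (l :: R) + wMerge r L k l R * wDot r (L ++ [k]) l R)
        (st K v) := by
  refine model_rel (L := L ++ [k, l] ++ R) ((kills_wMerge _ _ _ _).mul_left _ |>.congr (by simp))
    (((kills_wDot _ _ _).mul_left _ |>.congr (by simp)).add
      ((kills_wDot _ _ _).mul_left _ |>.congr (by simp))) ?_ K hK v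
  intro B hd hs hB v
  obtain ⟨B₁, X, B₂, rfl, h₁, hX, h₂⟩ := exists_split3 hB
  simp only [List.map_eq_cons_iff, List.map_eq_nil_iff] at hX
  obtain ⟨A, _, rfl, hA, A', _, rfl, hA', rfl⟩ := hX
  have hd' := ((List.pairwise_append.1 (List.pairwise_append.1 hd).1).2).1
  simp only [List.pairwise_cons, List.mem_cons, List.not_mem_nil, or_false, forall_eq] at hd'
  simp only [List.sum_append, List.sum_cons, List.sum_nil] at hs
  rw [map_add, map_mul, map_mul, map_mul, LinearMap.add_apply, Module.End.mul_apply,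
    Module.End.mul_apply, Module.End.mul_apply,
    opWeb_wMerge (B₁ := B₁) (A := A) (A' := A') (B₂ := B₂) v (by simp) h₁ hA hA' h₂
      (by simp; omega),
    opWeb_wDot (B₁ := B₁) (A := A ∪ A') (B₂ := B₂) v (by simp) h₁
      (by rw [Finset.card_union_of_disjoint hd'.1, hA, hA']) h₂ (by simp; omega),
    opWeb_wDot (B₁ := B₁) (A := A) (B₂ := A' :: B₂) v (by simp) h₁ hA (by simp [hA', h₂])
      (by simp; omega),
    opWeb_wDot (B₁ := B₁ ++ [A]) (A := A') (B₂ := B₂) v (by simp) (by simp [h₁, hA]) hA' h₂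
      (by simp; omega),
    opWeb_wMerge (B₁ := B₁) (A := A) (A' := A') (B₂ := B₂) _ (by simp) h₁ hA hA' h₂
      (by simp; omega),
    opWeb_wMerge (B₁ := B₁) (A := A) (A' := A') (B₂ := B₂) _ (by simp) h₁ hA hA' h₂
      (by simp; omega), ← map_add, Finset.sum_union hd'.1]

theorem model_dot_split (L R : List ℕ) (k l : ℕ) (K : List (Finset (Fin r))) (hK : Good K)
    (v : Tens 1 r) :
    opWeb (wSplit r L k l R * wDot r L (k + l) R) (st K v) =
      opWeb (wDot r L k (l :: R) * wSplit r L k l R + wDot r (L ++ [k]) l R * wSplit r L k l R)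
        (st K v) := by
  refine model_rel (L := L ++ [k + l] ++ R) ((kills_wDot _ _ _).mul_left _ |>.congr (by simp))
    (((kills_wSplit _ _ _ _).mul_left _ |>.congr (by simp)).add
      ((kills_wSplit _ _ _ _).mul_left _ |>.congr (by simp))) ?_ K hK v
  intro B hd hs hB v
  obtain ⟨B₁, X, B₂, rfl, h₁, hX, h₂⟩ := exists_split3 hB
  simp only [List.map_eq_cons_iff, List.map_eq_nil_iff] at hX
  obtain ⟨A, _, rfl, hA, rfl⟩ := hX
  simp only [List.sum_append, List.sum_cons, List.sum_nil] at hs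
  rw [map_add, map_mul, map_mul, map_mul, LinearMap.add_apply, Module.End.mul_apply,
    Module.End.mul_apply, Module.End.mul_apply,
    opWeb_wDot (B₁ := B₁) (A := A) (B₂ := B₂) v (by simp) h₁ hA h₂ (by simp; omega),
    opWeb_wSplit (B₁ := B₁) (A := A) (B₂ := B₂) _ (by simp) h₁ hA h₂ (by simp; omega),
    opWeb_wSplit (B₁ := B₁) (A := A) (B₂ := B₂) v (by simp) h₁ hA h₂ (by simp; omega),
    map_sum, map_sum, ← Finset.sum_add_distrib]
  refine Finset.sum_congr rfl fun T hT => ?_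
  rw [Finset.mem_powersetCard] at hT
  have hc : (A \ T).card = k := by rw [Finset.card_sdiff_of_subset hT.1]; omega
  rw [opWeb_wDot (B₁ := B₁) (A := A \ T) (B₂ := T :: B₂) v (by simp) h₁ hc (by simp [hT.2, h₂])
      (by simp; omega),
    opWeb_wDot (B₁ := B₁ ++ [A \ T]) (A := T) (B₂ := B₂) v (by simp) (by simp [h₁, hc]) hT.2 h₂
      (by simp; omega), ← map_add, Finset.sum_sdiff hT.1]

/-- On blocks `{p}`, `{q}` the web `X` is the identity plus the exchange of the blocks. Conjugation
by the two dots multiplies the identity part by `clif p clif q clif p clif q = -1` and the exchange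
by `clif q clif p clif p clif q = 1`. In the difference the exchange cancels and the identity is
doubled. -/
theorem model_dumbbell (L R : List ℕ) (K : List (Finset (Fin r))) (hK : Good K)
    (v : Tens 1 r) :
    opWeb (wSplit r L 1 1 R * wMerge r L 1 1 R -
          wDot r L 1 (1 :: R) * wDot r (L ++ [1]) 1 R * (wSplit r L 1 1 R * wMerge r L 1 1 R) *
            (wDot r L 1 (1 :: R) * wDot r (L ++ [1]) 1 R)) (st K v) =
      opWeb ((2 : ℂ) • wOne r (L ++ 1 :: 1 :: R)) (st K v) := by
  refine model_rel (L := L ++ [1, 1] ++ R)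
    (((kills_wMerge _ _ _ _).mul_left _ |>.congr (by simp)).sub
      ((((kills_wDot _ _ _).mul_left _).mul_left _).congr (by simp)))
    ((kills_wOne _).smul _ |>.congr (by simp)) ?_ K hK v
  intro B hd hs hB v
  obtain ⟨B₁, X, B₂, rfl, h₁, hX, h₂⟩ := exists_split3 hB
  simp only [List.map_eq_cons_iff, List.map_eq_nil_iff] at hX
  obtain ⟨A, _, rfl, hA, A', _, rfl, hA', rfl⟩ := hX
  have hd' := ((List.pairwise_append.1 (List.pairwise_append.1 hd).1).2).1
  simp only [List.pairwise_cons, List.mem_cons, List.not_mem_nil, or_false, forall_eq] at hd'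
  simp only [List.sum_append, List.sum_cons, List.sum_nil] at hs
  obtain ⟨p, rfl⟩ := Finset.card_eq_one.1 hA
  obtain ⟨q, rfl⟩ := Finset.card_eq_one.1 hA'
  have hpq : p ≠ q := by simpa using hd'.1
  have hS : (L ++ 1 :: 1 :: R).sum = r := by simp; omega
  have D : ∀ (p q : Fin r) (v : Tens 1 r),
      opWeb (wDot r L 1 (1 :: R)) (opWeb (wDot r (L ++ [1]) 1 R) (st (B₁ ++ {p} :: {q} :: B₂) v)) =
        st (B₁ ++ {p} :: {q} :: B₂) (clif p (clif q v)) := by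
    intro p q v
    rw [opWeb_wDot (B₁ := B₁ ++ [{p}]) (A := {q}) (B₂ := B₂) v (by simp) (by simp [h₁]) (by simp)
      h₂ (by simpa using hS), opWeb_wDot (B₁ := B₁) (A := {p}) (B₂ := {q} :: B₂) _ (by simp) h₁
      (by simp) (by simp [h₂]) (by simpa using hS)]
    simp
  have X : ∀ (v : Tens 1 r),
      opWeb (wSplit r L 1 1 R) (opWeb (wMerge r L 1 1 R) (st (B₁ ++ {p} :: {q} :: B₂) v)) =
        st (B₁ ++ {p} :: {q} :: B₂) v + st (B₁ ++ {q} :: {p} :: B₂) v := by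
    intro v
    rw [opWeb_wMerge (B₁ := B₁) (A := {p}) (A' := {q}) (B₂ := B₂) v (by simp) h₁ (by simp)
      (by simp) h₂ hS, opWeb_wSplit' (B₁ := B₁) (A := {p} ∪ {q}) (B₂ := B₂) v (by simp) h₁
      (by rw [Finset.card_union_of_disjoint hd'.1]; simp) h₂ (by simp; omega),
      Finset.powersetCard_one, Finset.sum_map, Finset.sum_union hd'.1]
    have e1 : ({p} ∪ {q} : Finset (Fin r)) \ {p} = {q} := by
      rw [Finset.union_sdiff_cancel_left hd'.1]
    have e2 : ({p} ∪ {q} : Finset (Fin r)) \ {q} = {p} := by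
      rw [Finset.union_sdiff_cancel_right hd'.1]
    simp only [Finset.sum_singleton, Function.Embedding.coeFn_mk, e1, e2]
  have sq : ∀ (p : Fin r) (v : Tens 1 r), clif p (clif p v) = v :=
    fun p v => congrArg (fun T => T v) (clif_sq p)
  have anti : ∀ v : Tens 1 r, clif q (clif p v) = -clif p (clif q v) :=
    fun v => congrArg (fun T => T v) (clif_anti hpq.symm)
  have e : B₁ ++ [{p}, {q}] ++ B₂ = B₁ ++ {p} :: {q} :: B₂ := by simp
  simp only [e, map_sub, map_mul, LinearMap.sub_apply, Module.End.mul_apply, D, X, map_add,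
    map_smul, LinearMap.smul_apply]
  rw [opWeb_wOne _ _ _ (by subst h₁ h₂; simp [HasType]) hS]
  simp only [sq, anti, map_neg]
  module

end TypeQ

end


noncomputable section

namespace TypeQ

variable {r n : ℕ}

/-! ### Ladders -/

/-- The places of the tensorands labelled by `k`. -/
def fib (J : Mono n r) (k : Fin n) : Finset (Fin r) := Finset.univ.filter fun p => (J p).1 = k

/-- The parities of a monomial. -/
def parMono (J : Mono n r) : Mono 1 r := fun p => (0, (J p).2)

/-- A monomial, read as the list of the fibres of some of the labels, between fixed blocks. -/
def window (B₁ : List (Finset (Fin r))) (ks : List (Fin n)) (B₂ : List (Finset (Fin r))) :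
    Tens n r →ₗ[ℂ] BlockSpace r :=
  Finsupp.linearCombination ℂ fun J : Mono n r =>
    st (B₁ ++ ks.map (fib J) ++ B₂) (mono (parMono J))

theorem window_mono (B₁ : List (Finset (Fin r))) (ks : List (Fin n)) (B₂ : List (Finset (Fin r)))
    (J : Mono n r) : window B₁ ks B₂ (mono J) = st (B₁ ++ ks.map (fib J) ++ B₂) (mono (parMono J)) :=
  (Finsupp.linearCombination_single ℂ 1 J).trans (one_smul ℂ _)

theorem card_fib (J : Mono n r) (k : Fin n) : (fib J k).card = wt J k := rfl

theorem fib_update_self (J : Mono n r) (p : Fin r) (a : Fin n) (x : ZMod 2) :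
    fib (Function.update J p (a, x)) a = insert p (fib J a) := by
  ext q
  by_cases h : q = p
  · subst h; simp [fib]
  · simp [fib, h]

theorem fib_update_ne (J : Mono n r) (p : Fin r) {a c : Fin n} (x : ZMod 2) (h : c ≠ a) :
    fib (Function.update J p (a, x)) c = (fib J c).erase p := by
  ext q
  by_cases hq : q = p
  · subst hq; simp [fib, h.symm]
  · simp [fib, hq]

/-- Signs and parities do not depend on the labels. Hence the Clifford generator at `p`, acting on
the parities alone, reproduces the coefficient of the operator which also relabels the place `p`. -/
theorem opAt_parMono (J : Mono n r) (p : Fin r) (a : Fin n) (d : ZMod 2) :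
    opAt 0 0 d p (mono (parMono J)) =
      ksign d (prePar J p) • mono (parMono (Function.update J p (a, (J p).2 + d))) := by
  have h1 : prePar (parMono J) p = prePar J p := rfl
  have h2 : parMono (Function.update J p (a, (J p).2 + d)) =
      Function.update (parMono J) p (0, (parMono J p).2 + d) := by
    funext q
    by_cases h : q = p
    · subst h; simp [parMono]
    · simp [parMono, h]
  rw [h2, ← h1]
  simp [opAt, parMono]

/-- The parity of a rung. -/
def bpar (d : Bool) : ZMod 2 := if d then 1 else 0

section

variable {B₁ B₂ B : List (Finset (Fin r))} {A A' : Finset (Fin r)} {L R : List ℕ} {k l : ℕ}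

/-- A rung of thickness `1` carries one place `p` across; a dot on it contributes the Clifford
generator at `p`, uniformly expressed by `opAt 0 0 (bpar d) p`. -/
theorem opWeb_rungL (d : Bool) (hB : B = B₁ ++ A :: A' :: B₂) (h₁ : B₁.map Finset.card = L)
    (hA : A.card = k) (hA' : A'.card = l + 1) (h₂ : B₂.map Finset.card = R)
    (hs : (L ++ k :: (l + 1) :: R).sum = r) (v : Tens 1 r) :
    opWeb (rungL r L k l R d) (st B v) =
      ∑ p ∈ A', st (B₁ ++ insert p A :: A'.erase p :: B₂) (opAt 0 0 (bpar d) p v) := by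
  simp only [List.sum_append, List.sum_cons] at hs
  rw [rungL, map_mul, Module.End.mul_apply,
    opWeb_wSplit' (B₁ := B₁ ++ [A]) (A := A') (B₂ := B₂) v (by simp [hB]) (by simp [h₁, hA])
      (by omega) h₂ (by simp; omega), Finset.powersetCard_one, Finset.sum_map, map_sum]
  refine Finset.sum_congr rfl fun p hp => ?_
  have hc : (A'.erase p).card = l := by rw [Finset.card_erase_of_mem hp]; omega
  have hm : ∀ v : Tens 1 r, opWeb (wMerge r L k 1 (l :: R))
      (st (B₁ ++ [A] ++ {p} :: (A'.erase p) :: B₂) v) =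
        st (B₁ ++ insert p A :: A'.erase p :: B₂) v := by
    intro v
    rw [opWeb_wMerge (B₁ := B₁) (A := A) (A' := {p}) (B₂ := A'.erase p :: B₂) v (by simp) h₁ hA
      (by simp) (by simp [hc, h₂]) (by simp; omega), Finset.union_singleton]
  simp only [Function.Embedding.coeFn_mk, Finset.sdiff_singleton_eq_erase]
  cases d
  · simp only [Bool.false_eq_true, if_false, mul_one, bpar, hm, opAt_one_zero]
    rfl
  · simp only [if_true, map_mul, bpar, Module.End.mul_apply]
    rw [opWeb_wDot (B₁ := B₁ ++ [A]) (A := {p}) (B₂ := A'.erase p :: B₂) v (by simp)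
      (by simp [h₁, hA]) (by simp) (by simp [hc, h₂]) (by simp; omega), hm, Finset.sum_singleton]
    rfl

theorem opWeb_rungR (d : Bool) (hB : B = B₁ ++ A :: A' :: B₂) (h₁ : B₁.map Finset.card = L)
    (hA : A.card = k + 1) (hA' : A'.card = l) (h₂ : B₂.map Finset.card = R)
    (hs : (L ++ (k + 1) :: l :: R).sum = r) (v : Tens 1 r) :
    opWeb (rungR r L k l R d) (st B v) =
      ∑ p ∈ A, st (B₁ ++ A.erase p :: insert p A' :: B₂) (opAt 0 0 (bpar d) p v) := by
  simp only [List.sum_append, List.sum_cons] at hs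
  rw [rungR, map_mul, Module.End.mul_apply,
    opWeb_wSplit (B₁ := B₁) (A := A) (B₂ := A' :: B₂) v (by simp [hB]) h₁
      (by omega) (by simp [h₂, hA']) (by simp; omega), Finset.powersetCard_one, Finset.sum_map,
    map_sum]
  refine Finset.sum_congr rfl fun p hp => ?_
  have hc : (A.erase p).card = k := by rw [Finset.card_erase_of_mem hp]; omega
  have hm : ∀ v : Tens 1 r, opWeb (wMerge r (L ++ [k]) 1 l R)
      (st (B₁ ++ (A.erase p) :: {p} :: A' :: B₂) v) =
        st (B₁ ++ A.erase p :: insert p A' :: B₂) v := by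
    intro v
    rw [opWeb_wMerge (B₁ := B₁ ++ [A.erase p]) (A := {p}) (A' := A') (B₂ := B₂) v (by simp)
      (by simp [h₁, hc]) (by simp) hA' h₂ (by simp; omega), Finset.singleton_union]
    simp
  simp only [Function.Embedding.coeFn_mk, Finset.sdiff_singleton_eq_erase]
  cases d
  · simp only [Bool.false_eq_true, if_false, mul_one, bpar, hm, opAt_one_zero]
    rfl
  · simp only [if_true, map_mul, bpar, Module.End.mul_apply]
    rw [opWeb_wDot (B₁ := B₁ ++ [A.erase p]) (A := {p}) (B₂ := A' :: B₂) v (by simp)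
      (by simp [h₁, hc]) (by simp) (by simp [hA', h₂]) (by simp; omega), hm, Finset.sum_singleton]
    rfl

theorem disjoint_fib (J : Mono n r) {a b : Fin n} (h : a ≠ b) : Disjoint (fib J a) (fib J b) := by
  rw [Finset.disjoint_left]
  intro p hp hp'
  simp only [fib, Finset.mem_filter, Finset.mem_univ, true_and] at hp hp'
  exact h (hp.symm.trans hp')

theorem map_fib_update (J : Mono n r) (p : Fin r) {a b : Fin n} (x : ZMod 2) (hp : (J p).1 = b)
    {ks : List (Fin n)} (ha : a ∉ ks) (hb : b ∉ ks) :
    ks.map (fib (Function.update J p (a, x))) = ks.map (fib J) := by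
  refine List.map_congr_left fun c hc => ?_
  rw [fib_update_ne _ _ _ (by rintro rfl; exact ha hc), Finset.erase_eq_of_notMem]
  simp only [fib, Finset.mem_filter, Finset.mem_univ, true_and, hp]
  rintro rfl
  exact hb hc

/-- Carrying a place from the block of `b` to the block of `a` is relabelling it from `b` to `a`.
This identifies rungs with the operators `opD` and turns the ladder relations into brackets of such
operators. -/
theorem window_rungL (d : Bool) (k₁ k₂ : List (Fin n)) (a b : Fin n) (J : Mono n r)
    (hk : (k₁ ++ a :: b :: k₂).Nodup)
    (h₁ : B₁.map Finset.card ++ k₁.map (wt J) = L) (ha : wt J a = k) (hb : wt J b = l + 1)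
    (h₂ : k₂.map (wt J) ++ B₂.map Finset.card = R) (hs : (L ++ k :: (l + 1) :: R).sum = r) :
    opWeb (rungL r L k l R d) (window B₁ (k₁ ++ a :: b :: k₂) B₂ (mono J)) =
      window B₁ (k₁ ++ a :: b :: k₂) B₂ (opD a b (bpar d) (mono J)) := by
  rw [List.nodup_append] at hk
  obtain ⟨-, hk2, hk3⟩ := hk
  simp only [List.nodup_cons, List.mem_cons, not_or] at hk2
  have ha1 : a ∉ k₁ := fun h => hk3 a h a (by simp) rfl
  have hb1 : b ∉ k₁ := fun h => hk3 b h b (by simp) rfl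
  rw [window_mono, opWeb_rungL (B₁ := B₁ ++ k₁.map (fib J)) (A := fib J a) (A' := fib J b)
    (B₂ := k₂.map (fib J) ++ B₂) d (by simp) (by rw [← h₁]; simp [Function.comp_def, card_fib])
    ha hb (by rw [← h₂]; simp [Function.comp_def, card_fib]) hs,
    opD_mono, map_sum, fib, Finset.sum_filter]
  refine Finset.sum_congr rfl fun p _ => ?_
  split_ifs with hp
  · rw [map_smul, window_mono, opAt_parMono J p a, map_smul]
    congr 3
    simp only [List.map_append, List.map_cons, map_fib_update J p _ hp ha1 hb1,
      map_fib_update J p _ hp hk2.1.2 hk2.2.1, fib_update_self, fib_update_ne J p _ (Ne.symm hk2.1.1)]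
    simp [fib]
  · simp

theorem window_rungR (d : Bool) (k₁ k₂ : List (Fin n)) (a b : Fin n) (J : Mono n r)
    (hk : (k₁ ++ a :: b :: k₂).Nodup)
    (h₁ : B₁.map Finset.card ++ k₁.map (wt J) = L) (ha : wt J a = k + 1) (hb : wt J b = l)
    (h₂ : k₂.map (wt J) ++ B₂.map Finset.card = R) (hs : (L ++ (k + 1) :: l :: R).sum = r) :
    opWeb (rungR r L k l R d) (window B₁ (k₁ ++ a :: b :: k₂) B₂ (mono J)) =
      window B₁ (k₁ ++ a :: b :: k₂) B₂ (opD b a (bpar d) (mono J)) := by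
  rw [List.nodup_append] at hk
  obtain ⟨-, hk2, hk3⟩ := hk
  simp only [List.nodup_cons, List.mem_cons, not_or] at hk2
  have ha1 : a ∉ k₁ := fun h => hk3 a h a (by simp) rfl
  have hb1 : b ∉ k₁ := fun h => hk3 b h b (by simp) rfl
  rw [window_mono, opWeb_rungR (B₁ := B₁ ++ k₁.map (fib J)) (A := fib J a) (A' := fib J b)
    (B₂ := k₂.map (fib J) ++ B₂) d (by simp) (by rw [← h₁]; simp [Function.comp_def, card_fib])
    ha hb (by rw [← h₂]; simp [Function.comp_def, card_fib]) hs,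
    opD_mono, map_sum, fib, Finset.sum_filter]
  refine Finset.sum_congr rfl fun p _ => ?_
  split_ifs with hp
  · rw [map_smul, window_mono, opAt_parMono J p b, map_smul]
    congr 3
    simp only [List.map_append, List.map_cons, map_fib_update J p _ hp hb1 ha1,
      map_fib_update J p _ hp hk2.2.1 hk2.1.2, fib_update_self, fib_update_ne J p _ hk2.1.1]
    simp [fib]
  · simp

/-- After a first ladder a second one meets a sum of monomials, all with the weight recorded in `h`.
It is enough to know its effect on monomials of that weight. -/
theorem window_opD {x : FreeAlgebra ℂ (WebGen r)} {ks : List (Fin n)}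
    (T : Module.End ℂ (Tens n r)) (a b : Fin n) (d : ZMod 2) (J : Mono n r)
    (h : ∀ J' : Mono n r, (∀ k : Fin n, wt J' k + (if b = k then 1 else 0) =
      wt J k + if a = k then 1 else 0) →
      opWeb x (window B₁ ks B₂ (mono J')) = window B₁ ks B₂ (T (mono J'))) :
    opWeb x (window B₁ ks B₂ (opD a b d (mono J))) =
      window B₁ ks B₂ (T (opD a b d (mono J))) := by
  simp only [opD_mono, map_sum]
  refine Finset.sum_congr rfl fun p _ => ?_
  split_ifs with hp
  · simp only [map_smul]
    rw [h]
    intro k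
    rw [← wt_update J p a _ k, hp]
  · simp

end

/-- Three disjoint blocks are the fibres of a monomial. -/
theorem exists_mono {A A' A'' : Finset (Fin r)} (h : Disjoint A A') (h' : Disjoint A A'')
    (h'' : Disjoint A' A'') (I : Mono 1 r) : ∃ J : Mono 4 r, fib J 0 = A ∧ fib J 1 = A' ∧
      fib J 2 = A'' ∧ parMono J = I := by
  classical
  rw [Finset.disjoint_left] at h h' h''
  -- The letters `0`, `1`, `2` label the three blocks, and `3` labels all remaining places.
  refine ⟨fun p => (if p ∈ A then 0 else if p ∈ A' then 1 else if p ∈ A'' then 2 else 3, (I p).2),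
    ?_, ?_, ?_, ?_⟩
  · ext p; simp only [fib, Finset.mem_filter, Finset.mem_univ, true_and]
    split_ifs <;> simp_all
  · ext p; simp only [fib, Finset.mem_filter, Finset.mem_univ, true_and]
    split_ifs <;> simp_all
  · ext p; simp only [fib, Finset.mem_filter, Finset.mem_univ, true_and]
    split_ifs <;> simp_all
  · funext p
    exact Prod.ext (Subsingleton.elim _ _) rfl

theorem st_ext {E : Type} [AddCommGroup E] [Module ℂ E] {B : List (Finset (Fin r))}
    {F G : BlockSpace r →ₗ[ℂ] E} (h : ∀ I : Mono 1 r, F (st B (mono I)) = G (st B (mono I)))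
    (v : Tens 1 r) : F (st B v) = G (st B v) := by
  have : F ∘ₗ st B = G ∘ₗ st B := by
    apply Finsupp.lhom_ext'
    intro I
    apply LinearMap.ext_ring
    exact h I
  exact congrArg (fun T => T v) this

/-- `model_rel` for relations on two strands: the two blocks are read as the fibres of the letters
`0` and `1` of a monomial, so that `window` applies. -/
theorem model_rel_two {x y : FreeAlgebra ℂ (WebGen r)} {L R : List ℕ} {k l : ℕ}
    (hx : Kills x (L ++ k :: l :: R)) (hy : Kills y (L ++ k :: l :: R))
    (h : ∀ (B₁ B₂ : List (Finset (Fin r))) (J : Mono 4 r), (L ++ k :: l :: R).sum = r →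
      B₁.map Finset.card = L → B₂.map Finset.card = R → wt J 0 = k → wt J 1 = l →
      opWeb x (window B₁ [0, 1] B₂ (mono J)) = opWeb y (window B₁ [0, 1] B₂ (mono J)))
    (K : List (Finset (Fin r))) (hK : Good K) (v : Tens 1 r) :
    opWeb x (st K v) = opWeb y (st K v) := by
  refine model_rel hx hy ?_ K hK v
  intro B hd hs hB v
  have e : L ++ k :: l :: R = L ++ [k, l] ++ R := by simp
  rw [e] at hB
  obtain ⟨B₁, X, B₂, rfl, h₁, hX, h₂⟩ := exists_split3 hB
  simp only [List.map_eq_cons_iff, List.map_eq_nil_iff] at hX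
  obtain ⟨A, _, rfl, hA, A', _, rfl, hA', rfl⟩ := hX
  have hd' := ((List.pairwise_append.1 (List.pairwise_append.1 hd).1).2).1
  simp only [List.pairwise_cons, List.mem_cons, List.not_mem_nil, or_false, forall_eq] at hd'
  refine st_ext (fun I => ?_) v
  obtain ⟨J, rfl, rfl, -, rfl⟩ := exists_mono hd'.1 (Finset.disjoint_empty_right _)
    (Finset.disjoint_empty_right _) I
  have := h B₁ B₂ J hs h₁ h₂ hA hA'
  simpa [window_mono] using this

theorem model_rel_three {x y : FreeAlgebra ℂ (WebGen r)} {L R : List ℕ} {k l m : ℕ}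
    (hx : Kills x (L ++ k :: l :: m :: R)) (hy : Kills y (L ++ k :: l :: m :: R))
    (h : ∀ (B₁ B₂ : List (Finset (Fin r))) (J : Mono 4 r), (L ++ k :: l :: m :: R).sum = r →
      B₁.map Finset.card = L → B₂.map Finset.card = R → wt J 0 = k → wt J 1 = l → wt J 2 = m →
      opWeb x (window B₁ [0, 1, 2] B₂ (mono J)) = opWeb y (window B₁ [0, 1, 2] B₂ (mono J)))
    (K : List (Finset (Fin r))) (hK : Good K) (v : Tens 1 r) :
    opWeb x (st K v) = opWeb y (st K v) := by
  refine model_rel hx hy ?_ K hK v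
  intro B hd hs hB v
  have e : L ++ k :: l :: m :: R = L ++ [k, l, m] ++ R := by simp
  rw [e] at hB
  obtain ⟨B₁, X, B₂, rfl, h₁, hX, h₂⟩ := exists_split3 hB
  simp only [List.map_eq_cons_iff, List.map_eq_nil_iff] at hX
  obtain ⟨A, _, rfl, hA, A', _, rfl, hA', A'', _, rfl, hA'', rfl⟩ := hX
  have hd' := ((List.pairwise_append.1 (List.pairwise_append.1 hd).1).2).1
  simp only [List.pairwise_cons, List.mem_cons, List.not_mem_nil, or_false, forall_eq_or_imp,
    forall_eq] at hd'
  refine st_ext (fun I => ?_) v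
  obtain ⟨J, rfl, rfl, rfl, rfl⟩ := exists_mono hd'.1.1 hd'.1.2 hd'.2.1 I
  have := h B₁ B₂ J hs h₁ h₂ hA hA' hA''
  simpa [window_mono] using this

/-- The commutator of the ladders on two strands. -/
theorem window_square (L R : List ℕ) (k l : ℕ) (d d' : Bool)
    {B₁ B₂ : List (Finset (Fin r))} (J : Mono 4 r) (hs : (L ++ (k + 1) :: (l + 1) :: R).sum = r)
    (h₁ : B₁.map Finset.card = L) (h₂ : B₂.map Finset.card = R) (hk : wt J 0 = k + 1)
    (hl : wt J 1 = l + 1) :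
    opWeb (rungL r L k (l + 1) R d * rungR r L k (l + 1) R d' -
        rungR r L (k + 1) l R d' * rungL r L (k + 1) l R d) (window B₁ [0, 1] B₂ (mono J)) =
      window B₁ [0, 1] B₂ ((opD 0 1 (bpar d) * opD 1 0 (bpar d') -
        opD 1 0 (bpar d') * opD 0 1 (bpar d) : Module.End ℂ (Tens 4 r)) (mono J)) := by
  simp only [List.sum_append, List.sum_cons] at hs
  rw [map_sub, map_mul, map_mul, LinearMap.sub_apply, Module.End.mul_apply, Module.End.mul_apply,
    LinearMap.sub_apply, Module.End.mul_apply, Module.End.mul_apply, map_sub]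
  have e1 := window_rungR (B₁ := B₁) (B₂ := B₂) (L := L) (R := R) d' [] [] 0 1 J (by decide)
    (by simp [h₁]) hk hl (by simp [h₂]) (by simp; omega)
  have e2 := window_rungL (B₁ := B₁) (B₂ := B₂) (L := L) (R := R) d [] [] 0 1 J (by decide)
    (by simp [h₁]) hk hl (by simp [h₂]) (by simp; omega)
  simp only [List.nil_append] at e1 e2
  rw [e1, e2]
  congr 1
  · refine window_opD _ _ _ _ _ fun J' hJ' => ?_
    have w0 := hJ' 0
    have w1 := hJ' 1
    simp at w0 w1
    exact window_rungL (B₁ := B₁) (B₂ := B₂) (L := L) (R := R) d [] [] 0 1 J' (by decide)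
      (by simp [h₁]) (by omega) (by omega) (by simp [h₂]) (by simp; omega)
  · refine window_opD _ _ _ _ _ fun J' hJ' => ?_
    have w0 := hJ' 0
    have w1 := hJ' 1
    simp at w0 w1
    exact window_rungR (B₁ := B₁) (B₂ := B₂) (L := L) (R := R) d' [] [] 0 1 J' (by decide)
      (by simp [h₁]) (by omega) (by omega) (by simp [h₂]) (by simp; omega)

theorem opD_same_mono (j : Fin n) (J : Mono n r) :
    opD j j 0 (mono J) = (wt J j : ℂ) • mono J := by
  have := congrArg (fun T => T (mono J)) (opD_diag j (wtW J))
  simpa [Module.End.mul_apply, opOne, wtW] using this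

theorem kills_square (L R : List ℕ) (k l : ℕ) (d d' : Bool) :
    Kills (rungL r L k (l + 1) R d * rungR r L k (l + 1) R d' -
        rungR r L (k + 1) l R d' * rungL r L (k + 1) l R d) (L ++ (k + 1) :: (l + 1) :: R) :=
  ((kills_rungR _ _ _ _ _).mul_left _).sub ((kills_rungL _ _ _ _ _).mul_left _)

theorem model_square_switch (L R : List ℕ) (k l : ℕ) (K : List (Finset (Fin r))) (hK : Good K)
    (v : Tens 1 r) :
    opWeb (rungL r L k (l + 1) R false * rungR r L k (l + 1) R false -
          rungR r L (k + 1) l R false * rungL r L (k + 1) l R false) (st K v) =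
      opWeb (((k + 1 : ℕ) - (l + 1 : ℕ) : ℂ) • wOne r (L ++ (k + 1) :: (l + 1) :: R)) (st K v) := by
  refine model_rel_two (kills_square _ _ _ _ _ _) ((kills_wOne _).smul _) ?_ K hK v
  intro B₁ B₂ J hs h₁ h₂ hk hl
  rw [window_square L R k l _ _ J hs h₁ h₂ hk hl]
  -- The bracket is `opD 0 0 0 - opD 1 1 0`, which acts by the difference of the two block sizes.
  have h := opD_bracket (r := r) (0 : Fin 4) 1 1 0 0 0
  simp only [if_true, ksign_zero_left, one_smul, add_zero] at h
  simp only [bpar, Bool.false_eq_true, if_false]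
  rw [h, LinearMap.sub_apply, opD_same_mono, opD_same_mono, hk, hl, ← sub_smul, map_smul, map_smul,
    LinearMap.smul_apply, window_mono, opWeb_wOne _ _ _ _ hs]
  subst h₁ h₂
  simp [HasType, card_fib, hk, hl]

theorem opWeb_window_dot {B₁ B₂ : List (Finset (Fin r))} {L R : List ℕ} {k : ℕ}
    (k₁ k₂ : List (Fin n)) (a : Fin n) (J : Mono n r)
    (h₁ : B₁.map Finset.card ++ k₁.map (wt J) = L) (ha : wt J a = k)
    (h₂ : k₂.map (wt J) ++ B₂.map Finset.card = R) (hs : (L ++ k :: R).sum = r) :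
    opWeb (wDot r L k R) (window B₁ (k₁ ++ a :: k₂) B₂ (mono J)) =
      window B₁ (k₁ ++ a :: k₂) B₂ (opD a a 1 (mono J)) := by
  rw [window_mono, opWeb_wDot (B₁ := B₁ ++ k₁.map (fib J)) (A := fib J a)
    (B₂ := k₂.map (fib J) ++ B₂) _ (by simp) (by rw [← h₁]; simp [Function.comp_def, card_fib])
    ha (by rw [← h₂]; simp [Function.comp_def, card_fib]) hs, opD_mono, map_sum, map_sum]
  rw [fib, Finset.sum_filter]
  refine Finset.sum_congr rfl fun p _ => ?_
  split_ifs with hp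
  · rw [map_smul, window_mono, clif, opAt_parMono J p a, map_smul]
    have : fib (Function.update J p (a, (J p).2 + 1)) = fib J := by
      funext c
      ext q
      by_cases h : q = p
      · subst h; simp [fib, hp]
      · simp [fib, h]
    simp [this]
  · simp

/-- By `hd` exactly one of the two kinds of rungs is dotted. The bracket is then the odd operator
`opD 0 0 1 - opD 1 1 1`, the difference of the dots on the two strands. -/
theorem model_square_switch_dots (L R : List ℕ) (k l : ℕ) (d d' : Bool) (hd : bpar d + bpar d' = 1)
    (K : List (Finset (Fin r))) (hK : Good K) (v : Tens 1 r) :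
    opWeb (rungL r L k (l + 1) R d * rungR r L k (l + 1) R d' -
          rungR r L (k + 1) l R d' * rungL r L (k + 1) l R d) (st K v) =
      opWeb (wDot r L (k + 1) ((l + 1) :: R) - wDot r (L ++ [k + 1]) (l + 1) R) (st K v) := by
  refine model_rel_two (kills_square _ _ _ _ _ _)
    ((kills_wDot _ _ _).sub ((kills_wDot _ _ _).congr (by simp))) ?_ K hK v
  intro B₁ B₂ J hs h₁ h₂ hk hl
  rw [window_square L R k l _ _ J hs h₁ h₂ hk hl]
  have h := opD_bracket (r := r) (0 : Fin 4) 1 1 0 (bpar d) (bpar d')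
  have hk' : ksign (bpar d) (bpar d') = 1 := by
    cases d <;> cases d' <;> simp [bpar]
    simp [bpar, zmod2_one_add_one] at hd
  simp only [if_true, hk', one_smul, hd] at h
  have e1 := opWeb_window_dot (B₁ := B₁) (B₂ := B₂) (L := L) (R := (l + 1) :: R) [] [1] 0 J
    (by simp [h₁]) hk (by simp [hl, h₂]) hs
  have e2 := opWeb_window_dot (B₁ := B₁) (B₂ := B₂) (L := L ++ [k + 1]) (R := R) [0] [] 1 J
    (by simp [h₁, hk]) hl (by simp [h₂]) (by simpa using hs)
  simp only [List.nil_append, List.singleton_append] at e1 e2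
  rw [h, map_sub, LinearMap.sub_apply, LinearMap.sub_apply, e1, e2, map_sub]

/-- The lower ladder is evaluated at a monomial with known weight; the upper one needs the weights
afterwards, which `window_opD` provides. -/
theorem window_LL (L R : List ℕ) (h k l : ℕ) (x y : Bool) {B₁ B₂ : List (Finset (Fin r))}
    (J : Mono 4 r) (hs : (L ++ h :: (k + 1) :: (l + 1) :: R).sum = r)
    (h₁ : B₁.map Finset.card = L) (h₂ : B₂.map Finset.card = R) (hh : wt J 0 = h)
    (hk : wt J 1 = k + 1) (hl : wt J 2 = l + 1) :
    opWeb (rungsLL r L h k l R x y) (window B₁ [0, 1, 2] B₂ (mono J)) =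
      window B₁ [0, 1, 2] B₂ ((opD 0 1 (bpar x) * opD 1 2 (bpar y) :
        Module.End ℂ (Tens 4 r)) (mono J)) := by
  simp only [List.sum_append, List.sum_cons] at hs
  rw [rungsLL, map_mul, Module.End.mul_apply, Module.End.mul_apply]
  have e1 := window_rungL (B₁ := B₁) (B₂ := B₂) (L := L ++ [h]) (R := R) y [0] [] 1 2 J (by decide)
    (by simp [h₁, hh]) hk hl (by simp [h₂]) (by simp; omega)
  simp only [List.singleton_append] at e1
  rw [e1]
  refine window_opD _ _ _ _ _ fun J' hJ' => ?_
  have w0 := hJ' 0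
  have w1 := hJ' 1
  have w2 := hJ' 2
  simp at w0 w1 w2
  exact window_rungL (B₁ := B₁) (B₂ := B₂) (L := L) (R := l :: R) x [] [2] 0 1 J' (by decide)
    (by simp [h₁]) (by omega) (by omega) (by simp [h₂]; omega) (by simp; omega)

theorem window_LL' (L R : List ℕ) (h k l : ℕ) (x y : Bool) {B₁ B₂ : List (Finset (Fin r))}
    (J : Mono 4 r) (hs : (L ++ h :: (k + 1) :: (l + 1) :: R).sum = r)
    (h₁ : B₁.map Finset.card = L) (h₂ : B₂.map Finset.card = R) (hh : wt J 0 = h)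
    (hk : wt J 1 = k + 1) (hl : wt J 2 = l + 1) :
    opWeb (rungsLL' r L h k l R x y) (window B₁ [0, 1, 2] B₂ (mono J)) =
      window B₁ [0, 1, 2] B₂ ((opD 1 2 (bpar y) * opD 0 1 (bpar x) :
        Module.End ℂ (Tens 4 r)) (mono J)) := by
  simp only [List.sum_append, List.sum_cons] at hs
  rw [rungsLL', map_mul, Module.End.mul_apply, Module.End.mul_apply]
  have e1 := window_rungL (B₁ := B₁) (B₂ := B₂) (L := L) (R := (l + 1) :: R) x [] [2] 0 1 J
    (by decide) (by simp [h₁]) hh hk (by simp [h₂, hl]) (by simp; omega)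
  simp only [List.nil_append] at e1
  rw [e1]
  refine window_opD _ _ _ _ _ fun J' hJ' => ?_
  have w0 := hJ' 0
  have w1 := hJ' 1
  have w2 := hJ' 2
  simp at w0 w1 w2
  exact window_rungL (B₁ := B₁) (B₂ := B₂) (L := L ++ [h + 1]) (R := R) y [0] [] 1 2 J' (by decide)
    (by simp [h₁]; omega) (by omega) (by omega) (by simp [h₂]) (by simp; omega)

theorem window_RR (L R : List ℕ) (l k h : ℕ) (x y : Bool) {B₁ B₂ : List (Finset (Fin r))}
    (J : Mono 4 r) (hs : (L ++ (l + 1) :: (k + 1) :: h :: R).sum = r)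
    (h₁ : B₁.map Finset.card = L) (h₂ : B₂.map Finset.card = R) (hl : wt J 0 = l + 1)
    (hk : wt J 1 = k + 1) (hh : wt J 2 = h) :
    opWeb (rungsRR r L l k h R x y) (window B₁ [0, 1, 2] B₂ (mono J)) =
      window B₁ [0, 1, 2] B₂ ((opD 2 1 (bpar x) * opD 1 0 (bpar y) :
        Module.End ℂ (Tens 4 r)) (mono J)) := by
  simp only [List.sum_append, List.sum_cons] at hs
  rw [rungsRR, map_mul, Module.End.mul_apply, Module.End.mul_apply]
  have e1 := window_rungR (B₁ := B₁) (B₂ := B₂) (L := L) (R := h :: R) y [] [2] 0 1 J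
    (by decide) (by simp [h₁]) hl hk (by simp [h₂, hh]) (by simp; omega)
  simp only [List.nil_append] at e1
  rw [e1]
  refine window_opD _ _ _ _ _ fun J' hJ' => ?_
  have w0 := hJ' 0
  have w1 := hJ' 1
  have w2 := hJ' 2
  simp at w0 w1 w2
  exact window_rungR (B₁ := B₁) (B₂ := B₂) (L := L ++ [l]) (R := R) x [0] [] 1 2 J' (by decide)
    (by simp [h₁]; omega) (by omega) (by omega) (by simp [h₂]) (by simp; omega)

theorem window_RR' (L R : List ℕ) (l k h : ℕ) (x y : Bool) {B₁ B₂ : List (Finset (Fin r))}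
    (J : Mono 4 r) (hs : (L ++ (l + 1) :: (k + 1) :: h :: R).sum = r)
    (h₁ : B₁.map Finset.card = L) (h₂ : B₂.map Finset.card = R) (hl : wt J 0 = l + 1)
    (hk : wt J 1 = k + 1) (hh : wt J 2 = h) :
    opWeb (rungsRR' r L l k h R x y) (window B₁ [0, 1, 2] B₂ (mono J)) =
      window B₁ [0, 1, 2] B₂ ((opD 1 0 (bpar y) * opD 2 1 (bpar x) :
        Module.End ℂ (Tens 4 r)) (mono J)) := by
  simp only [List.sum_append, List.sum_cons] at hs
  rw [rungsRR', map_mul, Module.End.mul_apply, Module.End.mul_apply]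
  have e1 := window_rungR (B₁ := B₁) (B₂ := B₂) (L := L ++ [l + 1]) (R := R) x [0] [] 1 2 J
    (by decide) (by simp [h₁, hl]) hk hh (by simp [h₂]) (by simp; omega)
  simp only [List.singleton_append] at e1
  rw [e1]
  refine window_opD _ _ _ _ _ fun J' hJ' => ?_
  have w0 := hJ' 0
  have w1 := hJ' 1
  have w2 := hJ' 2
  simp at w0 w1 w2
  exact window_rungR (B₁ := B₁) (B₂ := B₂) (L := L) (R := (h + 1) :: R) y [] [2] 0 1 J' (by decide)
    (by simp [h₁]) (by omega) (by omega) (by simp [h₂]; omega) (by simp; omega)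

theorem kills_rungsLL (L R : List ℕ) (h k l : ℕ) (x y : Bool) :
    Kills (rungsLL r L h k l R x y) (L ++ h :: (k + 1) :: (l + 1) :: R) :=
  ((kills_rungL _ _ _ _ _).mul_left _).congr (by simp)

theorem kills_rungsLL' (L R : List ℕ) (h k l : ℕ) (x y : Bool) :
    Kills (rungsLL' r L h k l R x y) (L ++ h :: (k + 1) :: (l + 1) :: R) :=
  (kills_rungL _ _ _ _ _).mul_left _

theorem kills_rungsRR (L R : List ℕ) (l k h : ℕ) (x y : Bool) :
    Kills (rungsRR r L l k h R x y) (L ++ (l + 1) :: (k + 1) :: h :: R) :=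
  (kills_rungR _ _ _ _ _).mul_left _

theorem kills_rungsRR' (L R : List ℕ) (l k h : ℕ) (x y : Bool) :
    Kills (rungsRR' r L l k h R x y) (L ++ (l + 1) :: (k + 1) :: h :: R) :=
  ((kills_rungR _ _ _ _ _).mul_left _).congr (by simp)

/-- For each pair of parities the same operator `opD a c (x + y)` measures the failure to
supercommute. In every double rung relation the two sides have the same total parity, hence both
equal this operator. -/
theorem opD_double (a b c : Fin n) (x y : ZMod 2) (h : a ≠ c) :
    opD (r := r) a b x * opD b c y = ksign x y • (opD b c y * opD a b x) + opD a c (x + y) := by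
  have := opD_bracket (r := r) a b b c x y
  rw [if_pos rfl, if_neg h.symm, smul_zero, sub_zero, sub_eq_iff_eq_add] at this
  rw [this, add_comm]

theorem model_double_one (L R : List ℕ) (h k l : ℕ) (K : List (Finset (Fin r))) (hK : Good K)
    (v : Tens 1 r) :
    opWeb (rungsLL r L h k l R false false - rungsLL' r L h k l R false false) (st K v) =
      opWeb (rungsLL r L h k l R true true + rungsLL' r L h k l R true true) (st K v) := by
  refine model_rel_three ((kills_rungsLL _ _ _ _ _ _ _).sub (kills_rungsLL' _ _ _ _ _ _ _))
    ((kills_rungsLL _ _ _ _ _ _ _).add (kills_rungsLL' _ _ _ _ _ _ _)) ?_ K hK v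
  intro B₁ B₂ J hs h₁ h₂ hh hk hl
  simp only [map_sub, map_add, LinearMap.sub_apply, LinearMap.add_apply,
    window_LL _ _ _ _ _ _ _ J hs h₁ h₂ hh hk hl, window_LL' _ _ _ _ _ _ _ J hs h₁ h₂ hh hk hl]
  rw [opD_double _ _ _ _ _ (by decide), opD_double _ _ _ _ _ (by decide)]
  simp [bpar, zmod2_one_add_one]

theorem model_double_two (L R : List ℕ) (h k l : ℕ) (K : List (Finset (Fin r))) (hK : Good K)
    (v : Tens 1 r) :
    opWeb (rungsLL r L h k l R false true - rungsLL' r L h k l R false true) (st K v) =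
      opWeb (rungsLL r L h k l R true false - rungsLL' r L h k l R true false) (st K v) := by
  refine model_rel_three ((kills_rungsLL _ _ _ _ _ _ _).sub (kills_rungsLL' _ _ _ _ _ _ _))
    ((kills_rungsLL _ _ _ _ _ _ _).sub (kills_rungsLL' _ _ _ _ _ _ _)) ?_ K hK v
  intro B₁ B₂ J hs h₁ h₂ hh hk hl
  simp only [map_sub, LinearMap.sub_apply,
    window_LL _ _ _ _ _ _ _ J hs h₁ h₂ hh hk hl, window_LL' _ _ _ _ _ _ _ J hs h₁ h₂ hh hk hl]
  rw [opD_double _ _ _ _ _ (by decide), opD_double _ _ _ _ _ (by decide)]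
  simp [bpar]

theorem model_double_one' (L R : List ℕ) (h k l : ℕ) (K : List (Finset (Fin r))) (hK : Good K)
    (v : Tens 1 r) :
    opWeb (rungsRR r L l k h R false false - rungsRR' r L l k h R false false) (st K v) =
      opWeb (rungsRR r L l k h R true true + rungsRR' r L l k h R true true) (st K v) := by
  refine model_rel_three ((kills_rungsRR _ _ _ _ _ _ _).sub (kills_rungsRR' _ _ _ _ _ _ _))
    ((kills_rungsRR _ _ _ _ _ _ _).add (kills_rungsRR' _ _ _ _ _ _ _)) ?_ K hK v
  intro B₁ B₂ J hs h₁ h₂ hl hk hh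
  simp only [map_sub, map_add, LinearMap.sub_apply, LinearMap.add_apply,
    window_RR _ _ _ _ _ _ _ J hs h₁ h₂ hl hk hh, window_RR' _ _ _ _ _ _ _ J hs h₁ h₂ hl hk hh]
  rw [opD_double _ _ _ _ _ (by decide), opD_double _ _ _ _ _ (by decide)]
  simp [bpar, zmod2_one_add_one]

theorem model_double_two' (L R : List ℕ) (h k l : ℕ) (K : List (Finset (Fin r))) (hK : Good K)
    (v : Tens 1 r) :
    opWeb (rungsRR r L l k h R false true - rungsRR' r L l k h R false true) (st K v) =
      opWeb (rungsRR r L l k h R true false - rungsRR' r L l k h R true false) (st K v) := by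
  refine model_rel_three ((kills_rungsRR _ _ _ _ _ _ _).sub (kills_rungsRR' _ _ _ _ _ _ _))
    ((kills_rungsRR _ _ _ _ _ _ _).sub (kills_rungsRR' _ _ _ _ _ _ _)) ?_ K hK v
  intro B₁ B₂ J hs h₁ h₂ hl hk hh
  simp only [map_sub, LinearMap.sub_apply,
    window_RR _ _ _ _ _ _ _ J hs h₁ h₂ hl hk hh, window_RR' _ _ _ _ _ _ _ J hs h₁ h₂ hl hk hh]
  rw [opD_double _ _ _ _ _ (by decide), opD_double _ _ _ _ _ (by decide)]
  simp [bpar]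

theorem opWeb_rel {x y : FreeAlgebra ℂ (WebGen r)} (h : WebRel r x y)
    (K : List (Finset (Fin r))) (hK : Good K) (v : Tens 1 r) :
    opWeb x (st K v) = opWeb y (st K v) := by
  cases h with
  | one_left b g => exact model_one_left b g K hK v
  | one_right a g => exact model_one_right a g K hK v
  | one_sum => exact model_one_sum K hK v
  | superinterchange L x M y R => exact model_superinterchange L x M y R K hK v
  | merge_assoc L R h k l => exact model_merge_assoc L R h k l K hK v
  | split_assoc L R h k l => exact model_split_assoc L R h k l K hK v
  | explosion L R k l => exact model_explosion L R k l K hK v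
  | dot_sq L R k => exact model_dot_sq L R k K hK v
  | dot_merge L R k => exact model_dot_merge L R 1 k K hK v
  | dot_merge' L R k => exact model_dot_merge L R k 1 K hK v
  | dot_split L R k => exact model_dot_split L R 1 k K hK v
  | dot_split' L R k => exact model_dot_split L R k 1 K hK v
  | dumbbell L R => exact model_dumbbell L R K hK v
  | square_switch L R k l => exact model_square_switch L R k l K hK v
  | square_switch_dots L R k l =>
    exact model_square_switch_dots L R k l true false (by simp [bpar]) K hK v
  | square_switch_dots' L R k l =>
    exact model_square_switch_dots L R k l false true (by simp [bpar]) K hK v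
  | double_rungs_one L R h k l => exact model_double_one L R h k l K hK v
  | double_rungs_two L R h k l => exact model_double_two L R h k l K hK v
  | double_rungs_one' L R h k l => exact model_double_one' L R h k l K hK v
  | double_rungs_two' L R h k l => exact model_double_two' L R h k l K hK v

end TypeQ

end


noncomputable section

namespace TypeQ

variable {r n : ℕ}

/-! ## Comparison of the tensor space with the model -/

/-- The monomial `I`, with the labels of the tensorands at the places in `T` replaced by `a`. -/
def move (T : Finset (Fin r)) (a : Fin n) (I : Mono n r) : Mono n r :=
  fun p => if p ∈ T then (a, (I p).2) else I p

/-- Double counting: a subset with `k + 1` elements arises from `k + 1` pairs of a `k`-subset and a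
further element. -/
theorem sum_powersetCard_insert {ι E : Type} [DecidableEq ι] [AddCommGroup E]
    (s : Finset ι) (k : ℕ) (f : Finset ι → E) :
    ∑ T ∈ s.powersetCard k, ∑ p ∈ s \ T, f (insert p T) =
      (k + 1) • ∑ T ∈ s.powersetCard (k + 1), f T := by
  have : ∀ T ∈ s.powersetCard (k + 1), ∑ _p ∈ T, f T = (k + 1) • f T := by
    intro T hT
    rw [Finset.sum_const, (Finset.mem_powersetCard.1 hT).2]
  rw [Finset.smul_sum, ← Finset.sum_congr rfl this, Finset.sum_sigma', Finset.sum_sigma']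
  refine Finset.sum_bij' (fun x _ => ⟨insert x.2 x.1, x.2⟩) (fun x _ => ⟨x.1.erase x.2, x.2⟩)
    ?_ ?_ ?_ ?_ ?_
  · rintro ⟨T, p⟩ h
    simp only [Finset.mem_sigma, Finset.mem_powersetCard, Finset.mem_sdiff] at h ⊢
    exact ⟨⟨Finset.insert_subset h.2.1 h.1.1, by rw [Finset.card_insert_of_notMem h.2.2, h.1.2]⟩,
      Finset.mem_insert_self _ _⟩
  · rintro ⟨T, p⟩ h
    simp only [Finset.mem_sigma, Finset.mem_powersetCard, Finset.mem_sdiff] at h ⊢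
    refine ⟨⟨(Finset.erase_subset _ _).trans h.1.1, ?_⟩, h.1.1 h.2, Finset.notMem_erase _ _⟩
    rw [Finset.card_erase_of_mem h.2, h.1.2]; rfl
  · rintro ⟨T, p⟩ h
    simp only [Finset.mem_sigma, Finset.mem_sdiff] at h
    simp [Finset.erase_insert h.2.2]
  · rintro ⟨T, p⟩ h
    simp only [Finset.mem_sigma] at h
    simp [Finset.insert_erase h.2]
  · rintro ⟨T, p⟩ _
    rfl

theorem mem_fib {I : Mono n r} {c : Fin n} {p : Fin r} : p ∈ fib I c ↔ (I p).1 = c := by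
  simp [fib]

theorem fib_move_ne {T : Finset (Fin r)} {a c : Fin n} (I : Mono n r) (h : c ≠ a) :
    fib (move T a I) c = fib I c \ T := by
  ext p
  by_cases hp : p ∈ T <;> simp [mem_fib, move, hp, h.symm]

theorem fib_move_self {T : Finset (Fin r)} {a : Fin n} (I : Mono n r) :
    fib (move T a I) a = fib I a ∪ T := by
  ext p
  by_cases hp : p ∈ T <;> simp [mem_fib, move, hp]

theorem parMono_move (T : Finset (Fin r)) (a : Fin n) (I : Mono n r) :
    parMono (move T a I) = parMono I := by
  funext p
  by_cases hp : p ∈ T <;> simp [parMono, move, hp]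

/-- An even operator relabels places without signs, and a set of `k` places is relabelled in `k!`
orders. This is why the divided power moves every `k`-subset exactly once. -/
theorem opD_pow_mono {a b : Fin n} (h : a ≠ b) (k : ℕ) (I : Mono n r) :
    (opD a b 0 ^ k) (mono I) =
      k.factorial • ∑ T ∈ (fib I b).powersetCard k, mono (move T a I) := by
  induction k with
  | zero =>
    have : move ∅ a I = I := funext fun p => by simp [move]
    simp [this]
  | succ k ih =>
    rw [pow_succ', Module.End.mul_apply, ih, map_nsmul, map_sum, Nat.factorial_succ,
      mul_comm, mul_smul, ← sum_powersetCard_insert]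
    congr 1
    refine Finset.sum_congr rfl fun T hT => ?_
    rw [opD_mono, ← fib_move_ne I h.symm, fib, Finset.sum_filter]
    refine Finset.sum_congr rfl fun p _ => ?_
    split_ifs with hp
    · rw [ksign_zero_left, one_smul, add_zero]
      congr 1
      funext q
      by_cases hq : q = p
      · subst hq
        by_cases hqT : q ∈ T <;> simp [move, hqT]
      · by_cases hqT : q ∈ T <;> simp [move, hq, hqT]
    · rfl

theorem divPow_opD_mono {a b : Fin n} (h : a ≠ b) (k : ℕ) (I : Mono n r) :
    divPow (opD a b 0) k (mono I) = ∑ T ∈ (fib I b).powersetCard k, mono (move T a I) := by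
  rw [divPow, LinearMap.smul_apply, opD_pow_mono h, ← Nat.cast_smul_eq_nsmul ℂ, smul_smul,
    inv_mul_cancel₀ (by exact_mod_cast k.factorial_ne_zero), one_smul]

theorem divPow_opD_mono_all {a b : Fin n} (h : a ≠ b) {k : ℕ} (I : Mono n r) (hk : wt I b = k) :
    divPow (opD a b 0) k (mono I) = mono (move (fib I b) a I) := by
  rw [divPow_opD_mono h, ← hk, ← card_fib, Finset.powersetCard_self, Finset.sum_singleton]

/-- The nonempty fibres of a monomial. -/
def blocksOf (I : Mono n r) : List (Finset (Fin r)) :=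
  ((List.finRange n).map (fib I)).filter fun A => decide A.Nonempty

/-- The map from the tensor space to the model. -/
def toBlocks (n r : ℕ) : Tens n r →ₗ[ℂ] BlockSpace r := window [] (List.finRange n) []

theorem toBlocks_mono (I : Mono n r) :
    toBlocks n r (mono I) = st ((List.finRange n).map (fib I)) (mono (parMono I)) := by
  rw [toBlocks, window_mono, List.nil_append, List.append_nil]

theorem toBlocks_mono_congr {I J : Mono n r} (h : blocksOf I = blocksOf J)
    (h' : parMono I = parMono J) : toBlocks n r (mono I) = toBlocks n r (mono J) := by
  rw [toBlocks_mono, toBlocks_mono, h', st_congr h]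

theorem finRange_split (p : ℕ) (hp : p + 1 < n) : ∃ k₁ k₂ : List (Fin n),
    List.finRange n = k₁ ++ ⟨p, by omega⟩ :: ⟨p + 1, hp⟩ :: k₂ ∧ k₁.length = p := by
  refine ⟨(List.finRange n).take p, (List.finRange n).drop (p + 2), ?_, by simp; omega⟩
  conv_lhs => rw [← List.take_append_drop p (List.finRange n)]
  congr 1
  rw [List.drop_eq_getElem_cons (by simp; omega), List.drop_eq_getElem_cons (by simp; omega)]
  simp

theorem finRange_split_one (p : ℕ) (hp : p < n) : ∃ k₁ k₂ : List (Fin n),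
    List.finRange n = k₁ ++ ⟨p, hp⟩ :: k₂ ∧ k₁.length = p := by
  refine ⟨(List.finRange n).take p, (List.finRange n).drop (p + 1), ?_, by simp; omega⟩
  conv_lhs => rw [← List.take_append_drop p (List.finRange n)]
  congr 1
  rw [List.drop_eq_getElem_cons (by simp; omega)]
  simp

theorem notMem_of_split {k₁ k₂ : List (Fin n)} {a b : Fin n}
    (h : List.finRange n = k₁ ++ a :: b :: k₂) :
    a ∉ k₁ ∧ b ∉ k₁ ∧ a ∉ k₂ ∧ b ∉ k₂ ∧ a ≠ b := by
  have hk := List.nodup_finRange n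
  rw [h, List.nodup_append] at hk
  obtain ⟨-, hk2, hk3⟩ := hk
  simp only [List.nodup_cons, List.mem_cons, not_or] at hk2
  exact ⟨fun h => hk3 a h a (by simp) rfl, fun h => hk3 b h b (by simp) rfl, hk2.1.2, hk2.2.1,
    hk2.1.1⟩

theorem map_fib_congr {I J : Mono n r} {a b : Fin n} {k : List (Fin n)} (ha : a ∉ k) (hb : b ∉ k)
    (h : ∀ c, c ≠ a → c ≠ b → fib I c = fib J c) : k.map (fib I) = k.map (fib J) :=
  List.map_congr_left fun c hc => h c (by rintro rfl; exact ha hc) (by rintro rfl; exact hb hc)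

/-- Exchanging an empty fibre with an adjacent one. -/
theorem blocksOf_eq_of_exchange {I J : Mono n r} (p : ℕ) (hp : p + 1 < n)
    (h : ∀ c, c ≠ ⟨p, by omega⟩ → c ≠ ⟨p + 1, hp⟩ → fib I c = fib J c)
    (h' : (fib I ⟨p, by omega⟩ = ∅ ∧ fib J ⟨p + 1, hp⟩ = ∅ ∧
        fib I ⟨p + 1, hp⟩ = fib J ⟨p, by omega⟩) ∨
      (fib J ⟨p, by omega⟩ = ∅ ∧ fib I ⟨p + 1, hp⟩ = ∅ ∧
        fib J ⟨p + 1, hp⟩ = fib I ⟨p, by omega⟩)) : blocksOf I = blocksOf J := by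
  obtain ⟨k₁, k₂, hk, -⟩ := finRange_split p hp
  obtain ⟨h1, h2, h3, h4, -⟩ := notMem_of_split hk
  rw [blocksOf, blocksOf, hk]
  simp only [List.map_append, List.map_cons, map_fib_congr h1 h2 h, map_fib_congr h3 h4 h,
    List.filter_append, List.filter_cons]
  rcases h' with ⟨a, b, c⟩ | ⟨a, b, c⟩ <;> simp [a, b, c]

/-- The operator of `e_p`. -/
def opE (p : ℕ) : Module.End ℂ (Tens n r) :=
  if h : p + 1 < n then opD ⟨p, by omega⟩ ⟨p + 1, h⟩ 0 else 0

/-- The operator of `f_p`. -/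
def opF (p : ℕ) : Module.End ℂ (Tens n r) :=
  if h : p + 1 < n then opD ⟨p + 1, h⟩ ⟨p, by omega⟩ 0 else 0

theorem map_divPow {A B : Type} [Ring A] [Algebra ℂ A] [Ring B] [Algebra ℂ B] (f : A →ₐ[ℂ] B)
    (x : A) (k : ℕ) : f (divPow x k) = divPow (f x) k := by simp [divPow]

theorem schurRep_schurE (p : ℕ) : schurRep n r (schurE n r p) = opE p := by
  unfold schurE opE
  split_ifs
  · rw [schurRep, Presented.lift_mk]; simp [gE, schurOp]
  · simp

theorem schurRep_schurF (p : ℕ) : schurRep n r (schurF n r p) = opF p := by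
  unfold schurF opF
  split_ifs
  · rw [schurRep, Presented.lift_mk]; simp [gF, schurOp]
  · simp

theorem schurRep_schurH (j : Fin n) : schurRep n r (schurH n r j) = opD j j 1 := by
  rw [schurH, dif_pos j.2, schurRep, Presented.lift_mk]; simp [gH, schurOp]

theorem schurRep_schurOne (l : Weight n r) : schurRep n r (schurOne l) = opOne l := by
  rw [schurOne, schurRep, Presented.lift_mk]; simp [g1, schurOp]

theorem schurRep_eProd (i : ℕ) (a : Composition r) : schurRep r r (eProd i a) =
    (((List.range' i (r - 1 - i)).map fun p =>
      divPow (opE p) (a.blocks.getD (p + 1) 0)).reverse).prod := by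
  rw [eProd, map_list_prod, List.map_reverse, List.map_map]
  congr 2
  refine List.map_congr_left fun p _ => ?_
  simp [map_divPow, schurRep_schurE]

theorem schurRep_fProd (i : ℕ) (a : Composition r) : schurRep r r (fProd i a) =
    ((List.range' i (r - 1 - i)).map fun p =>
      divPow (opF p) (a.blocks.getD (p + 1) 0)).prod := by
  rw [fProd, map_list_prod, List.map_map]
  congr 1
  refine List.map_congr_left fun p _ => ?_
  simp [map_divPow, schurRep_schurF]

/-- Closing a gap in the labels by the operators `e_p`. -/
theorem eProd_shift (c : ℕ → ℕ) (m : ℕ) : ∀ (p : ℕ) (hp : p < n) (J : Mono n r), p + m + 1 = n →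
    fib J ⟨p, hp⟩ = ∅ → (∀ k : Fin n, p < k → wt J k = c k) →
    ∃ J' : Mono n r, (((List.range' p m).map fun q => divPow (opE q) (c (q + 1))).reverse).prod
      (mono J) = mono J' ∧ blocksOf J' = blocksOf J ∧ parMono J' = parMono J ∧
      (∀ k : Fin n, k.val < p → fib J' k = fib J k) ∧
      (∀ (k : ℕ) (hk : k + 1 < n), p ≤ k → fib J' ⟨k, by omega⟩ = fib J ⟨k + 1, hk⟩) ∧
      fib J' ⟨n - 1, by omega⟩ = ∅ := by
  induction m with
  | zero =>
    intro p hp J hm hJ _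
    obtain rfl : p = n - 1 := by omega
    exact ⟨J, by simp, rfl, rfl, fun _ _ => rfl, fun k hk h => by omega, hJ⟩
  | succ m ih =>
    intro p hp J hm hJ hw
    have hp1 : p + 1 < n := by omega
    have hne : (⟨p, hp⟩ : Fin n) ≠ ⟨p + 1, hp1⟩ := by simp [Fin.ext_iff]
    -- The factor `e_p` is applied first. Its divided power is the full size of the fibre of `p +
    -- 1`, so the whole fibre fills the gap at `p` and the gap wanders to `p + 1`.
    set J₁ := move (fib J ⟨p + 1, hp1⟩) ⟨p, hp⟩ J with hJ₁
    have hf : ∀ c : Fin n, c ≠ ⟨p, hp⟩ → c ≠ ⟨p + 1, hp1⟩ → fib J₁ c = fib J c := by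
      intro c h1 h2
      rw [hJ₁, fib_move_ne _ h1, Finset.sdiff_eq_self_of_disjoint (disjoint_fib J h2)]
    have hf0 : fib J₁ ⟨p, hp⟩ = fib J ⟨p + 1, hp1⟩ := by
      rw [hJ₁, fib_move_self, hJ, Finset.empty_union]
    have hf1 : fib J₁ ⟨p + 1, hp1⟩ = ∅ := by
      rw [hJ₁, fib_move_ne _ hne.symm, Finset.sdiff_self]
    obtain ⟨J', h1, h2, h3, h4, h5, h6⟩ := ih (p + 1) hp1 J₁ (by omega) hf1 (by
      intro k hk
      have hk1 : p + 1 < k.val := hk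
      rw [← card_fib, hf k (by rw [Ne, Fin.ext_iff]; simp; omega)
        (by rw [Ne, Fin.ext_iff]; simp; omega), card_fib]
      exact hw k (by omega))
    refine ⟨J', ?_, ?_, ?_, ?_, ?_, h6⟩
    · rw [List.range'_succ, List.map_cons, List.reverse_cons, List.prod_append,
        List.prod_singleton, Module.End.mul_apply]
      rw [show divPow (opE p) (c (p + 1)) (mono J) = mono J₁ from ?_, h1]
      rw [opE, dif_pos hp1]
      exact divPow_opD_mono_all hne J (hw ⟨p + 1, hp1⟩ (by simp))
    · rw [h2]
      exact blocksOf_eq_of_exchange p hp1 hf (Or.inr ⟨hJ, hf1, hf0.symm⟩)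
    · rw [h3, parMono_move]
    · intro k hk
      rw [h4 k (by omega), hf k (by rw [Ne, Fin.ext_iff]; simp; omega)
        (by rw [Ne, Fin.ext_iff]; simp; omega)]
    · intro k hk hpk
      rcases hpk.eq_or_lt with rfl | hpk
      · rw [h4 _ (by simp), hf0]
      · rw [h5 k hk hpk, hf _ (by rw [Ne, Fin.ext_iff]; simp; omega)
          (by rw [Ne, Fin.ext_iff]; simp; omega)]

/-- Opening a gap in the labels by the operators `f_p`. -/
theorem fProd_shift (c : ℕ → ℕ) (m : ℕ) : ∀ (p : ℕ) (hp : p < n) (J : Mono n r), p + m + 1 = n →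
    fib J ⟨n - 1, by omega⟩ = ∅ →
    (∀ k : Fin n, p ≤ k.val → k.val < n - 1 → wt J k = c (k + 1)) →
    ∃ J' : Mono n r, ((List.range' p m).map fun q => divPow (opF q) (c (q + 1))).prod
      (mono J) = mono J' ∧ blocksOf J' = blocksOf J ∧ parMono J' = parMono J ∧
      fib J' ⟨p, hp⟩ = ∅ ∧ (∀ k : Fin n, k.val < p → fib J' k = fib J k) ∧
      ∀ (k : ℕ) (hk : k + 1 < n), p ≤ k → fib J' ⟨k + 1, hk⟩ = fib J ⟨k, by omega⟩ := by
  induction m with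
  | zero =>
    intro p hp J hm hJ _
    obtain rfl : p = n - 1 := by omega
    exact ⟨J, by simp, rfl, rfl, hJ, fun _ _ => rfl, fun k hk h => by omega⟩
  | succ m ih =>
    intro p hp J hm hJ hw
    have hp1 : p + 1 < n := by omega
    have hne : (⟨p + 1, hp1⟩ : Fin n) ≠ ⟨p, hp⟩ := by simp [Fin.ext_iff]
    -- The factors with larger indices act first and free the label `p + 1`; then `f_p` moves the
    -- whole fibre of `p` there.
    obtain ⟨J₁, h1, h2, h3, h4, h5, h6⟩ := ih (p + 1) hp1 J (by omega) hJ
      fun k hk => hw k (by omega)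
    set J' := move (fib J₁ ⟨p, hp⟩) ⟨p + 1, hp1⟩ J₁ with hJ'
    have hf : ∀ c : Fin n, c ≠ ⟨p, hp⟩ → c ≠ ⟨p + 1, hp1⟩ → fib J' c = fib J₁ c := by
      intro c h1 h2
      rw [hJ', fib_move_ne _ h2, Finset.sdiff_eq_self_of_disjoint (disjoint_fib J₁ h1)]
    have hf1 : fib J' ⟨p + 1, hp1⟩ = fib J₁ ⟨p, hp⟩ := by
      rw [hJ', fib_move_self, h4, Finset.empty_union]
    have hf0 : fib J' ⟨p, hp⟩ = ∅ := by
      rw [hJ', fib_move_ne _ hne.symm, Finset.sdiff_self]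
    refine ⟨J', ?_, ?_, ?_, hf0, ?_, ?_⟩
    · rw [List.range'_succ, List.map_cons, List.prod_cons, Module.End.mul_apply, h1, opF,
        dif_pos hp1]
      refine divPow_opD_mono_all hne J₁ ?_
      rw [← card_fib, h5 ⟨p, hp⟩ (by simp), card_fib]
      exact hw ⟨p, hp⟩ le_rfl (by simp; omega)
    · rw [← h2]
      exact blocksOf_eq_of_exchange p hp1 hf (Or.inl ⟨hf0, h4, hf1⟩)
    · rw [← h3, hJ', parMono_move]
    · intro k hk
      rw [hf k (by rw [Ne, Fin.ext_iff]; simp; omega) (by rw [Ne, Fin.ext_iff]; simp; omega)]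
      exact h5 k (by omega)
    · intro k hk hpk
      rcases hpk.eq_or_lt with rfl | hpk
      · rw [hf1, h5 _ (by simp)]
      · rw [hf _ (by rw [Ne, Fin.ext_iff]; simp; omega) (by rw [Ne, Fin.ext_iff]; simp; omega),
          h6 k hk hpk]

/-- The only zeros of the weight are trailing. -/
def Trailing (I : Mono r r) : Prop := ∀ i j : Fin r, i ≤ j → wt I i = 0 → wt I j = 0

/-- Erasing trailing zeros shifts no entry, and reading beyond the end gives the default value `0`.
-/
theorem erase0_getD_of_trailing (l : List ℕ)
    (h : ∀ i j, i ≤ j → l.getD i 0 = 0 → l.getD j 0 = 0) (k : ℕ) :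
    (erase0 l).getD k 0 = l.getD k 0 := by
  induction l generalizing k with
  | nil => rfl
  | cons a l ih =>
    rcases Nat.eq_zero_or_pos a with rfl | ha
    · have hz : ∀ j, (0 :: l).getD j 0 = 0 := fun j => h 0 j (by omega) (by simp)
      have : erase0 (0 :: l) = [] := by
        rw [erase0, List.filter_eq_nil_iff]
        intro b hb
        obtain ⟨j, hj, rfl⟩ := List.mem_iff_getElem.1 hb
        have := hz j
        rw [List.getD_eq_getElem _ _ hj] at this
        simp [this]
      rw [this, hz]; rfl
    · have : erase0 (a :: l) = a :: erase0 l := by simp [erase0, ha]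
      rw [this]
      rcases k with _ | k
      · simp
      · simp only [List.getD_cons_succ]
        refine ih (fun i j hij hi => ?_) k
        simpa using h (i + 1) (j + 1) (by omega) (by simpa using hi)

theorem getD_map_finRange (f : Fin r → ℕ) (k : Fin r) :
    ((List.finRange r).map f).getD k 0 = f k := by
  rw [List.getD_eq_getElem _ _ (by simp)]
  simp

theorem mono_mem_weightSpace {I : Mono n r} {l : Weight n r} (h : wt I = l.1) :
    mono I ∈ weightSpace l := Submodule.subset_span ⟨I, h, rfl⟩

theorem wt_congr_fib {I J : Mono n r} {c d : Fin n} (h : fib I c = fib J d) : wt I c = wt J d :=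
  congrArg Finset.card h

theorem map_wt_of_hat {I : Mono r r} {a : Composition r} (h : wt I = (hat a).1.1) :
    (List.finRange r).map (wt I) = a.blocks ++ List.replicate (r - a.blocks.length) 0 := by
  have := a.length_le
  refine List.ext_getElem (by simp) fun k h1 h2 => ?_
  simp only [List.getElem_map, List.getElem_finRange, h, hat]
  by_cases hk : k < a.blocks.length
  · simp [hk]
  · simp [List.getElem_append, hk]

theorem map_card_fib (I : Mono n r) (ks : List (Fin n)) :
    (ks.map (fib I)).map Finset.card = ks.map (wt I) := by
  rw [List.map_map]; rfl

/-- The type forgets the positions of the zero entries. Since these are trailing, the nonzero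
entries still determine the weight. -/
theorem hasType_iff {I : Mono r r} (hI : Trailing I) (a : Composition r) :
    HasType ((List.finRange r).map (fib I)) a.blocks ↔ wt I = (hat a).1.1 := by
  rw [HasType, map_card_fib, erase0_eq_self (L := a.blocks) fun i hi => a.blocks_pos hi]
  constructor
  · intro h
    funext k
    have := erase0_getD_of_trailing ((List.finRange r).map (wt I)) (by
      intro i j hij hi
      by_cases hj : j < r
      · rw [getD_map_finRange (wt I) ⟨j, hj⟩]
        rw [getD_map_finRange (wt I) ⟨i, by omega⟩] at hi
        exact hI _ _ (by simpa using hij) hi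
      · rw [List.getD_eq_default]; simpa using hj) k
    rw [getD_map_finRange, h] at this
    exact this.symm
  · intro h
    rw [map_wt_of_hat h, erase0_append, erase0_eq_self fun i hi => a.blocks_pos hi]
    simp [erase0]

theorem wLoc_congr {L L' R R' : List ℕ} (x : LocGen) (hL : erase0 L = erase0 L')
    (hR : erase0 R = erase0 R') : wLoc r L x R = wLoc r L' x R' := by
  have hs : (L ++ x.src ++ R).sum = (L' ++ x.src ++ R').sum := by
    simp only [List.sum_append]
    rw [← erase0_sum L, ← erase0_sum R, hL, hR, erase0_sum, erase0_sum]
  unfold wLoc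
  simp only [hs, hL, hR]

end TypeQ

end


/-! ### The prescribed Schur elements act as the generating webs. -/

noncomputable section

namespace TypeQ

variable {r n : ℕ}

theorem blocksOf_card (I : Mono n r) :
    (blocksOf I).map Finset.card = erase0 ((List.finRange n).map (wt I)) := by
  rw [blocksOf, filter_map_card, map_card_fib]

/-- The first divided power, of `e_i`, moves the whole fibre of `i + 1` into that of `i`, which is
the merge. The remaining factors close the gap left at `i + 1` and are invisible in the list of
nonempty blocks. -/
theorem toBlocks_merge (L R : List ℕ) (k l : ℕ) (a b : Composition r)
    (ha : a.blocks = L ++ (LocGen.merge k l).src ++ R)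
    (hb : b.blocks = L ++ (LocGen.merge k l).tgt ++ R) (I : Mono r r)
    (hI : wt I = (hat a).1.1) :
    toBlocks r r (schurRep r r (eProd L.length a) (mono I)) =
      opWeb (FreeAlgebra.ι ℂ (.loc L (.merge k l) R a b ha hb)) (toBlocks r r (mono I)) ∧
    schurRep r r (eProd L.length a) (mono I) ∈ weightSpace (hat b).1 := by
  have hlen : a.blocks.length ≤ r := a.length_le
  have hlen' : a.blocks.length = L.length + 2 + R.length := by simp [ha, LocGen.src]; omega
  have hp : L.length + 1 < r := by omega
  set i := L.length with hi
  have hpos : ∀ j ∈ a.blocks, 0 < j := fun j hj => a.blocks_pos hj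
  have hk0 : 0 < k := hpos k (by simp [ha, LocGen.src])
  have hl0 : 0 < l := hpos l (by simp [ha, LocGen.src])
  obtain ⟨k₁, k₂, hk, hk1⟩ := finRange_split i hp
  obtain ⟨n1, n2, n3, n4, hne⟩ := notMem_of_split hk
  have hw := map_wt_of_hat hI
  rw [hk, ha] at hw
  simp only [List.map_append, List.map_cons, LocGen.src, List.append_assoc, List.cons_append,
    List.nil_append] at hw
  obtain ⟨hw1, hw2⟩ := List.append_inj hw (by simp [hk1, hi])
  simp only [List.cons.injEq] at hw2
  obtain ⟨hwk, hwl, hw2⟩ := hw2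
  have hwt : ∀ q : Fin r, wt I q = a.blocks.getD q 0 := fun q => congrFun hI q
  -- The monomial after the first divided power: merged fibre at `i`, empty fibre at `i + 1`.
  set J := move (fib I ⟨i + 1, hp⟩) ⟨i, by omega⟩ I with hJ
  have hf : ∀ c : Fin r, c ≠ ⟨i, by omega⟩ → c ≠ ⟨i + 1, hp⟩ → fib J c = fib I c := by
    intro c h1 h2
    rw [hJ, fib_move_ne _ h1, Finset.sdiff_eq_self_of_disjoint (disjoint_fib I h2)]
  have hf0 : fib J ⟨i, by omega⟩ = fib I ⟨i, by omega⟩ ∪ fib I ⟨i + 1, hp⟩ := by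
    rw [hJ, fib_move_self]
  have hf1 : fib J ⟨i + 1, hp⟩ = ∅ := by
    rw [hJ, fib_move_ne _ hne.symm, Finset.sdiff_self]
  -- Of the `m + 1` factors one performs the merge and `m` close the gap.
  obtain ⟨m, hm⟩ : ∃ m, r - 1 - i = m + 1 := ⟨r - 2 - i, by omega⟩
  obtain ⟨J', h1, h2, h3, h4, h5, h6⟩ := eProd_shift (fun q => a.blocks.getD q 0) m (i + 1) hp J (by omega) hf1
    (by
      intro q hq
      have hq' : i + 1 < q.val := hq
      rw [← card_fib, hf q (by rw [Ne, Fin.ext_iff]; simp; omega)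
        (by rw [Ne, Fin.ext_iff]; simp; omega), card_fib]
      exact hwt q)
  have e : schurRep r r (eProd i a) (mono I) = mono J' := by
    rw [schurRep_eProd, hm, List.range'_succ, List.map_cons, List.reverse_cons, List.prod_append,
      List.prod_singleton, Module.End.mul_apply, ← h1]
    congr 1
    rw [opE, dif_pos hp]
    exact divPow_opD_mono_all hne I (hwt ⟨i + 1, hp⟩)
  rw [e]
  refine ⟨?_, mono_mem_weightSpace ?_⟩
  swap
  · funext q
    have hq : (hat b).1.1 q = b.blocks.getD q 0 := rfl
    rw [hq]
    -- Labels below `i` are unchanged, `i` carries the union, a larger label inherits the fibre of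
    -- its successor, and the last label becomes empty.
    rcases lt_trichotomy q.val i with hqi | hqi | hqi
    · rw [wt_congr_fib (h4 q (by omega)), wt_congr_fib (hf q (by rw [Ne, Fin.ext_iff]; simp; omega)
        (by rw [Ne, Fin.ext_iff]; simp; omega)), hwt, ha, hb]
      simp only [List.getD, List.append_assoc]
      rw [List.getElem?_append_left (by omega), List.getElem?_append_left (by omega)]
    · have hqe : q = ⟨i, by omega⟩ := Fin.ext hqi
      rw [hqe]
      rw [wt_congr_fib (h4 ⟨i, by omega⟩ (by simp)), ← card_fib, hf0,
        Finset.card_union_of_disjoint (disjoint_fib I hne), card_fib, card_fib, hwk, hwl]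
      simp [hb, LocGen.tgt, hi, List.getD]
    · rcases Nat.lt_or_ge (q.val + 1) r with hq1 | hq1
      · obtain ⟨t, ht⟩ : ∃ t, q.val = i + 1 + t := ⟨q.val - (i + 1), by omega⟩
        rw [wt_congr_fib (h5 q.val hq1 (by omega)), wt_congr_fib (hf ⟨q.val + 1, hq1⟩
          (by rw [Ne, Fin.ext_iff]; simp; omega) (by rw [Ne, Fin.ext_iff]; simp; omega)), hwt]
        simp only [ht]
        rw [ha, hb]
        simp only [LocGen.src, LocGen.tgt, List.getD]
        rw [List.append_assoc, List.append_assoc, List.getElem?_append_right (l₁ := L) (by omega),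
          List.getElem?_append_right (l₁ := L) (by omega),
          show i + 1 + t - L.length = t + 1 by omega,
          show i + 1 + t + 1 - L.length = t + 2 by omega]
        simp
      · have hqe : q = ⟨r - 1, by omega⟩ := Fin.ext (by simp only; omega)
        rw [hqe]
        rw [← card_fib, h6, Finset.card_empty, List.getD_eq_default]
        simp [hb, LocGen.tgt]; omega
  have eJ : toBlocks r r (mono J) = st (k₁.map (fib I) ++
      (fib I ⟨i, by omega⟩ ∪ fib I ⟨i + 1, hp⟩) :: k₂.map (fib I)) (mono (parMono I)) := by
    rw [toBlocks_mono, hk, hJ, parMono_move, ← hJ]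
    simp only [List.map_append, List.map_cons, map_fib_congr n1 n2 hf, map_fib_congr n3 n4 hf, hf0,
      hf1]
    have := st_nil_mid (k₁.map (fib I) ++ [fib I ⟨i, by omega⟩ ∪ fib I ⟨i + 1, hp⟩])
      (k₂.map (fib I))
    simp only [List.append_assoc, List.singleton_append] at this
    rw [this]
  have hR : (k₂.map (wt I)).sum = R.sum := by rw [hw2]; simp
  have hs := a.blocks_sum
  rw [ha] at hs
  simp only [LocGen.src, List.sum_append, List.sum_cons, List.sum_nil] at hs
  -- `R` is replaced by the weights of all labels after `i + 1`, trailing zeros included, so that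
  -- the sizes match the unfiltered list of fibres.
  rw [toBlocks_mono_congr h2 h3, eJ, ι_loc_eq, toBlocks_mono, hk,
    wLoc_congr (L' := L) (R' := k₂.map (wt I)) _ rfl (by rw [hw2, erase0_append]; simp [erase0])]
  have := opWeb_wMerge (B₁ := k₁.map (fib I)) (A := fib I ⟨i, by omega⟩) (A' := fib I ⟨i + 1, hp⟩)
    (B₂ := k₂.map (fib I)) (L := L) (R := k₂.map (wt I)) (k := k) (l := l) (mono (parMono I)) rfl
    (by rw [map_card_fib, hw1]) hwk hwl (map_card_fib _ _) (by simp [hR]; omega)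
  rw [wMerge, if_neg (by omega)] at this
  rw [← this]
  simp

/-- The factors with index above `i` act first and open a gap at `i + 1`, without changing the
nonempty blocks. The last factor, the divided power of `f_i` of order `l`, moves each `l`-subset of
the fibre of `i` into this gap. -/
theorem toBlocks_split (L R : List ℕ) (k l : ℕ) (a b : Composition r)
    (ha : a.blocks = L ++ (LocGen.split k l).src ++ R)
    (hb : b.blocks = L ++ (LocGen.split k l).tgt ++ R) (I : Mono r r)
    (hI : wt I = (hat a).1.1) :
    toBlocks r r (schurRep r r (fProd L.length b) (mono I)) =
      opWeb (FreeAlgebra.ι ℂ (.loc L (.split k l) R a b ha hb)) (toBlocks r r (mono I)) ∧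
    schurRep r r (fProd L.length b) (mono I) ∈ weightSpace (hat b).1 := by
  have hlen : b.blocks.length ≤ r := b.length_le
  have hlen' : b.blocks.length = L.length + 2 + R.length := by simp [hb, LocGen.tgt]; omega
  have hlen'' : a.blocks.length = L.length + 1 + R.length := by simp [ha, LocGen.src]; omega
  have hp : L.length + 1 < r := by omega
  set i := L.length with hi
  have hpos : ∀ j ∈ b.blocks, 0 < j := fun j hj => b.blocks_pos hj
  have hk0 : 0 < k := hpos k (by simp [hb, LocGen.tgt])
  have hl0 : 0 < l := hpos l (by simp [hb, LocGen.tgt])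
  have hwt : ∀ q : Fin r, wt I q = a.blocks.getD q 0 := fun q => congrFun hI q
  have hbl : b.blocks.getD (i + 1) 0 = l := by simp [hb, LocGen.tgt, hi, List.getD]
  have hshift : ∀ q : Fin r, i + 1 ≤ q.val → wt I q = b.blocks.getD (q + 1) 0 := by
    intro q hq
    obtain ⟨t, ht⟩ : ∃ t, q.val = i + 1 + t := ⟨q.val - (i + 1), by omega⟩
    rw [hwt, ht, ha, hb]
    simp only [LocGen.src, LocGen.tgt, List.getD]
    rw [List.append_assoc, List.append_assoc, List.getElem?_append_right (l₁ := L) (by omega),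
      List.getElem?_append_right (l₁ := L) (by omega),
      show i + 1 + t - L.length = t + 1 by omega, show i + 1 + t + 1 - L.length = t + 2 by omega]
    simp
  obtain ⟨m, hm⟩ : ∃ m, r - 1 - i = m + 1 := ⟨r - 2 - i, by omega⟩
  -- There is room for the gap: `a` has one part less than `b`, so fewer than `r` parts, and the
  -- last label is unused.
  obtain ⟨J, h1, h2, h3, h4, h5, h6⟩ := fProd_shift (fun q => b.blocks.getD q 0) m (i + 1) hp I
    (by omega) (by
      rw [← Finset.card_eq_zero, card_fib, hwt, List.getD_eq_default]
      simp only; omega)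
    fun q hq _ => hshift q hq
  obtain ⟨k₁, k₂, hk, hk1⟩ := finRange_split i hp
  obtain ⟨n1, n2, n3, n4, hne⟩ := notMem_of_split hk
  have hI' : (List.finRange r).map (wt I) = _ := map_wt_of_hat hI
  have hfJ : fib J ⟨i, by omega⟩ = fib I ⟨i, by omega⟩ := h5 _ (by simp)
  have hkI : wt I ⟨i, by omega⟩ = k + l := by
    rw [hwt]; simp [ha, LocGen.src, hi, List.getD]
  have hk₁ : k₁.map (wt J) = L := by
    rw [ha, hk] at hI'
    simp only [List.map_append, LocGen.src, List.append_assoc] at hI'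
    rw [← (List.append_inj hI' (by simp [hk1, hi])).1]
    refine List.map_congr_left fun q hq => ?_
    rw [← card_fib, h5, card_fib]
    obtain ⟨t, ht, rfl⟩ := List.mem_iff_getElem.1 hq
    have : (List.finRange r)[t]'(by rw [hk]; simp; omega) = k₁[t] := by
      simp only [hk]
      rw [List.getElem_append_left]
    rw [← this]
    simp; omega
  -- Opening the gap keeps the list of nonempty blocks, so the sizes beyond the gap are found by
  -- cancelling the common initial part.
  have hk₂ : erase0 (k₂.map (wt J)) = R := by
    have e1 := blocksOf_card J
    rw [h2, blocksOf_card, hI', hk] at e1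
    simp only [List.map_append, List.map_cons, hk₁, ha, erase0_append, LocGen.src] at e1
    have hLp : erase0 L = L := erase0_eq_self fun j hj => a.blocks_pos (by simp [ha, hj])
    have hRp : erase0 R = R := erase0_eq_self fun j hj => a.blocks_pos (by simp [ha, hj])
    have e2 : wt J ⟨i, by omega⟩ = k + l := by rw [← card_fib, hfJ, card_fib, hkI]
    have e3 : wt J ⟨i + 1, hp⟩ = 0 := by rw [← card_fib, h4, Finset.card_empty]
    rw [e2, e3, hLp, hRp, List.append_assoc, List.append_assoc] at e1
    have e4 := List.append_cancel_left e1
    have hkl : 0 < k + l := by omega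
    simp [erase0, hkl] at e4
    rw [erase0, ← e4]
  have hk₂s : (k₂.map (wt J)).sum = R.sum := by rw [← erase0_sum, hk₂]
  have e : schurRep r r (fProd i b) (mono I) =
      ∑ T ∈ (fib I ⟨i, by omega⟩).powersetCard l, mono (move T ⟨i + 1, hp⟩ J) := by
    rw [schurRep_fProd, hm, List.range'_succ, List.map_cons, List.prod_cons, Module.End.mul_apply,
      h1, opF, dif_pos hp, hbl, divPow_opD_mono hne.symm, hfJ]
  have hf : ∀ T ∈ (fib I ⟨i, by omega⟩).powersetCard l, ∀ c : Fin r, c ≠ ⟨i, by omega⟩ →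
      c ≠ ⟨i + 1, hp⟩ → fib (move T ⟨i + 1, hp⟩ J) c = fib J c := by
    intro T hT c h1 h2
    rw [fib_move_ne _ h2, Finset.sdiff_eq_self_of_disjoint]
    exact (disjoint_fib J h1).mono_right (by rw [hfJ]; exact (Finset.mem_powersetCard.1 hT).1)
  refine ⟨?_, ?_⟩
  swap
  · rw [e]
    refine Submodule.sum_mem _ fun T hT => mono_mem_weightSpace ?_
    funext q
    have hq : (hat b).1.1 q = b.blocks.getD q 0 := rfl
    rw [hq]
    rcases lt_trichotomy q.val i with hqi | hqi | hqi
    · rw [wt_congr_fib (hf T hT q (by rw [Ne, Fin.ext_iff]; simp; omega)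
        (by rw [Ne, Fin.ext_iff]; simp; omega)), wt_congr_fib (h5 q (by omega)), hwt, ha, hb]
      simp only [List.getD, List.append_assoc]
      rw [List.getElem?_append_left (by omega), List.getElem?_append_left (by omega)]
    · have hqe : q = ⟨i, by omega⟩ := Fin.ext hqi
      rw [hqe]
      rw [Finset.mem_powersetCard] at hT
      rw [← card_fib, fib_move_ne _ hne, hfJ, Finset.card_sdiff_of_subset hT.1, hT.2, card_fib,
        hkI]
      simp [hb, LocGen.tgt, hi, List.getD]
    · rcases Nat.lt_or_ge (i + 1) q.val with hq1 | hq1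
      · obtain ⟨t, ht⟩ : ∃ t, q.val = t + 1 := ⟨q.val - 1, by omega⟩
        have hq' : q = ⟨t + 1, by omega⟩ := Fin.ext ht
        rw [wt_congr_fib (hf T hT q (by rw [Ne, Fin.ext_iff]; simp; omega)
          (by rw [Ne, Fin.ext_iff]; simp; omega)), hq', wt_congr_fib (h6 t (by omega) (by omega)),
          hshift ⟨t, by omega⟩ (by simp only; omega)]
      · have hqe : q = ⟨i + 1, hp⟩ := Fin.ext (by simp only; omega)
        rw [hqe]
        rw [← card_fib, fib_move_self, h4, Finset.empty_union, (Finset.mem_powersetCard.1 hT).2]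
        exact hbl.symm
  have hs := a.blocks_sum
  rw [ha] at hs
  simp only [LocGen.src, List.sum_append, List.sum_cons, List.sum_nil] at hs
  have eJ : toBlocks r r (mono J) = st (k₁.map (fib J) ++
      fib I ⟨i, by omega⟩ :: k₂.map (fib J)) (mono (parMono J)) := by
    rw [toBlocks_mono, hk]
    simp only [List.map_append, List.map_cons, hfJ, h4]
    have := st_nil_mid (k₁.map (fib J) ++ [fib I ⟨i, by omega⟩]) (k₂.map (fib J))
    simp only [List.append_assoc, List.singleton_append] at this
    rw [this]
  have := opWeb_wSplit (B₁ := k₁.map (fib J)) (A := fib I ⟨i, by omega⟩)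
    (B₂ := k₂.map (fib J)) (L := L) (R := k₂.map (wt J)) (k := k) (l := l) (mono (parMono J)) rfl
    (by rw [map_card_fib, hk₁]) hkI (map_card_fib _ _) (by simp [hk₂s]; omega)
  rw [wSplit, if_neg (by omega)] at this
  rw [← toBlocks_mono_congr h2 h3, eJ, ι_loc_eq,
    wLoc_congr (L' := L) (R' := k₂.map (wt J)) _ rfl
      (by rw [hk₂]; exact erase0_eq_self fun j hj => a.blocks_pos (by simp [ha, hj])), this, e,
    map_sum]
  refine Finset.sum_congr rfl fun T hT => ?_
  rw [toBlocks_mono, hk, parMono_move]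
  simp only [List.map_append, List.map_cons, map_fib_congr n1 n2 (hf T hT),
    map_fib_congr n3 n4 (hf T hT),
    fib_move_self, h4, fib_move_ne J hne, hfJ, Finset.empty_union]

theorem toBlocks_dot (L R : List ℕ) (k : ℕ) (a b : Composition r)
    (ha : a.blocks = L ++ (LocGen.dot k).src ++ R)
    (hb : b.blocks = L ++ (LocGen.dot k).tgt ++ R) (I : Mono r r)
    (hI : wt I = (hat a).1.1) :
    toBlocks r r (schurRep r r (schurH r r L.length) (mono I)) =
      opWeb (FreeAlgebra.ι ℂ (.loc L (.dot k) R a b ha hb)) (toBlocks r r (mono I)) ∧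
    schurRep r r (schurH r r L.length) (mono I) ∈ weightSpace (hat b).1 := by
  have hlen : a.blocks.length ≤ r := a.length_le
  have hlen' : a.blocks.length = L.length + 1 + R.length := by simp [ha, LocGen.src]; omega
  have hp : L.length < r := by omega
  obtain ⟨k₁, k₂, hk, hk1⟩ := finRange_split_one L.length hp
  have hw := map_wt_of_hat hI
  rw [hk, ha] at hw
  simp only [List.map_append, List.map_cons, LocGen.src, List.append_assoc, List.cons_append,
    List.nil_append] at hw
  obtain ⟨hw1, hw2⟩ := List.append_inj hw (by simp [hk1])
  simp only [List.cons.injEq] at hw2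
  obtain ⟨hwk, hw2⟩ := hw2
  have hs := a.blocks_sum
  rw [ha] at hs
  simp only [LocGen.src, List.sum_append, List.sum_cons, List.sum_nil] at hs
  have := opWeb_window_dot (B₁ := []) (B₂ := []) (L := L) (R := k₂.map (wt I)) k₁ k₂
    ⟨L.length, hp⟩ I (by simp [hw1]) hwk (by simp) (by simp [hw2]; omega)
  have e := schurRep_schurH (n := r) (r := r) ⟨L.length, hp⟩
  simp only at e
  have hR : erase0 R = erase0 (k₂.map (wt I)) := by rw [hw2, erase0_append]; simp [erase0]
  refine ⟨by rw [e, ι_loc_eq, toBlocks, hk, ← this, wDot, wLoc_congr _ rfl hR], ?_⟩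
  obtain rfl : b = a := Composition.ext (hb.trans ha.symm)
  rw [e, opD_mono]
  refine Submodule.sum_mem _ fun p _ => ?_
  split_ifs with hp
  · refine Submodule.smul_mem _ _ (mono_mem_weightSpace ?_)
    rw [← hI]
    refine wt_congr fun q => ?_
    by_cases hq : q = p
    · subst hq; simp [hp]
    · simp [hq]
  · exact Submodule.zero_mem _

theorem hasType_of_wt {I : Mono r r} {a : Composition r} (h : wt I = (hat a).1.1) :
    HasType ((List.finRange r).map (fib I)) a.blocks := by
  rw [HasType, map_card_fib, map_wt_of_hat h, erase0_append]
  simp [erase0]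

theorem schurRep_schurOne_mono (a : Composition r) (I : Mono r r) :
    schurRep r r (schurOne (hat a).1) (mono I) = if wt I = (hat a).1.1 then mono I else 0 := by
  rw [schurRep_schurOne, opOne, onMono_mono]

theorem schurRep_genElt_of_ne (g : WebGen r) (I : Mono r r) (h : wt I ≠ (hat g.src).1.1) :
    schurRep r r (genElt g) (mono I) = 0 := by
  rcases g with a | ⟨L, ⟨k, l⟩ | ⟨k, l⟩ | k, R, a, b, ha, hb⟩
  · rw [genElt, schurRep_schurOne_mono, if_neg (show wt I ≠ (hat a).1.1 from h)]
  all_goals rw [genElt, map_mul, Module.End.mul_apply, schurRep_schurOne_mono,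
    if_neg (show wt I ≠ (hat a).1.1 from h), map_zero]

theorem toBlocks_genElt_aux (g : WebGen r) (I : Mono r r) (h : wt I = (hat g.src).1.1) :
    toBlocks r r (schurRep r r (genElt g) (mono I)) =
      opWeb (FreeAlgebra.ι ℂ g) (toBlocks r r (mono I)) ∧
    schurRep r r (genElt g) (mono I) ∈ weightSpace (hat g.tgt).1 := by
  rcases g with a | ⟨L, x, R, a, b, ha, hb⟩
  · simp only [WebGen.src] at h
    rw [genElt, schurRep_schurOne_mono, if_pos h, ι_one_eq, toBlocks_mono,
      opWeb_wOne _ _ _ (hasType_of_wt h) a.blocks_sum]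
    exact ⟨rfl, mono_mem_weightSpace h⟩
  · simp only [WebGen.src] at h
    rcases x with ⟨k, l⟩ | ⟨k, l⟩ | k
    · rw [genElt, map_mul, Module.End.mul_apply, schurRep_schurOne_mono, if_pos h]
      exact toBlocks_merge L R k l a b ha hb I h
    · rw [genElt, map_mul, Module.End.mul_apply, schurRep_schurOne_mono, if_pos h]
      exact toBlocks_split L R k l a b ha hb I h
    · rw [genElt, map_mul, Module.End.mul_apply, schurRep_schurOne_mono, if_pos h]
      exact toBlocks_dot L R k a b ha hb I h

/-- For other weights both sides must vanish. Here trailing zeros are essential: otherwise the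
fibres could have the type of the bottom of `g` although the weight is different. -/
theorem toBlocks_genElt (g : WebGen r) (I : Mono r r) (hI : Trailing I) :
    toBlocks r r (schurRep r r (genElt g) (mono I)) =
      opWeb (FreeAlgebra.ι ℂ g) (toBlocks r r (mono I)) := by
  by_cases h : wt I = (hat g.src).1.1
  · exact (toBlocks_genElt_aux g I h).1
  · rw [schurRep_genElt_of_ne g I h, map_zero, toBlocks_mono]
    have hT := mt (hasType_iff hI g.src).1 h
    rcases g with a | ⟨L, x, R, a, b, ha, hb⟩
    · have hT' : ¬ HasType ((List.finRange r).map (fib I)) a.blocks := hT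
      rw [ι_one_eq, opWeb_wOne_zero _ _ _ hT']
    · rw [ι_loc_eq, opWeb_wLoc_zero]
      rw [← ha]
      exact hT

theorem tens_induction {p : Tens n r → Prop} (v : Tens n r) (zero : p 0)
    (add : ∀ u v, p u → p v → p (u + v)) (smul : ∀ (c : ℂ) I, p (c • mono I)) : p v := by
  have : ∀ v : Mono n r →₀ ℂ, p v := by
    intro v
    induction v using Finsupp.induction_linear with
    | zero => exact zero
    | add f g hf hg => exact add f g hf hg
    | single I c =>
      have : (Finsupp.single I c : Mono n r →₀ ℂ) = c • Finsupp.single I 1 := by simp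
      rw [this]
      exact smul c I
  exact this v

theorem schurRep_genElt_mem (g : WebGen r) (v : Tens r r) :
    schurRep r r (genElt g) v ∈ weightSpace (hat g.tgt).1 := by
  induction v using tens_induction with
  | zero => rw [map_zero]; exact Submodule.zero_mem _
  | add f g hf hg => rw [map_add]; exact Submodule.add_mem _ hf hg
  | smul c I =>
    rw [map_smul]
    refine Submodule.smul_mem _ _ ?_
    by_cases h : wt I = (hat g.src).1.1
    · exact (toBlocks_genElt_aux g I h).2
    · rw [schurRep_genElt_of_ne g I h]; exact Submodule.zero_mem _

end TypeQ

end


/-! ### The operators supercommute with the Sergeev superalgebra. -/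

noncomputable section

namespace TypeQ

variable {r n : ℕ}

theorem opAt_opS_left (a b : Fin n) (d : ZMod 2) (i : ℕ) (hi : i + 1 < r) :
    opAt a b d ⟨i, by omega⟩ * opS i hi = opS i hi * opAt a b d ⟨i + 1, hi⟩ := by
  refine end_ext fun I => ?_
  have hne : (⟨i, by omega⟩ : Fin r) ≠ ⟨i + 1, hi⟩ := by simp [Fin.ext_iff]
  by_cases hb : (I ⟨i + 1, hi⟩).1 = b <;>
    simp only [opAt, opS, Module.End.mul_apply, onMono_mono, hb, if_true, if_false, map_smul,
      map_zero, Function.comp_apply, Equiv.swap_apply_left, smul_zero, smul_smul,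
      Function.update_self, Function.update_of_ne hne]
  rw [prePar_swap _ _ _ _ (by simp), prePar_succ]
  congr 1
  · rw [ksign_add, ksign_add, ksign_comm d (I ⟨i, by omega⟩).2]
    linear_combination (-ksign (I ⟨i, by omega⟩).2 (I ⟨i + 1, hi⟩).2 *
      ksign d (prePar I ⟨i, by omega⟩)) * ksign_mul_self (I ⟨i, by omega⟩).2 d
  · congr 1
    funext s
    by_cases h1 : s = ⟨i, by omega⟩
    · subst h1; simp
    · by_cases h2 : s = ⟨i + 1, hi⟩
      · subst h2; simp [hne, hne.symm]
      · simp [h1, h2, Equiv.swap_apply_of_ne_of_ne h1 h2]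

/-- A signed swap permutes the places at which the operator is applied. Summing over all places, as
in `opD`, removes the dependence on the permutation. -/
theorem opAt_opS (a b : Fin n) (d : ZMod 2) (i : ℕ) (hi : i + 1 < r) (p : Fin r) :
    opAt a b d p * opS i hi =
      opS i hi * opAt a b d (Equiv.swap (⟨i, by omega⟩ : Fin r) ⟨i + 1, hi⟩ p) := by
  by_cases h1 : p = ⟨i, by omega⟩
  · rw [h1, Equiv.swap_apply_left, opAt_opS_left]
  by_cases h2 : p = ⟨i + 1, hi⟩
  · rw [h2, Equiv.swap_apply_right]
    -- The case of the right place follows from that of the left place by conjugation with the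
    -- involution `opS i hi`.
    have h := congrArg (fun x => opS i hi * x * opS i hi) (opAt_opS_left a b d i hi)
    beta_reduce at h
    rw [← mul_assoc, mul_assoc _ (opS i hi) (opS i hi), opS_sq, mul_one, ← mul_assoc (opS i hi),
      opS_sq, one_mul] at h
    exact h.symm
  rw [Equiv.swap_apply_of_ne_of_ne h1 h2]
  refine end_ext fun I => ?_
  by_cases hb : (I p).1 = b <;>
    simp only [opAt, opS, Module.End.mul_apply, onMono_mono, hb, if_true, if_false, map_smul,
      map_zero, Function.comp_apply, smul_zero, smul_smul, Equiv.swap_apply_of_ne_of_ne h1 h2,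
      Function.update_of_ne (Ne.symm h1), Function.update_of_ne (Ne.symm h2)]
  rw [prePar_swap _ _ _ _ (fun h => h2 (Fin.ext h)), mul_comm]
  congr 2
  funext s
  by_cases hs : s = p
  · subst hs; simp [Equiv.swap_apply_of_ne_of_ne h1 h2]
  · have : Equiv.swap (⟨i, by omega⟩ : Fin r) ⟨i + 1, hi⟩ s ≠ p := by
      rw [Equiv.swap_apply_def]
      split_ifs
      exacts [Ne.symm h2, Ne.symm h1, hs]
    simp [hs, this]

theorem opD_opS (a b : Fin n) (d : ZMod 2) (i : ℕ) (hi : i + 1 < r) :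
    opD a b d * opS i hi = opS i hi * opD a b d := by
  rw [opD, Finset.sum_mul, Finset.mul_sum]
  simp_rw [opAt_opS]
  exact Equiv.sum_comp (Equiv.swap (⟨i, by omega⟩ : Fin r) ⟨i + 1, hi⟩)
    fun p => opS i hi * opAt a b d p

/-- At different places the sign is that of the prefix parities. At the same place both operators
shift the parity, and the sign `(-1)^{|u|}` in `P` changes by `(-1)^d` when the parity of the
tensorand is shifted by `d`. -/
theorem opAt_opC (a b : Fin n) (d : ZMod 2) (p j : Fin r) :
    opAt a b d p * opC j = ksign d 1 • (opC j * opAt a b d p) := by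
  refine end_ext fun I => ?_
  by_cases hpj : p = j
  · subst hpj
    by_cases hb : (I p).1 = b <;>
      simp only [opAt, opC, Module.End.mul_apply, LinearMap.smul_apply, onMono_mono, hb, if_true,
        if_false, map_smul, map_zero, smul_zero, smul_smul, Function.update_self, prePar_update,
        lt_irrefl, add_zero, Function.update_idem, ksign_add]
    rw [add_right_comm, ksign_comm 1 d]
    congr 1
    linear_combination (-ksign 1 (prePar I p) * ksign 1 (I p).2 * Complex.I *
      ksign d (prePar I p)) * ksign_mul_self d 1
  by_cases hb : (I p).1 = b <;>
    simp only [opAt, opC, LinearMap.smul_apply, Module.End.mul_apply, onMono_mono, hb, if_true,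
      if_false, map_smul, map_zero, Function.update_of_ne hpj, Function.update_of_ne (Ne.symm hpj),
      smul_zero, prePar_update, ksign_add, smul_smul]
  rw [Function.update_comm hpj]
  congr 1
  rcases lt_or_gt_of_ne hpj with h | h
  · simp only [h, h.not_gt, if_true, if_false, ksign_zero_right]
    rw [ksign_comm 1 d]
    linear_combination (-ksign 1 (prePar I j) * ksign d (prePar I p) * ksign 1 (I j).2 *
      Complex.I) * ksign_mul_self d 1
  · simp only [h, h.not_gt, if_true, if_false, ksign_zero_right]
    ring

theorem opD_opC (a b : Fin n) (d : ZMod 2) (j : Fin r) :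
    opD a b d * opC j = ksign d 1 • (opC j * opD a b d) := by
  rw [opD, Finset.sum_mul, Finset.mul_sum, Finset.smul_sum]
  exact Finset.sum_congr rfl fun p _ => opAt_opC a b d p j

theorem opOne_sergeevOp (l : Weight n r) (g : SergeevGen r) :
    opOne l * sergeevOp g = sergeevOp g * opOne l := by
  refine end_ext fun I => ?_
  cases g with
  | s i hi =>
    simp only [sergeevOp, opS, opOne, Module.End.mul_apply, onMono_mono, map_smul, wt_swap]
    split_ifs <;> simp
  | c j =>
    have : wt (Function.update I j ((I j).1, (I j).2 + 1)) = wt I :=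
      wt_congr fun p => by
        by_cases h : p = j
        · subst h; simp
        · simp [h]
    simp only [sergeevOp, opC, opOne, Module.End.mul_apply, onMono_mono, map_smul, this]
    split_ifs <;> simp

theorem sergeevRep_word (w : List (SergeevGen r)) :
    sergeevRep n r (Presented.mk (SergeevRel r) (w.map (FreeAlgebra.ι ℂ)).prod) =
      (w.map sergeevOp).prod := by
  rw [sergeevRep, Presented.lift_mk, map_list_prod, List.map_map]
  congr 1
  exact List.map_congr_left fun g _ => by simp

/-- An operator which supercommutes with the generators supercommutes with the Sergeev
superalgebra. -/
theorem mem_homPart_of_gen {F : Module.End ℂ (Tens n r)} {d : ZMod 2}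
    (hp : ∀ j, ∀ m ∈ tensParity n r j, F m ∈ tensParity n r (d + j))
    (h : ∀ g : SergeevGen r, F * sergeevOp g = ksign d g.par • (sergeevOp g * F)) :
    F ∈ homPart (sergeevParity r) (tensParity n r) (tensParity n r) d := by
  refine ⟨hp, fun k x hx m => ?_⟩
  have hw : ∀ w : List (SergeevGen r), F * (w.map sergeevOp).prod =
      ksign d (w.map SergeevGen.par).sum • ((w.map sergeevOp).prod * F) := by
    intro w
    induction w with
    | nil => simp
    | cons g w ih =>
      rw [List.map_cons, List.prod_cons, ← mul_assoc, h g, smul_mul_assoc, mul_assoc, ih,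
        List.map_cons, List.sum_cons, ksign_add, mul_smul_comm, smul_smul, mul_assoc]
  simp only [sergeev_smul_def]
  induction hx using Submodule.span_induction with
  | mem x hx =>
    obtain ⟨w, rfl, rfl⟩ := hx
    rw [sergeevRep_word]
    exact congrArg (fun f : Module.End ℂ (Tens n r) => f m) (hw w)
  | zero => simp
  | add x y _ _ hx hy => simp [hx, hy]
  | smul c x _ hx => simp only [map_smul, LinearMap.smul_apply, hx, smul_comm c]

theorem mono_mem_tensParity {I : Mono n r} {i : ZMod 2} (h : ∑ p, (I p).2 = i) :
    mono I ∈ tensParity n r i := Submodule.subset_span ⟨I, h, rfl⟩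

theorem sum_par_update (I : Mono n r) (p : Fin r) (a : Fin n) (d : ZMod 2) :
    ∑ q, (Function.update I p (a, (I p).2 + d) q).2 = d + ∑ q, (I q).2 := by
  have : ∀ q, (Function.update I p (a, (I p).2 + d) q).2 =
      (if q = p then d else 0) + (I q).2 := by
    intro q
    by_cases h : q = p
    · subst h; simp [add_comm]
    · simp [h]
  simp [this, Finset.sum_add_distrib]

theorem opD_mem_homPart (a b : Fin n) (d : ZMod 2) :
    opD a b d ∈ homPart (sergeevParity r) (tensParity n r) (tensParity n r) d := by
  refine mem_homPart_of_gen (fun j m hm => ?_) fun g => ?_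
  · induction hm using Submodule.span_induction with
    | mem x hx =>
      obtain ⟨I, rfl, rfl⟩ := hx
      rw [opD_mono]
      refine Submodule.sum_mem _ fun p _ => ?_
      split_ifs
      · exact Submodule.smul_mem _ _ (mono_mem_tensParity (sum_par_update I p a d))
      · exact Submodule.zero_mem _
    | zero => rw [map_zero]; exact Submodule.zero_mem _
    | add x y _ _ hx hy => rw [map_add]; exact Submodule.add_mem _ hx hy
    | smul c x _ hx => rw [map_smul]; exact Submodule.smul_mem _ _ hx
  · cases g with
    | s i hi => simp [sergeevOp, SergeevGen.par, opD_opS]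
    | c j => exact opD_opC a b d j

theorem opOne_mem_homPart (l : Weight n r) :
    opOne l ∈ homPart (sergeevParity r) (tensParity n r) (tensParity n r) 0 := by
  refine mem_homPart_of_gen (fun j m hm => ?_) fun g => ?_
  · rw [zero_add]
    induction hm using Submodule.span_induction with
    | mem x hx =>
      obtain ⟨I, rfl, rfl⟩ := hx
      rw [opOne, onMono_mono]
      split_ifs
      · exact mono_mem_tensParity rfl
      · exact Submodule.zero_mem _
    | zero => rw [map_zero]; exact Submodule.zero_mem _
    | add x y _ _ hx hy => rw [map_add]; exact Submodule.add_mem _ hx hy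
    | smul c x _ hx => rw [map_smul]; exact Submodule.smul_mem _ _ hx
  · rw [ksign_zero_left, one_smul, opOne_sergeevOp]

/-- The even operators on `V^{⊗ r}` which commute with the Sergeev superalgebra. -/
def evenComm (n r : ℕ) : Subalgebra ℂ (Module.End ℂ (Tens n r)) :=
  (homPart (sergeevParity r) (tensParity n r) (tensParity n r) 0).toSubalgebra
    ⟨fun j m hm => by simpa using hm, fun k x _ m => by simp⟩
    fun f g hf hg => by simpa using homPart_mul _ _ hf hg

theorem opE_mem (p : ℕ) : opE p ∈ evenComm n r := by
  unfold opE
  split_ifs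
  · exact opD_mem_homPart _ _ 0
  · exact Subalgebra.zero_mem _

theorem opF_mem (p : ℕ) : opF p ∈ evenComm n r := by
  unfold opF
  split_ifs
  · exact opD_mem_homPart _ _ 0
  · exact Subalgebra.zero_mem _

theorem divPow_mem {A : Type} [Ring A] [Algebra ℂ A] (S : Subalgebra ℂ A) {x : A} (hx : x ∈ S)
    (k : ℕ) : divPow x k ∈ S := S.smul_mem (pow_mem hx k) _

/-- Merges and splits are products of even operators from the subalgebra `evenComm`; only the dot
involves an odd operator. -/
theorem schurRep_genElt_mem_homPart (g : WebGen r) : schurRep r r (genElt g) ∈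
    homPart (sergeevParity r) (tensParity r r) (tensParity r r) g.par := by
  rcases g with a | ⟨L, ⟨k, l⟩ | ⟨k, l⟩ | k, R, a, b, ha, hb⟩
  · rw [genElt, schurRep_schurOne]
    exact opOne_mem_homPart _
  · have h : schurRep r r (eProd L.length a * schurOne (hat a).1) ∈ evenComm r r := by
      rw [map_mul, schurRep_eProd, schurRep_schurOne]
      refine mul_mem (list_prod_mem fun x hx => ?_) (opOne_mem_homPart _)
      obtain ⟨p, -, rfl⟩ := List.mem_map.1 (List.mem_reverse.1 hx)
      exact divPow_mem _ (opE_mem p) _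
    exact h
  · have h : schurRep r r (fProd L.length b * schurOne (hat a).1) ∈ evenComm r r := by
      rw [map_mul, schurRep_fProd, schurRep_schurOne]
      refine mul_mem (list_prod_mem fun x hx => ?_) (opOne_mem_homPart _)
      obtain ⟨p, -, rfl⟩ := List.mem_map.1 hx
      exact divPow_mem _ (opF_mem p) _
    exact h
  · have hlen : a.blocks.length ≤ r := a.length_le
    have hp : L.length < r := by
      have : a.blocks.length = L.length + 1 + R.length := by simp [ha, LocGen.src]; omega
      omega
    have e := schurRep_schurH (n := r) (r := r) ⟨L.length, hp⟩
    simp only at e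
    rw [genElt, map_mul, e, schurRep_schurOne]
    have := homPart_mul _ _ (opD_mem_homPart (r := r) (⟨L.length, hp⟩ : Fin r) ⟨L.length, hp⟩ 1)
      (opOne_mem_homPart (hat a).1)
    rwa [add_zero] at this

end TypeQ

end


noncomputable section

namespace TypeQ

variable {r n : ℕ}

/-! ## The sum of the permutation supermodules inside the tensor space -/

theorem permIncl_permOf (l : Weight' r) (m : permMod l.1) : permIncl r (permOf l m) = m :=
  DirectSum.toModule_lof ℂ (M := fun l : Weight' r => permMod l.1) l m

theorem opOne_of_mem {l : Weight n r} {v : Tens n r} (hv : v ∈ weightSpace l) : opOne l v = v := by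
  induction hv using Submodule.span_induction with
  | mem x hx => obtain ⟨I, hI, rfl⟩ := hx; rw [opOne, onMono_mono, if_pos hI]
  | zero => rw [map_zero]
  | add x y _ _ hx hy => rw [map_add, hx, hy]
  | smul c x _ hx => rw [map_smul, hx]

theorem opOne_of_mem_ne {l m : Weight n r} (h : l ≠ m) {v : Tens n r} (hv : v ∈ weightSpace l) :
    opOne m v = 0 := by
  induction hv using Submodule.span_induction with
  | mem x hx =>
    obtain ⟨I, hI, rfl⟩ := hx
    rw [opOne, onMono_mono, if_neg]
    rw [hI]
    exact fun e => h (Subtype.ext e)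
  | zero => rw [map_zero]
  | add x y _ _ hx hy => rw [map_add, hx, hy, add_zero]
  | smul c x _ hx => rw [map_smul, hx, smul_zero]

theorem opOne_mem (l : Weight n r) (v : Tens n r) : opOne l v ∈ weightSpace l := by
  induction v using tens_induction with
  | zero => rw [map_zero]; exact Submodule.zero_mem _
  | add f g hf hg => rw [map_add]; exact Submodule.add_mem _ hf hg
  | smul c I =>
    rw [map_smul, opOne, onMono_mono]
    refine Submodule.smul_mem _ _ ?_
    split_ifs with h
    · exact mono_mem_weightSpace h
    · exact Submodule.zero_mem _

/-- The projection of `V^{⊗ r}` onto `M^λ`, as a map to `M^λ`. -/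
def toPermMod (l : Weight n r) : Tens n r →ₗ[ℂ] permMod l where
  toFun v := ⟨opOne l v, opOne_mem l v⟩
  map_add' u v := Subtype.ext (map_add (opOne l) u v)
  map_smul' c v := Subtype.ext (map_smul (opOne l) c v)

theorem coe_toPermMod (l : Weight n r) (v : Tens n r) : (toPermMod l v : Tens n r) = opOne l v :=
  rfl

open scoped Classical in
/-- The retraction of `V^{⊗ r}` onto `⨁_{λ ∈ Λ'(r)} M^λ`. -/
def permRetr (r : ℕ) : Tens r r →ₗ[ℂ] PermSum r := ∑ l : Weight' r, permOf l ∘ₗ toPermMod l.1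

open scoped Classical in
theorem permRetr_permOf (l : Weight' r) (m : permMod l.1) : permRetr r m = permOf l m := by
  rw [permRetr, LinearMap.sum_apply, Finset.sum_eq_single l]
  · rw [LinearMap.comp_apply]
    congr 1
    exact Subtype.ext (opOne_of_mem m.2)
  · intro l' _ h
    rw [LinearMap.comp_apply]
    have : toPermMod l'.1 (m : Tens r r) = 0 :=
      Subtype.ext (opOne_of_mem_ne (fun e => h (Subtype.ext e.symm)) m.2)
    rw [this, map_zero]
  · simp

theorem permSum_induction {p : PermSum r → Prop} (m : PermSum r) (zero : p 0)
    (permOf : ∀ l x, p (permOf l x)) (add : ∀ x y, p x → p y → p (x + y)) : p m :=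
  DirectSum.induction_on m zero permOf fun x y hx hy => add x y hx hy

theorem permRetr_permIncl (m : PermSum r) : permRetr r (permIncl r m) = m := by
  induction m using permSum_induction with
  | zero => simp
  | permOf l x => rw [permIncl_permOf, permRetr_permOf]
  | add x y hx hy => rw [map_add, map_add, hx, hy]

/-- Identities in the direct sum can therefore be checked inside `V^{⊗ r}`. -/
theorem permIncl_injective : Function.Injective (permIncl r) :=
  Function.LeftInverse.injective permRetr_permIncl

theorem permIncl_permRetr (l : Weight' r) {v : Tens r r} (hv : v ∈ weightSpace l.1) :
    permIncl r (permRetr r v) = v := by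
  have h := permRetr_permOf l ⟨v, hv⟩
  simp only at h
  rw [h, permIncl_permOf]

theorem permIncl_smul (x : Sergeev r) (m : PermSum r) :
    permIncl r (x • m) = x • permIncl r m := by
  induction m using permSum_induction with
  | zero => simp
  | permOf l y =>
    have : x • permOf l y = permOf l (x • y) := 
      ((DirectSum.lof (Sergeev r) (Weight' r) (fun l => permMod l.1) l).map_smul x y).symm
    rw [this, permIncl_permOf, permIncl_permOf]
    rfl
  | add u v hu hv => rw [smul_add, map_add, hu, hv, map_add, smul_add]

theorem opOne_permIncl (l : Weight' r) (m : PermSum r) :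
    opOne l.1 (permIncl r m) = DirectSum.component ℂ (Weight' r) (fun l => permMod l.1) l m := by
  induction m using permSum_induction with
  | zero => simp
  | permOf l' y =>
    rw [permIncl_permOf]
    by_cases h : l' = l
    · subst h
      rw [opOne_of_mem y.2, permOf, DirectSum.component.lof_self]
    · rw [opOne_of_mem_ne (fun e => h (Subtype.ext e)) y.2, permOf, DirectSum.component.of,
        dif_neg h]
      rfl
  | add u v hu hv => rw [map_add, map_add, hu, hv, map_add]; rfl

/-- The grading of the direct sum is defined by components. These are obtained from the image in
`V^{⊗ r}` by the even projections `opOne`, and the image is the sum of the components. -/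
theorem mem_permSumParity {m : PermSum r} {i : ZMod 2} :
    m ∈ permSumParity r i ↔ permIncl r m ∈ tensParity r r i := by
  constructor
  · intro h
    rw [permSumParity, Submodule.mem_iInf] at h
    have : permIncl r m = ∑ l : Weight' r,
        (DirectSum.component ℂ (Weight' r) (fun l => permMod l.1) l m : Tens r r) := by
      conv_lhs => rw [← permRetr_permIncl m]
      rw [permRetr, LinearMap.sum_apply, map_sum]
      refine Finset.sum_congr (by ext; simp) fun l _ => ?_
      rw [LinearMap.comp_apply, permIncl_permOf, coe_toPermMod, opOne_permIncl]
    rw [this]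
    exact Submodule.sum_mem _ fun l _ => h l
  · intro h
    rw [permSumParity, Submodule.mem_iInf]
    intro l
    have := (opOne_mem_homPart l.1).1 i _ h
    rw [zero_add, opOne_permIncl] at this
    exact this

theorem mem_homPart_of_permIncl {f : Module.End ℂ (PermSum r)} {F : Module.End ℂ (Tens r r)}
    {i : ZMod 2} (hF : F ∈ homPart (sergeevParity r) (tensParity r r) (tensParity r r) i)
    (h : ∀ m, permIncl r (f m) = F (permIncl r m)) :
    f ∈ homPart (sergeevParity r) (permSumParity r) (permSumParity r) i := by
  refine ⟨fun j m hm => ?_, fun k x hx m => permIncl_injective ?_⟩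
  · rw [mem_permSumParity, h]
    exact hF.1 j _ (mem_permSumParity.1 hm)
  · rw [h, permIncl_smul, hF.2 k x hx, map_smul, permIncl_smul, h]

/-- The operator on `⨁_{λ ∈ Λ'(r)} M^λ` which is attached to a generating web. -/
def genEnd (g : WebGen r) : Module.End ℂ (PermSum r) :=
  permRetr r ∘ₗ schurRep r r (genElt g) ∘ₗ permIncl r

/-- The Schur element maps everything into the weight space of the top of `g`, on which the
retraction inverts the inclusion; so nothing is lost by retracting. -/
theorem permIncl_genEnd (g : WebGen r) (m : PermSum r) :
    permIncl r (genEnd g m) = schurRep r r (genElt g) (permIncl r m) :=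
  permIncl_permRetr (hat g.tgt) (schurRep_genElt_mem g _)

theorem genEnd_mem_homPart (g : WebGen r) :
    genEnd g ∈ homPart (sergeevParity r) (permSumParity r) (permSumParity r) g.par :=
  mem_homPart_of_permIncl (schurRep_genElt_mem_homPart g) (permIncl_genEnd g)

/-! ## The homomorphism from the web superalgebra -/

theorem permIncl_mem_span (m : PermSum r) :
    permIncl r m ∈ Submodule.span ℂ {v | ∃ I : Mono r r, Trailing I ∧ v = mono I} := by
  induction m using permSum_induction with
  | zero => rw [map_zero]; exact Submodule.zero_mem _
  | permOf l x =>
    rw [permIncl_permOf]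
    refine (Submodule.span_mono ?_ :
      Submodule.span ℂ {v | ∃ I : Mono r r, wt I = l.1.1 ∧ v = mono I} ≤ _) x.2
    rintro v ⟨I, hI, rfl⟩
    refine ⟨I, ?_, rfl⟩
    intro i j hij h
    rw [hI] at h ⊢
    exact l.2 i j hij h
  | add x y hx hy => rw [map_add]; exact Submodule.add_mem _ hx hy

theorem eq_filter_append_replicate {α : Type} [DecidableEq α] (l : List (Finset α))
    (h : l.Pairwise fun A B => A = ∅ → B = ∅) :
    l = (l.filter fun A => decide A.Nonempty) ++
      List.replicate (l.length - (l.filter fun A => decide A.Nonempty).length) ∅ := by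
  induction l with
  | nil => rfl
  | cons A l ih =>
    rw [List.pairwise_cons] at h
    by_cases hA : A = ∅
    · subst hA
      have e : l = List.replicate l.length ∅ :=
        List.eq_replicate_iff.2 ⟨rfl, fun B hB => h.1 B hB rfl⟩
      have hf : (l.filter fun A => decide A.Nonempty) = [] := by
        rw [e]; simp
      rw [List.filter_cons_of_neg (by simp), hf]
      simp only [List.nil_append, List.length_cons, List.length_nil, Nat.sub_zero,
        List.replicate_succ]
      rw [← e]
    · rw [List.filter_cons_of_pos (by simpa using Finset.nonempty_iff_ne_empty.2 hA)]
      simp only [List.cons_append, List.length_cons, Nat.add_sub_add_right]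
      rw [← ih h.2]

/-- With trailing zeros the list of all fibres is the list of nonempty blocks padded by empty ones
to length `r`. The blocks thus determine the labels, and `parMono` the parities. -/
theorem trailing_ext {I J : Mono r r} (hI : Trailing I) (hJ : Trailing J)
    (h : blocksOf I = blocksOf J) (h' : parMono I = parMono J) : I = J := by
  have key : ∀ I : Mono r r, Trailing I → (List.finRange r).map (fib I) =
      blocksOf I ++ List.replicate (r - (blocksOf I).length) ∅ := by
    intro I hI
    have := eq_filter_append_replicate ((List.finRange r).map (fib I)) (by
      rw [List.pairwise_map]
      refine (List.pairwise_lt_finRange r).imp fun {i j} hij hi => ?_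
      rw [← Finset.card_eq_zero, card_fib] at hi ⊢
      exact hI i j hij.le hi)
    rwa [List.length_map, List.length_finRange] at this
  have e : (List.finRange r).map (fib I) = (List.finRange r).map (fib J) := by
    rw [key I hI, key J hJ, h]
  have e' : ∀ k, fib I k = fib J k := fun k => List.map_inj_left.1 e k (List.mem_finRange k)
  funext p
  refine Prod.ext ?_ ?_
  · have : p ∈ fib I (I p).1 := mem_fib.2 rfl
    rw [e'] at this
    exact (mem_fib.1 this).symm
  · have := congrFun h' p
    simpa [parMono] using this

theorem toBlocks_mono' (I : Mono n r) : toBlocks n r (mono I) =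
    Finsupp.single (blocksOf I) (mono (parMono I)) := by
  rw [toBlocks_mono]; rfl

/-- The linear map on `V^{⊗ r}` with prescribed values on monomials. -/
def tensLift {E : Type} [AddCommGroup E] [Module ℂ E] (F : Mono n r → E) : Tens n r →ₗ[ℂ] E :=
  Finsupp.linearCombination ℂ F

theorem tensLift_mono {E : Type} [AddCommGroup E] [Module ℂ E] (F : Mono n r → E) (I : Mono n r) :
    tensLift F (mono I) = F I :=
  (Finsupp.linearCombination_single ℂ 1 I).trans (one_smul ℂ _)

open scoped Classical in
/-- A left inverse of the comparison map on the span of the monomials with trailing zeros. -/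
def ofBlocks (r : ℕ) : BlockSpace r →ₗ[ℂ] Tens r r :=
  Finsupp.lsum ℂ fun B => tensLift fun J =>
    if h : ∃ I : Mono r r, Trailing I ∧ blocksOf I = B ∧ parMono I = J then mono h.choose else 0

theorem ofBlocks_toBlocks_mono {I : Mono r r} (hI : Trailing I) :
    ofBlocks r (toBlocks r r (mono I)) = mono I := by
  have h : ∃ J : Mono r r, Trailing J ∧ blocksOf J = blocksOf I ∧ parMono J = parMono I :=
    ⟨I, hI, rfl, rfl⟩
  have e : h.choose = I :=
    trailing_ext h.choose_spec.1 hI h.choose_spec.2.1 h.choose_spec.2.2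
  rw [toBlocks_mono', ofBlocks, Finsupp.lsum_single, tensLift_mono, dif_pos h, e]

theorem toBlocks_permIncl_injective :
    Function.Injective (toBlocks r r ∘ₗ permIncl r) := by
  have : ∀ m, ofBlocks r (toBlocks r r (permIncl r m)) = permIncl r m := by
    intro m
    have hm := permIncl_mem_span m
    generalize permIncl r m = v at hm ⊢
    induction hm using Submodule.span_induction with
    | mem x hx => obtain ⟨I, hI, rfl⟩ := hx; exact ofBlocks_toBlocks_mono hI
    | zero => simp
    | add x y _ _ hx hy => simp only [map_add, hx, hy]
    | smul c x _ hx => simp only [map_smul, hx]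
  intro m m' h
  refine permIncl_injective ?_
  rw [← this m, ← this m']
  exact congrArg _ h

theorem toBlocks_permIncl_genEnd (g : WebGen r) (m : PermSum r) :
    toBlocks r r (permIncl r (genEnd g m)) =
      opWeb (FreeAlgebra.ι ℂ g) (toBlocks r r (permIncl r m)) := by
  rw [permIncl_genEnd]
  have hm := permIncl_mem_span m
  generalize permIncl r m = v at hm ⊢
  induction hm using Submodule.span_induction with
  | mem x hx => obtain ⟨I, hI, rfl⟩ := hx; exact toBlocks_genElt g I hI
  | zero => simp
  | add x y _ _ hx hy => simp only [map_add, hx, hy]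
  | smul c x _ hx => simp only [map_smul, hx]

theorem toBlocks_permIncl_lift (x : FreeAlgebra ℂ (WebGen r)) : ∀ m : PermSum r,
    toBlocks r r (permIncl r (FreeAlgebra.lift ℂ genEnd x m)) =
      opWeb x (toBlocks r r (permIncl r m)) := by
  induction x using FreeAlgebra.induction with
  | grade0 c => intro m; simp [Algebra.algebraMap_eq_smul_one]
  | grade1 g => intro m; rw [FreeAlgebra.lift_ι_apply, toBlocks_permIncl_genEnd]
  | mul a b ha hb => intro m; simp only [map_mul, Module.End.mul_apply, ha, hb]
  | add a b ha hb => intro m; simp only [map_add, LinearMap.add_apply, ha, hb]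

theorem pairwise_disjoint_map_fib (I : Mono n r) (ks : List (Fin n)) (h : ks.Nodup) :
    (ks.map (fib I)).Pairwise Disjoint := by
  rw [List.pairwise_map]
  exact h.imp fun hij => disjoint_fib I hij

theorem good_map_fib (I : Mono n r) : Good ((List.finRange n).map (fib I)) := by
  refine ⟨pairwise_disjoint_map_fib I _ (List.nodup_finRange n), ?_⟩
  rw [map_card_fib, ← List.ofFn_eq_map, List.sum_ofFn, sum_wt]

/-- The fibres of a monomial form a good list, where the relations hold in the model; injectivity of
the comparison map pulls them back. -/
theorem lift_genEnd_rel {x y : FreeAlgebra ℂ (WebGen r)} (h : WebRel r x y) :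
    FreeAlgebra.lift ℂ genEnd x = FreeAlgebra.lift ℂ genEnd y := by
  refine LinearMap.ext fun m => toBlocks_permIncl_injective ?_
  simp only [LinearMap.comp_apply, toBlocks_permIncl_lift]
  generalize permIncl r m = v
  induction v using tens_induction with
  | zero => simp
  | add u v hu hv => simp only [map_add, hu, hv]
  | smul c I => simp only [map_smul, toBlocks_mono, opWeb_rel h _ (good_map_fib I)]

/-- The operator attached to a generating web, as an element of the endomorphism superalgebra. -/
def genEndPerm (g : WebGen r) : EndPerm r :=
  ⟨genEnd g, homPart_le_superHom _ _ _ _ (genEnd_mem_homPart g)⟩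

theorem coe_lift_genEndPerm (x : FreeAlgebra ℂ (WebGen r)) :
    (FreeAlgebra.lift ℂ genEndPerm x : Module.End ℂ (PermSum r)) =
      FreeAlgebra.lift ℂ genEnd x := by
  have : (EndPerm r).val.comp (FreeAlgebra.lift ℂ genEndPerm) = FreeAlgebra.lift ℂ genEnd := by
    ext g; simp [genEndPerm]
  exact congrArg (fun f => f x) this

/-- The homomorphism from the web superalgebra to the endomorphism superalgebra. -/
def webHom (r : ℕ) : Web r →ₐ[ℂ] EndPerm r :=
  RingQuot.liftAlgHom ℂ (s := WebRel r) ⟨FreeAlgebra.lift ℂ genEndPerm, fun x y h => Subtype.ext (by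
    rw [coe_lift_genEndPerm, coe_lift_genEndPerm, lift_genEnd_rel h])⟩

theorem coe_webHom_mk (x : FreeAlgebra ℂ (WebGen r)) :
    (webHom r (Presented.mk _ x) : Module.End ℂ (PermSum r)) = FreeAlgebra.lift ℂ genEnd x := by
  rw [← coe_lift_genEndPerm]
  exact congrArg Subtype.val (RingQuot.liftAlgHom_mkAlgHom_apply ℂ _ _ _)

theorem coe_webHom_gen (g : WebGen r) :
    (webHom r (Web.gen g) : Module.End ℂ (PermSum r)) = genEnd g := by
  rw [Web.gen, coe_webHom_mk, FreeAlgebra.lift_ι_apply]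

theorem coe_webHom_one (a : Composition r) :
    (webHom r (Web.gen (.one a)) : Module.End ℂ (PermSum r)) = permProj (hat a) := by
  rw [coe_webHom_gen]
  refine LinearMap.ext fun m => permIncl_injective ?_
  rw [permIncl_genEnd, genElt, schurRep_schurOne, permProj, LinearMap.comp_apply, permIncl_permOf,
    opOne_permIncl]

theorem coe_webHom_mem_homPart {i : ZMod 2} {w : Web r} (hw : w ∈ webParity r i) :
    (webHom r w : Module.End ℂ (PermSum r)) ∈
      homPart (sergeevParity r) (permSumParity r) (permSumParity r) i := by
  induction hw using Submodule.span_induction with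
  | mem x hx =>
    obtain ⟨w, rfl, rfl⟩ := hx
    rw [coe_webHom_mk, map_list_prod, List.map_map]
    induction w with
    | nil => exact ⟨fun j m hm => by simpa using hm, fun k x _ m => by simp⟩
    | cons g w ih =>
      simp only [List.map_cons, List.prod_cons, List.sum_cons, Function.comp_apply,
        FreeAlgebra.lift_ι_apply]
      exact homPart_mul _ _ (genEnd_mem_homPart g) ih
  | zero => rw [map_zero]; exact Submodule.zero_mem _
  | add x y _ _ hx hy => rw [map_add]; exact Submodule.add_mem _ hx hy
  | smul c x _ hx => rw [map_smul]; exact Submodule.smul_mem _ _ hx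

end TypeQ

end


noncomputable section

namespace TypeQ

/-! ## Calculus in the web superalgebra -/

namespace Web

variable {r : ℕ}

/-- The identity web on the strands `L`. -/
def one (r : ℕ) (L : List ℕ) : Web r := Presented.mk _ (wOne r L)

/-- The local picture `x` between identity strands. -/
def loc (r : ℕ) (L : List ℕ) (x : LocGen) (R : List ℕ) : Web r := Presented.mk _ (wLoc r L x R)

/-- The merge of adjacent strands. -/
def merge (r : ℕ) (L : List ℕ) (k l : ℕ) (R : List ℕ) : Web r := Presented.mk _ (wMerge r L k l R)

/-- The split into adjacent strands. -/
def split (r : ℕ) (L : List ℕ) (k l : ℕ) (R : List ℕ) : Web r := Presented.mk _ (wSplit r L k l R)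

/-- The dot on a strand. -/
def dot (r : ℕ) (L : List ℕ) (k : ℕ) (R : List ℕ) : Web r := Presented.mk _ (wDot r L k R)

theorem one_congr {L L' : List ℕ} (h : erase0 L = erase0 L') : one r L = one r L' := by
  have hs : L.sum = L'.sum := by rw [← erase0_sum, h, erase0_sum]
  unfold one wOne
  simp only [hs, h]

theorem loc_congr {L L' R R' : List ℕ} (x : LocGen) (hL : erase0 L = erase0 L')
    (hR : erase0 R = erase0 R') : loc r L x R = loc r L' x R' := by
  rw [loc, wLoc_congr x hL hR, loc]

theorem gen_one (a : Composition r) : Web.gen (.one a) = one r a.blocks := by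
  rw [Web.gen, ι_one_eq, one]

theorem gen_loc (L x R) (a b : Composition r) (ha hb) :
    Web.gen (.loc L x R a b ha hb) = loc r L x R := by
  rw [Web.gen, ι_loc_eq, loc]

theorem one_eq_gen {L : List ℕ} (h : L.sum = r) : one r L =
    Web.gen (.one ⟨erase0 L, fun hi => erase0_pos hi, (erase0_sum L).trans h⟩) := by
  rw [one, wOne, dif_pos h, Web.gen]

theorem one_of_sum_ne {L : List ℕ} (h : L.sum ≠ r) : one r L = 0 := by
  rw [one, wOne, dif_neg h, map_zero]

theorem gen_one_mul_gen (b : Composition r) (g : WebGen r) :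
    Web.gen (.one b) * Web.gen g = if b = g.tgt then Web.gen g else 0 := by
  rw [Web.gen, Web.gen, ← map_mul, Presented.mk_rel (.one_left b g)]
  split_ifs <;> simp

theorem gen_mul_gen_one (a : Composition r) (g : WebGen r) :
    Web.gen g * Web.gen (.one a) = if a = g.src then Web.gen g else 0 := by
  rw [Web.gen, Web.gen, ← map_mul, Presented.mk_rel (.one_right a g)]
  split_ifs <;> simp

theorem sum_gen_one : ∑ a : Composition r, Web.gen (.one a) = (1 : Web r) := by
  have h := Presented.mk_rel (WebRel.one_sum (r := r))
  rwa [map_sum, map_one] at h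

theorem one_mul_one (L : List ℕ) : one r L * one r L = one r L := by
  by_cases h : L.sum = r
  · rw [one_eq_gen h, gen_one_mul_gen]
    exact if_pos rfl
  · rw [one_of_sum_ne h, mul_zero]

theorem one_mul_one_of_ne {L L' : List ℕ} (h : erase0 L ≠ erase0 L') : one r L * one r L' = 0 := by
  by_cases hL : L.sum = r
  · by_cases hL' : L'.sum = r
    · rw [one_eq_gen hL, one_eq_gen hL', gen_one_mul_gen, if_neg]
      exact fun e => h (congrArg Composition.blocks e)
    · rw [one_of_sum_ne hL', mul_zero]
  · rw [one_of_sum_ne hL, zero_mul]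

/-- The conditions under which a local picture is not zero. -/
def Fits (r : ℕ) (L : List ℕ) (x : LocGen) (R : List ℕ) : Prop :=
  (L ++ x.src ++ R).sum = r ∧ ∀ i ∈ x.src ++ x.tgt, 0 < i

theorem loc_of_not_fits {L R : List ℕ} {x : LocGen} (h : ¬ Fits r L x R) : loc r L x R = 0 := by
  unfold Fits at h
  rw [loc, wLoc, dif_neg h, map_zero]

theorem exists_loc_eq_gen {L R : List ℕ} {x : LocGen} (h : Fits r L x R) :
    ∃ g : WebGen r, loc r L x R = Web.gen g ∧ g.src.blocks = erase0 (L ++ x.src ++ R) ∧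
      g.tgt.blocks = erase0 (L ++ x.tgt ++ R) := by
  unfold Fits at h
  refine ⟨_, by rw [loc, wLoc, dif_pos h, ← Web.gen], ?_, ?_⟩
  · rw [erase0_append, erase0_append, erase0_eq_self (L := x.src) fun i hi => h.2 i (by simp [hi])]
    rfl
  · rw [erase0_append, erase0_append, erase0_eq_self (L := x.tgt) fun i hi => h.2 i (by simp [hi])]
    rfl

theorem loc_mul_one (L : List ℕ) (x : LocGen) (R : List ℕ) {M : List ℕ}
    (hM : erase0 M = erase0 (L ++ x.src ++ R)) : loc r L x R * one r M = loc r L x R := by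
  rw [one_congr hM]
  by_cases h : Fits r L x R
  · obtain ⟨g, hg, hs, -⟩ := exists_loc_eq_gen h
    rw [hg, one_eq_gen h.1, gen_mul_gen_one, if_pos (Composition.ext hs.symm)]
  · rw [loc_of_not_fits h, zero_mul]

theorem one_mul_loc (L : List ℕ) (x : LocGen) (R : List ℕ) {M : List ℕ}
    (hM : erase0 M = erase0 (L ++ x.tgt ++ R)) : one r M * loc r L x R = loc r L x R := by
  rw [one_congr hM]
  by_cases h : Fits r L x R
  · obtain ⟨g, hg, -, ht⟩ := exists_loc_eq_gen h
    rw [hg, one_eq_gen (by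
      rw [← h.1, List.sum_append, List.sum_append, x.sum_tgt, List.sum_append,
        List.sum_append]), gen_one_mul_gen, if_pos (Composition.ext ht.symm)]
  · rw [loc_of_not_fits h, mul_zero]

theorem loc_mul_one_of_ne {L R M : List ℕ} {x : LocGen}
    (hM : erase0 M ≠ erase0 (L ++ x.src ++ R)) : loc r L x R * one r M = 0 := by
  rw [← loc_mul_one L x R rfl, mul_assoc, one_mul_one_of_ne (Ne.symm hM), mul_zero]

theorem merge_eq_loc {L R : List ℕ} {k l : ℕ} (hk : 0 < k) (hl : 0 < l) :
    merge r L k l R = loc r L (.merge k l) R := by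
  rw [merge, wMerge, if_neg (by omega), loc]

theorem split_eq_loc {L R : List ℕ} {k l : ℕ} (hk : 0 < k) (hl : 0 < l) :
    split r L k l R = loc r L (.split k l) R := by
  rw [split, wSplit, if_neg (by omega), loc]

theorem dot_eq_loc (L R : List ℕ) (k : ℕ) : dot r L k R = loc r L (.dot k) R := rfl

theorem merge_of_zero {L R : List ℕ} {k l : ℕ} (h : k = 0 ∨ l = 0) :
    merge r L k l R = one r (L ++ (k + l) :: R) := by
  rw [merge, wMerge, if_pos h, one]

theorem split_of_zero {L R : List ℕ} {k l : ℕ} (h : k = 0 ∨ l = 0) :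
    split r L k l R = one r (L ++ (k + l) :: R) := by
  rw [split, wSplit, if_pos h, one]

theorem merge_congr {L L' R R' : List ℕ} (k l : ℕ) (hL : erase0 L = erase0 L')
    (hR : erase0 R = erase0 R') : merge r L k l R = merge r L' k l R' := by
  by_cases h : k = 0 ∨ l = 0
  · rw [merge_of_zero h, merge_of_zero h]
    refine one_congr ?_
    rw [erase0_append, erase0_append, hL, ← List.singleton_append, erase0_append, hR,
      ← erase0_append, List.singleton_append]
  · rw [merge_eq_loc (by omega) (by omega), merge_eq_loc (by omega) (by omega),
      loc_congr _ hL hR]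

theorem split_congr {L L' R R' : List ℕ} (k l : ℕ) (hL : erase0 L = erase0 L')
    (hR : erase0 R = erase0 R') : split r L k l R = split r L' k l R' := by
  by_cases h : k = 0 ∨ l = 0
  · rw [split_of_zero h, split_of_zero h]
    refine one_congr ?_
    rw [erase0_append, erase0_append, hL, ← List.singleton_append, erase0_append, hR,
      ← erase0_append, List.singleton_append]
  · rw [split_eq_loc (by omega) (by omega), split_eq_loc (by omega) (by omega),
      loc_congr _ hL hR]

theorem erase0_merge_zero {L R : List ℕ} {k l : ℕ} (h : k = 0 ∨ l = 0) :
    erase0 (L ++ (k + l) :: R) = erase0 (L ++ k :: l :: R) := by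
  rcases h with rfl | rfl <;> simp [erase0, List.filter_cons]

theorem merge_mul_one (L R : List ℕ) (k l : ℕ) :
    merge r L k l R * one r (L ++ k :: l :: R) = merge r L k l R := by
  by_cases h : k = 0 ∨ l = 0
  · rw [merge_of_zero h, one_congr (erase0_merge_zero h), one_mul_one]
  · rw [merge_eq_loc (by omega) (by omega), loc_mul_one]; simp [LocGen.src]

theorem one_mul_merge (L R : List ℕ) (k l : ℕ) :
    one r (L ++ (k + l) :: R) * merge r L k l R = merge r L k l R := by
  by_cases h : k = 0 ∨ l = 0
  · rw [merge_of_zero h, one_mul_one]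
  · rw [merge_eq_loc (by omega) (by omega), one_mul_loc]; simp [LocGen.tgt]

theorem one_mul_split (L R : List ℕ) (k l : ℕ) :
    one r (L ++ k :: l :: R) * split r L k l R = split r L k l R := by
  by_cases h : k = 0 ∨ l = 0
  · rw [split_of_zero h, one_congr (erase0_merge_zero h), one_mul_one]
  · rw [split_eq_loc (by omega) (by omega), one_mul_loc]; simp [LocGen.tgt]

theorem split_mul_one (L R : List ℕ) (k l : ℕ) :
    split r L k l R * one r (L ++ (k + l) :: R) = split r L k l R := by
  by_cases h : k = 0 ∨ l = 0
  · rw [split_of_zero h, one_mul_one]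
  · rw [split_eq_loc (by omega) (by omega), loc_mul_one]; simp [LocGen.src]

theorem interchange (L : List ℕ) (x : LocGen) (M : List ℕ) (y : LocGen) (R : List ℕ) :
    loc r L x (M ++ y.tgt ++ R) * loc r (L ++ x.src ++ M) y R =
      ksign x.par y.par • (loc r (L ++ x.tgt ++ M) y R * loc r L x (M ++ y.src ++ R)) := by
  simpa only [loc, map_mul, map_smul] using
    Presented.mk_rel (WebRel.superinterchange (r := r) L x M y R)

/-- A local picture passes a merge on its left. -/
theorem loc_mul_merge_left (L : List ℕ) (k l : ℕ) (M : List ℕ) (y : LocGen) (R : List ℕ) :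
    loc r (L ++ (k + l) :: M) y R * merge r L k l (M ++ y.src ++ R) =
      merge r L k l (M ++ y.tgt ++ R) * loc r (L ++ k :: l :: M) y R := by
  by_cases h : k = 0 ∨ l = 0
  · rw [merge_of_zero h, merge_of_zero h, loc_congr y (erase0_merge_zero h) rfl,
      loc_mul_one, one_mul_loc]
    · have := erase0_merge_zero (L := L) (R := M ++ y.tgt ++ R) h
      simpa using this
    · have := erase0_merge_zero (L := L) (R := M ++ y.src ++ R) h
      simpa using this
  · have := interchange (r := r) L (.merge k l) M y R
    rw [merge_eq_loc (by omega) (by omega), merge_eq_loc (by omega) (by omega)]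
    simp only [LocGen.par, ksign_zero_left, one_smul, LocGen.src, LocGen.tgt, List.append_assoc,
      List.cons_append, List.nil_append] at this ⊢
    exact this.symm

/-- A local picture passes a merge on its right. -/
theorem loc_mul_merge_right (L : List ℕ) (y : LocGen) (M : List ℕ) (k l : ℕ) (R : List ℕ) :
    loc r L y (M ++ (k + l) :: R) * merge r (L ++ y.src ++ M) k l R =
      merge r (L ++ y.tgt ++ M) k l R * loc r L y (M ++ k :: l :: R) := by
  by_cases h : k = 0 ∨ l = 0
  · rw [merge_of_zero h, merge_of_zero h, loc_congr y rfl (erase0_merge_zero h),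
      loc_mul_one, one_mul_loc]
    · have := erase0_merge_zero (L := L ++ y.tgt ++ M) (R := R) h
      simpa using this
    · have := erase0_merge_zero (L := L ++ y.src ++ M) (R := R) h
      simpa using this
  · have := interchange (r := r) L y M (.merge k l) R
    rw [merge_eq_loc (by omega) (by omega), merge_eq_loc (by omega) (by omega)]
    simp only [LocGen.par, ksign_zero_right, one_smul, LocGen.src, LocGen.tgt, List.append_assoc,
      List.cons_append, List.nil_append] at this ⊢
    exact this

/-! ### Iterated merges of thin strands. -/

/-- `n` strands of thickness `1`. -/
def thin (n : ℕ) : List ℕ := List.replicate n 1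

@[simp] theorem thin_zero : thin 0 = [] := rfl

theorem thin_succ (n : ℕ) : thin (n + 1) = 1 :: thin n := rfl

theorem thin_add (m n : ℕ) : thin (m + n) = thin m ++ thin n := List.replicate_add ..

theorem sum_thin (n : ℕ) : (thin n).sum = n := by simp [thin]

/-- The iterated merge of `k` thin strands. -/
def fan (r : ℕ) : List ℕ → ℕ → List ℕ → Web r
  | P, 0, Q => one r (P ++ Q)
  | P, k + 1, Q => merge r P 1 k Q * fan r (P ++ [1]) k Q

/-- The iterated merges of thin strands to the strands `L`. -/
def tot (r : ℕ) : List ℕ → List ℕ → List ℕ → Web r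
  | P, [], Q => one r (P ++ Q)
  | P, k :: L, Q => fan r P k (L ++ Q) * tot r (P ++ thin k) L Q

theorem one_mul_fan (P : List ℕ) (k : ℕ) (Q : List ℕ) :
    one r (P ++ k :: Q) * fan r P k Q = fan r P k Q := by
  cases k with
  | zero =>
    rw [fan, one_congr (L' := P ++ Q), one_mul_one]
    simp [erase0]
  | succ k => rw [fan, ← mul_assoc, add_comm k 1, one_mul_merge]

theorem fan_mul_one (k : ℕ) : ∀ P Q : List ℕ,
    fan r P k Q * one r (P ++ thin k ++ Q) = fan r P k Q := by
  induction k with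
  | zero => intro P Q; simp [fan, one_mul_one]
  | succ k ih =>
    intro P Q
    have := ih (P ++ [1]) Q
    simp only [List.append_assoc, List.singleton_append] at this
    rw [fan, mul_assoc]
    simp only [thin_succ, List.append_assoc, List.cons_append] at this ⊢
    rw [this]

/-- A picture to the right of an iterated merge slides below it. Merges are even, so no sign
appears. -/
theorem loc_mul_fan_left (y : LocGen) (M R : List ℕ) (k : ℕ) : ∀ P : List ℕ,
    loc r (P ++ k :: M) y R * fan r P k (M ++ y.src ++ R) =
      fan r P k (M ++ y.tgt ++ R) * loc r (P ++ thin k ++ M) y R := by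
  induction k with
  | zero =>
    intro P
    rw [fan, fan, loc_mul_one, one_mul_loc]
    · exact loc_congr _ (by simp [erase0]) rfl
    · simp
    · simp [erase0]
  | succ k ih =>
    intro P
    have h1 := loc_mul_merge_left (r := r) P 1 k M y R
    have h2 := ih (P ++ [1])
    simp only [List.append_assoc, List.cons_append, List.nil_append] at h1 h2
    simp only [fan, List.append_assoc, thin_succ, List.cons_append] at *
    rw [← mul_assoc, add_comm k 1, h1, mul_assoc, h2, mul_assoc]

theorem loc_mul_fan_right (L : List ℕ) (y : LocGen) (R : List ℕ) (k : ℕ) : ∀ M : List ℕ,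
    loc r L y (M ++ k :: R) * fan r (L ++ y.src ++ M) k R =
      fan r (L ++ y.tgt ++ M) k R * loc r L y (M ++ thin k ++ R) := by
  induction k with
  | zero =>
    intro M
    rw [fan, fan, loc_mul_one, one_mul_loc]
    · exact loc_congr _ rfl (by simp [erase0])
    · simp
    · simp [erase0]
  | succ k ih =>
    intro M
    have h1 := loc_mul_merge_right (r := r) L y M 1 k R
    have h2 := ih (M ++ [1])
    simp only [List.append_assoc, List.cons_append, List.nil_append] at h1 h2
    simp only [fan, List.append_assoc, thin_succ, List.cons_append] at *
    rw [← mul_assoc, add_comm k 1, h1, mul_assoc, h2, mul_assoc]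

theorem one_mul_tot (L : List ℕ) (P Q : List ℕ) :
    one r (P ++ L ++ Q) * tot r P L Q = tot r P L Q := by
  cases L with
  | nil => simp [tot, one_mul_one]
  | cons k L =>
    have := one_mul_fan (r := r) P k (L ++ Q)
    rw [tot, ← mul_assoc]
    simp only [List.append_assoc, List.cons_append]
    rw [this]

theorem tot_append (L₁ L₂ Q : List ℕ) : ∀ P : List ℕ,
    tot r P (L₁ ++ L₂) Q = tot r P L₁ (L₂ ++ Q) * tot r (P ++ thin L₁.sum) L₂ Q := by
  induction L₁ with
  | nil =>
    intro P
    have := one_mul_tot (r := r) L₂ P Q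
    simp only [List.append_assoc] at this
    simp [tot, this]
  | cons k L ih =>
    intro P
    rw [List.cons_append, tot, ih, tot, List.sum_cons, thin_add]
    simp only [List.append_assoc, mul_assoc]

/-- The purpose is to bring a picture down to the level where all strands beside it are thin. -/
theorem loc_mul_tot_left (y : LocGen) (M R : List ℕ) (L : List ℕ) : ∀ P : List ℕ,
    loc r (P ++ L ++ M) y R * tot r P L (M ++ y.src ++ R) =
      tot r P L (M ++ y.tgt ++ R) * loc r (P ++ thin L.sum ++ M) y R := by
  induction L with
  | nil =>
    intro P
    rw [tot, tot, loc_mul_one _ _ _ (by simp), one_mul_loc _ _ _ (by simp)]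
    simp
  | cons k L ih =>
    intro P
    have h1 := loc_mul_fan_left (r := r) y (L ++ M) R k P
    have h2 := ih (P ++ thin k)
    rw [tot, tot, List.sum_cons, thin_add]
    simp only [List.append_assoc, List.cons_append] at h1 h2 ⊢
    rw [← mul_assoc, h1, mul_assoc, h2, mul_assoc]

theorem loc_mul_tot_right (K : List ℕ) (y : LocGen) (R : List ℕ) (L : List ℕ) : ∀ M : List ℕ,
    loc r K y (M ++ L ++ R) * tot r (K ++ y.src ++ M) L R =
      tot r (K ++ y.tgt ++ M) L R * loc r K y (M ++ thin L.sum ++ R) := by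
  induction L with
  | nil =>
    intro M
    rw [tot, tot, loc_mul_one _ _ _ (by simp), one_mul_loc _ _ _ (by simp)]
    simp
  | cons k L ih =>
    intro M
    have h1 := loc_mul_fan_right (r := r) K y (L ++ R) k M
    have h2 := ih (M ++ thin k)
    rw [tot, tot, List.sum_cons, thin_add]
    simp only [List.append_assoc, List.cons_append] at h1 h2 ⊢
    rw [← mul_assoc, h1, mul_assoc, h2, mul_assoc]

end Web

end TypeQ

end


/-! ### The defining relations inside the web superalgebra, and reduction to thin webs. -/

noncomputable section

namespace TypeQ
namespace Web

variable {r : ℕ}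

theorem merge_assoc (L R : List ℕ) {h k l : ℕ} (hh : 0 < h) (hk : 0 < k) (hl : 0 < l) :
    merge r L (h + k) l R * merge r L h k (l :: R) =
      merge r L h (k + l) R * merge r (L ++ [h]) k l R := by
  simpa only [merge, map_mul] using Presented.mk_rel (WebRel.merge_assoc (r := r) L R h k l hh hk hl)

theorem split_assoc (L R : List ℕ) {h k l : ℕ} (hh : 0 < h) (hk : 0 < k) (hl : 0 < l) :
    split r L h k (l :: R) * split r L (h + k) l R =
      split r (L ++ [h]) k l R * split r L h (k + l) R := by
  simpa only [split, map_mul] using Presented.mk_rel (WebRel.split_assoc (r := r) L R h k l hh hk hl)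

theorem explosion (L R : List ℕ) {k l : ℕ} (hk : 0 < k) (hl : 0 < l) :
    merge r L k l R * split r L k l R = ((k + l).choose l : ℂ) • one r (L ++ (k + l) :: R) := by
  simpa only [merge, split, one, map_mul, map_smul] using
    Presented.mk_rel (WebRel.explosion (r := r) L R k l hk hl)

theorem dot_sq (L R : List ℕ) {k : ℕ} (hk : 0 < k) :
    dot r L k R * dot r L k R = (k : ℂ) • one r (L ++ k :: R) := by
  simpa only [dot, one, map_mul, map_smul] using
    Presented.mk_rel (WebRel.dot_sq (r := r) L R k hk)

theorem dot_merge (L R : List ℕ) {k : ℕ} (hk : 0 < k) :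
    dot r L (1 + k) R * merge r L 1 k R =
      merge r L 1 k R * dot r L 1 (k :: R) + merge r L 1 k R * dot r (L ++ [1]) k R := by
  simpa only [dot, merge, map_mul, map_add] using
    Presented.mk_rel (WebRel.dot_merge (r := r) L R k hk)

theorem dot_split (L R : List ℕ) {k : ℕ} (hk : 0 < k) :
    split r L 1 k R * dot r L (1 + k) R =
      dot r L 1 (k :: R) * split r L 1 k R + dot r (L ++ [1]) k R * split r L 1 k R := by
  simpa only [dot, split, map_mul, map_add] using
    Presented.mk_rel (WebRel.dot_split (r := r) L R k hk)

theorem dumbbell (L R : List ℕ) :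
    split r L 1 1 R * merge r L 1 1 R - dot r L 1 (1 :: R) * dot r (L ++ [1]) 1 R *
      (split r L 1 1 R * merge r L 1 1 R) * (dot r L 1 (1 :: R) * dot r (L ++ [1]) 1 R) =
      (2 : ℂ) • one r (L ++ 1 :: 1 :: R) := by
  simpa only [dot, split, merge, one, map_mul, map_sub, map_smul] using
    Presented.mk_rel (WebRel.dumbbell (r := r) L R)

/-- The square switch, in which `0`-strands may occur. -/
theorem square_switch (L R : List ℕ) (k l : ℕ) :
    merge r L k 1 ((l + 1) :: R) * split r (L ++ [k]) 1 (l + 1) R *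
        (merge r (L ++ [k]) 1 (l + 1) R * split r L k 1 ((l + 1) :: R)) -
      merge r (L ++ [k + 1]) 1 l R * split r L (k + 1) 1 (l :: R) *
        (merge r L (k + 1) 1 (l :: R) * split r (L ++ [k + 1]) 1 l R) =
      ((k + 1 : ℕ) - (l + 1 : ℕ) : ℂ) • one r (L ++ (k + 1) :: (l + 1) :: R) := by
  simpa only [rungL, rungR, dot, split, merge, one, map_mul, map_sub, map_smul, mul_one,
    Bool.false_eq_true, if_false] using
    Presented.mk_rel (WebRel.square_switch (r := r) L R k l)

/-- The square switch on strands of thickness `1` and `l + 1`: the left leg of one of its ladders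
becomes a `0`-strand, so that ladder degenerates to a split after a merge. The other term involves
only a thin `split` after `merge` and strands of smaller thickness, which drives the induction in
`split_one_mem_stab`. -/
theorem split_mul_merge_left (L R : List ℕ) (l : ℕ) :
    split r L 1 (l + 1) R * merge r L 1 (l + 1) R =
      merge r (L ++ [1]) 1 l R * (split r L 1 1 (l :: R) * merge r L 1 1 (l :: R)) *
        split r (L ++ [1]) 1 l R - (l : ℂ) • one r (L ++ 1 :: (l + 1) :: R) := by
  have h := square_switch (r := r) L R 0 l
  have e0 : erase0 (L ++ [0]) = erase0 L := by simp [erase0]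
  have h1 : one r (L ++ (0 + 1) :: (l + 1) :: R) * split r L 1 (l + 1) R = split r L 1 (l + 1) R :=
    one_mul_split L R 1 (l + 1)
  have h2 : merge r L 1 (l + 1) R * one r (L ++ (0 + 1) :: (l + 1) :: R) = merge r L 1 (l + 1) R :=
    merge_mul_one L R 1 (l + 1)
  rw [merge_of_zero (Or.inl rfl), split_of_zero (L := L) (Or.inl rfl), split_congr _ _ e0 rfl,
    merge_congr _ _ e0 rfl, h1, h2] at h
  simp only [zero_add, mul_assoc] at h ⊢
  rw [sub_eq_iff_eq_add] at h
  rw [h]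
  push_cast
  module

/-- The mirror degeneration of the square switch, on strands of thickness `2` and `1`. It is needed
for the braid relation only. -/
theorem split_mul_merge_right (L R : List ℕ) :
    split r L 2 1 R * merge r L 2 1 R =
      merge r L 1 1 (1 :: R) * (split r (L ++ [1]) 1 1 R * merge r (L ++ [1]) 1 1 R) *
        split r L 1 1 (1 :: R) - one r (L ++ 2 :: 1 :: R) := by
  have h := square_switch (r := r) L R 1 0
  have e0 : erase0 (0 :: R) = erase0 R := by simp [erase0]
  have e1 : one r (L ++ [1 + 1] ++ (1 + 0) :: R) = one r (L ++ 2 :: 1 :: R) := by simp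
  have h1 : one r (L ++ 2 :: 1 :: R) * split r L 2 1 R = split r L 2 1 R := one_mul_split L R 2 1
  have h2 : merge r L 2 1 R * one r (L ++ 2 :: 1 :: R) = merge r L 2 1 R := merge_mul_one L R 2 1
  rw [merge_of_zero (L := L ++ [1 + 1]) (Or.inr rfl), split_of_zero (L := L ++ [1 + 1]) (Or.inr rfl),
    e1, split_congr (L := L) (1 + 1) 1 rfl e0, merge_congr (L := L) (1 + 1) 1 rfl e0,
    show 1 + 1 = 2 from rfl, h1, h2] at h
  simp only [zero_add, mul_assoc] at h ⊢
  rw [sub_eq_iff_eq_add] at h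
  rw [h]
  push_cast
  module

/-! ### The thin webs -/

/-- The identity web on thin strands. -/
def thinOne (r : ℕ) : Web r := one r (thin r)

/-- The thin web with a merge and a split at the place `j`. -/
def cross (r j : ℕ) : Web r :=
  split r (thin j) 1 1 (thin (r - 2 - j)) * merge r (thin j) 1 1 (thin (r - 2 - j))

/-- The dot on the thin strand at the place `j`. -/
def thinDot (r j : ℕ) : Web r := dot r (thin j) 1 (thin (r - 1 - j))

/-- The algebra generated by the thin webs. -/
def thinAlg (r : ℕ) : Subalgebra ℂ (Web r) :=
  Algebra.adjoin ℂ ({x | ∃ j, j + 1 < r ∧ x = cross r j} ∪ {x | ∃ j, j < r ∧ x = thinDot r j})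

/-- The span of the iterated merges of thin webs. -/
def spanTot (r : ℕ) : Submodule ℂ (Web r) :=
  Submodule.span ℂ {x | ∃ L : List ℕ, (∀ i ∈ L, 0 < i) ∧ L.sum = r ∧ ∃ a ∈ thinAlg r, x = tot r [] L [] * a}

/-- The elements which preserve the span of the iterated merges of thin webs. -/
def stab (r : ℕ) : Subalgebra ℂ (Web r) where
  carrier := {x | ∀ y ∈ spanTot r, x * y ∈ spanTot r}
  mul_mem' := fun {a b} ha hb y hy => by rw [mul_assoc]; exact ha _ (hb _ hy)
  add_mem' := fun {a b} ha hb y hy => by rw [add_mul]; exact add_mem (ha _ hy) (hb _ hy)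
  algebraMap_mem' c y hy := by
    rw [Algebra.algebraMap_eq_smul_one, smul_mul_assoc, one_mul]
    exact Submodule.smul_mem _ _ hy

theorem tot_mul_mem {L : List ℕ} (hp : ∀ i ∈ L, 0 < i) (hL : L.sum = r) {a : Web r}
    (ha : a ∈ thinAlg r) : tot r [] L [] * a ∈ spanTot r :=
  Submodule.subset_span ⟨L, hp, hL, a, ha, rfl⟩

theorem mem_stab {x : Web r} (h : ∀ L : List ℕ, (∀ i ∈ L, 0 < i) → L.sum = r → ∀ a ∈ thinAlg r,
    x * (tot r [] L [] * a) ∈ spanTot r) : x ∈ stab r := by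
  intro y hy
  induction hy using Submodule.span_induction with
  | mem y hy => obtain ⟨L, hp, hL, a, ha, rfl⟩ := hy; exact h L hp hL a ha
  | zero => rw [mul_zero]; exact Submodule.zero_mem _
  | add y z _ _ hy hz => rw [mul_add]; exact add_mem hy hz
  | smul c y _ hy => rw [mul_smul_comm]; exact Submodule.smul_mem _ _ hy

theorem one_mul_tot_nil (L : List ℕ) : one r L * tot r [] L [] = tot r [] L [] := by
  simpa using one_mul_tot (r := r) L [] []

/-- It suffices to consider the iterated merges whose top matches the bottom of the local picture. -/
theorem loc_mem_stab {x : LocGen} (h : ∀ L R, (∀ i ∈ L, 0 < i) → (∀ i ∈ R, 0 < i) → Fits r L x R →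
    ∀ a ∈ thinAlg r, loc r L x R * (tot r [] (L ++ x.src ++ R) [] * a) ∈ spanTot r)
    (L R : List ℕ) : loc r L x R ∈ stab r := by
  have e0 : ∀ L, erase0 L = erase0 (erase0 L) := fun L =>
    (erase0_eq_self fun i hi => erase0_pos hi).symm
  rw [loc_congr x (e0 L) (e0 R)]
  have hL : ∀ i ∈ erase0 L, 0 < i := fun i hi => erase0_pos hi
  have hR : ∀ i ∈ erase0 R, 0 < i := fun i hi => erase0_pos hi
  generalize erase0 L = L at hL ⊢
  generalize erase0 R = R at hR ⊢
  by_cases hf : Fits r L x R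
  · refine mem_stab fun M hM hMr a ha => ?_
    by_cases e : M = L ++ x.src ++ R
    · rw [e]; exact h L R hL hR hf a ha
    -- If top and bottom do not match, the product vanishes because distinct identity webs are
    -- orthogonal.
    · rw [← one_mul_tot_nil, ← mul_assoc, ← mul_assoc, loc_mul_one_of_ne, zero_mul, zero_mul]
      · exact Submodule.zero_mem _
      · rw [erase0_eq_self hM, erase0_eq_self]
        · exact e
        · intro i hi
          simp only [List.mem_append] at hi
          rcases hi with (hi | hi) | hi
          exacts [hL i hi, hf.2 i (by simp [hi]), hR i hi]
  · rw [loc_of_not_fits hf]; exact Subalgebra.zero_mem _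

theorem one_mem_stab (L : List ℕ) : one r L ∈ stab r := by
  refine mem_stab fun M hM hMr a ha => ?_
  by_cases e : erase0 L = erase0 M
  · rw [one_congr e, ← mul_assoc, one_mul_tot_nil]
    exact tot_mul_mem hM hMr ha
  · rw [← one_mul_tot_nil, ← mul_assoc, ← mul_assoc, one_mul_one_of_ne e, zero_mul, zero_mul]
    exact Submodule.zero_mem _

/-- The iterated merges around a local picture. -/
theorem tot_around (P X Q : List ℕ) : tot r [] (P ++ X ++ Q) [] =
    tot r [] P (X ++ Q) * tot r (thin P.sum) X Q * tot r (thin P.sum ++ thin X.sum) Q [] := by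
  rw [List.append_assoc, tot_append, tot_append]
  simp [mul_assoc]

theorem fan_one (P Q : List ℕ) : fan r P 1 Q = one r (P ++ 1 :: Q) := by
  rw [fan, fan, merge_of_zero (Or.inr rfl), List.append_assoc, List.singleton_append, one_mul_one]

theorem tot_single (P : List ℕ) (k : ℕ) (Q : List ℕ) : tot r P [k] Q = fan r P k Q := by
  have := fan_mul_one (r := r) k P Q
  simpa [tot] using this

theorem tot_pair (P : List ℕ) (l : ℕ) (Q : List ℕ) :
    tot r P [1, l] Q = fan r (P ++ [1]) l Q := by
  have h := one_mul_fan (r := r) (P ++ [1]) l Q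
  rw [tot, tot_single, fan_one]
  simpa [thin] using h

theorem tot_thin (m : ℕ) (Q : List ℕ) : ∀ P : List ℕ,
    tot r P (thin m) Q = one r (P ++ thin m ++ Q) := by
  induction m with
  | zero => intro P; simp [tot]
  | succ m ih =>
    intro P
    rw [thin_succ, tot, fan_one, ih]
    simp [thin, one_mul_one]

theorem tot_around_thin (P : List ℕ) (m : ℕ) (Q : List ℕ) : tot r [] (P ++ thin m ++ Q) [] =
    tot r [] P (thin m ++ Q) * tot r (thin P.sum ++ thin m) Q [] := by
  have h := one_mul_tot (r := r) Q (thin P.sum ++ thin m) []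
  rw [tot_around, tot_thin, sum_thin, mul_assoc]
  simp only [List.append_assoc, List.append_nil] at h ⊢
  rw [h]

/-- The merges to the left and to the right of `y` are passed one after the other; `y` ends up
between thin strands. -/
theorem loc_mul_tot_around (P : List ℕ) (y : LocGen) (Q : List ℕ) :
    loc r P y Q * (tot r [] P (y.src ++ Q) * tot r (thin P.sum ++ y.src) Q []) =
      tot r [] P (y.tgt ++ Q) * tot r (thin P.sum ++ y.tgt) Q [] *
        loc r (thin P.sum) y (thin Q.sum) := by
  have h1 := loc_mul_tot_left (r := r) y [] Q P []
  have h2 := loc_mul_tot_right (r := r) (thin P.sum) y [] Q []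
  simp only [List.append_nil, List.nil_append] at h1 h2
  rw [← mul_assoc, h1, mul_assoc, h2, mul_assoc]

/-- A fan is defined by merging a thin strand onto a smaller fan, so merging `1` with the top of an
`l`-fan completes it to a fan of `1 + l` strands. The merges to the left of the fan are passed by
sliding. -/
theorem merge_mul_tot (P : List ℕ) (l : ℕ) (Q : List ℕ) (hl : 0 < l) :
    merge r P 1 l Q * tot r [] (P ++ 1 :: l :: Q) [] = tot r [] (P ++ (1 + l) :: Q) [] := by
  have h1 := tot_around (r := r) P [1, l] Q
  have h2 := tot_around (r := r) P [1 + l] Q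
  have h3 := loc_mul_tot_left (r := r) (.merge 1 l) [] Q P []
  rw [tot_pair] at h1
  rw [tot_single, add_comm 1 l, fan] at h2
  simp only [List.append_assoc, List.cons_append, List.nil_append, List.append_nil, List.sum_cons,
    List.sum_nil, add_zero, LocGen.src, LocGen.tgt] at h1 h2 h3
  rw [h1, add_comm 1 l, h2, ← mul_assoc, ← mul_assoc, merge_eq_loc one_pos hl, h3,
    merge_eq_loc one_pos hl, add_comm 1 l]
  simp only [mul_assoc]

theorem thinDot_mem {j : ℕ} (h : j < r) : thinDot r j ∈ thinAlg r :=
  Algebra.subset_adjoin (Or.inr ⟨j, h, rfl⟩)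

theorem cross_mem {j : ℕ} (h : j + 1 < r) : cross r j ∈ thinAlg r :=
  Algebra.subset_adjoin (Or.inl ⟨j, h, rfl⟩)

/-- Nothing is merged below a thin strand, so the dot slides down to a thin dot. -/
theorem dot_one_mem_stab (L R : List ℕ) : dot r L 1 R ∈ stab r := by
  refine loc_mem_stab (fun L R hL hR hf a ha => ?_) L R
  have hs : L.sum + 1 + R.sum = r := by
    have := hf.1
    simp [LocGen.src] at this; omega
  have h1 := tot_around_thin (r := r) L 1 R
  have h2 := loc_mul_tot_around (r := r) L (.dot 1) R
  have e1 : LocGen.src (.dot 1) = thin 1 := rfl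
  have e2 : LocGen.tgt (.dot 1) = thin 1 := rfl
  have e3 : loc r (thin L.sum) (.dot 1) (thin R.sum) = thinDot r L.sum := by
    rw [thinDot, dot_eq_loc, show r - 1 - L.sum = R.sum by omega]
  rw [e1, e2, ← h1, e3] at h2
  rw [e1, ← mul_assoc, h2, mul_assoc]
  refine tot_mul_mem ?_ ?_ (mul_mem (thinDot_mem (by omega)) ha)
  · intro i hi
    simp only [List.mem_append] at hi
    rcases hi with (hi | hi) | hi
    exacts [hL i hi, by simp [thin] at hi; omega, hR i hi]
  · simp [sum_thin]; omega

/-- Top and bottom of the composite have two thin strands in the middle. Merge and split slide down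
separately and combine to `cross` below all other merges. -/
theorem split_mul_merge_mem_stab (L R : List ℕ) :
    split r L 1 1 R * merge r L 1 1 R ∈ stab r := by
  have e0 : ∀ L, erase0 L = erase0 (erase0 L) := fun L =>
    (erase0_eq_self fun i hi => erase0_pos hi).symm
  rw [split_congr 1 1 (e0 L) (e0 R), merge_congr 1 1 (e0 L) (e0 R)]
  have hL : ∀ i ∈ erase0 L, 0 < i := fun i hi => erase0_pos hi
  have hR : ∀ i ∈ erase0 R, 0 < i := fun i hi => erase0_pos hi
  generalize erase0 L = L at hL ⊢
  generalize erase0 R = R at hR ⊢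
  refine mem_stab fun M hM hMr a ha => ?_
  by_cases e : M = L ++ 1 :: 1 :: R
  · have hs : L.sum + 2 + R.sum = r := by
      rw [e] at hMr; simp at hMr; omega
    have h1 := tot_around_thin (r := r) L 2 R
    have h2 := loc_mul_tot_around (r := r) L (.merge 1 1) R
    have h3 := loc_mul_tot_around (r := r) L (.split 1 1) R
    have e1 : LocGen.src (.merge 1 1) = thin 2 := rfl
    have e2 : LocGen.tgt (.split 1 1) = thin 2 := rfl
    have e3 : LocGen.src (.split 1 1) = [2] := rfl
    have e4 : LocGen.tgt (.merge 1 1) = [2] := rfl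
    rw [e1, e4, ← h1] at h2
    rw [e2, e3, ← h1] at h3
    have e5 : loc r (thin L.sum) (.split 1 1) (thin R.sum) *
        loc r (thin L.sum) (.merge 1 1) (thin R.sum) = cross r L.sum := by
      rw [cross, split_eq_loc one_pos one_pos, merge_eq_loc one_pos one_pos,
        show r - 2 - L.sum = R.sum by omega]
    have e6 : M = L ++ thin 2 ++ R := by rw [e]; simp [thin]
    rw [split_eq_loc one_pos one_pos, merge_eq_loc one_pos one_pos, e6, mul_assoc, ← mul_assoc (loc r L (.merge 1 1) R), h2,
      mul_assoc, ← mul_assoc, h3, mul_assoc, ← mul_assoc (loc r (thin L.sum) (.split 1 1) _), e5, ← e6]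
    exact tot_mul_mem hM hMr (mul_mem (cross_mem (by omega)) ha)
  · rw [← one_mul_tot_nil, ← merge_mul_one, mul_assoc (one r M), mul_assoc, mul_assoc (merge r _ _ _ _),
      ← mul_assoc (one r _) (one r M), one_mul_one_of_ne, zero_mul, mul_zero, mul_zero]
    · exact Submodule.zero_mem _
    · rw [erase0_eq_self hM, erase0_eq_self]
      · exact Ne.symm e
      · intro i hi
        simp only [List.mem_append, List.mem_cons] at hi
        rcases hi with hi | rfl | rfl | hi
        exacts [hL i hi, one_pos, one_pos, hR i hi]

theorem merge_one_mem_stab (l : ℕ) (L R : List ℕ) : merge r L 1 l R ∈ stab r := by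
  rcases Nat.eq_zero_or_pos l with rfl | hl
  · rw [merge_of_zero (Or.inr rfl)]; exact one_mem_stab _
  rw [merge_eq_loc one_pos hl]
  refine loc_mem_stab (fun L R hL hR hf a ha => ?_) L R
  have h := merge_mul_tot (r := r) L l R hl
  have e : L ++ LocGen.src (.merge 1 l) ++ R = L ++ 1 :: l :: R := by simp [LocGen.src]
  rw [e, ← merge_eq_loc one_pos hl, ← mul_assoc, h]
  refine tot_mul_mem ?_ ?_ ha
  · intro i hi
    simp only [List.mem_append, List.mem_cons] at hi
    rcases hi with hi | rfl | hi
    exacts [hL i hi, by omega, hR i hi]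
  · have := hf.1
    simp [LocGen.src] at this ⊢; omega

/-- Applied to an iterated merge, the split meets the last merge of a fan. `split_mul_merge_left`
rewrites this pair by elements already known to lie in `stab r` and by the split of a strand thinner
by one. -/
theorem split_one_mem_stab (l : ℕ) : ∀ L R : List ℕ, split r L 1 l R ∈ stab r := by
  induction l with
  | zero => intro L R; rw [split_of_zero (Or.inr rfl)]; exact one_mem_stab _
  | succ l ih =>
    intro L R
    rw [split_eq_loc one_pos l.succ_pos]
    refine loc_mem_stab (fun L R hL hR hf a ha => ?_) L R
    have h := merge_mul_tot (r := r) L (l + 1) R l.succ_pos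
    have e : L ++ LocGen.src (.split 1 (l + 1)) ++ R = L ++ (1 + (l + 1)) :: R := by
      simp [LocGen.src]
    rw [e, ← split_eq_loc one_pos l.succ_pos, ← h, mul_assoc, ← mul_assoc, split_mul_merge_left]
    have hm : merge r (L ++ [1]) 1 l R * (split r L 1 1 (l :: R) * merge r L 1 1 (l :: R)) *
        split r (L ++ [1]) 1 l R - (l : ℂ) • one r (L ++ 1 :: (l + 1) :: R) ∈ stab r :=
      sub_mem (mul_mem (mul_mem (merge_one_mem_stab _ _ _) (split_mul_merge_mem_stab _ _)) (ih _ _))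
        ((stab r).smul_mem (one_mem_stab _) _)
    refine hm _ (tot_mul_mem ?_ ?_ ha)
    · intro i hi
      simp only [List.mem_append, List.mem_cons] at hi
      rcases hi with hi | rfl | rfl | hi
      exacts [hL i hi, one_pos, l.succ_pos, hR i hi]
    · have := hf.1
      simp [LocGen.src] at this ⊢; omega

/-- A thick strand is opened into a thin strand and the rest. -/
theorem one_eq_merge_mul_split (L R : List ℕ) {k : ℕ} (hk : 0 < k) : one r (L ++ (1 + k) :: R) =
    ((k + 1 : ℂ)⁻¹) • (merge r L 1 k R * split r L 1 k R) := by
  rw [explosion L R one_pos hk, smul_smul, Nat.add_comm 1 k, Nat.choose_succ_self_right]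
  push_cast
  rw [inv_mul_cancel₀ (by exact_mod_cast k.succ_ne_zero), one_smul]

/-- The left strand is opened into a thin strand and a strand of thickness `k`; associativity then
leaves only merges with a thin strand and the merge from the induction hypothesis. Splits and dots
are treated in the same way below. -/
theorem merge_mem_stab (k : ℕ) : ∀ (l : ℕ) (L R : List ℕ), merge r L k l R ∈ stab r := by
  induction k with
  | zero => intro l L R; rw [merge_of_zero (Or.inl rfl)]; exact one_mem_stab _
  | succ k ih =>
    intro l L R
    rcases Nat.eq_zero_or_pos l with rfl | hl
    · rw [merge_of_zero (Or.inr rfl)]; exact one_mem_stab _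
    rcases Nat.eq_zero_or_pos k with rfl | hk
    · exact merge_one_mem_stab _ _ _
    rw [← merge_mul_one, add_comm k 1, one_eq_merge_mul_split _ _ hk, mul_smul_comm, ← mul_assoc,
      merge_assoc _ _ one_pos hk hl]
    exact (stab r).smul_mem (mul_mem (mul_mem (merge_one_mem_stab _ _ _) (ih _ _ _))
      (split_one_mem_stab _ _ _)) _

theorem split_mem_stab (k : ℕ) : ∀ (l : ℕ) (L R : List ℕ), split r L k l R ∈ stab r := by
  induction k with
  | zero => intro l L R; rw [split_of_zero (Or.inl rfl)]; exact one_mem_stab _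
  | succ k ih =>
    intro l L R
    rcases Nat.eq_zero_or_pos l with rfl | hl
    · rw [split_of_zero (Or.inr rfl)]; exact one_mem_stab _
    rcases Nat.eq_zero_or_pos k with rfl | hk
    · exact split_one_mem_stab _ _ _
    rw [← one_mul_split, add_comm k 1, one_eq_merge_mul_split _ _ hk, smul_mul_assoc, mul_assoc,
      split_assoc _ _ one_pos hk hl]
    exact (stab r).smul_mem (mul_mem (merge_one_mem_stab _ _ _) (mul_mem (ih _ _ _)
      (split_one_mem_stab _ _ _))) _

theorem dot_mem_stab (k : ℕ) : ∀ (L R : List ℕ), dot r L k R ∈ stab r := by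
  induction k with
  | zero =>
    intro L R
    rw [dot_eq_loc, loc_of_not_fits]
    · exact Subalgebra.zero_mem _
    · exact fun h => absurd (h.2 0 (by simp [LocGen.src])) (lt_irrefl 0)
  | succ k ih =>
    intro L R
    rcases Nat.eq_zero_or_pos k with rfl | hk
    · exact dot_one_mem_stab _ _
    have h : dot r L (1 + k) R * one r (L ++ (1 + k) :: R) = dot r L (1 + k) R :=
      loc_mul_one _ _ _ (by simp [LocGen.src])
    rw [add_comm k 1, ← h, one_eq_merge_mul_split _ _ hk, mul_smul_comm, ← mul_assoc,
      dot_merge _ _ hk]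
    exact (stab r).smul_mem (mul_mem (add_mem (mul_mem (merge_one_mem_stab _ _ _)
      (dot_one_mem_stab _ _)) (mul_mem (merge_one_mem_stab _ _ _) (ih _ _)))
      (split_one_mem_stab _ _ _)) _

theorem gen_mem_stab (g : WebGen r) : Web.gen g ∈ stab r := by
  rcases g with a | ⟨L, ⟨k, l⟩ | ⟨k, l⟩ | k, R, a, b, ha, hb⟩
  · rw [gen_one]; exact one_mem_stab _
  · rw [gen_loc, ← merge_eq_loc (a.blocks_pos (by simp [ha, LocGen.src]))
      (a.blocks_pos (by simp [ha, LocGen.src]))]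
    exact merge_mem_stab _ _ _ _
  · rw [gen_loc, ← split_eq_loc (b.blocks_pos (by simp [hb, LocGen.tgt]))
      (b.blocks_pos (by simp [hb, LocGen.tgt]))]
    exact split_mem_stab _ _ _ _
  · rw [gen_loc]; exact dot_mem_stab _ _ _

theorem mem_stab_all (w : Web r) : w ∈ stab r := by
  obtain ⟨x, rfl⟩ := Presented.mk_surjective (WebRel r) w
  induction x using FreeAlgebra.induction with
  | grade0 c => rw [AlgHom.commutes]; exact (stab r).algebraMap_mem c
  | grade1 g => exact gen_mem_stab g
  | mul a b ha hb => rw [map_mul]; exact mul_mem ha hb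
  | add a b ha hb => rw [map_add]; exact add_mem ha hb

/-- The webs between thin strands are generated by the thin webs. -/
theorem exists_thin (w : Web r) :
    ∃ a ∈ thinAlg r, thinOne r * w * thinOne r = thinOne r * a := by
  have e : tot r [] (thin r) [] = thinOne r := by rw [tot_thin]; simp [thinOne]
  have h : w * thinOne r ∈ spanTot r := by
    refine mem_stab_all w _ ?_
    -- With all strands thin the iterated merge is the identity web, so `thinOne r` itself lies in
    -- the span.
    have := tot_mul_mem (r := r) (L := thin r) (by simp [thin]) (sum_thin r)
      (Subalgebra.one_mem (thinAlg r))
    rwa [e, mul_one] at this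
  rw [mul_assoc]
  generalize w * thinOne r = y at h
  induction h using Submodule.span_induction with
  | mem y hy =>
    obtain ⟨L, hL, hr, a, ha, rfl⟩ := hy
    -- Multiplication by `thinOne r` on the left kills all iterated merges except the trivial one.
    by_cases hLt : L = thin r
    · exact ⟨a, ha, by rw [hLt, e, ← mul_assoc, thinOne, one_mul_one]⟩
    · refine ⟨0, Subalgebra.zero_mem _, ?_⟩
      rw [← one_mul_tot_nil, thinOne, ← mul_assoc, ← mul_assoc, one_mul_one_of_ne, zero_mul,
        zero_mul, mul_zero]
      rw [erase0_eq_self hL, erase0_eq_self (by simp [thin])]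
      exact Ne.symm hLt
  | zero => exact ⟨0, Subalgebra.zero_mem _, by simp⟩
  | add y z _ _ hy hz =>
    obtain ⟨a, ha, h1⟩ := hy
    obtain ⟨b, hb, h2⟩ := hz
    exact ⟨a + b, add_mem ha hb, by rw [mul_add, mul_add, h1, h2]⟩
  | smul c y _ hy =>
    obtain ⟨a, ha, h1⟩ := hy
    exact ⟨c • a, (thinAlg r).smul_mem ha c, by rw [mul_smul_comm, mul_smul_comm, h1]⟩

end Web
end TypeQ

end


/-! ### Thin webs satisfy the Sergeev relations, and the thin idempotent is full. -/

noncomputable section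

namespace TypeQ

/-- Elements of an algebra which satisfy the relations of the Sergeev superalgebra, with the
idempotent `e` as the identity. -/
structure SergeevFamily {A : Type} [Ring A] [Algebra ℂ A] (r : ℕ) (e : A) (s d : ℕ → A) : Prop where
  e_sq : e * e = e
  e_s : ∀ i, i + 1 < r → e * s i = s i
  s_e : ∀ i, i + 1 < r → s i * e = s i
  e_d : ∀ j, j < r → e * d j = d j
  d_e : ∀ j, j < r → d j * e = d j
  s_sq : ∀ i, i + 1 < r → s i * s i = e
  braid : ∀ i, i + 1 + 1 < r → s i * s (i + 1) * s i = s (i + 1) * s i * s (i + 1)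
  s_comm : ∀ i j, i + 1 < j → j + 1 < r → s i * s j = s j * s i
  d_sq : ∀ j, j < r → d j * d j = e
  d_anti : ∀ i j, i < j → j < r → d i * d j = -(d j * d i)
  s_d : ∀ i, i + 1 < r → s i * d i = d (i + 1) * s i
  s_d' : ∀ i, i + 1 < r → s i * d (i + 1) = d i * s i
  s_d_far : ∀ i j, i + 1 < r → j < r → j ≠ i → j ≠ i + 1 → s i * d j = d j * s i

/-- The dumbbell relation turns into the relation between transpositions and Clifford generators. -/
theorem dumbbell_aux {A : Type} [Ring A] [Algebra ℂ A] {e x a b : A} (ex : e * x = x)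
    (ea : e * a = a) (eb : e * b = b) (aa : a * a = e)
    (bb : b * b = e) (ab : a * b = -(b * a)) (h : (a + b) * x = x * (a + b))
    (hx : x - a * b * x * (a * b) = (2 : ℂ) • e) : a * x - x * b = a - b := by
  -- The hypothesis `h` gives a second expression for the quantity to be determined.
  have h1 : a * x - x * b = x * a - b * x := by
    rw [add_mul, mul_add] at h
    rw [sub_eq_sub_iff_add_eq_add, h]
  have h2 : a * x * b - b * x * a = (2 : ℂ) • (a * b) := by
    have := congrArg (fun z => a * z * b) hx
    simp only [mul_sub, sub_mul, mul_smul_comm, smul_mul_assoc] at this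
    have e1 : a * (a * b * x * (a * b)) * b = b * x * a := by
      have : a * (a * b * x * (a * b)) * b = (a * a) * b * x * (a * (b * b)) := by
        simp only [mul_assoc]
      rw [this, aa, bb, eb]
      have ae : a * e = a := by rw [← aa, ← mul_assoc, aa, ea]
      rw [ae]
    have e2 : a * e * b = a * b := by rw [mul_assoc, eb]
    rwa [e1, e2] at this
  -- Multiplication by `a + b` loses nothing, since the square of `a + b` is `2 e`. One expression
  -- of the quantity is used for the factor `a` and the other for `b`; the remaining quadratic terms
  -- are given by `h2`.
  have h3 : (a + b) * (a * x - x * b) = -((2 : ℂ) • (a * b)) := by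
    rw [← h2, add_mul]
    nth_rewrite 2 [h1]
    rw [mul_sub, mul_sub, ← mul_assoc, ← mul_assoc, ← mul_assoc, ← mul_assoc, aa, bb, ex]
    abel
  have h4 : (a + b) * (a + b) = (2 : ℂ) • e := by
    rw [add_mul, mul_add, mul_add, aa, bb, ab, two_smul]
    abel
  have h5 := congrArg (fun z => (a + b) * z) h3
  rw [← mul_assoc, h4, smul_mul_assoc, mul_sub, ← mul_assoc, ← mul_assoc, ea, ex] at h5
  have h6 : (a + b) * (a * b) = b - a := by
    rw [add_mul, ← mul_assoc, aa, eb, ab, mul_neg, ← mul_assoc, bb, ea]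
    abel
  rw [mul_neg, mul_smul_comm, h6, ← smul_neg] at h5
  have := smul_right_injective A (two_ne_zero (α := ℂ)) h5
  rw [this]; abel

namespace Web

variable {r : ℕ}

/-! ### Thick strands factor through thin strands -/

/-- The two-sided ideal generated by the identity web on thin strands. -/
def thinIdeal (r : ℕ) : Submodule ℂ (Web r) :=
  Submodule.span ℂ {z | ∃ x y : Web r, z = x * thinOne r * y}

theorem mul_mem_thinIdeal {z : Web r} (hz : z ∈ thinIdeal r) (x y : Web r) :
    x * z * y ∈ thinIdeal r := by
  induction hz using Submodule.span_induction with
  | mem z hz =>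
    obtain ⟨x', y', rfl⟩ := hz
    exact Submodule.subset_span ⟨x * x', y' * y, by simp only [mul_assoc]⟩
  | zero => simp
  | add a b _ _ ha hb => rw [mul_add, add_mul]; exact add_mem ha hb
  | smul c a _ ha => rw [mul_smul_comm, smul_mul_assoc]; exact Submodule.smul_mem _ _ ha

/-- By explosion, the identity of a strand of thickness `1 + k` factors through strands `1` and `k`;
the latter is opened by induction. -/
theorem one_mem_thinIdeal_of_thin (Q : List ℕ) (k : ℕ) : ∀ P : List ℕ,
    one r (P ++ thin k ++ Q) ∈ thinIdeal r → one r (P ++ k :: Q) ∈ thinIdeal r := by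
  induction k with
  | zero =>
    intro P h
    rwa [one_congr (L' := P ++ thin 0 ++ Q)]
    simp [erase0]
  | succ k ih =>
    intro P h
    rcases Nat.eq_zero_or_pos k with rfl | hk
    · simpa [thin] using h
    rw [add_comm k 1, one_eq_merge_mul_split _ _ hk, ← merge_mul_one]
    refine Submodule.smul_mem _ _ (mul_mem_thinIdeal ?_ _ _)
    have := ih (P ++ [1]) (by simpa [thin_succ] using h)
    simpa using this

theorem one_mem_thinIdeal (L : List ℕ) : ∀ p : ℕ, p + L.sum = r →
    one r (thin p ++ L) ∈ thinIdeal r := by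
  induction L with
  | nil =>
    intro p hp
    obtain rfl : p = r := by simpa using hp
    refine Submodule.subset_span ⟨1, 1, ?_⟩
    simp [thinOne]
  | cons k L ih =>
    intro p hp
    refine one_mem_thinIdeal_of_thin L k (thin p) ?_
    rw [← thin_add]
    exact ih _ (by rw [← hp, List.sum_cons]; omega)

/-- The thin idempotent is full. Both injectivity and surjectivity of `webHom` are thereby reduced
to the corner of webs between thin strands. -/
theorem one_mem_thinIdeal' : (1 : Web r) ∈ thinIdeal r := by
  rw [← sum_gen_one]
  refine Submodule.sum_mem _ fun a _ => ?_
  rw [gen_one]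
  exact one_mem_thinIdeal a.blocks 0 (by rw [zero_add, a.blocks_sum])

/-! ### Relations between thin webs -/

/-- The thin web with a merge and a split, between identity strands. -/
def crossAt (r : ℕ) (L R : List ℕ) : Web r := split r L 1 1 R * merge r L 1 1 R

theorem loc_mul_split_left (L : List ℕ) {k l : ℕ} (hk : 0 < k) (hl : 0 < l) (M : List ℕ)
    (y : LocGen) (R : List ℕ) :
    loc r (L ++ k :: l :: M) y R * split r L k l (M ++ y.src ++ R) =
      split r L k l (M ++ y.tgt ++ R) * loc r (L ++ (k + l) :: M) y R := by
  have := interchange (r := r) L (.split k l) M y R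
  rw [split_eq_loc hk hl, split_eq_loc hk hl]
  simp only [LocGen.par, ksign_zero_left, one_smul, LocGen.src, LocGen.tgt, List.append_assoc,
    List.cons_append, List.nil_append] at this ⊢
  exact this.symm

theorem loc_mul_split_right (L : List ℕ) (y : LocGen) (M : List ℕ) {k l : ℕ} (hk : 0 < k)
    (hl : 0 < l) (R : List ℕ) :
    loc r L y (M ++ k :: l :: R) * split r (L ++ y.src ++ M) k l R =
      split r (L ++ y.tgt ++ M) k l R * loc r L y (M ++ (k + l) :: R) := by
  have := interchange (r := r) L y M (.split k l) R
  rw [split_eq_loc hk hl, split_eq_loc hk hl]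
  simp only [LocGen.par, ksign_zero_right, one_smul, LocGen.src, LocGen.tgt, List.append_assoc,
    List.cons_append, List.nil_append] at this ⊢
  exact this

theorem loc_mul_crossAt_left (L M : List ℕ) (y : LocGen) (R : List ℕ) :
    loc r (L ++ 1 :: 1 :: M) y R * crossAt r L (M ++ y.src ++ R) =
      crossAt r L (M ++ y.tgt ++ R) * loc r (L ++ 1 :: 1 :: M) y R := by
  rw [crossAt, ← mul_assoc, loc_mul_split_left _ one_pos one_pos, mul_assoc, loc_mul_merge_left,
    crossAt, mul_assoc]

theorem loc_mul_crossAt_right (L : List ℕ) (y : LocGen) (M R : List ℕ) :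
    loc r L y (M ++ 1 :: 1 :: R) * crossAt r (L ++ y.src ++ M) R =
      crossAt r (L ++ y.tgt ++ M) R * loc r L y (M ++ 1 :: 1 :: R) := by
  rw [crossAt, ← mul_assoc, loc_mul_split_right _ _ _ one_pos one_pos, mul_assoc,
    loc_mul_merge_right, crossAt, mul_assoc]

theorem crossAt_comm (L M R : List ℕ) :
    crossAt r (L ++ 1 :: 1 :: M) R * crossAt r L (M ++ 1 :: 1 :: R) =
      crossAt r L (M ++ 1 :: 1 :: R) * crossAt r (L ++ 1 :: 1 :: M) R := by
  have h1 := loc_mul_crossAt_left (r := r) L M (.merge 1 1) R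
  have h2 := loc_mul_crossAt_left (r := r) L M (.split 1 1) R
  simp only [LocGen.src, LocGen.tgt, List.append_assoc, List.cons_append, List.nil_append] at h1 h2
  rw [crossAt, split_eq_loc one_pos one_pos, merge_eq_loc one_pos one_pos, mul_assoc, h1,
    ← mul_assoc, h2, mul_assoc]

theorem crossAt_sq (L R : List ℕ) : crossAt r L R * crossAt r L R = (2 : ℂ) • crossAt r L R := by
  have h : crossAt r L R * crossAt r L R =
      split r L 1 1 R * (merge r L 1 1 R * split r L 1 1 R) * merge r L 1 1 R := by
    simp only [crossAt, mul_assoc]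
  rw [h, explosion _ _ one_pos one_pos, mul_smul_comm, split_mul_one, smul_mul_assoc, ← crossAt]
  norm_num

/-- Two instances of the square switch, with strands `2, 1` and `1, 2`, turn both sides into the web
which merges three thin strands to one and splits it again. Associativity of merges and splits
identifies the two. -/
theorem crossAt_braid (L R : List ℕ) :
    crossAt r L (1 :: R) * crossAt r (L ++ [1]) R * crossAt r L (1 :: R) - crossAt r L (1 :: R) =
      crossAt r (L ++ [1]) R * crossAt r L (1 :: R) * crossAt r (L ++ [1]) R -
        crossAt r (L ++ [1]) R := by
  have h1 : crossAt r L (1 :: R) * crossAt r (L ++ [1]) R * crossAt r L (1 :: R) -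
      crossAt r L (1 :: R) = split r L 1 1 (1 :: R) * (split r L 2 1 R * merge r L 2 1 R) *
        merge r L 1 1 (1 :: R) := by
    rw [split_mul_merge_right, mul_sub, sub_mul]
    congr 1
    · simp only [crossAt, mul_assoc]
    · rw [split_mul_one L (1 :: R) 1 1, crossAt]
  have h2 : crossAt r (L ++ [1]) R * crossAt r L (1 :: R) * crossAt r (L ++ [1]) R -
      crossAt r (L ++ [1]) R = split r (L ++ [1]) 1 1 R * (split r L 1 2 R * merge r L 1 2 R) *
        merge r (L ++ [1]) 1 1 R := by
    have e := split_mul_one (r := r) (L ++ [1]) R 1 1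
    simp only [List.append_assoc, List.singleton_append] at e
    rw [split_mul_merge_left, mul_sub, sub_mul]
    congr 1
    · simp only [crossAt, mul_assoc]
    · rw [Nat.cast_one, one_smul, e, crossAt]
  have h3 := split_assoc (r := r) L R one_pos one_pos one_pos
  have h4 := merge_assoc (r := r) L R one_pos one_pos one_pos
  rw [h1, h2]
  calc _ = split r L 1 1 (1 :: R) * split r L (1 + 1) 1 R *
      (merge r L (1 + 1) 1 R * merge r L 1 1 (1 :: R)) := by simp only [mul_assoc]
    _ = _ := by rw [h3, h4]; simp only [mul_assoc, Nat.reduceAdd]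

theorem dots_mul_crossAt (L R : List ℕ) :
    (dot r L 1 (1 :: R) + dot r (L ++ [1]) 1 R) * crossAt r L R =
      crossAt r L R * (dot r L 1 (1 :: R) + dot r (L ++ [1]) 1 R) := by
  rw [crossAt, ← mul_assoc, add_mul, ← dot_split _ _ one_pos, mul_assoc, dot_merge _ _ one_pos,
    mul_assoc, mul_add, mul_add, mul_add]

theorem dot_anti (L M R : List ℕ) : dot r L 1 (M ++ 1 :: R) * dot r (L ++ 1 :: M) 1 R =
    -(dot r (L ++ 1 :: M) 1 R * dot r L 1 (M ++ 1 :: R)) := by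
  have := interchange (r := r) L (.dot 1) M (.dot 1) R
  simpa [LocGen.src, LocGen.tgt, LocGen.par, dot_eq_loc] using this

theorem one_mul_crossAt (L R : List ℕ) : one r (L ++ 1 :: 1 :: R) * crossAt r L R = crossAt r L R := by
  rw [crossAt, ← mul_assoc, one_mul_split]

theorem crossAt_mul_one (L R : List ℕ) : crossAt r L R * one r (L ++ 1 :: 1 :: R) = crossAt r L R := by
  rw [crossAt, mul_assoc, merge_mul_one]

theorem one_mul_dot (L R : List ℕ) (k : ℕ) : one r (L ++ k :: R) * dot r L k R = dot r L k R :=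
  one_mul_loc _ _ _ (by simp [LocGen.tgt])

theorem dot_mul_one (L R : List ℕ) (k : ℕ) : dot r L k R * one r (L ++ k :: R) = dot r L k R :=
  loc_mul_one _ _ _ (by simp [LocGen.src])

/-- With `crossAt = 1 + s` this means that `s` carries the dot from one strand to the other. The
dumbbell relation yields it only through `dumbbell_aux`, since it is quadratic in the dots. -/
theorem dot_mul_crossAt (L R : List ℕ) :
    dot r L 1 (1 :: R) * crossAt r L R - crossAt r L R * dot r (L ++ [1]) 1 R =
      dot r L 1 (1 :: R) - dot r (L ++ [1]) 1 R := by
  have e1 : L ++ 1 :: 1 :: R = L ++ [1] ++ 1 :: R := by simp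
  refine dumbbell_aux (e := one r (L ++ 1 :: 1 :: R)) (one_mul_crossAt _ _)
    (one_mul_dot _ _ _) ?_ ?_ ?_ ?_ (dots_mul_crossAt L R) ?_
  · rw [e1, one_mul_dot]
  · rw [dot_sq _ _ one_pos, Nat.cast_one, one_smul]
  · rw [dot_sq _ _ one_pos, Nat.cast_one, one_smul, e1]
  · exact dot_anti L [] R
  · exact dumbbell L R

/-- The mirror relation, obtained because the sum of the two dots commutes with `crossAt`. -/
theorem crossAt_mul_dot (L R : List ℕ) :
    crossAt r L R * dot r L 1 (1 :: R) - dot r (L ++ [1]) 1 R * crossAt r L R =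
      dot r L 1 (1 :: R) - dot r (L ++ [1]) 1 R := by
  rw [← dot_mul_crossAt]
  have := dots_mul_crossAt (r := r) L R
  rw [add_mul, mul_add] at this
  rw [sub_eq_sub_iff_add_eq_add, ← this, add_comm]

theorem thin_add_one_add (a b : ℕ) : thin (a + 1 + b) = thin a ++ 1 :: thin b := by
  rw [add_assoc, thin_add, add_comm 1 b, thin_succ]

theorem cross_eq (i p : ℕ) : cross (i + 2 + p) i = crossAt (i + 2 + p) (thin i) (thin p) := by
  rw [cross, crossAt, show i + 2 + p - 2 - i = p by omega]

theorem cross_eq' {i p : ℕ} (h : r = i + 2 + p) : cross r i = crossAt r (thin i) (thin p) := by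
  subst h; exact cross_eq i p

theorem thinDot_eq {j p : ℕ} (h : r = j + 1 + p) : thinDot r j = dot r (thin j) 1 (thin p) := by
  rw [thinDot, show r - 1 - j = p by omega]

theorem thinOne_eq (a b : ℕ) (h : r = a + b) : thinOne r = one r (thin a ++ thin b) := by
  rw [thinOne, h, thin_add]

/-- The merge-split web is the identity plus a transposition, so `cross r i - thinOne r` plays the
role of `s_i` and the thin dots that of the Clifford generators. For `x = cross r i`, `x² = 2x`
becomes `s_i² = 1`, and `crossAt_braid` becomes the braid relation. -/
theorem sergeevFamily_thin (r : ℕ) :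
    SergeevFamily r (thinOne r) (fun i => cross r i - thinOne r) (thinDot r) := by
  have ee : thinOne r * thinOne r = thinOne r := one_mul_one _
  have ec : ∀ i, i + 1 < r → thinOne r * cross r i = cross r i := by
    intro i hi
    obtain ⟨p, hp⟩ : ∃ p, r = i + 2 + p := ⟨r - i - 2, by omega⟩
    rw [cross_eq' hp, thinOne_eq i (p + 2) (by omega), thin_succ, thin_succ, one_mul_crossAt]
  have ce : ∀ i, i + 1 < r → cross r i * thinOne r = cross r i := by
    intro i hi
    obtain ⟨p, hp⟩ : ∃ p, r = i + 2 + p := ⟨r - i - 2, by omega⟩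
    rw [cross_eq' hp, thinOne_eq i (p + 2) (by omega), thin_succ, thin_succ, crossAt_mul_one]
  have ed : ∀ j, j < r → thinOne r * thinDot r j = thinDot r j := by
    intro j hj
    obtain ⟨p, hp⟩ : ∃ p, r = j + 1 + p := ⟨r - j - 1, by omega⟩
    rw [thinDot_eq hp, thinOne_eq j (p + 1) (by omega), thin_succ, one_mul_dot]
  have de : ∀ j, j < r → thinDot r j * thinOne r = thinDot r j := by
    intro j hj
    obtain ⟨p, hp⟩ : ∃ p, r = j + 1 + p := ⟨r - j - 1, by omega⟩
    rw [thinDot_eq hp, thinOne_eq j (p + 1) (by omega), thin_succ, dot_mul_one]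
  have cd : ∀ i, i + 1 < r → cross r i * thinDot r i - thinDot r (i + 1) * cross r i =
      thinDot r i - thinDot r (i + 1) := by
    intro i hi
    obtain ⟨p, hp⟩ : ∃ p, r = i + 2 + p := ⟨r - i - 2, by omega⟩
    have := crossAt_mul_dot (r := r) (thin i) (thin p)
    rw [cross_eq' hp, thinDot_eq (p := p + 1) (by omega), thinDot_eq (j := i + 1) (p := p) (by omega),
      thin_succ p, thin_add i 1]
    exact this
  have dc : ∀ i, i + 1 < r → thinDot r i * cross r i - cross r i * thinDot r (i + 1) =
      thinDot r i - thinDot r (i + 1) := by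
    intro i hi
    obtain ⟨p, hp⟩ : ∃ p, r = i + 2 + p := ⟨r - i - 2, by omega⟩
    have := dot_mul_crossAt (r := r) (thin i) (thin p)
    rw [cross_eq' hp, thinDot_eq (p := p + 1) (by omega), thinDot_eq (j := i + 1) (p := p) (by omega),
      thin_succ p, thin_add i 1]
    exact this
  constructor
  · exact ee
  · intro i hi
    rw [mul_sub, ec i hi, ee]
  · intro i hi
    rw [sub_mul, ce i hi, ee]
  · exact ed
  · exact de
  · intro i hi
    obtain ⟨p, hp⟩ : ∃ p, r = i + 2 + p := ⟨r - i - 2, by omega⟩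
    have h : cross r i * cross r i = (2 : ℂ) • cross r i := by rw [cross_eq' hp, crossAt_sq]
    rw [mul_sub, sub_mul, sub_mul, ec i hi, ce i hi, ee, h, two_smul]
    abel
  · intro i hi
    obtain ⟨p, hp⟩ : ∃ p, r = i + 2 + (p + 1) := ⟨r - i - 3, by omega⟩
    have h := crossAt_braid (r := r) (thin i) (thin p)
    have e1 : cross r i = crossAt r (thin i) (1 :: thin p) := cross_eq' hp
    have e2 : cross r (i + 1) = crossAt r (thin i ++ [1]) (thin p) := by
      rw [cross_eq' (i := i + 1) (p := p) (by omega), thin_add i 1]; rfl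
    have hs : ∀ i, i + 1 < r → cross r i * cross r i = (2 : ℂ) • cross r i := by
      intro i hi
      obtain ⟨p, hp⟩ : ∃ p, r = i + 2 + p := ⟨r - i - 2, by omega⟩
      rw [cross_eq' hp, crossAt_sq]
    rw [← e1, ← e2] at h
    -- The left side of the braid relation, expanded so that `x * y * x - x` is isolated; the
    -- correction terms agree after exchanging `x` and `y`.
    have key : ∀ x y : Web r, thinOne r * x = x → x * thinOne r = x → thinOne r * y = y →
        y * thinOne r = y → x * x = (2 : ℂ) • x →
        (x - thinOne r) * (y - thinOne r) * (x - thinOne r) = (x * y * x - x) + x + y + x - x * y -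
          y * x - (x - x) - thinOne r - x + (x - x) := by
      intro x y h1 h2 h3 h4 h5
      simp only [mul_sub, sub_mul, h1, h2, h3, h4, ee, h5, mul_assoc, two_smul]
      abel
    rw [key _ _ (ec i (by omega)) (ce i (by omega)) (ec _ hi) (ce _ hi) (hs i (by omega)),
      key _ _ (ec _ hi) (ce _ hi) (ec i (by omega)) (ce i (by omega)) (hs _ hi), h]
    abel
  · intro i j hij hj
    obtain ⟨m, rfl⟩ : ∃ m, j = i + 2 + m := ⟨j - i - 2, by omega⟩
    obtain ⟨p, hp⟩ : ∃ p, r = i + 2 + m + 2 + p := ⟨r - (i + 2 + m + 2), by omega⟩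
    have h := crossAt_comm (r := r) (thin i) (thin m) (thin p)
    have e1 : cross r i = crossAt r (thin i) (thin m ++ 1 :: 1 :: thin p) := by
      rw [cross_eq' (p := m + (p + 1 + 1)) (by omega), thin_add, thin_succ, thin_succ]
    have e2 : cross r (i + 2 + m) = crossAt r (thin i ++ 1 :: 1 :: thin m) (thin p) := by
      rw [cross_eq' hp, show i + 2 + m = i + (m + 1 + 1) by omega, thin_add, thin_succ, thin_succ]
    rw [← e1, ← e2] at h
    rw [mul_sub, mul_sub, sub_mul, sub_mul, sub_mul, sub_mul, ec i (by omega), ce i (by omega),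
      ec _ hj, ce _ hj, h]
    abel
  · intro j hj
    obtain ⟨p, hp⟩ : ∃ p, r = j + 1 + p := ⟨r - j - 1, by omega⟩
    rw [thinDot_eq hp, dot_sq _ _ one_pos, Nat.cast_one, one_smul, thinOne_eq j (p + 1) (by omega),
      thin_succ]
  · intro i j hij hj
    obtain ⟨m, rfl⟩ : ∃ m, j = i + 1 + m := ⟨j - i - 1, by omega⟩
    obtain ⟨p, hp⟩ : ∃ p, r = i + 1 + m + 1 + p := ⟨r - (i + 1 + m + 1), by omega⟩
    have h := dot_anti (r := r) (thin i) (thin m) (thin p)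
    rw [thinDot_eq hp, thinDot_eq (p := m + 1 + p) (by omega), thin_add_one_add, thin_add_one_add]
    exact h
  · intro i hi
    have := cd i hi
    rw [sub_mul, mul_sub, ed i (by omega), de _ hi]
    rw [sub_eq_iff_eq_add] at this
    rw [this]; abel
  · intro i hi
    have := dc i hi
    rw [sub_mul, mul_sub, ed _ hi, de i (by omega)]
    rw [sub_eq_iff_eq_add] at this
    rw [this]; abel
  · intro i j hi hj h1 h2
    have key : cross r i * thinDot r j = thinDot r j * cross r i := by
      rcases Nat.lt_or_ge j i with hji | hji
      · obtain ⟨m, rfl⟩ : ∃ m, i = j + 1 + m := ⟨i - j - 1, by omega⟩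
        obtain ⟨p, hp⟩ : ∃ p, r = j + 1 + m + 2 + p := ⟨r - (j + 1 + m + 2), by omega⟩
        have h := loc_mul_crossAt_right (r := r) (thin j) (.dot 1) (thin m) (thin p)
        simp only [LocGen.src, LocGen.tgt, List.append_assoc, List.singleton_append] at h
        rw [cross_eq' hp, thinDot_eq (p := m + (p + 1 + 1)) (by omega), thin_add_one_add, thin_add m,
          thin_succ, thin_succ]
        exact h.symm
      · obtain ⟨m, rfl⟩ : ∃ m, j = i + 2 + m := ⟨j - i - 2, by omega⟩
        obtain ⟨p, hp⟩ : ∃ p, r = i + 2 + m + 1 + p := ⟨r - (i + 2 + m + 1), by omega⟩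
        have h := loc_mul_crossAt_left (r := r) (thin i) (thin m) (.dot 1) (thin p)
        simp only [LocGen.src, LocGen.tgt, List.append_assoc, List.singleton_append] at h
        rw [cross_eq' (p := m + 1 + p) (by omega), thinDot_eq hp, thin_add_one_add,
          show i + 2 + m = i + (m + 1 + 1) by omega, thin_add i, thin_succ, thin_succ]
        exact h.symm
    rw [sub_mul, mul_sub, ed _ hj, de _ hj, key]

end Web
end TypeQ

end


/-! ### Normal forms of Sergeev words and the dimension bound. -/

noncomputable section

namespace TypeQ

open scoped Pointwise Classical

namespace SergeevFamily

variable {A : Type} [Ring A] [Algebra ℂ A] {r : ℕ} {e : A} {s d : ℕ → A}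

/-- The monomials in the first `n` Clifford generators. -/
def cliffordMonomials (e : A) (d : ℕ → A) : ℕ → Finset A
  | 0 => {e}
  | n + 1 => cliffordMonomials e d n * {e, d n}

/-- The product `s_{n-1} ⋯ s_j` with `n - j = k` factors. -/
def descent (e : A) (s : ℕ → A) (n : ℕ) : ℕ → A
  | 0 => e
  | k + 1 => descent e s n k * s (n - 1 - k)

/-- Normal forms of the permutations of `n` letters. -/
def permMonomials (e : A) (s : ℕ → A) : ℕ → Finset A
  | 0 => {e}
  | n + 1 => permMonomials e s n * (Finset.range (n + 1)).image (descent e s n)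

omit [Algebra ℂ A] in
theorem card_cliffordMonomials_le (n : ℕ) : (cliffordMonomials e d n).card ≤ 2 ^ n := by
  induction n with
  | zero => simp [cliffordMonomials]
  | succ n ih =>
    rw [cliffordMonomials, pow_succ]
    exact Finset.card_mul_le.trans (Nat.mul_le_mul ih Finset.card_le_two)

omit [Algebra ℂ A] in
theorem card_permMonomials_le (n : ℕ) : (permMonomials e s n).card ≤ n.factorial := by
  induction n with
  | zero => simp [permMonomials]
  | succ n ih =>
    rw [permMonomials, Nat.factorial_succ, mul_comm]
    refine Finset.card_mul_le.trans (Nat.mul_le_mul ih ?_)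
    exact Finset.card_image_le.trans (by simp)

/-- Closure of a span of products under right multiplication. -/
theorem mul_mem_span_of_forall {S : Set A} {M : Submodule ℂ A} {x : A} (h : ∀ y ∈ S, y * x ∈ M) :
    ∀ y ∈ Submodule.span ℂ S, y * x ∈ M := by
  intro y hy
  induction hy using Submodule.span_induction with
  | mem y hy => exact h y hy
  | zero => rw [zero_mul]; exact M.zero_mem
  | add a b _ _ ha hb => rw [add_mul]; exact M.add_mem ha hb
  | smul c a _ ha => rw [smul_mul_assoc]; exact M.smul_mem c ha

variable (H : SergeevFamily r e s d)
include H

/-- A Clifford generator moves left past those of larger index and is absorbed by its own factor, by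
`d_sq` or as a new factor. The signs force the span in place of the finite set. -/
theorem clifford_mul_d (n : ℕ) : n ≤ r → ∀ j < n, ∀ x ∈ cliffordMonomials e d n,
    x * d j ∈ Submodule.span ℂ (cliffordMonomials e d n : Set A) := by
  induction n with
  | zero => intro _ j hj; omega
  | succ n ih =>
    intro hn j hj x hx
    have hsub : ∀ y ∈ Submodule.span ℂ (cliffordMonomials e d n : Set A),
        ∀ z ∈ ({e, d n} : Finset A),
        y * z ∈ Submodule.span ℂ (cliffordMonomials e d (n + 1) : Set A) := by
      intro y hy z hz
      refine mul_mem_span_of_forall (fun y hy => ?_) y hy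
      refine Submodule.subset_span ?_
      rw [cliffordMonomials]
      exact Finset.mem_coe.2 (Finset.mul_mem_mul hy hz)
    rw [cliffordMonomials, Finset.mem_mul] at hx
    obtain ⟨y, hy, z, hz, rfl⟩ := hx
    have hy' := Submodule.subset_span (R := ℂ) (Finset.mem_coe.2 hy)
    rw [Finset.mem_insert, Finset.mem_singleton] at hz
    by_cases hjn : j = n
    · subst hjn
      rcases hz with rfl | rfl
      · rw [mul_assoc, H.e_d j hn]
        exact hsub y hy' _ (by simp)
      · rw [mul_assoc, H.d_sq j hn]
        exact hsub y hy' _ (by simp)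
    · have hj' : j < n := by omega
      have h1 := ih (by omega) j hj' y hy
      rcases hz with rfl | rfl
      · rw [mul_assoc, H.e_d j (by omega), ← H.d_e j (by omega), ← mul_assoc]
        exact hsub _ h1 _ (by simp)
      · have : d n * d j = -(d j * d n) := by rw [H.d_anti j n hj' hn, neg_neg]
        rw [mul_assoc, this, mul_neg, ← mul_assoc]
        exact Submodule.neg_mem _ (hsub _ h1 _ (by simp))

theorem descent_e (n : ℕ) (hn : n < r) (k : ℕ) (hk : k ≤ n) :
    descent e s n k * e = descent e s n k := by
  cases k with
  | zero => exact H.e_sq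
  | succ k => rw [descent, mul_assoc, H.s_e _ (by omega)]

/-- A transposition of small index passes the product to the left. -/
theorem descent_mul_s_low (n : ℕ) (hn : n < r) (k : ℕ) (hk : k ≤ n) (i : ℕ) (hi : i + 1 + k < n) :
    descent e s n k * s i = s i * descent e s n k := by
  induction k with
  | zero => rw [descent, H.e_s i (by omega), H.s_e i (by omega)]
  | succ k ih =>
    rw [descent, mul_assoc, ← H.s_comm i (n - 1 - k) (by omega) (by omega), ← mul_assoc,
      ih (by omega) (by omega), mul_assoc]

/-- A transposition of large index passes the product to the left, with a shift of its index. -/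
theorem descent_mul_s_high (n : ℕ) (hn : n < r) (k : ℕ) (hk : k ≤ n) (i : ℕ) (hin : i < n)
    (hi : n < i + k) : descent e s n k * s i = s (i - 1) * descent e s n k := by
  induction k with
  | zero => omega
  | succ k ih =>
    by_cases h : n < i + k
    · rw [descent, mul_assoc, H.s_comm (n - 1 - k) i (by omega) (by omega), ← mul_assoc,
        ih (by omega) h, mul_assoc]
    -- Here `i + k = n`, so the product ends in `s i * s (i - 1)` and the braid relation applies to
    -- the additional `s i`; the new letter on the left then commutes with the rest.
    · obtain ⟨k, rfl⟩ : ∃ m, k = m + 1 := ⟨k - 1, by omega⟩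
      obtain ⟨m, rfl⟩ : ∃ m, i = m + 1 := ⟨i - 1, by omega⟩
      have e1 : n - 1 - k = m + 1 := by omega
      have e2 : n - 1 - (k + 1) = m := by omega
      rw [descent, descent, e1, e2, mul_assoc, mul_assoc, ← mul_assoc (s (m + 1)),
        ← H.braid m (by omega), ← mul_assoc, ← mul_assoc,
        H.descent_mul_s_low n hn k (by omega) m (by omega)]
      simp only [mul_assoc, Nat.add_sub_cancel]

/-- A descent `s_{n-1} ⋯ s_{n-k}` absorbs `s_i` in one of four ways: for small or large `i` a
transposition passes to the left, unchanged or with index `i - 1`; for `i = n - 1 - k` the descent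
becomes longer; for `i = n - k` its last factor cancels. -/
theorem perm_mul_s (n : ℕ) : n ≤ r → ∀ i, i + 1 < n → ∀ x ∈ permMonomials e s n,
    x * s i ∈ permMonomials e s n := by
  induction n with
  | zero => intro _ i hi; omega
  | succ n ih =>
    intro hn i hi x hx
    rw [permMonomials, Finset.mem_mul] at hx ⊢
    obtain ⟨y, hy, z, hz, rfl⟩ := hx
    obtain ⟨k, hk, rfl⟩ := Finset.mem_image.1 hz
    have hk' : k ≤ n := by rw [Finset.mem_range] at hk; omega
    rcases Nat.lt_or_ge (i + 1 + k) n with h1 | h1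
    · refine ⟨y * s i, ih (by omega) i (by omega) y hy, _, hz, ?_⟩
      rw [mul_assoc, mul_assoc, H.descent_mul_s_low n hn k hk' i h1]
    rcases Nat.lt_or_ge n (i + k) with h2 | h2
    · refine ⟨y * s (i - 1), ih (by omega) (i - 1) (by omega) y hy, _, hz, ?_⟩
      rw [mul_assoc, mul_assoc, H.descent_mul_s_high n hn k hk' i (by omega) h2]
    rcases Nat.lt_or_ge (i + k) n with h3 | h3
    · refine ⟨y, hy, descent e s n (k + 1), Finset.mem_image_of_mem _ ?_, ?_⟩
      · rw [Finset.mem_range]; omega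
      · rw [descent, mul_assoc, show n - 1 - k = i by omega]
    · obtain ⟨k, rfl⟩ : ∃ m, k = m + 1 := ⟨k - 1, by omega⟩
      refine ⟨y, hy, descent e s n k, Finset.mem_image_of_mem _ ?_, ?_⟩
      · rw [Finset.mem_range]; omega
      · rw [descent, show n - 1 - k = i by omega, mul_assoc, mul_assoc, H.s_sq i (by omega),
          H.descent_e n hn k (by omega)]

theorem s_mul_d (i : ℕ) (hi : i + 1 < r) (j : ℕ) (hj : j < r) :
    ∃ j' < r, s i * d j = d j' * s i := by
  by_cases h1 : j = i
  · subst h1; exact ⟨j + 1, hi, H.s_d j hi⟩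
  by_cases h2 : j = i + 1
  · subst h2; exact ⟨i, by omega, H.s_d' i hi⟩
  exact ⟨j, hj, H.s_d_far i j hi hj h1 h2⟩

theorem descent_mul_d (n : ℕ) (hn : n < r) (k : ℕ) (hk : k ≤ n) :
    ∀ j < r, ∃ j' < r, descent e s n k * d j = d j' * descent e s n k := by
  induction k with
  | zero => intro j hj; exact ⟨j, hj, by rw [descent, H.e_d j hj, H.d_e j hj]⟩
  | succ k ih =>
    intro j hj
    obtain ⟨j1, h1, e1⟩ := H.s_mul_d (n - 1 - k) (by omega) j hj
    obtain ⟨j2, h2, e2⟩ := ih (by omega) j1 h1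
    exact ⟨j2, h2, by rw [descent, mul_assoc, e1, ← mul_assoc, e2, mul_assoc]⟩

/-- Only the existence of some index `j'` matters: the spanning set contains all monomials in the
Clifford generators to the left of the permutations. -/
theorem perm_mul_d (n : ℕ) : n ≤ r → ∀ x ∈ permMonomials e s n, ∀ j < r, ∃ j' < r,
    x * d j = d j' * x := by
  induction n with
  | zero =>
    intro _ x hx j hj
    rw [permMonomials, Finset.mem_singleton] at hx
    exact ⟨j, hj, by rw [hx, H.e_d j hj, H.d_e j hj]⟩
  | succ n ih =>
    intro hn x hx j hj
    rw [permMonomials, Finset.mem_mul] at hx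
    obtain ⟨y, hy, z, hz, rfl⟩ := hx
    obtain ⟨k, hk, rfl⟩ := Finset.mem_image.1 hz
    obtain ⟨j1, h1, e1⟩ := H.descent_mul_d n hn k (by rw [Finset.mem_range] at hk; omega) j hj
    obtain ⟨j2, h2, e2⟩ := ih (by omega) y hy j1 h1
    exact ⟨j2, h2, by rw [mul_assoc, e1, ← mul_assoc, e2, mul_assoc]⟩

theorem e_mem_clifford (n : ℕ) : e ∈ cliffordMonomials e d n := by
  induction n with
  | zero => simp [cliffordMonomials]
  | succ n ih =>
    rw [cliffordMonomials]
    exact Finset.mem_mul.2 ⟨e, ih, e, by simp, H.e_sq⟩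

theorem e_mem_perm (n : ℕ) : e ∈ permMonomials e s n := by
  induction n with
  | zero => simp [permMonomials]
  | succ n ih =>
    rw [permMonomials]
    exact Finset.mem_mul.2 ⟨e, ih, e, Finset.mem_image.2 ⟨0, by simp, rfl⟩, H.e_sq⟩

/-- The right module generated by the idempotent is spanned by at most `2 ^ r * r!` elements. -/
theorem exists_finset : ∃ B : Finset A, B.card ≤ 2 ^ r * r.factorial ∧
    e ∈ Submodule.span ℂ (B : Set A) ∧
    (∀ i, i + 1 < r → ∀ x ∈ Submodule.span ℂ (B : Set A), x * s i ∈ Submodule.span ℂ (B : Set A)) ∧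
    ∀ j < r, ∀ x ∈ Submodule.span ℂ (B : Set A), x * d j ∈ Submodule.span ℂ (B : Set A) := by
  refine ⟨cliffordMonomials e d r * permMonomials e s r, Finset.card_mul_le.trans
    (Nat.mul_le_mul (card_cliffordMonomials_le r) (card_permMonomials_le r)), ?_, ?_, ?_⟩
  · refine Submodule.subset_span (Finset.mem_coe.2 ?_)
    exact Finset.mem_mul.2 ⟨e, H.e_mem_clifford r, e, H.e_mem_perm r, H.e_sq⟩
  · refine fun i hi => mul_mem_span_of_forall fun x hx => Submodule.subset_span ?_
    obtain ⟨y, hy, z, hz, rfl⟩ := Finset.mem_mul.1 (Finset.mem_coe.1 hx)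
    rw [mul_assoc]
    exact Finset.mem_coe.2 (Finset.mul_mem_mul hy (H.perm_mul_s r le_rfl i hi z hz))
  · refine fun j hj => mul_mem_span_of_forall fun x hx => ?_
    obtain ⟨y, hy, z, hz, rfl⟩ := Finset.mem_mul.1 (Finset.mem_coe.1 hx)
    obtain ⟨j', hj', e1⟩ := H.perm_mul_d r le_rfl z hz j hj
    rw [mul_assoc, e1, ← mul_assoc]
    refine mul_mem_span_of_forall (fun w hw => ?_) _ (H.clifford_mul_d r le_rfl j' hj' y hy)
    exact Submodule.subset_span (Finset.mem_coe.2 (Finset.mul_mem_mul (Finset.mem_coe.1 hw) hz))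

end SergeevFamily

namespace Web

variable {r : ℕ}

/-- The webs between thin strands span a space of dimension at most `2 ^ r * r!`. -/
theorem exists_finset_thin (r : ℕ) : ∃ B : Finset (Web r), B.card ≤ 2 ^ r * r.factorial ∧
    ∀ w, thinOne r * w * thinOne r ∈ Submodule.span ℂ (B : Set (Web r)) := by
  have H := sergeevFamily_thin r
  obtain ⟨B, hB, he, hs, hd⟩ := H.exists_finset
  refine ⟨B, hB, fun w => ?_⟩
  obtain ⟨a, ha, h⟩ := exists_thin w
  rw [h]
  suffices key : ∀ x ∈ Submodule.span ℂ (B : Set (Web r)), x * a ∈ Submodule.span ℂ (B : Set (Web r))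
    from key _ he
  clear h
  induction ha using Algebra.adjoin_induction with
  | mem a ha =>
    intro x hx
    rcases ha with ⟨i, hi, rfl⟩ | ⟨j, hj, rfl⟩
    -- `cross` is `s_i` plus the idempotent, and right multiplication by the idempotent is twofold
    -- multiplication by `s_i`.
    · have h1 := hs i hi x hx
      have h2 := hs i hi _ h1
      rw [mul_assoc, H.s_sq i hi] at h2
      rw [show cross r i = (cross r i - thinOne r) + thinOne r by abel, mul_add]
      exact add_mem h1 h2
    · exact hd j hj x hx
  | algebraMap c =>
    intro x hx
    rw [Algebra.algebraMap_eq_smul_one, mul_smul_comm, mul_one]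
    exact Submodule.smul_mem _ _ hx
  | add a b _ _ ha hb => intro x hx; rw [mul_add]; exact add_mem (ha x hx) (hb x hx)
  | mul a b _ _ ha hb => intro x hx; rw [← mul_assoc]; exact hb _ (ha x hx)

end Web
end TypeQ

end


noncomputable section

namespace TypeQ

variable {r : ℕ}

/-! ## The thin webs act faithfully -/

theorem thinOne_eq_gen (r : ℕ) : Web.thinOne r = Web.gen (.one (Composition.ones r)) := by
  rw [Web.gen_one]; rfl

/-- The monomial `v_1 ⊗ ⋯ ⊗ v_r`. -/
def baseMono (r : ℕ) : Mono r r := fun p => (p, 0)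

theorem fib_baseMono (k : Fin r) : fib (baseMono r) k = {k} := by
  ext p; simp [mem_fib, baseMono]

theorem wt_baseMono : wt (baseMono r) = (hat (Composition.ones r)).1.1 := by
  funext k
  rw [← card_fib, fib_baseMono, Finset.card_singleton]
  have : (hat (Composition.ones r)).1.1 k = (List.replicate r 1).getD k 0 := rfl
  rw [this]
  simp [List.getD]

/-- The monomial `v_1 ⊗ ⋯ ⊗ v_r`, in the sum of the permutation supermodules. -/
def baseVec (r : ℕ) : PermSum r :=
  permOf (hat (Composition.ones r)) ⟨mono (baseMono r), mono_mem_weightSpace wt_baseMono⟩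

theorem permIncl_baseVec : permIncl r (baseVec r) = mono (baseMono r) := permIncl_permOf _ _

theorem permProj_permOf (l : Weight' r) (x : permMod l.1) : permProj l (permOf l x) = permOf l x := by
  rw [permProj, LinearMap.comp_apply, permOf, DirectSum.component.lof_self]

theorem coe_webHom_thinOne :
    (webHom r (Web.thinOne r) : Module.End ℂ (PermSum r)) = permProj (hat (Composition.ones r)) := by
  rw [thinOne_eq_gen, coe_webHom_one]

/-- The action of webs on the base vector, in the model. -/
def evalBase (r : ℕ) : Web r →ₗ[ℂ] BlockSpace r where
  toFun w := toBlocks r r (permIncl r ((webHom r w : Module.End ℂ (PermSum r)) (baseVec r)))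
  map_add' u v := by simp
  map_smul' c v := by simp

theorem evalBase_apply (w : Web r) : evalBase r w =
    toBlocks r r (permIncl r ((webHom r w : Module.End ℂ (PermSum r)) (baseVec r))) := rfl

theorem toBlocks_permIncl_webHom (x : FreeAlgebra ℂ (WebGen r)) (m : PermSum r) :
    toBlocks r r (permIncl r ((webHom r (Presented.mk _ x) : Module.End ℂ (PermSum r)) m)) =
      opWeb x (toBlocks r r (permIncl r m)) := by
  rw [coe_webHom_mk, toBlocks_permIncl_lift]

theorem evalBase_mk_mul (x : FreeAlgebra ℂ (WebGen r)) (w : Web r) :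
    evalBase r (Presented.mk _ x * w) = opWeb x (evalBase r w) := by
  rw [evalBase_apply, map_mul, evalBase_apply, ← toBlocks_permIncl_webHom]
  rfl

/-- Compression of a web to the thin strands. -/
def compress (r : ℕ) : Web r →ₗ[ℂ] Web r where
  toFun w := Web.thinOne r * w * Web.thinOne r
  map_add' u v := by rw [mul_add, add_mul]
  map_smul' c v := by rw [mul_smul_comm, smul_mul_assoc]; rfl

theorem compress_apply (w : Web r) : compress r w = Web.thinOne r * w * Web.thinOne r := rfl

/-- The values of the webs between thin strands at the base vector. -/
def thinImage (r : ℕ) : Submodule ℂ (BlockSpace r) :=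
  (LinearMap.range (compress r)).map (evalBase r)

/-- The hypothesis says that `x` ends in thin strands. As elements of the image already end in thin
strands, composing with `x` gives again a value of a compressed web. -/
theorem opWeb_mem_thinImage {x : FreeAlgebra ℂ (WebGen r)}
    (h : Web.thinOne r * Presented.mk _ x = Presented.mk (WebRel r) x) {u : BlockSpace r}
    (hu : u ∈ thinImage r) : opWeb x u ∈ thinImage r := by
  obtain ⟨_, ⟨w, rfl⟩, rfl⟩ := hu
  refine ⟨_, ⟨Presented.mk _ x * Web.thinOne r * w, rfl⟩, ?_⟩
  rw [← evalBase_mk_mul, compress_apply, compress_apply]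
  congr 1
  rw [← mul_assoc, ← mul_assoc, h]
  simp only [mul_assoc]

theorem st_baseMono_mem : st ((List.finRange r).map fun p => {p}) (mono (parMono (baseMono r))) ∈
    thinImage r := by
  refine ⟨_, ⟨1, rfl⟩, ?_⟩
  have e : (fun p : Fin r => ({p} : Finset (Fin r))) = fib (baseMono r) := by
    funext k; rw [fib_baseMono]
  rw [compress_apply, mul_one, Web.thinOne, Web.one_mul_one, ← Web.thinOne, evalBase_apply,
    coe_webHom_thinOne, baseVec, permProj_permOf, ← baseVec, permIncl_baseVec, toBlocks_mono, e]

theorem map_card_singleton (B : List (Fin r)) :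
    (B.map fun p => ({p} : Finset (Fin r))).map Finset.card = Web.thin B.length := by
  induction B with
  | nil => rfl
  | cons p B ih => rw [List.map_cons, List.map_cons, ih, List.length_cons, Web.thin_succ]; rfl

/-- On singleton blocks a thin dot is a single Clifford generator, so the dot is placed on the
strand where `p` occurs. -/
theorem st_clif_mem {B : List (Fin r)} (hB : B.length = r) {p : Fin r} (hp : p ∈ B) {v : Tens 1 r}
    (h : st (B.map fun p => {p}) v ∈ thinImage r) :
    st (B.map fun p => {p}) (clif p v) ∈ thinImage r := by
  obtain ⟨B₁, B₂, rfl⟩ := List.append_of_mem hp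
  have hl : B₁.length + 1 + B₂.length = r := by simp at hB; omega
  have e := opWeb_wDot (r := r) (B₁ := B₁.map fun p => ({p} : Finset (Fin r))) (A := {p})
    (B₂ := B₂.map fun p => {p}) (L := Web.thin B₁.length) (R := Web.thin B₂.length) (k := 1) v rfl
    (map_card_singleton _) rfl (map_card_singleton _) (by simp [Web.sum_thin]; omega)
  rw [Finset.sum_singleton] at e
  have h' := opWeb_mem_thinImage (x := wDot r (Web.thin B₁.length) 1 (Web.thin B₂.length)) (by
    have := (Web.sergeevFamily_thin r).e_d B₁.length (by omega)
    rwa [Web.thinDot_eq hl.symm] at this) h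
  rw [List.map_append, List.map_cons] at h' ⊢
  rwa [e] at h'

theorem st_swap_mem {B₁ B₂ : List (Fin r)} {p q : Fin r} (hpq : p ≠ q)
    (hB : B₁.length + 2 + B₂.length = r) {v : Tens 1 r}
    (h : st ((B₁ ++ p :: q :: B₂).map fun p => {p}) v ∈ thinImage r) :
    st ((B₁ ++ q :: p :: B₂).map fun p => {p}) v ∈ thinImage r := by
  set C₁ := B₁.map fun p => ({p} : Finset (Fin r))
  set C₂ := B₂.map fun p => ({p} : Finset (Fin r))
  have h1 : C₁.map Finset.card = Web.thin B₁.length := map_card_singleton _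
  have h2 : C₂.map Finset.card = Web.thin B₂.length := map_card_singleton _
  have e1 := opWeb_wMerge (r := r) (B₁ := C₁) (A := {p}) (A' := {q}) (B₂ := C₂) (k := 1) (l := 1) v
    rfl h1 rfl rfl h2 (by simp [Web.sum_thin]; omega)
  have e2 := opWeb_wSplit (r := r) (B₁ := C₁) (A := {p} ∪ {q}) (B₂ := C₂) (k := 1) (l := 1) v
    rfl h1 (by rw [Finset.singleton_union, Finset.card_pair hpq]) h2 (by simp [Web.sum_thin]; omega)
  have hps : ({p} ∪ {q} : Finset (Fin r)).powersetCard 1 = {{p}, {q}} := by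
    ext T
    simp only [Finset.mem_powersetCard, Finset.card_eq_one, Finset.mem_insert, Finset.mem_singleton]
    constructor
    · rintro ⟨hT, a, rfl⟩
      simpa using hT
    · rintro (rfl | rfl) <;> simp
  rw [hps, Finset.sum_pair (by simpa using hpq)] at e2
  have hd1 : ({p} ∪ {q} : Finset (Fin r)) \ {p} = {q} := by
    ext a; simp; grind
  have hd2 : ({p} ∪ {q} : Finset (Fin r)) \ {q} = {p} := by
    ext a; simp; grind
  rw [hd1, hd2] at e2
  have h' := opWeb_mem_thinImage (x := wSplit r (Web.thin B₁.length) 1 1 (Web.thin B₂.length) *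
      wMerge r (Web.thin B₁.length) 1 1 (Web.thin B₂.length)) (by
    have := Web.one_mul_crossAt (r := r) (Web.thin B₁.length) (Web.thin B₂.length)
    rw [Web.thinOne_eq B₁.length (B₂.length + 1 + 1) (by omega), Web.thin_succ, Web.thin_succ,
      map_mul]
    exact this) h
  have e3 : (B₁ ++ p :: q :: B₂).map (fun p => ({p} : Finset (Fin r))) = C₁ ++ {p} :: {q} :: C₂ := by
    simp [C₁, C₂]
  have e4 : (B₁ ++ q :: p :: B₂).map (fun p => ({p} : Finset (Fin r))) = C₁ ++ {q} :: {p} :: C₂ := by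
    simp [C₁, C₂]
  rw [e3] at h h'
  rw [e4]
  rw [map_mul, Module.End.mul_apply, e1, e2] at h'
  -- The merge-split web gives the original list plus the exchanged one; the original is subtracted.
  simpa using sub_mem h' h

theorem clif_mono (p : Fin r) (J : Mono 1 r) : clif p (mono J) =
    ksign 1 (prePar J p) • mono (Function.update J p (0, (J p).2 + 1)) := by
  rw [clif, opAt, onMono_mono, if_pos (Subsingleton.elim _ _)]

/-- A subspace which contains one monomial and is stable under the Clifford generators is
everything. -/
theorem mono_mem_of_clif {M : Submodule ℂ (Tens 1 r)} (h0 : mono (parMono (baseMono r)) ∈ M)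
    (h : ∀ p, ∀ v ∈ M, clif p v ∈ M) (J : Mono 1 r) : mono J ∈ M := by
  have key : ∀ S : Finset (Fin r), mono (fun p => (0, if p ∈ S then (J p).2 else 0)) ∈ M := by
    intro S
    induction S using Finset.induction_on with
    | empty =>
      have e : (fun p => ((0 : Fin 1), if p ∈ (∅ : Finset (Fin r)) then (J p).2 else 0)) =
          parMono (baseMono r) := by
        funext p; simp [parMono, baseMono]
      rw [e]; exact h0
    | insert p S hp ih =>
      rcases zmod2_cases (J p).2 with hJ | hJ
      · convert ih using 3 with q
        by_cases hq : q = p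
        · subst hq; simp [hJ]
        · simp [hq]
      · have h1 := h p _ ih
        rw [clif_mono] at h1
        -- The scalar is its own inverse and removes the sign of the Clifford generator.
        have h2 := M.smul_mem (ksign 1 (prePar (fun p => ((0 : Fin 1), if p ∈ S then (J p).2 else 0)) p)) h1
        rw [smul_smul, ksign_mul_self, one_smul] at h2
        convert h2 using 2
        funext q
        by_cases hq : q = p
        · subst hq; simp [hJ, hp]
        · simp [hq]
  convert key Finset.univ using 2
  funext p
  exact Prod.ext (Subsingleton.elim _ _) (by simp)

/-- Permuted lists are linked by adjacent exchanges. The prefix `P` is there for the induction,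
which peels off common first elements. -/
theorem st_perm_mem {B B' : List (Fin r)} (hBB : B.Perm B') : ∀ P : List (Fin r),
    (P ++ B).Nodup → (P ++ B).length = r →
    (∀ v, st ((P ++ B).map fun p => {p}) v ∈ thinImage r) →
    ∀ v, st ((P ++ B').map fun p => {p}) v ∈ thinImage r := by
  induction hBB with
  | nil => intro P _ _ h; exact h
  | cons x _ ih =>
    intro P hn hl h
    have := ih (P ++ [x]) (by simpa using hn) (by simpa using hl) (by simpa using h)
    simpa using this
  | swap x y l =>
    intro P hn hl h v
    refine st_swap_mem ?_ ?_ (h v)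
    · rw [List.nodup_append] at hn
      have := hn.2.1
      simp only [List.nodup_cons, List.mem_cons, not_or] at this
      exact this.1.1
    · simp at hl; omega
  | trans h1 _ ih1 ih2 =>
    intro P hn hl h
    refine ih2 P ((h1.append_left P).nodup_iff.1 hn) ?_ (ih1 P hn hl h)
    simpa [h1.length_eq] using hl

theorem st_mem_thinImage {B : List (Fin r)} (hB : B.Perm (List.finRange r)) (v : Tens 1 r) :
    st (B.map fun p => {p}) v ∈ thinImage r := by
  have h0 : ∀ v, st ((List.finRange r).map fun p => {p}) v ∈ thinImage r := by
    intro v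
    induction v using tens_induction with
    | zero => rw [map_zero]; exact Submodule.zero_mem _
    | add u v hu hv => rw [map_add]; exact Submodule.add_mem _ hu hv
    | smul c J =>
      rw [map_smul]
      refine Submodule.smul_mem _ _ ?_
      exact mono_mem_of_clif (M := (thinImage r).comap (st ((List.finRange r).map fun p => {p})))
        st_baseMono_mem (fun p v hv => st_clif_mem (by simp) (List.mem_finRange p) hv) J
  exact st_perm_mem hB.symm [] (by simpa using List.nodup_finRange r) (by simp) h0 v

theorem st_singletons (B : List (Fin r)) (J : Mono 1 r) : st (B.map fun p => {p}) (mono J) =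
    Finsupp.single (B.map fun p => ({p} : Finset (Fin r))) (mono J) := by
  rw [st, Finsupp.lsingle_apply, List.filter_eq_self.2]
  intro A hA
  obtain ⟨p, -, rfl⟩ := List.mem_map.1 hA
  simp

/-- The basis of monomials of `V^{⊗ r}`. -/
def tensBasis (n r : ℕ) : Module.Basis (Mono n r) ℂ (Tens n r) :=
  (Finsupp.basisSingleOne : Module.Basis (Mono n r) ℂ (Mono n r →₀ ℂ))

theorem tensBasis_apply {n : ℕ} (I : Mono n r) : tensBasis n r I = mono I :=
  congrFun (Finsupp.coe_basisSingleOne (R := ℂ) (ι := Mono n r)) I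

/-- The standard basis of the model. -/
def blockBasis (r : ℕ) : Module.Basis (Σ _ : List (Finset (Fin r)), Mono 1 r) ℂ (BlockSpace r) :=
  Finsupp.basis fun _ => tensBasis 1 r

theorem blockBasis_apply (B : List (Finset (Fin r))) (J : Mono 1 r) :
    blockBasis r ⟨B, J⟩ = Finsupp.single B (mono J) := by
  rw [← tensBasis_apply]
  exact congrFun (Finsupp.coe_basis fun _ : List (Finset (Fin r)) => tensBasis 1 r) ⟨B, J⟩

/-- A permutation of the places and a choice of parities give distinct basis vectors of the model,
all of which are reached by thin webs. -/
theorem card_le_finrank_thinImage [Module.Finite ℂ (thinImage r)] :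
    2 ^ r * r.factorial ≤ Module.finrank ℂ (thinImage r) := by
  let F : Equiv.Perm (Fin r) × Mono 1 r → Σ _ : List (Finset (Fin r)), Mono 1 r :=
    fun x => ⟨((List.finRange r).map x.1).map fun p => {p}, x.2⟩
  have hF : Function.Injective F := by
    rintro ⟨σ, J⟩ ⟨τ, K⟩ h
    simp only [F, Sigma.mk.injEq, heq_eq_eq] at h
    refine Prod.ext (Equiv.ext fun p => ?_) h.2
    have := List.map_injective_iff.2 (Finset.singleton_injective) h.1
    exact List.map_inj_left.1 this p (List.mem_finRange p)
  have hli := (blockBasis r).linearIndependent.comp F hF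
  have hmem : ∀ x, blockBasis r (F x) ∈ thinImage r := by
    rintro ⟨σ, J⟩
    rw [blockBasis_apply, ← st_singletons]
    refine st_mem_thinImage ?_ _
    exact Equiv.Perm.map_finRange_perm σ
  have hli' : LinearIndependent ℂ fun x => (⟨blockBasis r (F x), hmem x⟩ : thinImage r) :=
    LinearIndependent.of_comp (thinImage r).subtype hli
  have := hli'.fintype_card_le_finrank
  rw [Fintype.card_prod, Fintype.card_perm, Fintype.card_fin] at this
  have e : Fintype.card (Mono 1 r) = 2 ^ r := by
    rw [Fintype.card_fun]; simp
  rwa [e, mul_comm] at this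

/-- A web between thin strands is determined by its value at the base vector. -/
theorem compress_eq_zero {w : Web r}
    (h : (webHom r (compress r w) : Module.End ℂ (PermSum r)) (baseVec r) = 0) :
    compress r w = 0 := by
  obtain ⟨B, hB, hmem⟩ := Web.exists_finset_thin r
  set E := LinearMap.range (compress r) with hE
  have hle : E ≤ Submodule.span ℂ (B : Set (Web r)) := by
    rintro _ ⟨w, rfl⟩; exact hmem w
  have : Module.Finite ℂ (Submodule.span ℂ (B : Set (Web r))) :=
    Module.Finite.span_of_finite ℂ B.finite_toSet
  have : Module.Finite ℂ E := Submodule.finiteDimensional_of_le hle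
  have hE1 : Module.finrank ℂ E ≤ 2 ^ r * r.factorial :=
    (Submodule.finrank_mono hle).trans ((finrank_span_finset_le_card B).trans hB)
  let f : E →ₗ[ℂ] BlockSpace r := (evalBase r).domRestrict E
  have hr : LinearMap.range f = thinImage r := by
    rw [thinImage, ← hE, LinearMap.range_domRestrict]
  have : Module.Finite ℂ (thinImage r) := by rw [← hr]; infer_instance
  -- The corner has dimension at most `2 ^ r * r!` by the normal forms, and its image has dimension
  -- at least that; so the kernel is zero.
  have h1 := card_le_finrank_thinImage (r := r)
  have h2 := LinearMap.finrank_range_add_finrank_ker f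
  rw [hr] at h2
  have h3 : Module.finrank ℂ (LinearMap.ker f) = 0 := by omega
  have h4 : LinearMap.ker f = ⊥ := Submodule.finrank_eq_zero.1 h3
  have h5 : (⟨compress r w, ⟨w, rfl⟩⟩ : E) ∈ LinearMap.ker f := by
    rw [LinearMap.mem_ker]
    change evalBase r (compress r w) = 0
    rw [evalBase_apply, h]; simp
  rw [h4, Submodule.mem_bot] at h5
  exact congrArg Subtype.val h5

/-- If `w` acts by zero, so does each compression `e x w y e`, which is therefore zero by
`compress_eq_zero`. Writing `1` on both sides of `w` as an element of the ideal generated by `e`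
gives `w = 0`. -/
theorem webHom_injective : Function.Injective (webHom r) := by
  rw [injective_iff_map_eq_zero]
  intro w hw
  have hc : ∀ x y, Web.thinOne r * (x * w * y) * Web.thinOne r = 0 := by
    intro x y
    rw [← compress_apply]
    refine compress_eq_zero ?_
    rw [compress_apply]
    simp [hw]
  have h1 : ∀ z ∈ Web.thinIdeal r, ∀ z' ∈ Web.thinIdeal r, z * w * z' = 0 := by
    intro z hz z' hz'
    induction hz using Submodule.span_induction with
    | zero => simp
    | add a b _ _ ha hb => rw [add_mul, add_mul, ha, hb, add_zero]
    | smul c a _ ha => rw [smul_mul_assoc, smul_mul_assoc, ha, smul_zero]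
    | mem z hz =>
      obtain ⟨x, y, rfl⟩ := hz
      induction hz' using Submodule.span_induction with
      | zero => simp
      | add a b _ _ ha hb => rw [mul_add, ha, hb, add_zero]
      | smul c a _ ha => rw [mul_smul_comm, ha, smul_zero]
      | mem z' hz' =>
        obtain ⟨x', y', rfl⟩ := hz'
        have : x * Web.thinOne r * y * w * (x' * Web.thinOne r * y') =
            x * (Web.thinOne r * (y * w * x') * Web.thinOne r) * y' := by simp only [mul_assoc]
        rw [this, hc, mul_zero, zero_mul]
  have := h1 1 Web.one_mem_thinIdeal' 1 Web.one_mem_thinIdeal'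
  simpa using this

end TypeQ

end


noncomputable section

namespace TypeQ

variable {n r : ℕ}

/-! ## Parities -/

/-- The parity involution of `V^{⊗ r}`. -/
def parityInv (n r : ℕ) : Module.End ℂ (Tens n r) :=
  onMono fun I => ksign 1 (∑ p, (I p).2) • mono I

theorem parityInv_of_mem {i : ZMod 2} {v : Tens n r} (hv : v ∈ tensParity n r i) :
    parityInv n r v = ksign 1 i • v := by
  induction hv using Submodule.span_induction with
  | mem x hx => obtain ⟨I, rfl, rfl⟩ := hx; rw [parityInv, onMono_mono]
  | zero => rw [map_zero, smul_zero]
  | add x y _ _ hx hy => rw [map_add, hx, hy, smul_add]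
  | smul c x _ hx => rw [map_smul, hx, smul_comm]

theorem eq_zero_of_mem_tensParity {i : ZMod 2} {v : Tens n r} (h : v ∈ tensParity n r i)
    (h' : v ∈ tensParity n r (1 + i)) : v = 0 := by
  have e := (parityInv_of_mem h).symm.trans (parityInv_of_mem h')
  rw [ksign_add, ksign_one_one, neg_one_mul, neg_smul, eq_neg_iff_add_eq_zero, ← two_smul ℂ,
    smul_smul] at e
  refine (smul_eq_zero.1 e).resolve_left (mul_ne_zero two_ne_zero fun h0 => ?_)
  have := ksign_mul_self 1 i
  rw [h0] at this
  simp at this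

theorem eq_zero_of_mem_permSumParity {i : ZMod 2} {m : PermSum r} (h : m ∈ permSumParity r i)
    (h' : m ∈ permSumParity r (1 + i)) : m = 0 := by
  apply permIncl_injective
  rw [map_zero]
  exact eq_zero_of_mem_tensParity (mem_permSumParity.1 h) (mem_permSumParity.1 h')

theorem permSum_hom_ext {E : Type} [AddCommGroup E] [Module ℂ E] {f g : PermSum r →ₗ[ℂ] E}
    (h : ∀ I : Mono r r, Trailing I → f (permRetr r (mono I)) = g (permRetr r (mono I))) : f = g := by
  refine LinearMap.ext fun m => ?_
  rw [← permRetr_permIncl m]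
  have hm := permIncl_mem_span m
  generalize permIncl r m = v at hm ⊢
  induction hm using Submodule.span_induction with
  | mem x hx => obtain ⟨I, hI, rfl⟩ := hx; exact h I hI
  | zero => simp
  | add x y _ _ hx hy => simp only [map_add, hx, hy]
  | smul c x _ hx => simp only [map_smul, hx]

theorem permRetr_mono_mem {I : Mono r r} (hI : Trailing I) :
    permRetr r (mono I) ∈ permSumParity r (∑ p, (I p).2) := by
  rw [mem_permSumParity, permIncl_permRetr ⟨⟨wt I, sum_wt I⟩, hI⟩ (mono_mem_weightSpace rfl)]
  exact mono_mem_tensParity rfl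

/-- The value at a homogeneous vector would have both parities; such vectors span. -/
theorem eq_zero_of_mem_homPart {i : ZMod 2} {f : Module.End ℂ (PermSum r)}
    (h : f ∈ homPart (sergeevParity r) (permSumParity r) (permSumParity r) i)
    (h' : f ∈ homPart (sergeevParity r) (permSumParity r) (permSumParity r) (1 + i)) : f = 0 := by
  refine permSum_hom_ext fun I hI => ?_
  have hm := permRetr_mono_mem hI
  have := h'.1 _ _ hm
  rw [add_assoc] at this
  exact eq_zero_of_mem_permSumParity (h.1 _ _ hm) this

theorem webParity_sup (w : Web r) : w ∈ webParity r 0 ⊔ webParity r 1 := by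
  obtain ⟨x, rfl⟩ := Presented.mk_surjective _ w
  have hx : x ∈ Submodule.span ℂ
      (Set.range fun w : List (WebGen r) => (w.map (FreeAlgebra.ι ℂ)).prod) := by
    induction x using FreeAlgebra.induction with
    | grade0 c =>
      rw [Algebra.algebraMap_eq_smul_one]
      exact Submodule.smul_mem _ _ (Submodule.subset_span ⟨[], rfl⟩)
    | grade1 g => exact Submodule.subset_span ⟨[g], by simp⟩
    | mul a b ha hb =>
      have := Submodule.mul_mem_mul ha hb
      rw [Submodule.span_mul_span] at this
      refine Submodule.span_mono ?_ this
      rintro _ ⟨_, ⟨u, rfl⟩, _, ⟨v, rfl⟩, rfl⟩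
      exact ⟨u ++ v, by simp⟩
    | add a b ha hb => exact Submodule.add_mem _ ha hb
  induction hx using Submodule.span_induction with
  | mem x hx =>
    obtain ⟨u, rfl⟩ := hx
    have key : ∀ i : ZMod 2, (u.map WebGen.par).sum = i →
        Presented.mk (WebRel r) (u.map (FreeAlgebra.ι ℂ)).prod ∈ webParity r i :=
      fun i hi => Submodule.subset_span ⟨u, hi, rfl⟩
    rcases zmod2_cases (u.map WebGen.par).sum with h | h
    · exact Submodule.mem_sup_left (key 0 h)
    · exact Submodule.mem_sup_right (key 1 h)
  | zero => rw [map_zero]; exact Submodule.zero_mem _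
  | add x y _ _ hx hy => rw [map_add]; exact Submodule.add_mem _ hx hy
  | smul c x _ hx => rw [map_smul]; exact Submodule.smul_mem _ _ hx

theorem mem_webParity_iff (i : ZMod 2) (w : Web r) : w ∈ webParity r i ↔
    (webHom r w : Module.End ℂ (PermSum r)) ∈
      homPart (sergeevParity r) (permSumParity r) (permSumParity r) i := by
  refine ⟨coe_webHom_mem_homPart, fun h => ?_⟩
  obtain ⟨w', hw', w'', hw'', rfl⟩ : ∃ w' ∈ webParity r i, ∃ w'' ∈ webParity r (1 + i),
      w' + w'' = w := by
    have := webParity_sup w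
    rcases zmod2_cases i with rfl | rfl
    · exact Submodule.mem_sup.1 this
    · rw [sup_comm] at this
      exact Submodule.mem_sup.1 this
  have h2 := coe_webHom_mem_homPart hw''
  -- The component of `w` of the wrong parity is mapped to an operator of both parities, hence to
  -- zero, and `webHom` is injective.
  have h3 : (webHom r w'' : Module.End ℂ (PermSum r)) ∈
      homPart (sergeevParity r) (permSumParity r) (permSumParity r) i := by
    have := Submodule.add_mem _ h (Submodule.smul_mem _ (-1 : ℂ) (coe_webHom_mem_homPart hw'))
    rw [← Subalgebra.coe_smul, ← Subalgebra.coe_add, ← map_smul, ← map_add] at this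
    convert this using 4
    rw [neg_one_smul]; abel
  have h4 : w'' = 0 := by
    apply webHom_injective
    rw [map_zero]
    exact Subtype.ext (eq_zero_of_mem_homPart h3 h2)
  rwa [h4, add_zero]

/-! ## The base vector generates its permutation supermodule -/

/-- The Clifford generator flips one parity up to a nonzero scalar, which may be divided out. -/
theorem mono_flip_mem {M : Submodule ℂ (Tens n r)} (hM : ∀ j, ∀ v ∈ M, opC j v ∈ M)
    {I : Mono n r} (hI : mono I ∈ M) (j : Fin r) :
    mono (Function.update I j ((I j).1, (I j).2 + 1)) ∈ M := by
  have h := hM j _ hI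
  rw [opC, onMono_mono] at h
  refine (M.smul_mem_iff ?_).1 h
  have hk : ∀ a b, ksign a b ≠ 0 := fun a b h0 => by
    have := ksign_mul_self a b
    rw [h0] at this; simp at this
  exact mul_ne_zero (hk _ _) (mul_ne_zero (hk _ _) Complex.I_ne_zero)

theorem mono_mem_of_fst_eq {M : Submodule ℂ (Tens n r)} (hM : ∀ j, ∀ v ∈ M, opC j v ∈ M)
    {I J : Mono n r} (hI : mono I ∈ M) (hIJ : ∀ p, (J p).1 = (I p).1) : mono J ∈ M := by
  have key : ∀ S : Finset (Fin r), mono (fun p => if p ∈ S then J p else I p) ∈ M := by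
    intro S
    induction S using Finset.induction_on with
    | empty => simpa using hI
    | insert q S hq ih =>
      by_cases h : J q = I q
      · convert ih using 3 with p
        by_cases hp : p = q
        · subst hp; simp [h]
        · simp [hp]
      · convert mono_flip_mem hM ih q using 2
        funext p
        by_cases hp : p = q
        · subst hp
          have h2 : (J p).2 = (I p).2 + 1 := by
            have : (J p).2 ≠ (I p).2 := fun h2 => h (Prod.ext (hIJ p) h2)
            generalize (J p).2 = a at this ⊢
            generalize (I p).2 = b at this ⊢
            revert a b; decide
          simp only [Finset.mem_insert_self, if_true, Function.update_self, if_neg hq]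
          exact Prod.ext (hIJ p) h2
        · simp [hp]
  convert key Finset.univ using 2
  simp

/-- Adjacent transpositions generate the symmetric group, and each `opS` realises one of them up to
sign. -/
theorem mono_comp_perm_mem {M : Submodule ℂ (Tens n r)} (hM : ∀ i hi, ∀ v ∈ M, opS i hi v ∈ M)
    {I : Mono n r} (hI : mono I ∈ M) (σ : Equiv.Perm (Fin r)) : mono (I ∘ σ) ∈ M := by
  have hswap : ∀ (I : Mono n r) (i : ℕ) (hi : i + 1 < r), mono I ∈ M →
      mono (I ∘ Equiv.swap (⟨i, by omega⟩ : Fin r) ⟨i + 1, hi⟩) ∈ M := by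
    intro I i hi hI
    have h := hM i hi _ hI
    rw [opS, onMono_mono] at h
    refine (M.smul_mem_iff fun h0 => ?_).1 h
    have := ksign_mul_self (I ⟨i, by omega⟩).2 (I ⟨i + 1, hi⟩).2
    rw [h0] at this; simp at this
  rcases r with _ | r
  · convert hI
  · have hσ : σ ∈ Submonoid.closure (Set.range fun i : Fin r => Equiv.swap i.castSucc i.succ) := by
      rw [Equiv.Perm.mclosure_swap_castSucc_succ]; exact Submonoid.mem_top σ
    induction hσ using Submonoid.closure_induction_right with
    | one => exact hI
    | mul_right σ _ s hs ih =>
      obtain ⟨i, rfl⟩ := hs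
      exact hswap (I ∘ σ) i (by omega) ih

theorem exists_perm_of_wt_eq {I : Mono r r} (hI : wt I = (hat (Composition.ones r)).1.1) :
    ∃ σ : Equiv.Perm (Fin r), ∀ p, (I p).1 = σ p := by
  have hinj : Function.Injective fun p => (I p).1 := by
    intro p q hpq
    have h1 : (fib I (I p).1).card = 1 := by
      rw [card_fib, hI, ← wt_baseMono, ← card_fib, fib_baseMono, Finset.card_singleton]
    obtain ⟨a, ha⟩ := Finset.card_eq_one.1 h1
    have hp : p ∈ fib I (I p).1 := mem_fib.2 rfl
    have hq : q ∈ fib I (I p).1 := mem_fib.2 hpq.symm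
    rw [ha, Finset.mem_singleton] at hp hq
    rw [hp, hq]
  exact ⟨Equiv.ofBijective _ (Finite.injective_iff_bijective.1 hinj), fun p => rfl⟩

/-- A monomial of weight `(1, …, 1)` is a permutation of `v_1 ⊗ ⋯ ⊗ v_r` up to parities, so that one
monomial generates the supermodule. -/
theorem weightSpace_ones_le {M : Submodule ℂ (Tens r r)} (h0 : mono (baseMono r) ∈ M)
    (hM : ∀ g, ∀ v ∈ M, sergeevOp g v ∈ M) : weightSpace (hat (Composition.ones r)).1 ≤ M := by
  refine Submodule.span_le.2 ?_
  rintro _ ⟨I, hI, rfl⟩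
  obtain ⟨σ, hσ⟩ := exists_perm_of_wt_eq hI
  exact mono_mem_of_fst_eq (fun j => hM (.c j)) (mono_comp_perm_mem (fun i hi => hM (.s i hi)) h0 σ) hσ

theorem permRetr_smul (l : Weight' r) (x : Sergeev r) {v : Tens r r} (hv : v ∈ weightSpace l.1) :
    permRetr r (x • v) = x • permRetr r v := by
  apply permIncl_injective
  rw [permIncl_smul, permIncl_permRetr l hv, permIncl_permRetr l]
  exact (permMod l.1).smul_mem x hv

/-- The kernel inside this supermodule is stable under the Sergeev generators, up to signs which do
not matter, and contains a generating vector. -/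
theorem apply_permOf_eq_zero_of_homPart {i : ZMod 2} {f : Module.End ℂ (PermSum r)}
    (hf : f ∈ homPart (sergeevParity r) (permSumParity r) (permSumParity r) i)
    (h0 : f (baseVec r) = 0) (x : permMod (hat (Composition.ones r)).1) :
    f (permOf (hat (Composition.ones r)) x) = 0 := by
  let l := hat (Composition.ones r)
  have h := weightSpace_ones_le (M := weightSpace l.1 ⊓ LinearMap.ker (f ∘ₗ permRetr r))
    ⟨mono_mem_weightSpace wt_baseMono, by
      change f (permRetr r _) = 0
      rw [← permIncl_baseVec, permRetr_permIncl, h0]⟩ (by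
      rintro g v ⟨hv, hv'⟩
      refine ⟨sergeevOp_weightSpace l.1 g hv, ?_⟩
      have e : sergeevOp g v = Presented.mk (SergeevRel r) (FreeAlgebra.ι ℂ g) • v := by
        rw [sergeev_smul_def, sergeevRep, Presented.lift_mk, FreeAlgebra.lift_ι_apply]
      change f (permRetr r _) = 0 at hv'
      change f (permRetr r _) = 0
      rw [e, permRetr_smul l _ hv, hf.2 g.par _ (Submodule.subset_span ⟨[g], by simp, by simp⟩), hv',
        smul_zero, smul_zero])
  have : f (permRetr r x) = 0 := (h x.2).2
  rwa [permRetr_permOf l x] at this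

/-- An endomorphism is a sum of an even and an odd one. The base vector is even, so the two values
have different parities and vanish separately. -/
theorem apply_permOf_eq_zero {f : Module.End ℂ (PermSum r)} (hf : f ∈ EndPerm r)
    (h0 : f (baseVec r) = 0) (x : permMod (hat (Composition.ones r)).1) :
    f (permOf (hat (Composition.ones r)) x) = 0 := by
  obtain ⟨f₀, hf₀, f₁, hf₁, rfl⟩ := Submodule.mem_sup.1 hf
  have hb : baseVec r ∈ permSumParity r 0 := by
    rw [mem_permSumParity, permIncl_baseVec]
    exact mono_mem_tensParity (by simp [baseMono])
  have h1 := hf₁.1 _ _ hb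
  have h2 := hf₀.1 _ _ hb
  rw [LinearMap.add_apply] at h0
  have e : f₀ (baseVec r) = -f₁ (baseVec r) := eq_neg_of_add_eq_zero_left h0
  have h3 : f₀ (baseVec r) = 0 := by
    refine eq_zero_of_mem_permSumParity h2 ?_
    rw [e]
    exact neg_mem h1
  rw [h3, zero_add] at h0
  rw [LinearMap.add_apply, apply_permOf_eq_zero_of_homPart hf₀ h3,
    apply_permOf_eq_zero_of_homPart hf₁ h0, add_zero]

/-! ## Surjectivity -/

/-- Every vector of weight `(1, …, 1)` is the value of some thin web at the base vector; this is the
source of the preimages below. -/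
theorem toBlocks_mem_thinImage {v : Tens r r} (hv : v ∈ weightSpace (hat (Composition.ones r)).1) :
    toBlocks r r v ∈ thinImage r := by
  induction hv using Submodule.span_induction with
  | mem x hx =>
    obtain ⟨I, hI, rfl⟩ := hx
    obtain ⟨σ, hσ⟩ := exists_perm_of_wt_eq hI
    have e : fib I = fun k => {σ.symm k} := by
      funext k; ext p
      rw [mem_fib, hσ, Finset.mem_singleton, Equiv.eq_symm_apply]
    rw [toBlocks_mono, e]
    have := st_mem_thinImage (Equiv.Perm.map_finRange_perm σ.symm) (mono (parMono I))
    rwa [List.map_map] at this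
  | zero => rw [map_zero]; exact Submodule.zero_mem _
  | add x y _ _ hx hy => rw [map_add]; exact Submodule.add_mem _ hx hy
  | smul c x _ hx => rw [map_smul]; exact Submodule.smul_mem _ _ hx

theorem add_neg_one_smul_eq_zero_iff {x y : PermSum r} : x + (-1 : ℂ) • y = 0 ↔ x = y := by
  rw [← permIncl_injective.eq_iff, ← permIncl_injective.eq_iff (a := x), map_add, map_smul, map_zero,
    neg_one_smul, add_neg_eq_zero]

/-- A web with the same value at the base vector as the compressed endomorphism exists. The
difference vanishes at a generator of the summand of weight `(1, …, 1)`, hence on this summand, and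
it is zero on the other summands by construction. -/
theorem thin_mul_mul_thin_mem_range (f : EndPerm r) :
    webHom r (Web.thinOne r) * f * webHom r (Web.thinOne r) ∈ (webHom r).range := by
  set G := webHom r (Web.thinOne r) * f * webHom r (Web.thinOne r) with hG
  have hG' : ∀ m, (G : Module.End ℂ (PermSum r)) m =
      permOf (hat (Composition.ones r)) (DirectSum.component ℂ (Weight' r) (fun l => permMod l.1)
        (hat (Composition.ones r)) ((f : Module.End ℂ (PermSum r))
          (permProj (hat (Composition.ones r)) m))) := by
    intro m
    rw [hG, MulMemClass.coe_mul, MulMemClass.coe_mul, coe_webHom_thinOne]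
    rfl
  obtain ⟨_, ⟨w, rfl⟩, hw⟩ := toBlocks_mem_thinImage
    (v := permIncl r ((G : Module.End ℂ (PermSum r)) (baseVec r))) (by
      rw [hG', permIncl_permOf]; exact Subtype.prop _)
  have hw' := toBlocks_permIncl_injective hw
  refine ⟨compress r w, Subtype.ext (LinearMap.ext fun m => ?_)⟩
  set D := webHom r (compress r w) + (-1 : ℂ) • G with hD
  have hD' : ∀ m, (D : Module.End ℂ (PermSum r)) m =
      (webHom r (compress r w) : Module.End ℂ (PermSum r)) m +
        (-1 : ℂ) • (G : Module.End ℂ (PermSum r)) m := fun m => rfl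
  have h := apply_permOf_eq_zero D.2 (by rw [hD', hw', add_neg_one_smul_eq_zero_iff])
    (DirectSum.component ℂ (Weight' r) (fun l => permMod l.1) (hat (Composition.ones r)) m)
  -- Both terms of `D` factor on the right through the thin projection, so only one summand has to
  -- be tested.
  have e : D = D * webHom r (Web.thinOne r) := by
    have ee : webHom r (Web.thinOne r) * webHom r (Web.thinOne r) = webHom r (Web.thinOne r) := by
      rw [← map_mul, Web.thinOne, Web.one_mul_one]
    rw [hD, add_mul, smul_mul_assoc, hG, compress_apply, map_mul, map_mul]
    simp only [mul_assoc, ee]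
  have e' := congrArg (fun g : EndPerm r => (g : Module.End ℂ (PermSum r)) m) e
  simp only [MulMemClass.coe_mul, coe_webHom_thinOne] at e'
  have h' := e'.trans h
  rw [hD', add_neg_one_smul_eq_zero_iff] at h'
  exact h'

/-- Fullness of the thin idempotent again: `f = 1 f 1` is a combination of products of images of
webs and compressed endomorphisms `e g e`, which are images by the previous result. -/
theorem webHom_surjective : Function.Surjective (webHom r) := by
  intro f
  have h1 : ∀ z ∈ Web.thinIdeal r, ∀ z' ∈ Web.thinIdeal r,
      webHom r z * f * webHom r z' ∈ (webHom r).range := by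
    intro z hz z' hz'
    induction hz using Submodule.span_induction with
    | zero => simp only [map_zero, zero_mul]; exact zero_mem _
    | add a b _ _ ha hb => simp only [map_add, add_mul]; exact add_mem ha hb
    | smul c a _ ha => simp only [map_smul, smul_mul_assoc]; exact Subalgebra.smul_mem _ ha c
    | mem z hz =>
      obtain ⟨x, y, rfl⟩ := hz
      induction hz' using Submodule.span_induction with
      | zero => simp only [map_zero, mul_zero]; exact zero_mem _
      | add a b _ _ ha hb => simp only [map_add, mul_add]; exact add_mem ha hb
      | smul c a _ ha => simp only [map_smul, mul_smul_comm]; exact Subalgebra.smul_mem _ ha c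
      | mem z' hz' =>
        obtain ⟨x', y', rfl⟩ := hz'
        have : webHom r (x * Web.thinOne r * y) * f * webHom r (x' * Web.thinOne r * y') =
            webHom r x * (webHom r (Web.thinOne r) * (webHom r y * f * webHom r x') *
              webHom r (Web.thinOne r)) * webHom r y' := by simp only [map_mul, mul_assoc]
        rw [this]
        exact mul_mem (mul_mem ⟨x, rfl⟩ (thin_mul_mul_thin_mem_range _)) ⟨y', rfl⟩
  have := h1 1 Web.one_mem_thinIdeal' 1 Web.one_mem_thinIdeal'
  rw [map_one, one_mul, mul_one] at this
  exact this

/-- The isomorphism from the web superalgebra. -/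
def webEquiv (r : ℕ) : Web r ≃ₐ[ℂ] EndPerm r :=
  AlgEquiv.ofBijective (webHom r) ⟨webHom_injective, webHom_surjective⟩

/-! ## Homomorphisms between the summands -/

/-- The projection onto the summand `M^λ`. -/
abbrev permComp (l : Weight' r) : PermSum r →ₗ[ℂ] permMod l.1 :=
  DirectSum.component ℂ (Weight' r) (fun l => permMod l.1) l

theorem permComp_permOf (l : Weight' r) (x : permMod l.1) : permComp l (permOf l x) = x :=
  DirectSum.component.lof_self ℂ (M := fun l : Weight' r => permMod l.1) l x

theorem permOf_smul (l : Weight' r) (x : Sergeev r) (m : permMod l.1) :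
    permOf l (x • m) = x • permOf l m :=
  (DirectSum.lof (Sergeev r) (Weight' r) (fun l => permMod l.1) l).map_smul x m

theorem permComp_smul (l : Weight' r) (x : Sergeev r) (m : PermSum r) :
    permComp l (x • m) = x • permComp l m :=
  (DirectSum.component (Sergeev r) (Weight' r) (fun l => permMod l.1) l).map_smul x m

theorem permOf_mem_permSumParity {l : Weight' r} {i : ZMod 2} {m : permMod l.1}
    (hm : m ∈ permParity l.1 i) : permOf l m ∈ permSumParity r i := by
  rw [mem_permSumParity, permIncl_permOf]; exact hm

theorem permComp_mem_permParity (l : Weight' r) {i : ZMod 2} {m : PermSum r}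
    (hm : m ∈ permSumParity r i) : permComp l m ∈ permParity l.1 i := by
  rw [permSumParity, Submodule.mem_iInf] at hm
  exact hm l

/-- The component of an endomorphism between two summands. -/
def homComp (l m : Weight' r) : Module.End ℂ (PermSum r) →ₗ[ℂ] permMod l.1 →ₗ[ℂ] permMod m.1 where
  toFun f := permComp m ∘ₗ f ∘ₗ permOf l
  map_add' f g := by ext; simp
  map_smul' c f := by ext; simp

/-- The extension by zero of a map between two summands. -/
def homExt (l m : Weight' r) : (permMod l.1 →ₗ[ℂ] permMod m.1) →ₗ[ℂ] Module.End ℂ (PermSum r) where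
  toFun g := permOf m ∘ₗ g ∘ₗ permComp l
  map_add' _ _ := LinearMap.ext fun _ => map_add (permOf m) _ _
  map_smul' _ _ := LinearMap.ext fun _ => map_smul (permOf m) _ _

theorem homComp_homExt (l m : Weight' r) (g : permMod l.1 →ₗ[ℂ] permMod m.1) :
    homComp l m (homExt l m g) = g := by
  refine LinearMap.ext fun x => ?_
  change permComp m (permOf m (g (permComp l (permOf l x)))) = g x
  rw [permComp_permOf, permComp_permOf]

theorem homExt_homComp (l m : Weight' r) (f : Module.End ℂ (PermSum r)) :
    homExt l m (homComp l m f) = permProj m * f * permProj l := rfl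

theorem homComp_mem_homPart {l m : Weight' r} {i : ZMod 2} {f : Module.End ℂ (PermSum r)}
    (hf : f ∈ homPart (sergeevParity r) (permSumParity r) (permSumParity r) i) :
    homComp l m f ∈ homPart (sergeevParity r) (permParity l.1) (permParity m.1) i := by
  refine ⟨fun j x hx => permComp_mem_permParity m (hf.1 j _ (permOf_mem_permSumParity hx)),
    fun k x hx v => ?_⟩
  change permComp m (f (permOf l (x • v))) = ksign i k • x • permComp m (f (permOf l v))
  rw [permOf_smul, hf.2 k x hx, map_smul, permComp_smul]

theorem homExt_mem_homPart {l m : Weight' r} {i : ZMod 2} {g : permMod l.1 →ₗ[ℂ] permMod m.1}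
    (hg : g ∈ homPart (sergeevParity r) (permParity l.1) (permParity m.1) i) :
    homExt l m g ∈ homPart (sergeevParity r) (permSumParity r) (permSumParity r) i := by
  refine ⟨fun j x hx => permOf_mem_permSumParity (hg.1 j _ (permComp_mem_permParity l hx)),
    fun k x hx v => ?_⟩
  change permOf m (g (permComp l (x • v))) = ksign i k • x • permOf m (g (permComp l v))
  rw [permComp_smul, hg.2 k x hx, map_smul, permOf_smul]

theorem homComp_mem_superHom {l m : Weight' r} {f : Module.End ℂ (PermSum r)} (hf : f ∈ EndPerm r) :
    homComp l m f ∈ superHom (sergeevParity r) (permParity l.1) (permParity m.1) := by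
  obtain ⟨f₀, hf₀, f₁, hf₁, rfl⟩ := Submodule.mem_sup.1 hf
  rw [map_add]
  exact Submodule.add_mem_sup (homComp_mem_homPart hf₀) (homComp_mem_homPart hf₁)

theorem homExt_mem_endPerm {l m : Weight' r} {g : permMod l.1 →ₗ[ℂ] permMod m.1}
    (hg : g ∈ superHom (sergeevParity r) (permParity l.1) (permParity m.1)) :
    homExt l m g ∈ EndPerm r := by
  obtain ⟨g₀, hg₀, g₁, hg₁, rfl⟩ := Submodule.mem_sup.1 hg
  rw [map_add]
  exact Submodule.add_mem_sup (homExt_mem_homPart hg₀) (homExt_mem_homPart hg₁)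

theorem gen_one_mul_self (a : Composition r) :
    Web.gen (.one a) * Web.gen (.one a) = Web.gen (.one a) := by
  have := Presented.mk_rel (WebRel.one_left a (.one a))
  simp only [map_mul, WebGen.tgt, if_true] at this
  exact this

theorem coe_webHom_of_mem_hom {a b : Composition r} {w : Web r} (hw : w ∈ Web.hom a b) :
    (webHom r w : Module.End ℂ (PermSum r)) =
      homExt (hat a) (hat b) (homComp (hat a) (hat b) (webHom r w : Module.End ℂ (PermSum r))) := by
  rw [homExt_homComp, ← coe_webHom_one, ← coe_webHom_one, ← MulMemClass.coe_mul,
    ← MulMemClass.coe_mul, ← map_mul, ← map_mul]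
  exact congrArg (fun w => (webHom r w : Module.End ℂ (PermSum r))) (Eq.symm hw)

/-- The restriction of `webHom` to the webs from `a` to `b`. -/
def webHomRestrict (a b : Composition r) : Web.hom a b →ₗ[ℂ]
    superHom (sergeevParity r) (permParity (hat a).1) (permParity (hat b).1) where
  toFun w := ⟨homComp (hat a) (hat b) (webHom r (w : Web r) : Module.End ℂ (PermSum r)),
    homComp_mem_superHom (Subtype.prop _)⟩
  map_add' v w := Subtype.ext (by simp)
  map_smul' c w := Subtype.ext (by simp)

theorem coe_webHom_restrict {a b : Composition r} (w : Web.hom a b) :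
    (webHom r (w : Web r) : Module.End ℂ (PermSum r)) =
      homExt (hat a) (hat b) (webHomRestrict a b w).1 :=
  coe_webHom_of_mem_hom w.2

theorem webHomRestrict_bijective (a b : Composition r) :
    Function.Bijective (webHomRestrict a b) := by
  constructor
  · intro v w hvw
    refine Subtype.ext (webHom_injective (Subtype.ext ?_))
    rw [coe_webHom_restrict, coe_webHom_restrict, hvw]
  · rintro ⟨g, hg⟩
    obtain ⟨w, hw⟩ := webHom_surjective ⟨_, homExt_mem_endPerm hg⟩
    -- The preimage of the extension by zero is cut down by the identity webs to lie in the space of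
    -- webs from `a` to `b`; its image does not change.
    refine ⟨⟨Web.gen (.one b) * w * Web.gen (.one a), ?_⟩, Subtype.ext ?_⟩
    · change Web.gen (.one b) * (Web.gen (.one b) * w * Web.gen (.one a)) * Web.gen (.one a) = _
      rw [mul_assoc, mul_assoc, gen_one_mul_self, ← mul_assoc, ← mul_assoc, gen_one_mul_self]
    · change homComp (hat a) (hat b) (webHom r (Web.gen (.one b) * w * Web.gen (.one a)) :
        Module.End ℂ (PermSum r)) = g
      rw [map_mul, map_mul, hw, MulMemClass.coe_mul, MulMemClass.coe_mul, coe_webHom_one,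
        coe_webHom_one, ← homExt_homComp, homComp_homExt, homComp_homExt]

theorem mem_webParity_iff_restrict {a b : Composition r} (i : ZMod 2) (w : Web.hom a b) :
    (w : Web r) ∈ webParity r i ↔ (webHomRestrict a b w).1 ∈
      homPart (sergeevParity r) (permParity (hat a).1) (permParity (hat b).1) i := by
  rw [mem_webParity_iff]
  refine ⟨fun h => homComp_mem_homPart h, fun h => ?_⟩
  rw [coe_webHom_restrict]
  exact homExt_mem_homPart h

end TypeQ

end

theorem theorem5p2 (r : ℕ) (hr : 0 < r) :
    ∃ ψ : Web r ≃ₐ[ℂ] EndPerm r,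
      -- `ψ` preserves parities
      (∀ (i : ZMod 2) (w : Web r), w ∈ webParity r i ↔
        (ψ w : Module.End ℂ (PermSum r)) ∈
          homPart (sergeevParity r) (permSumParity r) (permSumParity r) i) ∧
      -- `ψ` is locally unital
      (∀ a : Composition r,
        (ψ (Web.gen (.one a)) : Module.End ℂ (PermSum r)) = permProj (hat a)) ∧
      -- the values of `ψ` on the generators
      (∀ (g : WebGen r) (m : PermSum r),
        permIncl r ((ψ (Web.gen g) : Module.End ℂ (PermSum r)) m) =
          schurRep r r (genElt g) (permIncl r m)) ∧
      -- `ψ` restricts to isomorphisms of superspaces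
      ∀ a b : Composition r,
        ∃ ψab : Web.hom a b ≃ₗ[ℂ]
            superHom (sergeevParity r) (permParity (hat a).1) (permParity (hat b).1),
          (∀ (w : Web.hom a b) (m : permMod (hat a).1),
            (ψ (w : Web r) : Module.End ℂ (PermSum r)) (permOf (hat a) m) =
              permOf (hat b) ((ψab w : permMod (hat a).1 →ₗ[ℂ] permMod (hat b).1) m)) ∧
          ∀ (i : ZMod 2) (w : Web.hom a b), (w : Web r) ∈ webParity r i ↔
            (ψab w : permMod (hat a).1 →ₗ[ℂ] permMod (hat b).1) ∈
              homPart (sergeevParity r) (permParity (hat a).1) (permParity (hat b).1) i := by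
  refine ⟨webEquiv r, mem_webParity_iff, coe_webHom_one, fun g m => ?_, fun a b =>
    ⟨LinearEquiv.ofBijective (webHomRestrict a b) (webHomRestrict_bijective a b), fun w m => ?_,
      mem_webParity_iff_restrict⟩⟩
  · change permIncl r ((webHom r (Web.gen g) : Module.End ℂ (PermSum r)) m) = _
    rw [coe_webHom_gen, permIncl_genEnd]
  · change (webHom r (w : Web r) : Module.End ℂ (PermSum r)) (permOf (hat a) m) = _
    rw [coe_webHom_restrict]
    change permOf (hat b) ((webHomRestrict a b w).1 (permComp (hat a) (permOf (hat a) m))) = _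
    rw [permComp_permOf]
    rfl
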